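/- Let $\lambda\in\{1,-1\}$, $L>0$, and let $q:\mathbb R\times[0,\infty)\to\mathbb C$ be a smooth solution of $iq_t+q_{xx}-2\lambda q|q|^2=0$ with $q(x+L,t)=q(x,t)$. **Notation.** $\bar f(k):=\overline{f(\bar k)}$; $\theta=kx+2k^2t$; $D_1,\dots,D_4$ are the open quadrants; $\mathcal D_n=\{|k-\frac{n\pi}{L}|<\frac{\pi}{4L}\}$; $[m]_j$ is the $j$-th column of $m$. For $k\in\mathbb C$ let $\mu(x)$ solve $\mu_x+ik[\sigma_3,\mu]=\begin{pmatrix}0&q(x,0)\\ \lambda\overline{q(x,0)}&0\end{pmatrix}\mu$, $\mu(L)=I$, and let $b(k)=\mu_{12}(0)$, $a(k)=\mu_{22}(0)$. Put $\Delta=ae^{-ikL}+\bar ae^{ikL}$. **Cuts.** For $\lambda=1$, $\mathcal C$ is the union of the spectral gaps $\{k\in\mathbb R:|\Delta(k)|>2\}$. For $\lambda=-1$, $\mathcal C$ is the union of $\{k\in\mathbb R:|\Delta(k)|>2\}$ and of the open vertical segments obtained by listing, on each vertical line, the non-real zeros of odd multiplicity of $4-\Delta^2$ upwards as $z_1,\dots,z_{2r}$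 and joining $z_{2i-1}$ to $z_{2i}$. Let $\mathcal B=\overline{\mathcal C}\setminus\mathcal C$, $\tilde\Sigma=\mathbb R\cup i\mathbb R\cup\overline{\mathcal C}$, let $\mathcal S$ consist of $0$ and the points where vertical cuts meet $\mathbb R$, and let $\tilde\Sigma_\star=\tilde\Sigma\setminus(\mathcal B\cup\mathcal S)$. The contour $\tilde\Sigma$ is oriented to the right on $\mathbb R_+$, to the left on $\mathbb R_-$, downwards in the open upper and upwards in the open lower half-plane; $f_+$, $f_-$ are boundary values from the left and from the right. **The function $\tilde\Gamma$.** Let $\sqrt{4-\Delta^2}$ be the analytic branch on $\mathbb C\setminus\overline{\mathcal C}$ with $\sqrt{4-\Delta^2}\sim 2\sin(kL)$ as $k\to\infty$, $k\in\mathbb R\setminus\bigcup_n\mathcal D_n$, and let $\tilde\Gamma=\frac{\lambda}{2e^{ikL}\bar b}\big(\bar ae^{ikL}-ae^{-ikL}-i\sqrt{4-\Delta^2}\big)$, a meromorphic function on $\mathbb C\setminus\overline{\mathcal C}$ (with removable singularities removed; $\tilde\Gamma=0$ if $b\equiv0$). Assume that $\tilde\Gamma$ has no poles on $\tilde\Sigma$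 (it is bounded near each point of $\tilde\Sigma$), and that its poles in $D_1$ and in $D_3$ are finitely many and simple. Let $\{p_j\}\subset D_1$ and $\{q_j\}\subset D_3$ be these poles and $\tilde P=\{p_j,\bar p_j\}\cup\{q_j,\bar q_j\}$. **Jump matrix.** Let $E=a+\lambda\bar b\tilde\Gamma e^{2ikL}$, $F=a-\lambda b\bar{\tilde\Gamma}$ and $$\tilde v_1=\begin{pmatrix}\frac{F-\lambda\tilde\Gamma(\bar a\bar{\tilde\Gamma}-\bar b)e^{2ikL}}{F}&-\tilde\Gamma e^{2ikL}e^{-2i\theta}\\ \frac{\lambda\bar{\tilde\Gamma}e^{2i\theta}}{FE}&\frac aE\end{pmatrix},\quad \tilde v_2=\begin{pmatrix}1-\lambda\tilde\Gamma\bar{\tilde\Gamma}&-\frac{(\bar a\tilde\Gamma e^{2ikL}+b)e^{-2i\theta}}{\bar E}\\ \frac{\lambda(a\bar{\tilde\Gamma}e^{-2ikL}+\bar b)e^{2i\theta}}{E}&\frac1{E\bar E}\end{pmatrix},$$ $$\tilde v_3=\begin{pmatrix}\frac{\bar F-\lambda\bar{\tilde\Gamma}(a\tilde\Gamma-b)e^{-2ikL}}{\bar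 F}&-\frac{\tilde\Gamma e^{-2i\theta}}{\bar F\bar E}\\ \lambda\bar{\tilde\Gamma}e^{-2ikL}e^{2i\theta}&\frac{\bar a}{\bar E}\end{pmatrix},\quad \tilde v_4=\begin{pmatrix}\frac{1-\lambda\tilde\Gamma\bar{\tilde\Gamma}}{F\bar F}&-\frac{(a\tilde\Gamma-b)e^{-2i\theta}}{\bar F}\\ \frac{\lambda(\bar a\bar{\tilde\Gamma}-\bar b)e^{2i\theta}}{F}&1\end{pmatrix},$$ $$V_1=\begin{pmatrix}\frac{E_+}{E_-}&(\tilde\Gamma_--\tilde\Gamma_+)e^{2ikL}e^{-2i\theta}\\0&\frac{E_-}{E_+}\end{pmatrix},\quad V_2=\begin{pmatrix}1&0\\ \frac{\lambda(\bar{\tilde\Gamma}_--\bar{\tilde\Gamma}_+)e^{2i\theta}}{F_-F_+}&1\end{pmatrix},$$ $$V_3=\begin{pmatrix}1&\frac{(\tilde\Gamma_--\tilde\Gamma_+)e^{-2i\theta}}{\bar F_-\bar F_+}\\0&1\end{pmatrix},\quad V_4=\begin{pmatrix}\frac{\bar E_-}{\bar E_+}&0\\ \lambda(\bar{\tilde\Gamma}_--\bar{\tilde\Gamma}_+)e^{2i\theta}e^{-2ikL}&\frac{\bar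 E_+}{\bar E_-}\end{pmatrix},$$ where the subscripts $\pm$ denote boundary values of the functions $\tilde\Gamma,\bar{\tilde\Gamma},E,\bar E,F,\bar F$ at $k$. On $\tilde\Sigma_\star\setminus\mathcal C$ the jump matrix $\tilde v$ is $\tilde v_1,\tilde v_2,\tilde v_3,\tilde v_4$ on $i\mathbb R_+,\mathbb R_+,i\mathbb R_-,\mathbb R_-$ respectively; on $\mathcal C\cap D_j$ it is $V_j$; on $\mathcal C\cap i\mathbb R_+$, $\mathcal C\cap\mathbb R_+$, $\mathcal C\cap i\mathbb R_-$, $\mathcal C\cap\mathbb R_-$ it is $V_1\tilde v_{1-}$, $V_1\tilde v_{2-}$, $V_3\tilde v_{3-}$, $V_3\tilde v_{4-}$ respectively. **Riemann–Hilbert problem at $(x,t)$.** Find a $2\times2$-matrix valued function $\tilde m(x,t,\cdot)$, analytic on $\mathbb C\setminus(\tilde\Sigma\cup\tilde P)$, such that (i) the boundary values $\tilde m_\pm$ exist and are continuous on $\tilde\Sigma_\star$, and $\tilde m_-=\tilde m_+\tilde v$ there; (ii) $\tilde m=I+O(k^{-1})$ as $k\to\infty$, $k\notin\bigcup_n\mathcal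 D_n$; (iii) $\tilde m$ is bounded near each point of $\tilde\Sigma\setminus\tilde\Sigma_\star$; (iv) at the points of $\tilde P$ the function $\tilde m$ has at most simple poles, with $$\operatorname*{Res}_{p_j}[\tilde m]_2=\{[\tilde m]_1E\bar ae^{2ikL}e^{-2i\theta}\}(p_j)\operatorname*{Res}_{p_j}\tilde\Gamma,\qquad \operatorname*{Res}_{\bar p_j}[\tilde m]_1=\{\lambda[\tilde m]_2\bar Eae^{-2ikL}e^{2i\theta}\}(\bar p_j)\,\overline{\operatorname*{Res}_{p_j}\tilde\Gamma},$$ $$\operatorname*{Res}_{q_j}[\tilde m]_2=\Big\{[\tilde m]_1\frac{ae^{-2i\theta}}{\bar F}\Big\}(q_j)\operatorname*{Res}_{q_j}\tilde\Gamma,\qquad \operatorname*{Res}_{\bar q_j}[\tilde m]_1=\Big\{\lambda[\tilde m]_2\frac{\bar ae^{2i\theta}}{F}\Big\}(\bar q_j)\,\overline{\operatorname*{Res}_{q_j}\tilde\Gamma},$$ where the column of $\tilde m$ on the right-hand side is analytic at the point in question and $E,\bar E,F,\bar F$ are continued analytically to it. **Theorem.** For each $(x,t)\in[0,L]\times[0,\infty)$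 this Riemann–Hilbert problem has a unique solution $\tilde m(x,t,\cdot)$, and $$q(x,t)=2i\lim_{k\to\infty}k\,\tilde m_{12}(x,t,k),$$ where the limit is taken along any ray $\arg k=\phi$ with $\phi\in\mathbb R\setminus\{n\pi/2:n\in\mathbb Z\}$, except that at the corner $(x,t)=(0,0)$ the ray must not lie in $D_4$ and at the corner $(x,t)=(L,0)$ it must not lie in $D_2$. -/

import Mathlib

open Complex Filter Topology Set Asymptotics
open scoped ContDiff ComplexConjugate

namespace PeriodicNLS

noncomputable section

/-- Complex `2 × 2` matrices; columns and rows are indexed by `0, 1`. -/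
abbrev Mat2 := Matrix (Fin 2) (Fin 2) ℂ

/-- A smooth (up to `t = 0`), `L`-periodic in `x`, solution on `ℝ × [0, ∞)` of
`i q_t + q_xx - 2 lam q |q|^2 = 0`. -/
structure IsSmoothPeriodicSolution (lam L : ℝ) (q : ℝ → ℝ → ℂ) : Prop where
  smooth : ContDiffOn ℝ ∞ (fun p : ℝ × ℝ => q p.1 p.2) (univ ×ˢ Ici 0)
  periodic : ∀ x t : ℝ, 0 ≤ t → q (x + L) t = q x t
  equation : ∀ x t : ℝ, 0 ≤ t →
    I * derivWithin (fun s => q x s) (Ici 0) t + iteratedDeriv 2 (fun y => q y t) x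
      - 2 * (lam : ℂ) * q x t * (‖q x t‖ : ℂ) ^ 2 = 0

/-! ### Spectral functions of the initial datum -/

/-- The third Pauli matrix. -/
def sigma3 : Mat2 := !![1, 0; 0, -1]

/-- The matrix `Q` of the Lax pair at a point where `q` has the value `z`. -/
def laxQ (lam : ℝ) (z : ℂ) : Mat2 := !![0, z; (lam : ℂ) * conj z, 0]

/-- `μ` solves the `x`-part `μ_x + i k [σ₃, μ] = Q μ` of the Lax pair with potential `q0`
(all of this at `t = 0`), normalized to be the identity at `x = L`. -/
def IsEigenfunction (lam L : ℝ) (q0 : ℝ → ℂ) (k : ℂ) (μ : ℝ → Mat2) : Prop :=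
  μ L = 1 ∧ ∀ (y : ℝ) (i j : Fin 2),
    HasDerivAt (fun s => μ s i j)
      ((laxQ lam (q0 y) * μ y - (I * k) • (sigma3 * μ y - μ y * sigma3)) i j) y

/-- The solution `x ↦ μ₃(x, 0, k)` of the (linear) initial value problem `IsEigenfunction`. -/
def eigenfunction (lam L : ℝ) (q0 : ℝ → ℂ) (k : ℂ) : ℝ → Mat2 :=
  Classical.epsilon (IsEigenfunction lam L q0 k)

/-- `s(k) = μ₃(0, 0, k)`. -/
def scattering (lam L : ℝ) (q0 : ℝ → ℂ) (k : ℂ) : Mat2 := eigenfunction lam L q0 k 0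

/-- The spectral function `a(k)`, the `(2,2)` entry of `s(k)`. -/
def specA (lam L : ℝ) (q0 : ℝ → ℂ) (k : ℂ) : ℂ := scattering lam L q0 k 1 1

/-- The spectral function `b(k)`, the `(1,2)` entry of `s(k)`. -/
def specB (lam L : ℝ) (q0 : ℝ → ℂ) (k : ℂ) : ℂ := scattering lam L q0 k 0 1

/-- The Schwarz conjugate `k ↦ conj (f (conj k))`. -/
def schwarz (f : ℂ → ℂ) (k : ℂ) : ℂ := conj (f (conj k))

/-! From here on everything is a function of `lam`, `L` and the two functions `a`, `b`. -/

/-- `Δ = a e^{-ikL} + ā e^{ikL}`. -/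
def discr (L : ℝ) (a : ℂ → ℂ) (k : ℂ) : ℂ :=
  a k * exp (-(I * k * L)) + schwarz a k * exp (I * k * L)

/-! ### Branch cuts -/

/-- The union of the open disks of radius `π/(4L)` centred at `nπ/L`, `n ∈ ℤ`. -/
def disks (L : ℝ) : Set ℂ :=
  ⋃ n : ℤ, Metric.ball (((n : ℝ) * Real.pi / L : ℝ) : ℂ) (Real.pi / (4 * L))

/-- The union of the (real) spectral gaps, i.e. the set of real `k` with `|Δ(k)| > 2`. -/
def spectralGaps (L : ℝ) (a : ℂ → ℂ) : Set ℂ := {k | k.im = 0 ∧ 2 < ‖discr L a k‖}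

/-- The non-real zeros of odd multiplicity of `4 - Δ²`. -/
def oddZeros (L : ℝ) (a : ℂ → ℂ) : Set ℂ :=
  {k | k.im ≠ 0 ∧ ∃ n : ℕ, Odd n ∧ analyticOrderAt (fun z => 4 - discr L a z ^ 2) k = n}

/-- On each vertical line list the points of `oddZeros` upwards as `z₁, z₂, …, z_{2r}`.  The
pairs `(z, w)` below are `(z₁, z₂), (z₃, z₄), …, (z_{2r-1}, z_{2r})`. -/
def IsCutPair (L : ℝ) (a : ℂ → ℂ) (z w : ℂ) : Prop :=
  z ∈ oddZeros L a ∧ w ∈ oddZeros L a ∧ z.re = w.re ∧ z.im < w.im ∧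
  (∀ u ∈ oddZeros L a, u.re = z.re → ¬ (z.im < u.im ∧ u.im < w.im)) ∧
  Even (Set.ncard {u | u ∈ oddZeros L a ∧ u.re = z.re ∧ u.im < z.im})

/-- The union of the open vertical segments joining the two points of a cut pair. -/
def verticalCuts (L : ℝ) (a : ℂ → ℂ) : Set ℂ :=
  {k | ∃ z w : ℂ, IsCutPair L a z w ∧ k ∈ openSegment ℝ z w}

/-- The set `𝒞` of branch cuts of `√(4 - Δ²)` (without the branch points). -/
def cuts (lam L : ℝ) (a : ℂ → ℂ) : Set ℂ :=
  {k | k ∈ spectralGaps L a ∨ (lam = -1 ∧ k ∈ verticalCuts L a)}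

/-- The set `ℬ` of branch points. -/
def branchPoints (lam L : ℝ) (a : ℂ → ℂ) : Set ℂ := closure (cuts lam L a) \ cuts lam L a

/-- The cross `Σ = ℝ ∪ iℝ`. -/
def cross : Set ℂ := {k | k.im = 0 ∨ k.re = 0}

/-- The contour `ℝ ∪ iℝ` together with branch cuts and branch points. -/
def contour (lam L : ℝ) (a : ℂ → ℂ) : Set ℂ := cross ∪ closure (cuts lam L a)

/-- The self-intersections of the contour: the origin and the points at which vertical branch
cuts meet the real axis. -/
def selfIntersections (lam L : ℝ) (a : ℂ → ℂ) : Set ℂ :=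
  {k | k = 0 ∨ (lam = -1 ∧ k ∈ verticalCuts L a ∧ k.im = 0)}

/-- The contour without branch points and self-intersections. -/
def contourStar (lam L : ℝ) (a : ℂ → ℂ) : Set ℂ :=
  contour lam L a \ (branchPoints lam L a ∪ selfIntersections lam L a)

/-! ### The square root and the function `Γ̃` -/

/-- `R` is the branch of `√(4 - Δ²)` off the closure of the cuts which is asymptotic to
`2 sin(kL)` as `k → ∞` along the real axis outside the disks. -/
def IsSqrtBranch (lam L : ℝ) (a : ℂ → ℂ) (R : ℂ → ℂ) : Prop :=
  DifferentiableOn ℂ R (closure (cuts lam L a))ᶜ ∧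
  (∀ k ∈ (closure (cuts lam L a))ᶜ, R k ^ 2 = 4 - discr L a k ^ 2) ∧
  IsEquivalent (cocompact ℂ ⊓ 𝓟 ({k : ℂ | k.im = 0} \ disks L)) R
    (fun k => 2 * Complex.sin (k * L))

/-- The function `√(4 - Δ²)`; only its values off the closure of the cuts matter. -/
def sqrtDiscr (lam L : ℝ) (a : ℂ → ℂ) : ℂ → ℂ := Classical.epsilon (IsSqrtBranch lam L a)

/-- The defining quotient of `Γ̃`. -/
def gammaQuotient (lam L : ℝ) (a b : ℂ → ℂ) (k : ℂ) : ℂ :=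
  (lam : ℂ) / (2 * exp (I * k * L) * schwarz b k) *
    (schwarz a k * exp (I * k * L) - a k * exp (-(I * k * L)) - I * sqrtDiscr lam L a k)

/-- The function `Γ̃`, meromorphic off the closure of the cuts.  The normal form fills in the
values at removable singularities of the quotient (common zeros of numerator and denominator). -/
def gammaT (lam L : ℝ) (a b : ℂ → ℂ) : ℂ → ℂ :=
  toMeromorphicNFOn (gammaQuotient lam L a b) (closure (cuts lam L a))ᶜ

/-! ### Quadrants, poles and the assumption on poles -/

/-- The open first quadrant. -/
def D1 : Set ℂ := {k | 0 < k.re ∧ 0 < k.im}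
/-- The open second quadrant. -/
def D2 : Set ℂ := {k | k.re < 0 ∧ 0 < k.im}
/-- The open third quadrant. -/
def D3 : Set ℂ := {k | k.re < 0 ∧ k.im < 0}
/-- The open fourth quadrant. -/
def D4 : Set ℂ := {k | 0 < k.re ∧ k.im < 0}

/-- The poles of `Γ̃` in the set `D`, off the cuts. -/
def polesIn (lam L : ℝ) (a b : ℂ → ℂ) (D : Set ℂ) : Set ℂ :=
  {p | p ∈ D ∧ p ∉ closure (cuts lam L a) ∧ meromorphicOrderAt (gammaT lam L a b) p < 0}

/-- `Γ̃` has no poles on the contour (it stays bounded near each of its points), and in the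
first and third quadrant it has at most finitely many poles, all of which are simple. -/
structure PoleAssumption (lam L : ℝ) (a b : ℂ → ℂ) : Prop where
  contour_bounded : ∀ k ∈ contour lam L a,
    gammaT lam L a b =O[𝓝[(closure (cuts lam L a))ᶜ] k] (fun _ => (1 : ℂ))
  finite_D1 : (polesIn lam L a b D1).Finite
  simple_D1 : ∀ p ∈ polesIn lam L a b D1, meromorphicOrderAt (gammaT lam L a b) p = -1
  finite_D3 : (polesIn lam L a b D3).Finite
  simple_D3 : ∀ p ∈ polesIn lam L a b D3, meromorphicOrderAt (gammaT lam L a b) p = -1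

/-- The poles of `Γ̃` in the first and third quadrant and their complex conjugates. -/
def poleSet (lam L : ℝ) (a b : ℂ → ℂ) : Set ℂ :=
  {k | (k ∈ polesIn lam L a b D1 ∪ polesIn lam L a b D3) ∨
    (conj k ∈ polesIn lam L a b D1 ∪ polesIn lam L a b D3)}

/-- The value at `p` of a function with a removable singularity there. -/
def valueAt (f : ℂ → ℂ) (p : ℂ) : ℂ := limUnder (𝓝[≠] p) f

/-- The residue of `f` at a simple pole `p`. -/
def simpleResidue (f : ℂ → ℂ) (p : ℂ) : ℂ := limUnder (𝓝[≠] p) (fun k => (k - p) * f k)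

/-! ### Orientation and boundary values

The contour is oriented so that its parts on the positive imaginary axis and in the open
upper half-plane run downwards, those on the negative imaginary axis and in the open lower
half-plane upwards, the positive real axis to the right, and the negative real axis to the left.
-/

/-- The unit normal at `k`, pointing to the left of the oriented contour. -/
def leftNormal (k : ℂ) : ℂ :=
  if 0 < k.im then 1 else if k.im < 0 then -1 else if 0 < k.re then I else -I

/-- The `+` side of the contour at `k` (a half-plane; the contour is straight near `k`). -/
def plusSide (k : ℂ) : Set ℂ := {z | 0 < ((z - k) * conj (leftNormal k)).re}

/-- The `-` side of the contour at `k`. -/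
def minusSide (k : ℂ) : Set ℂ := {z | ((z - k) * conj (leftNormal k)).re < 0}

/-- The boundary value `f_+` at `k`. -/
def bdryPlus (f : ℂ → ℂ) (k : ℂ) : ℂ := limUnder (𝓝[plusSide k] k) f

/-- The boundary value `f_-` at `k`. -/
def bdryMinus (f : ℂ → ℂ) (k : ℂ) : ℂ := limUnder (𝓝[minusSide k] k) f

/-! ### The jump matrix

`G` and `Gb` stand for the values (or boundary values) of `Γ̃` and of its Schwarz conjugate. -/

/-- `θ = k x + 2 k² t`. -/
def theta (x t : ℝ) (k : ℂ) : ℂ := k * x + 2 * k ^ 2 * t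

/-- `e^{2 i θ}`. -/
def eTheta (x t : ℝ) (k : ℂ) : ℂ := exp (2 * I * theta x t k)

/-- `e^{-2 i θ}`. -/
def eThetaInv (x t : ℝ) (k : ℂ) : ℂ := exp (-(2 * I * theta x t k))

/-- `e^{2 i k L}`. -/
def eL (L : ℝ) (k : ℂ) : ℂ := exp (2 * I * k * L)

/-- `e^{-2 i k L}`. -/
def eLInv (L : ℝ) (k : ℂ) : ℂ := exp (-(2 * I * k * L))

/-- The matrix on the positive imaginary axis. -/
def v1 (lam L x t : ℝ) (a b : ℂ → ℂ) (k G Gb : ℂ) : Mat2 :=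
  !![(a k - lam * b k * Gb - lam * G * (schwarz a k * Gb - schwarz b k) * eL L k)
        / (a k - lam * b k * Gb),
     -G * eL L k * eThetaInv x t k;
     (lam * Gb * eTheta x t k)
        / ((a k - lam * b k * Gb) * (a k + lam * schwarz b k * G * eL L k)),
     a k / (a k + lam * schwarz b k * G * eL L k)]

/-- The matrix on the positive real axis. -/
def v2 (lam L x t : ℝ) (a b : ℂ → ℂ) (k G Gb : ℂ) : Mat2 :=
  !![1 - lam * G * Gb,
     -((schwarz a k * G * eL L k + b k) * eThetaInv x t k)
        / (schwarz a k + lam * b k * Gb * eLInv L k);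
     (lam * (a k * Gb * eLInv L k + schwarz b k) * eTheta x t k)
        / (a k + lam * schwarz b k * G * eL L k),
     1 / ((a k + lam * schwarz b k * G * eL L k)
        * (schwarz a k + lam * b k * Gb * eLInv L k))]

/-- The matrix on the negative imaginary axis. -/
def v3 (lam L x t : ℝ) (a b : ℂ → ℂ) (k G Gb : ℂ) : Mat2 :=
  !![(schwarz a k - lam * schwarz b k * G - lam * Gb * (a k * G - b k) * eLInv L k)
        / (schwarz a k - lam * schwarz b k * G),
     -(G * eThetaInv x t k)
        / ((schwarz a k - lam * schwarz b k * G)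
          * (schwarz a k + lam * b k * Gb * eLInv L k));
     lam * Gb * eLInv L k * eTheta x t k,
     schwarz a k / (schwarz a k + lam * b k * Gb * eLInv L k)]

/-- The matrix on the negative real axis. -/
def v4 (lam x t : ℝ) (a b : ℂ → ℂ) (k G Gb : ℂ) : Mat2 :=
  !![(1 - lam * G * Gb)
        / ((a k - lam * b k * Gb) * (schwarz a k - lam * schwarz b k * G)),
     -((a k * G - b k) * eThetaInv x t k) / (schwarz a k - lam * schwarz b k * G);
     (lam * (schwarz a k * Gb - schwarz b k) * eTheta x t k) / (a k - lam * b k * Gb),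
     1]

/-- The matrix on the cuts in the first quadrant; `Gp`, `Gm` are the values of `Γ̃_±`. -/
def vCut1 (lam L x t : ℝ) (a b : ℂ → ℂ) (k Gp Gm : ℂ) : Mat2 :=
  !![(a k + lam * schwarz b k * Gp * eL L k) / (a k + lam * schwarz b k * Gm * eL L k),
     (Gm - Gp) * eL L k * eThetaInv x t k;
     0,
     (a k + lam * schwarz b k * Gm * eL L k) / (a k + lam * schwarz b k * Gp * eL L k)]

/-- The matrix on the cuts in the second quadrant; `Gbp`, `Gbm` are the boundary values of the
Schwarz conjugate of `Γ̃`. -/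
def vCut2 (lam x t : ℝ) (a b : ℂ → ℂ) (k Gbp Gbm : ℂ) : Mat2 :=
  !![1, 0;
     (lam * (Gbm - Gbp) * eTheta x t k)
        / ((a k - lam * b k * Gbm) * (a k - lam * b k * Gbp)),
     1]

/-- The matrix on the cuts in the third quadrant. -/
def vCut3 (lam x t : ℝ) (a b : ℂ → ℂ) (k Gp Gm : ℂ) : Mat2 :=
  !![1,
     ((Gm - Gp) * eThetaInv x t k)
        / ((schwarz a k - lam * schwarz b k * Gm) * (schwarz a k - lam * schwarz b k * Gp));
     0, 1]

/-- The matrix on the cuts in the fourth quadrant. -/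
def vCut4 (lam L x t : ℝ) (a b : ℂ → ℂ) (k Gbp Gbm : ℂ) : Mat2 :=
  !![(schwarz a k + lam * b k * Gbm * eLInv L k) / (schwarz a k + lam * b k * Gbp * eLInv L k),
     0;
     lam * (Gbm - Gbp) * eTheta x t k * eLInv L k,
     (schwarz a k + lam * b k * Gbp * eLInv L k) / (schwarz a k + lam * b k * Gbm * eLInv L k)]

open Classical in
/-- The jump matrix `ṽ` on the contour without branch points and self-intersections. -/
def jump (lam L x t : ℝ) (a b : ℂ → ℂ) (k : ℂ) : Mat2 :=
  let Γ := gammaT lam L a b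
  let G := Γ k
  let Gb := schwarz Γ k
  let Gp := bdryPlus Γ k
  let Gm := bdryMinus Γ k
  let Gbp := bdryPlus (schwarz Γ) k
  let Gbm := bdryMinus (schwarz Γ) k
  if k ∈ cuts lam L a then
    if k ∈ D1 then vCut1 lam L x t a b k Gp Gm
    else if k ∈ D2 then vCut2 lam x t a b k Gbp Gbm
    else if k ∈ D3 then vCut3 lam x t a b k Gp Gm
    else if k ∈ D4 then vCut4 lam L x t a b k Gbp Gbm
    else if 0 < k.im then vCut1 lam L x t a b k Gp Gm * v1 lam L x t a b k Gm Gbm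
    else if k.im < 0 then vCut3 lam x t a b k Gp Gm * v3 lam L x t a b k Gm Gbm
    else if 0 < k.re then vCut1 lam L x t a b k Gp Gm * v2 lam L x t a b k Gm Gbm
    else vCut3 lam x t a b k Gp Gm * v4 lam x t a b k Gm Gbm
  else
    if 0 < k.im then v1 lam L x t a b k G Gb
    else if k.im < 0 then v3 lam L x t a b k G Gb
    else if 0 < k.re then v2 lam L x t a b k G Gb
    else v4 lam x t a b k G Gb

/-! ### The Riemann–Hilbert problem -/

/-- Column `j` of `m` has a simple pole (or a removable singularity) at `p`, column `j'` extends
analytically to `p`, and `Res_p [m]_j = c [m]_{j'}(p)`. -/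
def ResidueCondition (m : ℂ → Mat2) (p : ℂ) (j j' : Fin 2) (c : ℂ) : Prop :=
  ∃ u : Fin 2 → ℂ, ∀ i : Fin 2,
    Tendsto (fun k => m k i j') (𝓝[≠] p) (𝓝 (u i)) ∧
    Tendsto (fun k => (k - p) * m k i j) (𝓝[≠] p) (𝓝 (c * u i))

/-- `m` solves the Riemann–Hilbert problem at the point `(x, t)`; only the values of `m` off the
contour and off the set of poles matter. -/
structure IsRHSolution (lam L x t : ℝ) (a b : ℂ → ℂ) (m : ℂ → Mat2) : Prop where
  analytic : ∀ i j : Fin 2,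
    AnalyticOnNhd ℂ (fun k => m k i j) (contour lam L a ∪ poleSet lam L a b)ᶜ
  jump_relation : ∃ mp mm : ℂ → Mat2,
    ContinuousOn mp (contourStar lam L a) ∧ ContinuousOn mm (contourStar lam L a) ∧
    ∀ k ∈ contourStar lam L a,
      Tendsto m (𝓝[plusSide k] k) (𝓝 (mp k)) ∧
      Tendsto m (𝓝[minusSide k] k) (𝓝 (mm k)) ∧
      mm k = mp k * jump lam L x t a b k
  at_infinity : ∀ i j : Fin 2,
    (fun k => m k i j - (1 : Mat2) i j)
      =O[cocompact ℂ ⊓ 𝓟 ((contour lam L a ∪ poleSet lam L a b)ᶜ \ disks L)] (fun k => k⁻¹)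
  bounded : ∀ k ∈ contour lam L a \ contourStar lam L a, ∀ i j : Fin 2,
    (fun z => m z i j) =O[𝓝[(contour lam L a)ᶜ] k] (fun _ => (1 : ℂ))
  residue_D1 : ∀ p ∈ polesIn lam L a b D1,
    ResidueCondition m p 1 0
      (valueAt (fun k => (a k + lam * schwarz b k * gammaT lam L a b k * eL L k)
          * schwarz a k * eL L k * eThetaInv x t k) p
        * simpleResidue (gammaT lam L a b) p)
  residue_D4 : ∀ p ∈ polesIn lam L a b D1,
    ResidueCondition m (conj p) 0 1
      (valueAt (fun k =>
          lam * (schwarz a k + lam * b k * schwarz (gammaT lam L a b) k * eLInv L k)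
          * a k * eLInv L k * eTheta x t k) (conj p)
        * conj (simpleResidue (gammaT lam L a b) p))
  residue_D3 : ∀ p ∈ polesIn lam L a b D3,
    ResidueCondition m p 1 0
      (valueAt (fun k => a k * eThetaInv x t k
          / (schwarz a k - lam * schwarz b k * gammaT lam L a b k)) p
        * simpleResidue (gammaT lam L a b) p)
  residue_D2 : ∀ p ∈ polesIn lam L a b D3,
    ResidueCondition m (conj p) 0 1
      (valueAt (fun k => lam * schwarz a k * eTheta x t k
          / (a k - lam * b k * schwarz (gammaT lam L a b) k)) (conj p)
        * conj (simpleResidue (gammaT lam L a b) p))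

end

end PeriodicNLS

namespace PeriodicNLS

open Metric

noncomputable section

section LinearODE

variable {𝔸 : Type*} [NormedRing 𝔸] [NormedAlgebra ℝ 𝔸]

/-- The terms of the Dyson (Picard) series of the linear equation `X' = A X`, `X 0 = 1`. -/
def dyson (A : ℝ → 𝔸) : ℕ → ℝ → 𝔸
  | 0 => fun _ => 1
  | n + 1 => fun s => ∫ τ in (0 : ℝ)..s, A τ * dyson A n τ

variable [CompleteSpace 𝔸] {A : ℝ → 𝔸}

omit [CompleteSpace 𝔸] in
theorem continuous_dyson (hA : Continuous A) (n : ℕ) : Continuous (dyson A n) := by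
  induction n with
  | zero => exact continuous_const
  | succ n ih =>
    exact intervalIntegral.continuous_primitive
      (fun a b => (hA.mul ih).intervalIntegrable a b) 0

theorem hasDerivAt_dyson_succ (hA : Continuous A) (n : ℕ) (s : ℝ) :
    HasDerivAt (dyson A (n + 1)) (A s * dyson A n s) s :=
  ((hA.mul (continuous_dyson hA n)).integral_hasStrictDerivAt 0 s).hasDerivAt

omit [CompleteSpace 𝔸] in
theorem norm_dyson_le (hA : Continuous A) {C : ℝ} (hC : ∀ s, ‖A s‖ ≤ C) (n : ℕ) (s : ℝ) :
    ‖dyson A n s‖ ≤ ‖(1 : 𝔸)‖ * ((C * |s|) ^ n / n.factorial) := by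
  have hC0 : 0 ≤ C := (norm_nonneg _).trans (hC 0)
  induction n generalizing s with
  | zero => simp [dyson]
  | succ n ih =>
    have h1 : ‖dyson A (n + 1) s‖ ≤ ∫ τ in uIoc (0 : ℝ) s, ‖A τ * dyson A n τ‖ :=
      intervalIntegral.norm_integral_le_integral_norm_uIoc
    have h2 : ∫ τ in uIoc (0 : ℝ) s, ‖A τ * dyson A n τ‖ ≤
        ∫ τ in uIoc (0 : ℝ) s, C * ‖(1 : 𝔸)‖ * C ^ n / n.factorial * |τ - 0| ^ n := by
      apply MeasureTheory.integral_mono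
      · exact (((hA.mul (continuous_dyson hA n)).norm).intervalIntegrable 0 s).def'
      · have : Continuous fun τ : ℝ => C * ‖(1 : 𝔸)‖ * C ^ n / n.factorial * |τ - 0| ^ n := by
          fun_prop
        exact (this.intervalIntegrable 0 s).def'
      · intro τ
        calc ‖A τ * dyson A n τ‖ ≤ ‖A τ‖ * ‖dyson A n τ‖ := norm_mul_le _ _
          _ ≤ C * (‖(1 : 𝔸)‖ * ((C * |τ|) ^ n / n.factorial)) := by
            gcongr
            · exact hC τ
            · exact ih τ
          _ = _ := by simp only [sub_zero, mul_pow]; ring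
    refine (h1.trans h2).trans (le_of_eq ?_)
    rw [MeasureTheory.integral_const_mul, integral_pow_abs_sub_uIoc, Nat.factorial_succ]
    push_cast
    field_simp
    simp only [sub_zero]
    ring

/-- Global existence for a linear equation with bounded continuous coefficient. -/
theorem exists_linear_solution (hA : Continuous A) {C : ℝ} (hC : ∀ s, ‖A s‖ ≤ C) :
    ∃ X : ℝ → 𝔸, X 0 = 1 ∧ (∀ s, HasDerivAt X (A s * X s) s) ∧
      ∀ s, ‖X s‖ ≤ ‖(1 : 𝔸)‖ * Real.exp (C * |s|) := by
  have hC0 : 0 ≤ C := (norm_nonneg _).trans (hC 0)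
  have hsum : ∀ r : ℝ, Summable fun n : ℕ => ‖(1 : 𝔸)‖ * (r ^ n / n.factorial) := fun r =>
    (Real.summable_pow_div_factorial r).mul_left _
  have hs : ∀ s, Summable fun n => dyson A n s := fun s =>
    Summable.of_norm_bounded (hsum (C * |s|)) (fun n => norm_dyson_le hA hC n s)
  have hz : ∀ n, dyson A (n + 1) 0 = 0 := fun n => by simp [dyson]
  refine ⟨fun s => ∑' n, dyson A n s, ?_, ?_, ?_⟩
  · change ∑' n, dyson A n 0 = 1
    rw [(hs 0).tsum_eq_zero_add]
    simp [dyson]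
  · intro s
    have key : HasDerivAt (fun z => ∑' n, dyson A (n + 1) z) (∑' n, A s * dyson A n s) s := by
      refine hasDerivAt_tsum_of_isPreconnected (y₀ := 0) (t := ball 0 (|s| + 1))
        (u := fun n => C * (‖(1 : 𝔸)‖ * ((C * (|s| + 1)) ^ n / n.factorial)))
        (g' := fun n y => A y * dyson A n y)
        ((hsum _).mul_left _) isOpen_ball (convex_ball _ _).isPreconnected
        (fun n y _ => hasDerivAt_dyson_succ hA n y) ?_ (by simp; positivity) ?_ (by simp)
      · intro n y hy
        have hy' : |y| ≤ |s| + 1 := by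
          rw [mem_ball, dist_zero_right, Real.norm_eq_abs] at hy; exact hy.le
        refine (norm_mul_le _ _).trans ?_
        gcongr
        · exact hC y
        · refine (norm_dyson_le hA hC n y).trans ?_
          gcongr
      · simp only [hz]; exact summable_zero
    rw [(hs s).tsum_mul_left] at key
    have heq : (fun z => ∑' n, dyson A n z) = fun z => 1 + ∑' n, dyson A (n + 1) z := by
      funext z
      rw [(hs z).tsum_eq_zero_add]; rfl
    rw [heq]
    have := key.const_add (1 : 𝔸)
    rwa [show (∑' n, dyson A n s) = 1 + ∑' n, dyson A (n + 1) s from congrFun heq s] at this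
  · intro s
    refine (norm_tsum_le_tsum_norm ((hsum (C * |s|)).of_nonneg_of_le (fun _ => norm_nonneg _)
      (fun n => norm_dyson_le hA hC n s))).trans ?_
    refine (((hsum (C * |s|)).of_nonneg_of_le (fun _ => norm_nonneg _)
      (fun n => norm_dyson_le hA hC n s)).tsum_le_tsum
      (fun n => norm_dyson_le hA hC n s) (hsum (C * |s|))).trans ?_
    rw [tsum_mul_left, Real.exp_eq_exp_ℝ, NormedSpace.exp_eq_tsum_div]

theorem norm_sub_le_of_deriv_bound {E : Type*} [NormedAddCommGroup E] [NormedSpace ℝ E]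
    {f f' : ℝ → E} {ℓ C : ℝ} (hf : ∀ s ∈ Icc (0 : ℝ) ℓ, HasDerivAt f (f' s) s)
    (hC : ∀ s ∈ Icc (0 : ℝ) ℓ, ‖f' s‖ ≤ C) {s : ℝ} (hs : s ∈ Icc (0 : ℝ) ℓ) :
    ‖f s - f 0‖ ≤ C * ℓ := by
  have hℓ : (0 : ℝ) ≤ ℓ := hs.1.trans hs.2
  have hC0 : 0 ≤ C := (norm_nonneg _).trans (hC 0 ⟨le_rfl, hℓ⟩)
  have := (convex_Icc (0 : ℝ) ℓ).norm_image_sub_le_of_norm_hasDerivWithin_le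
    (fun x hx => (hf x hx).hasDerivWithinAt) hC ⟨le_rfl, hℓ⟩ hs
  refine this.trans ?_
  rw [sub_zero, Real.norm_eq_abs, abs_of_nonneg hs.1]
  exact mul_le_mul_of_nonneg_left hs.2 hC0

/-- Differentiability of the solution of a linear equation with respect to a parameter. -/
theorem hasDerivWithinAt_linear_solution {𝕜 : Type*} [RCLike 𝕜] [NormedAlgebra 𝕜 𝔸]
    {S : Set 𝕜} {p₀ : 𝕜} (hp₀ : p₀ ∈ S) {ℓ : ℝ} (hℓ : 0 ≤ ℓ) {A X : 𝕜 → ℝ → 𝔸} {Z B : ℝ → 𝔸}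
    (hX0 : ∀ p ∈ S, X p 0 = 1)
    (hX : ∀ p ∈ S, ∀ s ∈ Icc (0 : ℝ) ℓ, HasDerivAt (X p) (A p s * X p s) s)
    (hZ0 : Z 0 = 1) (hZ : ∀ s ∈ Icc (0 : ℝ) ℓ, HasDerivAt Z (-(Z s * A p₀ s)) s)
    (hXZ : ∀ s ∈ Icc (0 : ℝ) ℓ, X p₀ s * Z s = 1)
    {K : ℝ} (hK : ∀ᶠ p in 𝓝[S] p₀, ∀ s ∈ Icc (0 : ℝ) ℓ, ‖X p s‖ ≤ K)
    (hB : ContinuousOn B (Icc 0 ℓ))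
    (hAB : ∀ ε > 0, ∀ᶠ p in 𝓝[S] p₀, ∀ s ∈ Icc (0 : ℝ) ℓ,
      ‖A p s - A p₀ s - (p - p₀) • B s‖ ≤ ε * ‖p - p₀‖) :
    HasDerivWithinAt (fun p => X p ℓ)
      (X p₀ ℓ * ∫ s in (0 : ℝ)..ℓ, Z s * B s * X p₀ s) S p₀ := by
  have hℓm : ℓ ∈ Icc (0 : ℝ) ℓ := ⟨hℓ, le_rfl⟩
  have hX0c : ContinuousOn (X p₀) (Icc 0 ℓ) := fun s hs =>
    (hX p₀ hp₀ s hs).continuousAt.continuousWithinAt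
  have hZc : ContinuousOn Z (Icc 0 ℓ) := fun s hs => (hZ s hs).continuousAt.continuousWithinAt
  obtain ⟨MX, hMX⟩ := isCompact_Icc.exists_bound_of_continuousOn hX0c
  obtain ⟨MZ, hMZ⟩ := isCompact_Icc.exists_bound_of_continuousOn hZc
  obtain ⟨MB, hMB⟩ := isCompact_Icc.exists_bound_of_continuousOn hB
  have hMX0 : 0 ≤ MX := (norm_nonneg _).trans (hMX ℓ hℓm)
  have hMZ0 : 0 ≤ MZ := (norm_nonneg _).trans (hMZ ℓ hℓm)
  have hMB0 : 0 ≤ MB := (norm_nonneg _).trans (hMB ℓ hℓm)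
  have hK0 : 0 ≤ K := by
    have := hK.self_of_nhdsWithin hp₀
    exact (norm_nonneg _).trans (this ℓ hℓm)
  have hvar : ∀ p ∈ S, ∀ s ∈ Icc (0 : ℝ) ℓ, HasDerivAt (fun s => Z s * X p s)
      (Z s * (A p s - A p₀ s) * X p s) s := by
    intro p hp s hs
    have := (hZ s hs).mul (hX p hp s hs)
    have heq : -(Z s * A p₀ s) * X p s + Z s * (A p s * X p s) =
        Z s * (A p s - A p₀ s) * X p s := by noncomm_ring
    rwa [heq] at this
  have hdiff : ∀ p ∈ S, ∀ s ∈ Icc (0 : ℝ) ℓ, X p s - X p₀ s = X p₀ s * (Z s * X p s - 1) := by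
    intro p hp s hs
    rw [mul_sub, ← mul_assoc, hXZ s hs]; simp
  have hclose : ∀ᶠ p in 𝓝[S] p₀, ∀ s ∈ Icc (0 : ℝ) ℓ,
      ‖X p s - X p₀ s‖ ≤ MX * (MZ * ((1 + MB) * ‖p - p₀‖) * K * ℓ) := by
    filter_upwards [hK, hAB 1 one_pos, self_mem_nhdsWithin] with p hpK hp1 hpS s hs
    have hA1 : ∀ s ∈ Icc (0 : ℝ) ℓ, ‖A p s - A p₀ s‖ ≤ (1 + MB) * ‖p - p₀‖ := by
      intro s hs
      have : A p s - A p₀ s = (A p s - A p₀ s - (p - p₀) • B s) + (p - p₀) • B s := by abel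
      rw [this]
      refine (norm_add_le _ _).trans ?_
      have h2 : ‖(p - p₀) • B s‖ ≤ ‖p - p₀‖ * MB :=
        (norm_smul_le _ _).trans (by gcongr; exact hMB s hs)
      linarith [hp1 s hs]
    have h3 := norm_sub_le_of_deriv_bound (hvar p hpS)
      (C := MZ * ((1 + MB) * ‖p - p₀‖) * K) (fun s hs => by
        refine (norm_mul_le _ _).trans ?_
        gcongr
        · refine (norm_mul_le _ _).trans ?_
          gcongr
          · exact hMZ s hs
          · exact hA1 s hs
        · exact hpK s hs) hs
    simp only [hZ0, hX0 p hpS, mul_one] at h3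
    rw [hdiff p hpS s hs]
    refine (norm_mul_le _ _).trans ?_
    gcongr
    exact hMX s hs
  rw [hasDerivWithinAt_iff_isLittleO, Asymptotics.isLittleO_iff]
  intro c hc
  set D : ℝ := MX * (MZ * (K + MB) * ℓ) + 1 with hD
  have hDpos : 0 < D := by positivity
  obtain ⟨ε, hε, hεD⟩ : ∃ ε > 0, ε * D ≤ c := ⟨c / D, by positivity, by field_simp; rfl⟩
  have hsmall : ∀ᶠ p in 𝓝[S] p₀, MX * (MZ * ((1 + MB) * ‖p - p₀‖) * K * ℓ) ≤ ε := by
    have : Tendsto (fun p : 𝕜 => MX * (MZ * ((1 + MB) * ‖p - p₀‖) * K * ℓ)) (𝓝[S] p₀)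
        (𝓝 (MX * (MZ * ((1 + MB) * ‖p₀ - p₀‖) * K * ℓ))) := by
      apply Tendsto.mono_left _ nhdsWithin_le_nhds
      apply Continuous.tendsto
      fun_prop
    simp only [sub_self, norm_zero, mul_zero, zero_mul] at this
    exact this.eventually_le_const hε
  filter_upwards [hK, hAB ε hε, hclose, hsmall, self_mem_nhdsWithin] with p hpK hpA hpc hps hpS
  have hG : ∀ s ∈ Icc (0 : ℝ) ℓ, HasDerivAt
      (fun s => Z s * X p s - (p - p₀) • ∫ τ in (0 : ℝ)..s, Z (projIcc 0 ℓ hℓ τ) *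
        B (projIcc 0 ℓ hℓ τ) * X p₀ (projIcc 0 ℓ hℓ τ))
      (Z s * (A p s - A p₀ s) * X p s - (p - p₀) • (Z s * B s * X p₀ s)) s := by
    intro s hs
    refine (hvar p hpS s hs).sub ?_
    have hcont : Continuous fun τ => Z (projIcc 0 ℓ hℓ τ) *
        B (projIcc 0 ℓ hℓ τ) * X p₀ (projIcc 0 ℓ hℓ τ) := by
      have : ContinuousOn (fun τ => Z τ * B τ * X p₀ τ) (Icc 0 ℓ) := (hZc.mul hB).mul hX0c
      exact this.comp_continuous (continuous_subtype_val.comp continuous_projIcc)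
        (fun τ => (projIcc 0 ℓ hℓ τ).2)
    have h4 := (hcont.integral_hasStrictDerivAt 0 s).hasDerivAt
    rw [projIcc_of_mem hℓ hs] at h4
    exact h4.const_smul (p - p₀)
  have hbound := norm_sub_le_of_deriv_bound hG (C := MZ * (K + MB) * (ε * ‖p - p₀‖))
    (fun s hs => by
      have hsplit : Z s * (A p s - A p₀ s) * X p s - (p - p₀) • (Z s * B s * X p₀ s) =
          Z s * ((A p s - A p₀ s - (p - p₀) • B s) * X p s +
            (p - p₀) • (B s * (X p s - X p₀ s))) := by
        simp only [sub_mul, mul_add, mul_sub, smul_mul_assoc, mul_smul_comm, smul_sub, mul_assoc]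
        abel
      rw [hsplit]
      refine (norm_mul_le _ _).trans ?_
      have h5 : ‖(A p s - A p₀ s - (p - p₀) • B s) * X p s‖ ≤ ε * ‖p - p₀‖ * K := by
        refine (norm_mul_le _ _).trans ?_
        gcongr
        · exact hpA s hs
        · exact hpK s hs
      have h6 : ‖(p - p₀) • (B s * (X p s - X p₀ s))‖ ≤ ‖p - p₀‖ * (MB * ε) := by
        refine (norm_smul_le _ _).trans ?_
        gcongr
        refine (norm_mul_le _ _).trans ?_
        gcongr
        · exact hMB s hs
        · exact (hpc s hs).trans hps
      calc ‖Z s‖ * ‖_ + _‖ ≤ MZ * (ε * ‖p - p₀‖ * K + ‖p - p₀‖ * (MB * ε)) := by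
            gcongr
            · exact hMZ s hs
            · exact (norm_add_le _ _).trans (add_le_add h5 h6)
        _ = _ := by ring) hℓm
  have hint : ∫ τ in (0 : ℝ)..ℓ, Z (projIcc 0 ℓ hℓ τ) *
        B (projIcc 0 ℓ hℓ τ) * X p₀ (projIcc 0 ℓ hℓ τ) = ∫ s in (0 : ℝ)..ℓ, Z s * B s * X p₀ s := by
    apply intervalIntegral.integral_congr
    intro τ hτ
    rw [uIcc_of_le hℓ] at hτ
    simp only [projIcc_of_mem hℓ hτ]
  rw [hint] at hbound
  simp only [hZ0, hX0 p hpS, mul_one, intervalIntegral.integral_same, smul_zero, sub_zero] at hbound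
  have hfin : X p ℓ - X p₀ ℓ - (p - p₀) • (X p₀ ℓ * ∫ s in (0 : ℝ)..ℓ, Z s * B s * X p₀ s) =
      X p₀ ℓ * (Z ℓ * X p ℓ - (p - p₀) • (∫ s in (0 : ℝ)..ℓ, Z s * B s * X p₀ s) - 1) := by
    rw [hdiff p hpS ℓ hℓm, mul_sub, mul_sub, mul_sub, mul_smul_comm, mul_one]
    abel
  rw [hfin]
  refine (norm_mul_le _ _).trans ?_
  calc ‖X p₀ ℓ‖ * ‖_‖ ≤ MX * (MZ * (K + MB) * (ε * ‖p - p₀‖) * ℓ) := by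
        gcongr
        exact hMX ℓ hℓm
    _ = (ε * (MX * (MZ * (K + MB) * ℓ))) * ‖p - p₀‖ := by ring
    _ ≤ c * ‖p - p₀‖ := by
        gcongr
        refine le_trans ?_ hεD
        gcongr
        linarith

end LinearODE

attribute [local instance] Matrix.linftyOpNormedRing Matrix.linftyOpNormedAlgebra

section FundamentalSolution

theorem hasDerivAt_mat {f : ℝ → Mat2} {f' : Mat2} {s : ℝ}
    (h : ∀ i j, HasDerivAt (fun s => f s i j) (f' i j) s) : HasDerivAt f f' s :=
  hasDerivAt_pi.2 fun i => hasDerivAt_pi.2 fun j => h i j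

theorem HasDerivAt.entry {f : ℝ → Mat2} {f' : Mat2} {s : ℝ} (h : HasDerivAt f f' s)
    (i j : Fin 2) : HasDerivAt (fun s => f s i j) (f' i j) s :=
  hasDerivAt_pi.1 (hasDerivAt_pi.1 h i) j

/-- The solution of `X' = A X`, `X 0 = 1`. -/
def fundSol (A : ℝ → Mat2) : ℝ → Mat2 :=
  Classical.epsilon fun X => X 0 = 1 ∧ (∀ s, HasDerivAt X (A s * X s) s) ∧
    ∀ C, (∀ s, ‖A s‖ ≤ C) → ∀ s, ‖X s‖ ≤ Real.exp (C * |s|)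

/-- Continuous, bounded, trace-free coefficients. -/
structure IsCoefficient (A : ℝ → Mat2) : Prop where
  cont : Continuous A
  bdd : ∃ C, ∀ s, ‖A s‖ ≤ C
  trace : ∀ s, A s 1 1 = -A s 0 0

variable {A : ℝ → Mat2}

theorem linear_solution_unique (hA : IsCoefficient A) {X Y : ℝ → Mat2} (hX0 : X 0 = 1)
    (hX : ∀ s, HasDerivAt X (A s * X s) s) :
    (∀ s, HasDerivAt (fun s => (X s).adjugate) (-((X s).adjugate * A s)) s) ∧
    (∀ s, (X s).det = 1) ∧
    ((∀ s, HasDerivAt Y (A s * Y s) s) → ∀ s, Y s = X s * Y 0) := by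
  have hadj : ∀ s, HasDerivAt (fun s => (X s).adjugate) (-((X s).adjugate * A s)) s := by
    intro s
    have h00 := HasDerivAt.entry (hX s) 0 0
    have h01 := HasDerivAt.entry (hX s) 0 1
    have h10 := HasDerivAt.entry (hX s) 1 0
    have h11 := HasDerivAt.entry (hX s) 1 1
    have ht := hA.trace s
    refine hasDerivAt_mat (Fin.forall_fin_two.2 ⟨Fin.forall_fin_two.2 ⟨?_, ?_⟩,
      Fin.forall_fin_two.2 ⟨?_, ?_⟩⟩) <;>
    rw [Matrix.neg_apply, Matrix.mul_apply, Fin.sum_univ_two] <;>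
    simp only [Matrix.adjugate_fin_two, Matrix.of_apply, Matrix.cons_val', Matrix.cons_val_zero,
      Matrix.cons_val_one, Matrix.cons_val_fin_one]
    · refine h11.congr_deriv ?_
      rw [Matrix.mul_apply, Fin.sum_univ_two, ht]; ring
    · refine h01.neg.congr_deriv ?_
      rw [Matrix.mul_apply, Fin.sum_univ_two, ht]; ring
    · refine h10.neg.congr_deriv ?_
      rw [Matrix.mul_apply, Fin.sum_univ_two, ht]; ring
    · refine h00.congr_deriv ?_
      rw [Matrix.mul_apply, Fin.sum_univ_two, ht]; ring
  have hconst : ∀ Y : ℝ → Mat2, (∀ s, HasDerivAt Y (A s * Y s) s) →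
      ∀ s, (X s).adjugate * Y s = Y 0 := by
    intro Y hY s
    have hd : ∀ s, HasDerivAt (fun s => (X s).adjugate * Y s) 0 s := by
      intro s
      have := (hadj s).mul (hY s)
      have heq : -((X s).adjugate * A s) * Y s + (X s).adjugate * (A s * Y s) = 0 := by
        noncomm_ring
      rwa [heq] at this
    have := is_const_of_deriv_eq_zero (fun s => (hd s).differentiableAt)
      (fun s => (hd s).deriv) s 0
    rw [this, hX0]; simp
  have hdet : ∀ s, (X s).det = 1 := by
    intro s
    have := hconst X hX s
    rw [Matrix.adjugate_mul, hX0] at this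
    simpa using congrFun (congrFun this 0) 0
  refine ⟨hadj, hdet, fun hY s => ?_⟩
  rw [← hconst Y hY s, ← mul_assoc, Matrix.mul_adjugate, hdet s]; simp

theorem fundSol_spec (hA : IsCoefficient A) :
    fundSol A 0 = 1 ∧ (∀ s, HasDerivAt (fundSol A) (A s * fundSol A s) s) ∧
    ∀ C, (∀ s, ‖A s‖ ≤ C) → ∀ s, ‖fundSol A s‖ ≤ Real.exp (C * |s|) := by
  have hex : ∃ X : ℝ → Mat2, X 0 = 1 ∧ (∀ s, HasDerivAt X (A s * X s) s) ∧
      ∀ C, (∀ s, ‖A s‖ ≤ C) → ∀ s, ‖X s‖ ≤ Real.exp (C * |s|) := by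
    obtain ⟨C, hC⟩ := hA.bdd
    obtain ⟨X, hX0, hX, -⟩ := exists_linear_solution hA.cont hC
    refine ⟨X, hX0, hX, fun C' hC' s => ?_⟩
    obtain ⟨X', hX0', hX', hb⟩ := exists_linear_solution hA.cont hC'
    have := (linear_solution_unique (Y := X) hA hX0' hX').2.2 hX s
    rw [this, hX0, mul_one]
    simpa using hb s
  exact Classical.epsilon_spec hex

theorem fundSol_zero (hA : IsCoefficient A) : fundSol A 0 = 1 := (fundSol_spec hA).1

theorem hasDerivAt_fundSol (hA : IsCoefficient A) (s : ℝ) :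
    HasDerivAt (fundSol A) (A s * fundSol A s) s := (fundSol_spec hA).2.1 s

theorem norm_fundSol_le (hA : IsCoefficient A) {C : ℝ} (hC : ∀ s, ‖A s‖ ≤ C) (s : ℝ) :
    ‖fundSol A s‖ ≤ Real.exp (C * |s|) := (fundSol_spec hA).2.2 C hC s

theorem hasDerivAt_adjugate_fundSol (hA : IsCoefficient A) (s : ℝ) :
    HasDerivAt (fun s => (fundSol A s).adjugate) (-((fundSol A s).adjugate * A s)) s :=
  (linear_solution_unique (Y := fundSol A) hA (fundSol_zero hA) (hasDerivAt_fundSol hA)).1 s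

theorem det_fundSol (hA : IsCoefficient A) (s : ℝ) : (fundSol A s).det = 1 :=
  (linear_solution_unique (Y := fundSol A) hA (fundSol_zero hA) (hasDerivAt_fundSol hA)).2.1 s

theorem adjugate_mul_fundSol (hA : IsCoefficient A) (s : ℝ) :
    (fundSol A s).adjugate * fundSol A s = 1 := by
  rw [Matrix.adjugate_mul, det_fundSol hA, one_smul]

theorem fundSol_mul_adjugate (hA : IsCoefficient A) (s : ℝ) :
    fundSol A s * (fundSol A s).adjugate = 1 := by
  rw [Matrix.mul_adjugate, det_fundSol hA, one_smul]

theorem eq_fundSol_mul (hA : IsCoefficient A) {Y : ℝ → Mat2}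
    (hY : ∀ s, HasDerivAt Y (A s * Y s) s) (s : ℝ) : Y s = fundSol A s * Y 0 :=
  (linear_solution_unique hA (fundSol_zero hA) (hasDerivAt_fundSol hA)).2.2 hY s

/-- A vector solution is the fundamental solution applied to its initial value. -/
theorem eq_fundSol_vec (hA : IsCoefficient A) {u v : ℝ → ℂ}
    (hu : ∀ s, HasDerivAt u (A s 0 0 * u s + A s 0 1 * v s) s)
    (hv : ∀ s, HasDerivAt v (A s 1 0 * u s + A s 1 1 * v s) s) (s : ℝ) :
    u s = fundSol A s 0 0 * u 0 + fundSol A s 0 1 * v 0 ∧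
    v s = fundSol A s 1 0 * u 0 + fundSol A s 1 1 * v 0 := by
  have hY : ∀ s, HasDerivAt (fun s => (!![u s, 0; v s, 0] : Mat2))
      (A s * !![u s, 0; v s, 0]) s := by
    intro s
    refine hasDerivAt_mat (Fin.forall_fin_two.2 ⟨Fin.forall_fin_two.2 ⟨?_, ?_⟩,
      Fin.forall_fin_two.2 ⟨?_, ?_⟩⟩) <;> simp [Matrix.mul_apply, Fin.sum_univ_two]
    · exact hu s
    · exact hasDerivAt_const _ _
    · exact hv s
    · exact hasDerivAt_const _ _
  have := eq_fundSol_mul hA hY s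
  have h0 := congrFun (congrFun this 0) 0
  have h1 := congrFun (congrFun this 1) 0
  simp [Matrix.mul_apply, Fin.sum_univ_two] at h0 h1
  exact ⟨h0, h1⟩

theorem eventually_quadratic_remainder_le {E : Type*} [NormedAddCommGroup E] [NormedSpace ℂ E]
    (A0 A1 : ℝ → E) {A2 : ℝ → E} {C : ℝ} (h2 : ∀ s, ‖A2 s‖ ≤ C) (k0 : ℂ) {ε : ℝ} (hε : 0 < ε) :
    ∀ᶠ k in 𝓝[univ] k0, ∀ s, ‖A0 s + k • A1 s + k ^ 2 • A2 s -
      (A0 s + k0 • A1 s + k0 ^ 2 • A2 s) - (k - k0) • (A1 s + (2 * k0) • A2 s)‖ ≤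
        ε * ‖k - k0‖ := by
  have hC0 : 0 ≤ C := (norm_nonneg _).trans (h2 0)
  rw [nhdsWithin_univ]
  filter_upwards [ball_mem_nhds k0 (show (0 : ℝ) < ε / (C + 1) by positivity)] with k hk s
  have hk' : ‖k - k0‖ < ε / (C + 1) := by simpa [dist_eq_norm] using hk
  have heq : A0 s + k • A1 s + k ^ 2 • A2 s - (A0 s + k0 • A1 s + k0 ^ 2 • A2 s) -
      (k - k0) • (A1 s + (2 * k0) • A2 s) = (k - k0) ^ 2 • A2 s := by
    module
  rw [heq, norm_smul, norm_pow]
  calc ‖k - k0‖ ^ 2 * ‖A2 s‖ ≤ (ε / (C + 1)) * ‖k - k0‖ * (C + 1) := by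
        rw [sq]
        gcongr
        linarith [h2 s]
    _ = ε * ‖k - k0‖ := by field_simp

set_option maxHeartbeats 2000000 in
/-- The fundamental solution is entire in a parameter on which the coefficient depends
quadratically. -/
theorem differentiable_fundSol {A0 A1 A2 : ℝ → Mat2} {C : ℝ}
    (h0 : ∀ s, ‖A0 s‖ ≤ C) (h1 : ∀ s, ‖A1 s‖ ≤ C) (h2 : ∀ s, ‖A2 s‖ ≤ C)
    (c1 : Continuous A1) (c2 : Continuous A2)
    (hA : ∀ k : ℂ, IsCoefficient fun s => A0 s + k • A1 s + k ^ 2 • A2 s)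
    {ℓ : ℝ} (hℓ : 0 ≤ ℓ) (i j : Fin 2) :
    Differentiable ℂ fun k : ℂ => fundSol (fun s => A0 s + k • A1 s + k ^ 2 • A2 s) ℓ i j := by
  intro k0
  have hC0 : 0 ≤ C := (norm_nonneg _).trans (h0 0)
  have hbd : ∀ k : ℂ, ∀ s, ‖A0 s + k • A1 s + k ^ 2 • A2 s‖ ≤ C + ‖k‖ * C + ‖k‖ ^ 2 * C := by
    intro k s
    refine (norm_add₃_le).trans ?_
    rw [norm_smul, norm_smul, norm_pow]
    gcongr
    · exact h0 s
    · exact h1 s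
    · exact h2 s
  set A : ℂ → ℝ → Mat2 := fun k s => A0 s + k • A1 s + k ^ 2 • A2 s with hAdef
  have hK : ∀ᶠ k in 𝓝[univ] k0, ∀ s ∈ Icc (0 : ℝ) ℓ, ‖fundSol (A k) s‖ ≤
      Real.exp ((C + (‖k0‖ + 1) * C + (‖k0‖ + 1) ^ 2 * C) * ℓ) := by
    rw [nhdsWithin_univ]
    filter_upwards [ball_mem_nhds k0 one_pos] with k hk s hs
    have hk' : ‖k‖ ≤ ‖k0‖ + 1 := by
      have : ‖k - k0‖ < 1 := by simpa [dist_eq_norm] using hk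
      have := norm_le_norm_add_norm_sub' k k0
      linarith
    refine (norm_fundSol_le (hA k) (hbd k) s).trans ?_
    rw [Real.exp_le_exp, abs_of_nonneg hs.1]
    exact mul_le_mul (by gcongr) hs.2 hs.1 (by positivity)
  have hAB : ∀ ε > 0, ∀ᶠ k in 𝓝[univ] k0, ∀ s ∈ Icc (0 : ℝ) ℓ,
      ‖A k s - A k0 s - (k - k0) • (A1 s + (2 * k0) • A2 s)‖ ≤ ε * ‖k - k0‖ := by
    exact fun ε hε => (eventually_quadratic_remainder_le A0 A1 h2 k0 hε).mono fun k hk s _ => hk s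
  have key := hasDerivWithinAt_linear_solution (𝔸 := Mat2) (𝕜 := ℂ) (S := univ) (p₀ := k0)
    (mem_univ _) hℓ (A := A) (X := fun k => fundSol (A k))
    (Z := fun s => (fundSol (A k0) s).adjugate)
    (B := fun s => A1 s + (2 * k0) • A2 s)
    (fun k _ => fundSol_zero (hA k)) (fun k _ s _ => hasDerivAt_fundSol (hA k) s)
    ((congrArg Matrix.adjugate (fundSol_zero (hA k0))).trans Matrix.adjugate_one)
    (fun s _ => hasDerivAt_adjugate_fundSol (hA k0) s)
    (fun s _ => fundSol_mul_adjugate (hA k0) s) hK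
    ((c1.add (c2.const_smul (2 * k0))).continuousOn) hAB
  rw [hasDerivWithinAt_univ] at key
  have k2 := hasDerivAt_pi.1 key i
  have k3 := hasDerivAt_pi.1 k2 j
  exact k3.differentiableAt

end FundamentalSolution

attribute [local instance] Matrix.linftyOpNormedRing Matrix.linftyOpNormedAlgebra

section SolutionData

/-- A solution of the equation together with the derivatives that enter the Lax pair. -/
structure IsNLSData (lam L : ℝ) (q qx qxx qt : ℝ → ℝ → ℂ) : Prop where
  cont : ContinuousOn (fun p : ℝ × ℝ => q p.1 p.2) (univ ×ˢ Ici 0)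
  contx : ContinuousOn (fun p : ℝ × ℝ => qx p.1 p.2) (univ ×ˢ Ici 0)
  contxx : ContinuousOn (fun p : ℝ × ℝ => qxx p.1 p.2) (univ ×ˢ Ici 0)
  contt : ContinuousOn (fun p : ℝ × ℝ => qt p.1 p.2) (univ ×ˢ Ici 0)
  dx : ∀ x t, 0 ≤ t → HasDerivAt (fun y => q y t) (qx x t) x
  dxx : ∀ x t, 0 ≤ t → HasDerivAt (fun y => qx y t) (qxx x t) x
  dt : ∀ x t, 0 ≤ t → HasDerivWithinAt (fun s => q x s) (qt x t) (Ici 0) t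
  per : ∀ x t, 0 ≤ t → q (x + L) t = q x t
  perx : ∀ x t, 0 ≤ t → qx (x + L) t = qx x t
  perxx : ∀ x t, 0 ≤ t → qxx (x + L) t = qxx x t
  eq : ∀ x t, 0 ≤ t → qt x t = I * qxx x t - 2 * I * lam * (q x t * q x t * conj (q x t))

theorem hasDerivAt_slice {H : ℝ × ℝ → ℂ} (hH : ContDiffOn ℝ ∞ H (univ ×ˢ Ici 0)) (x : ℝ) {t : ℝ}
    (ht : 0 ≤ t) :
    HasDerivAt (fun y => H (y, t)) (fderivWithin ℝ H (univ ×ˢ Ici 0) (x, t) (1, 0)) x ∧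
    HasDerivWithinAt (fun s => H (x, s)) (fderivWithin ℝ H (univ ×ˢ Ici 0) (x, t) (0, 1))
      (Ici 0) t := by
  have hd := (hH.differentiableOn (by simp) (x, t) ⟨mem_univ _, ht⟩).hasFDerivWithinAt
  constructor
  · rw [← hasDerivWithinAt_univ]
    have h1 : HasDerivWithinAt (fun y : ℝ => (y, t)) ((1 : ℝ), (0 : ℝ)) univ x :=
      ((hasDerivAt_id x).prodMk (hasDerivAt_const x t)).hasDerivWithinAt
    have hm : MapsTo (fun y : ℝ => (y, t)) univ (univ ×ˢ Ici 0) := fun y _ => ⟨mem_univ y, ht⟩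
    exact hd.comp_hasDerivWithinAt x h1 hm
  · have h1 : HasDerivWithinAt (fun s : ℝ => (x, s)) ((0 : ℝ), (1 : ℝ)) (Ici 0) t :=
      ((hasDerivAt_const t x).prodMk (hasDerivAt_id t)).hasDerivWithinAt
    have hm : MapsTo (fun s : ℝ => (x, s)) (Ici 0) (univ ×ˢ Ici 0) := fun y hy => ⟨mem_univ x, hy⟩
    exact hd.comp_hasDerivWithinAt t h1 hm

theorem contDiffOn_fderivWithin_apply {H : ℝ × ℝ → ℂ} (hH : ContDiffOn ℝ ∞ H (univ ×ˢ Ici 0))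
    (v : ℝ × ℝ) :
    ContDiffOn ℝ ∞ (fun p => fderivWithin ℝ H (univ ×ˢ Ici 0) p v) (univ ×ˢ Ici 0) :=
  (hH.fderivWithin (uniqueDiffOn_univ.prod (uniqueDiffOn_Ici 0)) (by simp)).clm_apply
    contDiffOn_const

theorem periodic_deriv {f g : ℝ → ℂ} {L : ℝ} (hf : ∀ x, HasDerivAt f (g x) x)
    (hp : ∀ x, f (x + L) = f x) (x : ℝ) : g (x + L) = g x := by
  have h1 : HasDerivAt (fun y => f (y + L)) (g (x + L)) x := (hf (x + L)).comp_add_const x L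
  rw [show (fun y => f (y + L)) = f from funext hp] at h1
  exact h1.unique (hf x)

theorem IsSmoothPeriodicSolution.exists_data {lam L : ℝ} {q : ℝ → ℝ → ℂ}
    (h : IsSmoothPeriodicSolution lam L q) : ∃ qx qxx qt, IsNLSData lam L q qx qxx qt := by
  set S : Set (ℝ × ℝ) := univ ×ˢ Ici 0 with hS
  set F : ℝ × ℝ → ℂ := fun p => q p.1 p.2 with hF
  have c0 : ContDiffOn ℝ ∞ F S := h.smooth
  set F1 : ℝ × ℝ → ℂ := fun p => fderivWithin ℝ F S p (1, 0) with hF1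
  have c1 : ContDiffOn ℝ ∞ F1 S := contDiffOn_fderivWithin_apply c0 _
  set F2 : ℝ × ℝ → ℂ := fun p => fderivWithin ℝ F1 S p (1, 0) with hF2
  have c2 : ContDiffOn ℝ ∞ F2 S := contDiffOn_fderivWithin_apply c1 _
  set Ft : ℝ × ℝ → ℂ := fun p => fderivWithin ℝ F S p (0, 1) with hFt
  have ct : ContDiffOn ℝ ∞ Ft S := contDiffOn_fderivWithin_apply c0 _
  have d1 : ∀ x t, 0 ≤ t → HasDerivAt (fun y => q y t) (F1 (x, t)) x := fun x t ht =>
    (hasDerivAt_slice c0 x ht).1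
  have d2 : ∀ x t, 0 ≤ t → HasDerivAt (fun y => F1 (y, t)) (F2 (x, t)) x := fun x t ht =>
    (hasDerivAt_slice c1 x ht).1
  have dt : ∀ x t, 0 ≤ t → HasDerivWithinAt (fun s => q x s) (Ft (x, t)) (Ici 0) t :=
    fun x t ht => (hasDerivAt_slice c0 x ht).2
  have p1 : ∀ x t, 0 ≤ t → F1 (x + L, t) = F1 (x, t) := fun x t ht =>
    periodic_deriv (fun y => d1 y t ht) (fun y => h.periodic y t ht) x
  refine ⟨fun x t => F1 (x, t), fun x t => F2 (x, t), fun x t => Ft (x, t),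
    c0.continuousOn, c1.continuousOn, c2.continuousOn, ct.continuousOn, d1, d2, dt, h.periodic,
    p1, fun x t ht => periodic_deriv (fun y => d2 y t ht) (fun y => p1 y t ht) x, ?_⟩
  intro x t ht
  have heq := h.equation x t ht
  rw [(dt x t ht).derivWithin (uniqueDiffOn_Ici 0 t ht)] at heq
  have hdd : iteratedDeriv 2 (fun y => q y t) x = F2 (x, t) := by
    rw [iteratedDeriv_succ, iteratedDeriv_one,
      show deriv (fun y => q y t) = fun y => F1 (y, t) from funext fun y => (d1 y t ht).deriv]
    exact (d2 x t ht).deriv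
  rw [hdd, ← Complex.mul_conj'] at heq
  linear_combination (-I) * heq + Ft (x, t) * I_mul_I

theorem exists_bound_of_periodic {L : ℝ} (hL : 0 < L) {H : ℝ → ℝ → ℂ}
    (hc : ContinuousOn (fun p : ℝ × ℝ => H p.1 p.2) (univ ×ˢ Ici 0))
    (hp : ∀ x t, 0 ≤ t → H (x + L) t = H x t) (T : ℝ) :
    ∃ B, ∀ x, ∀ t ∈ Icc 0 T, ‖H x t‖ ≤ B := by
  obtain ⟨B, hB⟩ := (isCompact_Icc (a := (0 : ℝ)) (b := L)).prod
    (isCompact_Icc (a := (0 : ℝ)) (b := T)) |>.exists_bound_of_continuousOn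
    (hc.mono (prod_mono (subset_univ _) Icc_subset_Ici_self))
  refine ⟨B, fun x t ht => ?_⟩
  obtain ⟨y, hy, hxy⟩ := Function.Periodic.exists_mem_Ico₀ (f := fun x => H x t)
    (fun x => hp x t ht.1) hL x
  rw [hxy]
  exact hB (y, t) ⟨⟨hy.1, hy.2.le⟩, ht⟩

theorem IsNLSData.continuous_slice {lam L : ℝ} {q qx qxx qt : ℝ → ℝ → ℂ}
    (h : IsNLSData lam L q qx qxx qt) {t : ℝ} (ht : 0 ≤ t) :
    Continuous (fun x => q x t) ∧ Continuous (fun x => qx x t) ∧ Continuous (fun x => qxx x t) ∧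
      Continuous (fun x => qt x t) := by
  have hm : ∀ x : ℝ, (x, t) ∈ (univ ×ˢ Ici 0 : Set (ℝ × ℝ)) := fun x => ⟨mem_univ _, ht⟩
  have hc : Continuous fun x : ℝ => (x, t) := by fun_prop
  exact ⟨h.cont.comp_continuous hc hm, h.contx.comp_continuous hc hm,
    h.contxx.comp_continuous hc hm, h.contt.comp_continuous hc hm⟩

end SolutionData

section LaxPair

/-- The coefficient of the `x`-part of the Lax pair. -/
def laxU (lam : ℝ) (z k : ℂ) : Mat2 := !![-(I * k), z; lam * conj z, I * k]

/-- The coefficient of the `t`-part of the Lax pair where `q`, `q_x` have the values `z`, `w`. -/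
def laxV (lam : ℝ) (z w k : ℂ) : Mat2 :=
  !![-(2 * I * k ^ 2) - I * lam * (z * conj z), 2 * k * z + I * w;
     2 * k * (lam * conj z) - I * (lam * conj w), 2 * I * k ^ 2 + I * lam * (z * conj z)]

theorem zero_curvature (lam : ℝ) (z w v k : ℂ) :
    (!![0, I * v - 2 * I * lam * (z * z * conj z);
        lam * conj (I * v - 2 * I * lam * (z * z * conj z)), 0] : Mat2) =
      !![-(I * lam * (w * conj z + z * conj w)), 2 * k * w + I * v;
         2 * k * (lam * conj w) - I * (lam * conj v), I * lam * (w * conj z + z * conj w)] +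
      laxV lam z w k * laxU lam z k - laxU lam z k * laxV lam z w k := by
  ext i j
  fin_cases i <;> fin_cases j <;>
    simp [laxU, laxV, conj_ofNat]
  · ring
  · linear_combination (-(2 * k * w)) * I_sq
  · linear_combination (-(2 * lam * k * conj w)) * I_sq
  · ring

/-- Coefficients that depend continuously on two bounded functions. -/
theorem exists_coefficient_bound {φ : ℂ × ℂ → Mat2} (hφ : Continuous φ) (B : ℝ) :
    ∃ C, ∀ z w : ℂ, ‖z‖ ≤ B → ‖w‖ ≤ B → ‖φ (z, w)‖ ≤ C := by
  obtain ⟨C, hC⟩ := ((isCompact_closedBall (0 : ℂ) B).prod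
    (isCompact_closedBall (0 : ℂ) B)).exists_bound_of_continuousOn hφ.continuousOn
  exact ⟨C, fun z w hz hw => hC (z, w) ⟨by simpa using hz, by simpa using hw⟩⟩

theorem continuous_laxU (lam : ℝ) (k : ℂ) : Continuous fun p : ℂ × ℂ => laxU lam p.1 k := by
  refine continuous_pi fun i => continuous_pi fun j => ?_
  fin_cases i <;> fin_cases j <;> simp [laxU] <;> fun_prop

theorem continuous_laxV (lam : ℝ) (k : ℂ) : Continuous fun p : ℂ × ℂ => laxV lam p.1 p.2 k := by
  refine continuous_pi fun i => continuous_pi fun j => ?_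
  fin_cases i <;> fin_cases j <;> simp [laxV] <;> fun_prop

theorem isCoefficient_laxU (lam : ℝ) {z : ℝ → ℂ} (hz : Continuous z) {B : ℝ}
    (hB : ∀ s, ‖z s‖ ≤ B) (k : ℂ) : IsCoefficient fun s => laxU lam (z s) k where
  cont := (continuous_laxU lam k).comp (hz.prodMk hz)
  bdd := by
    obtain ⟨C, hC⟩ := exists_coefficient_bound (continuous_laxU lam k) B
    exact ⟨C, fun s => hC _ _ (hB s) (hB s)⟩
  trace s := by simp [laxU]

theorem isCoefficient_laxV (lam : ℝ) {z w : ℝ → ℂ} (hz : Continuous z) (hw : Continuous w) {B : ℝ}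
    (hB : ∀ s, ‖z s‖ ≤ B) (hB' : ∀ s, ‖w s‖ ≤ B) (k : ℂ) :
    IsCoefficient fun s => laxV lam (z s) (w s) k := by
  refine ⟨?_, ?_, fun s => ?_⟩
  · have h1 : Continuous fun s => (z s, w s) := hz.prodMk hw
    have h2 := (continuous_laxV lam k).comp h1
    simp only [Function.comp_def] at h2
    exact h2
  · obtain ⟨C, hC⟩ := exists_coefficient_bound (continuous_laxV lam k) B
    exact ⟨C, fun s => hC (z s) (w s) (hB s) (hB' s)⟩
  · change 2 * I * k ^ 2 + I * lam * (z s * conj (z s)) =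
      -(-(2 * I * k ^ 2) - I * lam * (z s * conj (z s)))
    ring

theorem differentiable_fundSol_laxV (lam : ℝ) {z w : ℝ → ℂ} (hz : Continuous z)
    (hw : Continuous w) {B : ℝ} (hB : ∀ s, ‖z s‖ ≤ B) (hB' : ∀ s, ‖w s‖ ≤ B) {ℓ : ℝ}
    (hℓ : 0 ≤ ℓ) (i j : Fin 2) :
    Differentiable ℂ fun k => fundSol (fun s => laxV lam (z s) (w s) k) ℓ i j := by
  set Φ0 : ℂ × ℂ → Mat2 := fun p => laxV lam p.1 p.2 0
  set Φ1 : ℂ × ℂ → Mat2 := fun p => !![0, 2 * p.1; 2 * (lam * conj p.1), 0]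
  set Φ2 : ℂ × ℂ → Mat2 := fun _ => !![-(2 * I), 0; 0, 2 * I]
  have h1 : Continuous Φ1 := by
    refine continuous_pi fun i => continuous_pi fun j => ?_
    fin_cases i <;> fin_cases j <;> simp [Φ1] <;> fun_prop
  obtain ⟨C0, hC0⟩ := exists_coefficient_bound (continuous_laxV lam 0) B
  obtain ⟨C1, hC1⟩ := exists_coefficient_bound h1 B
  obtain ⟨C2, hC2⟩ := exists_coefficient_bound (φ := Φ2) continuous_const B
  have heq : ∀ k : ℂ, (fun s => laxV lam (z s) (w s) k) = fun s => Φ0 (z s, w s) +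
      k • Φ1 (z s, w s) + k ^ 2 • Φ2 (z s, w s) := by
    intro k; funext s; ext i j
    fin_cases i <;> fin_cases j <;> simp [Φ0, Φ1, Φ2, laxV] <;> ring
  simp_rw [heq]
  refine differentiable_fundSol (C := max C0 (max C1 C2))
    (fun s => (hC0 _ _ (hB s) (hB' s)).trans (le_max_left _ _))
    (fun s => (hC1 _ _ (hB s) (hB' s)).trans ((le_max_left _ _).trans (le_max_right _ _)))
    (fun s => (hC2 _ _ (hB s) (hB' s)).trans ((le_max_right _ _).trans (le_max_right _ _)))
    (h1.comp (hz.prodMk hw)) continuous_const (fun k => ?_) hℓ i j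
  rw [← heq]
  exact isCoefficient_laxV lam hz hw hB hB' k

theorem differentiable_fundSol_laxU (lam : ℝ) {z : ℝ → ℂ} (hz : Continuous z)
    {B : ℝ} (hB : ∀ s, ‖z s‖ ≤ B) {ℓ : ℝ} (hℓ : 0 ≤ ℓ) (i j : Fin 2) :
    Differentiable ℂ fun k => fundSol (fun s => laxU lam (z s) k) ℓ i j := by
  set Φ1 : Mat2 := !![-I, 0; 0, I]
  obtain ⟨C0, hC0⟩ := exists_coefficient_bound (continuous_laxU lam 0) B
  have heq : ∀ k : ℂ, (fun s => laxU lam (z s) k) = fun s => laxU lam (z s) 0 +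
      k • Φ1 + k ^ 2 • (0 : Mat2) := by
    intro k; funext s; ext i j
    fin_cases i <;> fin_cases j <;> simp [Φ1, laxU] <;> ring
  simp_rw [heq]
  refine differentiable_fundSol (C := max C0 ‖Φ1‖) (A0 := fun s => laxU lam (z s) 0)
    (A1 := fun _ => Φ1) (A2 := fun _ => 0)
    (fun s => (hC0 _ _ (hB s) (hB s)).trans (le_max_left _ _))
    (fun s => le_max_right _ _) (fun s => ?_) continuous_const continuous_const (fun k => ?_) hℓ i j
  · rw [norm_zero]; exact (norm_nonneg _).trans (le_max_right _ _)
  · rw [← heq]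
    exact isCoefficient_laxU lam hz hB k

end LaxPair

attribute [local instance] Matrix.linftyOpNormedRing Matrix.linftyOpNormedAlgebra

section Fundamental

/-- The fundamental matrix of the `x`-part, equal to the identity at `x = 0`. -/
def xFund (lam : ℝ) (q0 : ℝ → ℂ) (k : ℂ) : ℝ → Mat2 := fundSol fun s => laxU lam (q0 s) k

/-- The point of `[0, T]` closest to `s`. -/
def clamp (T s : ℝ) : ℝ := max 0 (min s T)

theorem continuous_clamp (T : ℝ) : Continuous (clamp T) := by unfold clamp; fun_prop

theorem clamp_mem {T : ℝ} (hT : 0 ≤ T) (s : ℝ) : clamp T s ∈ Icc 0 T :=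
  ⟨le_max_left _ _, max_le hT (min_le_right _ _)⟩

theorem clamp_of_mem {T s : ℝ} (hs : s ∈ Icc 0 T) : clamp T s = s := by
  simp [clamp, min_eq_left hs.2, max_eq_right hs.1]

/-- The fundamental matrix on `[0, T]` of the `t`-part at `x = 0`, equal to the identity at
`t = 0`. -/
def tFund (lam : ℝ) (q qx : ℝ → ℝ → ℂ) (T : ℝ) (k : ℂ) : ℝ → Mat2 :=
  fundSol fun s => laxV lam (q 0 (clamp T s)) (qx 0 (clamp T s)) k

variable {lam L T : ℝ} {q qx qxx qt : ℝ → ℝ → ℂ}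

theorem IsNLSData.isCoefficient_x (h : IsNLSData lam L q qx qxx qt) (hL : 0 < L) {t : ℝ}
    (ht : 0 ≤ t) (k : ℂ) : IsCoefficient fun s => laxU lam (q s t) k := by
  obtain ⟨B, hB⟩ := exists_bound_of_periodic hL h.cont h.per t
  exact isCoefficient_laxU lam (h.continuous_slice ht).1 (fun s => hB s t ⟨ht, le_rfl⟩) k

theorem IsNLSData.clamp_slice (h : IsNLSData lam L q qx qxx qt) (hL : 0 < L) (hT : 0 ≤ T) :
    Continuous (fun s => q 0 (clamp T s)) ∧ Continuous (fun s => qx 0 (clamp T s)) ∧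
      ∃ B, (∀ s, ‖q 0 (clamp T s)‖ ≤ B) ∧ ∀ s, ‖qx 0 (clamp T s)‖ ≤ B := by
  have hc : Continuous fun s : ℝ => ((0 : ℝ), clamp T s) :=
    continuous_const.prodMk (continuous_clamp T)
  have hm : ∀ s : ℝ, ((0 : ℝ), clamp T s) ∈ (univ ×ˢ Ici 0 : Set (ℝ × ℝ)) := fun s =>
    ⟨mem_univ _, (clamp_mem hT s).1⟩
  obtain ⟨B, hB⟩ := exists_bound_of_periodic hL h.cont h.per T
  obtain ⟨B', hB'⟩ := exists_bound_of_periodic hL h.contx h.perx T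
  exact ⟨h.cont.comp_continuous hc hm, h.contx.comp_continuous hc hm, max B B',
    fun s => (hB 0 _ (clamp_mem hT s)).trans (le_max_left _ _),
    fun s => (hB' 0 _ (clamp_mem hT s)).trans (le_max_right _ _)⟩

theorem IsNLSData.isCoefficient_t (h : IsNLSData lam L q qx qxx qt) (hL : 0 < L) (hT : 0 ≤ T)
    (k : ℂ) : IsCoefficient fun s => laxV lam (q 0 (clamp T s)) (qx 0 (clamp T s)) k := by
  obtain ⟨h1, h2, B, hB, hB'⟩ := h.clamp_slice hL hT
  exact isCoefficient_laxV lam h1 h2 hB hB' k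

theorem norm_laxQ_le (hlam : lam = 1 ∨ lam = -1) (z : ℂ) : ‖laxQ lam z‖ ≤ ‖z‖ := by
  rw [Matrix.linfty_opNorm_def]
  have : (Finset.univ.sup fun i : Fin 2 => ∑ j, ‖laxQ lam z i j‖₊) ≤ ‖z‖₊ := by
    refine Finset.sup_le fun i _ => ?_
    rw [← NNReal.coe_le_coe]
    fin_cases i <;> simp [laxQ, Fin.sum_univ_two]
    rcases hlam with rfl | rfl <;> simp
  exact this

theorem IsNLSData.eventually_laxU_le (h : IsNLSData lam L q qx qxx qt)
    (hlam : lam = 1 ∨ lam = -1) {t : ℝ} (ht : t ∈ Icc 0 T) (k : ℂ) {ε : ℝ} (hε : 0 < ε) :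
    ∀ᶠ t' in 𝓝[Icc 0 T] t, ∀ s ∈ Icc (0 : ℝ) L,
      ‖laxU lam (q s t') k - laxU lam (q s t) k - (t' - t) • laxQ lam (qt s t)‖ ≤
        ε * ‖t' - t‖ := by
  have huc := ((isCompact_Icc (a := (0 : ℝ)) (b := L)).prod
    (isCompact_Icc (a := (0 : ℝ)) (b := T))).uniformContinuousOn_of_continuous
    (h.contt.mono (prod_mono (subset_univ _) Icc_subset_Ici_self))
  obtain ⟨δ, hδ, hδ'⟩ := Metric.uniformContinuousOn_iff.1 huc ε hε
  filter_upwards [self_mem_nhdsWithin, mem_nhdsWithin_of_mem_nhds (ball_mem_nhds t hδ)]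
    with t' ht' hb s hs
  have hconv : Convex ℝ (Icc 0 T ∩ ball t δ) := (convex_Icc _ _).inter (convex_ball _ _)
  have hd : ∀ τ ∈ Icc 0 T ∩ ball t δ, HasDerivWithinAt
      (fun τ : ℝ => q s τ - τ • qt s t) (qt s τ - (1 : ℝ) • qt s t)
      (Icc 0 T ∩ ball t δ) τ := by
    intro τ hτ
    refine ((h.dt s τ hτ.1.1).mono fun x hx => hx.1.1).sub ?_
    exact ((hasDerivAt_id τ).smul_const (qt s t)).hasDerivWithinAt
  have key := hconv.norm_image_sub_le_of_norm_hasDerivWithin_le (C := ε) hd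
    (fun τ hτ => by
      rw [one_smul, ← dist_eq_norm]
      exact (hδ' (s, τ) ⟨hs, hτ.1⟩ (s, t) ⟨hs, ht⟩
        (by simpa [Prod.dist_eq] using hτ.2)).le)
    ⟨ht, mem_ball_self hδ⟩ ⟨ht', hb⟩
  have heq : laxU lam (q s t') k - laxU lam (q s t) k - (t' - t) • laxQ lam (qt s t) =
      laxQ lam (q s t' - t' • qt s t - (q s t - t • qt s t)) := by
    ext i j
    fin_cases i <;> fin_cases j <;> simp [laxU, laxQ] <;> ring
  rw [heq]
  exact (norm_laxQ_le hlam _).trans key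

/-- Evolution in time of the monodromy matrix. -/
theorem IsNLSData.hasDerivWithinAt_monodromy (h : IsNLSData lam L q qx qxx qt)
    (hlam : lam = 1 ∨ lam = -1) (hL : 0 < L) {t : ℝ} (ht : t ∈ Icc 0 T) (k : ℂ) :
    HasDerivWithinAt (fun t => xFund lam (fun y => q y t) k L)
      (laxV lam (q 0 t) (qx 0 t) k * xFund lam (fun y => q y t) k L -
        xFund lam (fun y => q y t) k L * laxV lam (q 0 t) (qx 0 t) k) (Icc 0 T) t := by
  have hco : ∀ t ∈ Icc 0 T, IsCoefficient fun s => laxU lam (q s t) k := fun t ht =>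
    h.isCoefficient_x hL ht.1 k
  obtain ⟨B, hB⟩ := exists_bound_of_periodic hL h.cont h.per T
  obtain ⟨C, hC⟩ := exists_coefficient_bound (continuous_laxU lam k) B
  set X : ℝ → ℝ → Mat2 := fun t => xFund lam (fun y => q y t) k with hX
  set Z : ℝ → Mat2 := fun s => (X t s).adjugate with hZ
  have hC0 : 0 ≤ C := (norm_nonneg _).trans (hC _ _ (hB 0 t ht) (hB 0 t ht))
  have e1 : ∀ p ∈ Icc 0 T, X p 0 = 1 := fun p hp => fundSol_zero (hco p hp)
  have e2 : ∀ p ∈ Icc 0 T, ∀ s ∈ Icc (0 : ℝ) L, HasDerivAt (X p)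
      (laxU lam (q s p) k * X p s) s := fun p hp s _ => hasDerivAt_fundSol (hco p hp) s
  have e3 : Z 0 = 1 := (congrArg Matrix.adjugate (e1 t ht)).trans Matrix.adjugate_one
  have e4 : ∀ s, HasDerivAt Z (-(Z s * laxU lam (q s t) k)) s := fun s =>
    hasDerivAt_adjugate_fundSol (hco t ht) s
  have e5 : ∀ s, X t s * Z s = 1 := fun s => fundSol_mul_adjugate (hco t ht) s
  have e6 : ∀ᶠ p in 𝓝[Icc 0 T] t, ∀ s ∈ Icc (0 : ℝ) L, ‖X p s‖ ≤ Real.exp (C * L) := by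
    filter_upwards [self_mem_nhdsWithin] with p hp s hs
    refine (norm_fundSol_le (hco p hp) (fun s => hC _ _ (hB s p hp) (hB s p hp)) s).trans ?_
    rw [Real.exp_le_exp, abs_of_nonneg hs.1]
    exact mul_le_mul_of_nonneg_left hs.2 hC0
  have hcq := (h.continuous_slice ht.1).2.2.2
  have e7 : Continuous fun s => laxQ lam (qt s t) := by
    refine continuous_pi fun i => continuous_pi fun j => ?_
    fin_cases i <;> fin_cases j <;> simp [laxQ] <;> fun_prop
  have key := hasDerivWithinAt_linear_solution ht hL.le (A := fun p s => laxU lam (q s p) k)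
    e1 e2 e3 (fun s _ => e4 s) (fun s _ => e5 s) e6 e7.continuousOn
    (fun ε hε => h.eventually_laxU_le hlam ht k hε)
  have hV : ∀ s, HasDerivAt (fun s => laxV lam (q s t) (qx s t) k)
      (!![-(I * lam * (qx s t * conj (q s t) + q s t * conj (qx s t))),
          2 * k * qx s t + I * qxx s t;
         2 * k * (lam * conj (qx s t)) - I * (lam * conj (qxx s t)),
          I * lam * (qx s t * conj (q s t) + q s t * conj (qx s t))]) s := by
    intro s
    have d0 := h.dx s t ht.1
    have d1 := h.dxx s t ht.1
    have d0' : HasDerivAt (fun y => conj (q y t)) (conj (qx s t)) s := d0.star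
    have d1' : HasDerivAt (fun y => conj (qx y t)) (conj (qxx s t)) s := d1.star
    refine hasDerivAt_mat (Fin.forall_fin_two.2 ⟨Fin.forall_fin_two.2 ⟨?_, ?_⟩,
      Fin.forall_fin_two.2 ⟨?_, ?_⟩⟩)
    · exact (((d0.mul d0').const_mul (I * lam)).const_sub (-(2 * I * k ^ 2))).congr_deriv (by simp)
    · exact (d0.const_mul (2 * k)).add (d1.const_mul I)
    · exact ((d0'.const_mul (lam : ℂ)).const_mul (2 * k)).sub
        ((d1'.const_mul (lam : ℂ)).const_mul I)
    · exact ((d0.mul d0').const_mul (I * lam)).const_add (2 * I * k ^ 2)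
  have hX' : ∀ s, HasDerivAt (X t) (laxU lam (q s t) k * X t s) s := fun s =>
    hasDerivAt_fundSol (hco t ht) s
  have hG : ∀ s, HasDerivAt (fun s => Z s * laxV lam (q s t) (qx s t) k * X t s)
      (Z s * laxQ lam (qt s t) * X t s) s := by
    intro s
    have hd := ((e4 s).mul (hV s)).mul (hX' s)
    have hz := zero_curvature lam (q s t) (qx s t) (qxx s t) k
    rw [← h.eq s t ht.1] at hz
    have hz' : laxQ lam (qt s t) = _ := hz
    refine hd.congr_deriv ?_
    rw [hz']
    simp only [Pi.mul_apply, mul_add, add_mul, sub_mul, mul_sub, neg_mul, mul_assoc]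
    abel
  have hZc : Continuous Z := continuous_iff_continuousAt.2 fun s => (e4 s).continuousAt
  have hXc : Continuous (X t) := continuous_iff_continuousAt.2 fun s => (hX' s).continuousAt
  have hint := intervalIntegral.integral_eq_sub_of_hasDerivAt (a := (0 : ℝ)) (b := L)
    (fun s _ => hG s) (((hZc.mul e7).mul hXc).intervalIntegrable _ _)
  rw [hint] at key
  refine key.congr_deriv ?_
  have hp0 : q L t = q 0 t := by simpa using h.per 0 t ht.1
  have hp1 : qx L t = qx 0 t := by simpa using h.perx 0 t ht.1
  rw [hp0, hp1, e3, e1 t ht, one_mul, mul_one, mul_sub, ← mul_assoc, ← mul_assoc, e5, one_mul]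

/-- The monodromy matrices at different times are conjugate. -/
theorem IsNLSData.monodromy_mul_tFund (h : IsNLSData lam L q qx qxx qt)
    (hlam : lam = 1 ∨ lam = -1) (hL : 0 < L) {t : ℝ} (ht : t ∈ Icc 0 T) (k : ℂ) :
    xFund lam (fun y => q y t) k L * tFund lam q qx T k t =
      tFund lam q qx T k t * xFund lam (fun y => q y 0) k L := by
  have hT : 0 ≤ T := ht.1.trans ht.2
  have hco := h.isCoefficient_t (T := T) hL hT k
  set Y := tFund lam q qx T k with hY
  set M : ℝ → Mat2 := fun t => xFund lam (fun y => q y t) k L with hM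
  have hd : ∀ t ∈ Icc 0 T, HasDerivWithinAt (fun t => (Y t).adjugate * M t * Y t) 0
      (Icc 0 T) t := by
    intro t ht
    have d1 : HasDerivAt (fun t => (Y t).adjugate) _ t := hasDerivAt_adjugate_fundSol hco t
    have d2 : HasDerivAt Y _ t := hasDerivAt_fundSol hco t
    have d3 : HasDerivWithinAt M _ _ t := h.hasDerivWithinAt_monodromy hlam hL ht k
    refine ((d1.hasDerivWithinAt.mul d3).mul d2.hasDerivWithinAt).congr_deriv ?_
    rw [clamp_of_mem ht]
    change (-((Y t).adjugate * laxV lam (q 0 t) (qx 0 t) k) * M t +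
      (Y t).adjugate * (laxV lam (q 0 t) (qx 0 t) k * M t - M t * laxV lam (q 0 t) (qx 0 t) k)) *
      Y t + (Y t).adjugate * M t * (laxV lam (q 0 t) (qx 0 t) k * Y t) = 0
    noncomm_ring
  have hc := (convex_Icc 0 T).norm_image_sub_le_of_norm_hasDerivWithin_le (C := 0) hd
    (fun t _ => by simp) ⟨le_rfl, hT⟩ ht
  rw [zero_mul, norm_le_zero_iff, sub_eq_zero] at hc
  have h0 : Y 0 = 1 := fundSol_zero hco
  rw [h0, Matrix.adjugate_one, one_mul, mul_one] at hc
  have h1 : Y t * (Y t).adjugate = 1 := fundSol_mul_adjugate hco t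
  calc M t * Y t = (Y t * (Y t).adjugate) * (M t * Y t) := by rw [h1, one_mul]
    _ = Y t * ((Y t).adjugate * M t * Y t) := by simp only [mul_assoc]
    _ = Y t * M 0 := by rw [hc]

/-- The Schwarz symmetry of the Lax pair. -/
def sym (lam : ℝ) (X : Mat2) : Mat2 :=
  !![conj (X 1 1), lam * conj (X 1 0); lam * conj (X 0 1), conj (X 0 0)]

theorem sym_mul (hlam : lam = 1 ∨ lam = -1) (X Y : Mat2) :
    sym lam (X * Y) = sym lam X * sym lam Y := by
  have h2 : (lam : ℂ) * lam = 1 := by rcases hlam with rfl | rfl <;> simp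
  rw [sym, sym, sym, Matrix.mul_fin_two]
  simp only [Matrix.mul_apply, Fin.sum_univ_two, map_add, map_mul]
  ext i j
  fin_cases i <;> fin_cases j <;> simp
  · linear_combination (-(conj (X 1 0) * conj (Y 0 1))) * h2
  · ring
  · ring
  · linear_combination (-(conj (X 0 1) * conj (Y 1 0))) * h2

theorem sym_one : sym lam 1 = 1 := by
  ext i j
  fin_cases i <;> fin_cases j <;> simp [sym]

theorem fundSol_sym (hlam : lam = 1 ∨ lam = -1) {A A' : ℝ → Mat2} (hA : IsCoefficient A)
    (hA' : IsCoefficient A') (hs : ∀ s, A' s = sym lam (A s)) (s : ℝ) :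
    fundSol A' s = sym lam (fundSol A s) := by
  have hd : ∀ s, HasDerivAt (fun s => sym lam (fundSol A s)) (A' s * sym lam (fundSol A s)) s := by
    intro s
    rw [hs s, ← sym_mul hlam]
    have hX := hasDerivAt_fundSol hA s
    have e : ∀ i j, HasDerivAt (fun s => conj (fundSol A s i j))
      (conj ((A s * fundSol A s) i j)) s := fun i j => (HasDerivAt.entry hX i j).star
    refine hasDerivAt_mat (Fin.forall_fin_two.2 ⟨Fin.forall_fin_two.2 ⟨?_, ?_⟩,
      Fin.forall_fin_two.2 ⟨?_, ?_⟩⟩)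
    · exact e 1 1
    · exact (e 1 0).const_mul (lam : ℂ)
    · exact (e 0 1).const_mul (lam : ℂ)
    · exact e 0 0
  have := eq_fundSol_mul hA' hd s
  rw [fundSol_zero hA, sym_one, mul_one] at this
  exact this.symm

theorem laxU_conj (hlam : lam = 1 ∨ lam = -1) (z k : ℂ) :
    laxU lam z k = sym lam (laxU lam z (conj k)) := by
  have h2 : (lam : ℂ) * lam = 1 := by rcases hlam with rfl | rfl <;> simp
  ext i j
  fin_cases i <;> fin_cases j <;> simp [laxU, sym, ← mul_assoc, h2]

theorem laxV_conj (hlam : lam = 1 ∨ lam = -1) (z w k : ℂ) :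
    laxV lam z w k = sym lam (laxV lam z w (conj k)) := by
  have h2 : (lam : ℂ) * lam = 1 := by rcases hlam with rfl | rfl <;> simp
  ext i j
  fin_cases i <;> fin_cases j <;> simp [laxV, sym, conj_ofNat]
  · ring
  · linear_combination (-(2 * k * z) - I * w) * h2
  · ring
  · exact Or.inl (by ring)

/-- The diagonal matrix `e^{i k y σ₃}`. -/
def expDiag (k : ℂ) (y : ℝ) : Mat2 := !![exp (I * k * y), 0; 0, exp (-(I * k * y))]

theorem expDiag_zero (k : ℂ) : expDiag k 0 = 1 := by
  ext i j
  fin_cases i <;> fin_cases j <;> simp [expDiag]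

theorem expDiag_mul_neg (k : ℂ) (y : ℝ) : expDiag k y * expDiag k (-y) = 1 := by
  ext i j
  fin_cases i <;> fin_cases j <;> simp [expDiag, ← Complex.exp_add]

theorem hasDerivAt_expDiag (k : ℂ) (y : ℝ) :
    HasDerivAt (expDiag k) (expDiag k y * ((I * k) • sigma3)) y := by
  have h1 : HasDerivAt (fun y : ℝ => I * k * (y : ℂ)) (I * k) y := by
    simpa using (Complex.ofRealCLM.hasDerivAt (x := y)).const_mul (I * k)
  refine hasDerivAt_mat (Fin.forall_fin_two.2 ⟨Fin.forall_fin_two.2 ⟨?_, ?_⟩,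
      Fin.forall_fin_two.2 ⟨?_, ?_⟩⟩)
  · exact h1.cexp.congr_deriv (by simp [expDiag, sigma3])
  · exact (hasDerivAt_const y (0 : ℂ)).congr_deriv (by simp [expDiag, sigma3])
  · exact (hasDerivAt_const y (0 : ℂ)).congr_deriv (by simp [expDiag, sigma3])
  · exact h1.neg.cexp.congr_deriv (by simp [expDiag, sigma3])

theorem laxU_eq (lam : ℝ) (z k : ℂ) : laxU lam z k = laxQ lam z - (I * k) • sigma3 := by
  ext i j
  fin_cases i <;> fin_cases j <;> simp [laxU, laxQ, sigma3]

theorem scattering_eq {q0 : ℝ → ℂ} {k : ℂ} (hco : IsCoefficient fun s => laxU lam (q0 s) k) :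
    scattering lam L q0 k = (xFund lam q0 k L).adjugate * expDiag k (-L) := by
  set X := xFund lam q0 k with hX
  have hX' : ∀ s, HasDerivAt X (laxU lam (q0 s) k * X s) s := fun s => hasDerivAt_fundSol hco s
  have hXa : ∀ s, X s * (X s).adjugate = 1 := fun s => fundSol_mul_adjugate hco s
  have haX : ∀ s, (X s).adjugate * X s = 1 := fun s => adjugate_mul_fundSol hco s
  have hex : IsEigenfunction lam L q0 k
      (fun y => X y * ((X L).adjugate * expDiag k (-L)) * expDiag k y) := by
    constructor
    · have h1 := expDiag_mul_neg k (-L)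
      rw [neg_neg] at h1
      simp only [← mul_assoc]
      rw [hXa, one_mul, h1]
    · intro y i j
      have hd := ((hX' y).mul_const ((X L).adjugate * expDiag k (-L))).mul (hasDerivAt_expDiag k y)
      refine HasDerivAt.entry (hd.congr_deriv ?_) i j
      rw [laxU_eq]
      simp only [sub_mul, smul_mul_assoc, mul_smul_comm, smul_sub, mul_assoc]
      abel
  have hspec : IsEigenfunction lam L q0 k (eigenfunction lam L q0 k) :=
    Classical.epsilon_spec (p := IsEigenfunction lam L q0 k) ⟨_, hex⟩
  have hun : ∀ μ, IsEigenfunction lam L q0 k μ → μ 0 = (X L).adjugate * expDiag k (-L) := by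
    intro μ hμ
    have hd : ∀ y, HasDerivAt (fun y => μ y * expDiag k (-y))
        (laxU lam (q0 y) k * (μ y * expDiag k (-y))) y := by
      intro y
      have d1 := hasDerivAt_mat (hμ.2 y)
      have d2 : HasDerivAt (fun y => expDiag k (-y)) _ y :=
        (hasDerivAt_expDiag k (-y)).scomp y (hasDerivAt_neg y)
      refine (d1.mul d2).congr_deriv ?_
      have hcomm : expDiag k (-y) * sigma3 = sigma3 * expDiag k (-y) := by
        ext i j
        fin_cases i <;> fin_cases j <;> simp [expDiag, sigma3]
      rw [laxU_eq]
      simp only [sub_mul, smul_mul_assoc, mul_smul_comm, mul_assoc, neg_smul, one_smul, mul_neg,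
        hcomm, smul_sub]
      abel
    have h1 := eq_fundSol_mul hco hd L
    simp only [neg_zero, expDiag_zero, mul_one, hμ.1, one_mul] at h1
    have h2 : expDiag k (-L) = X L * μ 0 := h1
    rw [h2, ← mul_assoc, haX, one_mul]
  exact hun _ hspec

theorem specA_eq {q0 : ℝ → ℂ} {k : ℂ} (hco : IsCoefficient fun s => laxU lam (q0 s) k) :
    specA lam L q0 k = exp (I * k * L) * xFund lam q0 k L 0 0 := by
  rw [specA, scattering_eq hco]
  simp [Matrix.adjugate_fin_two, expDiag, mul_comm]

theorem specB_eq {q0 : ℝ → ℂ} {k : ℂ} (hco : IsCoefficient fun s => laxU lam (q0 s) k) :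
    specB lam L q0 k = -(exp (I * k * L) * xFund lam q0 k L 0 1) := by
  rw [specB, scattering_eq hco]
  simp [Matrix.adjugate_fin_two, expDiag, mul_comm]

end Fundamental

section SineBound

theorem sin_lower_aux {u s : ℝ} (hu : 1 ≤ u) (h : 1 / 16 ≤ s ∨ (178 / 100 ≤ u ∧ 0 ≤ s)) :
    u / 36 ≤ (u + 2 + u⁻¹) / 4 - 1 + s := by
  have hu0 : 0 < u := by linarith
  have key : 0 ≤ ((u + 2 + u⁻¹) / 4 - 1 + s - u / 36) * (36 * u) := by
    have : ((u + 2 + u⁻¹) / 4 - 1 + s - u / 36) * (36 * u) =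
        8 * u ^ 2 - 18 * u + 9 + 36 * u * s := by
      field_simp; ring
    rw [this]
    rcases h with h | ⟨h, hs⟩
    · nlinarith [sq_nonneg (u - 1), sq_nonneg (16 * u - 16)]
    · nlinarith [mul_nonneg hu0.le hs]
  have h36 : 0 < 36 * u := by linarith
  have := nonneg_of_mul_nonneg_left key h36
  linarith

theorem exp_abs_im_le_sin {z : ℂ} (hz : ∀ n : ℤ, Real.pi / 4 ≤ ‖z - n * Real.pi‖) :
    Real.exp |z.im| ≤ 6 * ‖Complex.sin z‖ := by
  set n : ℤ := round (z.re / Real.pi) with hn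
  set w : ℂ := z - n * Real.pi with hw
  have hpi := Real.pi_pos
  have hpi3 := Real.pi_gt_three
  have hwim : w.im = z.im := by simp [hw]
  have hwre : |w.re| ≤ Real.pi / 2 := by
    have h1 := abs_sub_round (z.re / Real.pi)
    have h2 : w.re = (z.re / Real.pi - n) * Real.pi := by simp [hw]; field_simp
    rw [h2, abs_mul, abs_of_pos hpi]
    nlinarith
  have hsin : ‖Complex.sin z‖ = ‖Complex.sin w‖ := by
    rw [hw, Complex.sin_antiperiodic.sub_int_mul_eq]
    rcases Int.units_eq_one_or n.negOnePow with h | h <;> simp [h]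
  have hnorm : ‖Complex.sin w‖ ^ 2 =
      (Real.exp (2 * |w.im|) + 2 + (Real.exp (2 * |w.im|))⁻¹) / 4 - 1 + Real.sin w.re ^ 2 := by
    rw [← Complex.normSq_eq_norm_sq, Complex.sin_eq, ← ofReal_sin, ← ofReal_cosh, ← ofReal_cos,
      ← ofReal_sinh, ← ofReal_mul, ← ofReal_mul, Complex.normSq_add_mul_I]
    have hc : Real.cosh w.im ^ 2 = (Real.exp (2 * |w.im|) + 2 + (Real.exp (2 * |w.im|))⁻¹) / 4 := by
      rw [← Real.cosh_abs, Real.cosh_eq, ← Real.exp_neg, two_mul, Real.exp_add, neg_add,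
        Real.exp_add, Real.exp_neg]
      field_simp
      ring
    rw [← hc]
    have h1 := Real.cosh_sq w.im
    have h2 := Real.sin_sq_add_cos_sq w.re
    nlinarith
  have hw4 := hz n
  have hcase : 1 / 16 ≤ Real.sin w.re ^ 2 ∨
      (178 / 100 ≤ Real.exp (2 * |w.im|) ∧ 0 ≤ Real.sin w.re ^ 2) := by
    by_cases hre : Real.pi / 8 ≤ |w.re|
    · left
      have h1 := Real.mul_le_sin (abs_nonneg w.re) hwre
      have h2 : 1 / 4 ≤ 2 / Real.pi * |w.re| := by
        calc 1 / 4 = 2 / Real.pi * (Real.pi / 8) := by field_simp; norm_num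
          _ ≤ _ := by gcongr
      have h3 : Real.sin |w.re| ^ 2 = Real.sin w.re ^ 2 := by
        rcases abs_choice w.re with h | h <;> rw [h]
        rw [Real.sin_neg]; ring
      rw [← h3]
      nlinarith
    · right
      refine ⟨?_, sq_nonneg _⟩
      push Not at hre
      have h1 : Real.pi / 8 ≤ |w.im| := by
        by_contra hcon
        push Not at hcon
        have h5 : ‖w‖ ≤ |w.re| + |w.im| := norm_le_abs_re_add_abs_im w
        linarith
      have h2 := Real.add_one_le_exp (2 * |w.im|)
      nlinarith [Real.pi_gt_d2]
  have hfin := sin_lower_aux (Real.one_le_exp (by positivity)) hcase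
  rw [← hnorm] at hfin
  rw [hsin, ← hwim]
  have h6 : Real.exp |w.im| ^ 2 ≤ (6 * ‖Complex.sin w‖) ^ 2 := by
    have h7 : Real.exp |w.im| ^ 2 = Real.exp (2 * |w.im|) := by
      rw [← Real.exp_nat_mul]; norm_num
    rw [h7]; nlinarith
  exact le_of_sq_le_sq h6 (by positivity)
where
  le_of_sq_le_sq {a b : ℝ} (h : a ^ 2 ≤ b ^ 2) (hb : 0 ≤ b) : a ≤ b := abs_le_of_sq_le_sq' h hb |>.2

theorem exp_le_sin_of_notMem_disks {L : ℝ} (hL : 0 < L) {k : ℂ} (hk : k ∉ disks L) :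
    Real.exp (|k.im| * L) ≤ 6 * ‖Complex.sin (k * L)‖ := by
  have h1 : ∀ n : ℤ, Real.pi / 4 ≤ ‖k * L - n * Real.pi‖ := by
    intro n
    by_contra hcon
    push Not at hcon
    apply hk
    refine mem_iUnion.2 ⟨n, ?_⟩
    rw [mem_ball, dist_eq_norm]
    have h2 : k - (((n : ℝ) * Real.pi / L : ℝ) : ℂ) = (k * L - n * Real.pi) / L := by
      push_cast
      have : (L : ℂ) ≠ 0 := by exact_mod_cast hL.ne'
      field_simp
    rw [h2, norm_div, Complex.norm_real, Real.norm_eq_abs, abs_of_pos hL, div_lt_iff₀ hL]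
    calc _ < _ := hcon
      _ = _ := by field_simp
  have := exp_abs_im_le_sin h1
  rwa [show (k * L).im = k.im * L by simp, abs_mul, abs_of_pos hL] at this

end SineBound

section Riccati

/-- The periodic solution operator of `h' = -2 i k h + f`. -/
def greenOp (L : ℝ) (k : ℂ) (f : ℝ → ℂ) (x : ℝ) : ℂ :=
  (∫ s in (0 : ℝ)..L, exp (-(2 * I * k * s)) * f (x - s)) / (1 - exp (-(2 * I * k * L)))

theorem norm_one_sub_exp (L : ℝ) (k : ℂ) :
    ‖1 - exp (-(2 * I * k * L))‖ = 2 * ‖Complex.sin (k * L)‖ * Real.exp (k.im * L) := by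
  have h1 : 1 - exp (-(2 * I * k * L)) = 2 * I * Complex.sin (k * L) * exp (-(I * k * L)) := by
    rw [Complex.sin, mul_comm k (L : ℂ)]
    have e1 : exp (-(↑L * k) * I) = exp (-(I * k * L)) := by ring_nf
    have e2 : exp (↑L * k * I) * exp (-(I * k * L)) = 1 := by
      rw [← Complex.exp_add, show (L : ℂ) * k * I + -(I * k * L) = 0 by ring, Complex.exp_zero]
    have e3 : exp (-(2 * I * k * L)) = exp (-(I * k * L)) * exp (-(I * k * L)) := by
      rw [← Complex.exp_add]; ring_nf
    rw [e1, e3]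
    linear_combination (-1 : ℂ) * e2 - (exp (-(I * k * L)) * exp (-(I * k * L)) -
      exp (↑L * k * I) * exp (-(I * k * L))) * I_mul_I
  rw [h1, norm_mul, norm_mul, Complex.norm_exp]
  simp

theorem norm_greenOp_le {L : ℝ} (hL : 0 < L) {k : ℂ} (hk : k ∉ disks L) {f : ℝ → ℂ} {M : ℝ}
    (hf : ∀ x, ‖f x‖ ≤ M) (x : ℝ) : ‖greenOp L k f x‖ ≤ 3 * L * M := by
  have hM : 0 ≤ M := (norm_nonneg _).trans (hf 0)
  have hs := exp_le_sin_of_notMem_disks hL hk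
  have hden : Real.exp (|k.im| * L) * Real.exp (k.im * L) ≤ 3 * ‖1 - exp (-(2 * I * k * L))‖ := by
    rw [norm_one_sub_exp]
    nlinarith [Real.exp_pos (k.im * L)]
  have hpos : 0 < ‖1 - exp (-(2 * I * k * L))‖ := by
    have := mul_pos (Real.exp_pos (|k.im| * L)) (Real.exp_pos (k.im * L))
    linarith
  have hnum : ‖∫ s in (0 : ℝ)..L, exp (-(2 * I * k * s)) * f (x - s)‖ ≤
      (Real.exp (|k.im| * L) * Real.exp (k.im * L) * M) * |L - 0| := by
    apply intervalIntegral.norm_integral_le_of_norm_le_const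
    intro s hs
    rw [uIoc_of_le hL.le] at hs
    rw [norm_mul, Complex.norm_exp, ← Real.exp_add]
    gcongr
    · have h1 : (-(2 * I * k * s)).re = 2 * k.im * s := by simp
      rw [h1]
      rcases abs_cases k.im with ⟨h, h'⟩ | ⟨h, h'⟩ <;> rw [h] <;> nlinarith [hs.1, hs.2]
    · exact hf _
  rw [greenOp, norm_div, div_le_iff₀ hpos]
  refine hnum.trans ?_
  rw [sub_zero, abs_of_pos hL]
  nlinarith [mul_nonneg hL.le hM]

theorem hasDerivAt_greenOp {L : ℝ} (hL : 0 < L) {k : ℂ} (hk : k ∉ disks L) {f : ℝ → ℂ}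
    (hf : Continuous f) (hp : ∀ x, f (x + L) = f x) (x : ℝ) :
    HasDerivAt (greenOp L k f) (-(2 * I * k) * greenOp L k f x + f x) x := by
  have hs := exp_le_sin_of_notMem_disks hL hk
  have hne : 1 - exp (-(2 * I * k * L)) ≠ 0 := by
    rw [← norm_pos_iff, norm_one_sub_exp]
    have := Real.exp_pos (|k.im| * L)
    have h2 : 0 < ‖Complex.sin (k * L)‖ := by linarith
    positivity
  set g : ℝ → ℂ := fun u => exp (2 * I * k * u) * f u with hg
  have hgc : Continuous g := by fun_prop
  set P : ℝ → ℂ := fun x => ∫ u in (0 : ℝ)..x, g u with hP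
  have hPd : ∀ x, HasDerivAt P (g x) x := fun x => (hgc.integral_hasStrictDerivAt 0 x).hasDerivAt
  have hform : ∀ x, greenOp L k f x =
      exp (-(2 * I * k * x)) * (P x - P (x - L)) / (1 - exp (-(2 * I * k * L))) := by
    intro x
    have h1 : ∫ s in (0 : ℝ)..L, exp (-(2 * I * k * s)) * f (x - s) =
        ∫ u in (x - L)..(x - 0), exp (-(2 * I * k * x)) * g u := by
      rw [← intervalIntegral.integral_comp_sub_left (fun u => exp (-(2 * I * k * x)) * g u) x]
      congr 1
      funext s
      simp only [hg]
      rw [← mul_assoc, ← Complex.exp_add]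
      push_cast
      ring_nf
    rw [greenOp, h1, intervalIntegral.integral_const_mul, sub_zero,
      intervalIntegral.integral_interval_sub_left (hgc.intervalIntegrable _ _)
        (hgc.intervalIntegrable _ _)]
  have hE : HasDerivAt (fun x : ℝ => exp (-(2 * I * k * (x : ℂ))))
      (exp (-(2 * I * k * x)) * -(2 * I * k)) x := by
    have h1 : HasDerivAt (fun y : ℝ => 2 * I * k * (y : ℂ)) (2 * I * k) x := by
      simpa using (Complex.ofRealCLM.hasDerivAt (x := x)).const_mul (2 * I * k)
    exact h1.neg.cexp
  have hd := (hE.mul ((hPd x).sub ((hPd (x - L)).comp_sub_const x L))).div_const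
    (1 - exp (-(2 * I * k * L)))
  rw [show greenOp L k f = fun x : ℝ => exp (-(2 * I * k * x)) * (P x - P (x - L)) /
    (1 - exp (-(2 * I * k * L))) from funext hform]
  refine hd.congr_deriv ?_
  have hfx : f (x - L) = f x := by rw [← hp (x - L)]; simp
  have e1 : exp (-(2 * I * k * x)) * exp (2 * I * k * x) = 1 := by
    rw [← Complex.exp_add]; simp
  have e2 : exp (-(2 * I * k * x)) * exp (2 * I * k * (x - L : ℝ)) = exp (-(2 * I * k * L)) := by
    rw [← Complex.exp_add]; push_cast; ring_nf
  simp only [hg, hfx, Pi.sub_apply]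
  field_simp
  linear_combination f x * e1 - f x * e2

theorem greenOp_sub {L : ℝ} {k : ℂ} {f g : ℝ → ℂ} (hf : Continuous f) (hg : Continuous g) (x : ℝ) :
    greenOp L k f x - greenOp L k g x = greenOp L k (fun y => f y - g y) x := by
  simp only [greenOp, mul_sub]
  rw [intervalIntegral.integral_sub, sub_div]
  · exact Continuous.intervalIntegrable (by fun_prop) _ _
  · exact Continuous.intervalIntegrable (by fun_prop) _ _

/-- For large `k` off the disks the Riccati equation of the `x`-part has a small periodic
solution. -/
theorem exists_riccati {lam L : ℝ} (hlam : lam = 1 ∨ lam = -1) (hL : 0 < L) {B : ℝ} (hB : 1 ≤ B) :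
    ∃ K > 0, ∃ C > 0, ∀ q0 q1 q2 : ℝ → ℂ, Continuous q2 → (∀ x, HasDerivAt q0 (q1 x) x) →
      (∀ x, HasDerivAt q1 (q2 x) x) → (∀ x, q0 (x + L) = q0 x) → (∀ x, q1 (x + L) = q1 x) →
      (∀ x, q2 (x + L) = q2 x) → (∀ x, ‖q0 x‖ ≤ B) → (∀ x, ‖q1 x‖ ≤ B) → (∀ x, ‖q2 x‖ ≤ B) →
      ∀ k ∉ disks L, K ≤ ‖k‖ → ∃ Γ : ℝ → ℂ, (∀ x, HasDerivAt Γ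
        (-(2 * I * k) * Γ x + q0 x - lam * conj (q0 x) * Γ x ^ 2) x) ∧
        (∀ x, Γ (x + L) = Γ x) ∧ ∀ x, ‖Γ x - q0 x / (2 * I * k)‖ ≤ C / ‖k‖ ^ 2 := by
  have hB0 : 0 < B := by linarith
  set N : ℝ := 3 * L with hN
  have hN0 : 0 < N := by positivity
  refine ⟨max 1 (8 * N * B ^ 2), by positivity, 5 * N * B ^ 3 + B, by positivity, ?_⟩
  intro q0 q1 q2 c2 d0 d1 p0 p1 p2 b0 b1 b2 k hk hkK
  have hk1 : 1 ≤ ‖k‖ := (le_max_left _ _).trans hkK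
  have hk8 : 8 * N * B ^ 2 ≤ ‖k‖ := (le_max_right _ _).trans hkK
  have hkpos : 0 < ‖k‖ := by linarith
  have hk0 : k ≠ 0 := norm_pos_iff.1 hkpos
  have hlamn : ‖(lam : ℂ)‖ = 1 := by rcases hlam with rfl | rfl <;> simp
  have c0 : Continuous q0 := continuous_iff_continuousAt.2 fun x => (d0 x).continuousAt
  have c1 : Continuous q1 := continuous_iff_continuousAt.2 fun x => (d1 x).continuousAt
  set g : ℝ → ℂ := fun x => q0 x / (2 * I * k) + q1 x / (4 * k ^ 2) with hg
  have cg : Continuous g := by fun_prop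
  have bg : ∀ x, ‖g x‖ ≤ B / ‖k‖ := by
    intro x
    have h1 : ‖q0 x / (2 * I * k)‖ ≤ B / (2 * ‖k‖) := by
      rw [norm_div, norm_mul, norm_mul, norm_I, Complex.norm_ofNat, mul_one]
      gcongr
      exact b0 x
    have h2 : ‖q1 x / (4 * k ^ 2)‖ ≤ B / (4 * ‖k‖) := by
      rw [norm_div, norm_mul, Complex.norm_ofNat, norm_pow]
      have h3 : ‖k‖ ≤ ‖k‖ ^ 2 := by nlinarith
      gcongr
      exact b1 x
    calc ‖g x‖ ≤ B / (2 * ‖k‖) + B / (4 * ‖k‖) := (norm_add_le _ _).trans (add_le_add h1 h2)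
      _ = 3 / 4 * (B / ‖k‖) := by field_simp; norm_num
      _ ≤ B / ‖k‖ := by
        have : 0 ≤ B / ‖k‖ := by positivity
        linarith
  set ρ : ℝ := 5 * N * B ^ 3 / ‖k‖ ^ 2 with hρ
  have hρ0 : 0 ≤ ρ := by positivity
  have hρB : ρ ≤ B / ‖k‖ := by
    rw [hρ, div_le_div_iff₀ (by positivity) hkpos]
    have : 5 * N * B ^ 2 ≤ ‖k‖ := by nlinarith [mul_pos hN0 (pow_pos hB0 2)]
    nlinarith [mul_pos hB0 hkpos]
  set F : (ℝ → ℂ) → ℝ → ℂ := fun h x =>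
    -(q2 x / (4 * k ^ 2)) - lam * conj (q0 x) * (g x + h x) ^ 2 with hF
  have cF : ∀ h : ℝ → ℂ, Continuous h → Continuous (F h) := fun h hh => by fun_prop
  have bF : ∀ h : ℝ → ℂ, (∀ x, ‖h x‖ ≤ ρ) → ∀ x, ‖F h x‖ ≤ 5 * B ^ 3 / ‖k‖ ^ 2 := by
    intro h hh x
    have h1 : ‖q2 x / (4 * k ^ 2)‖ ≤ B / (4 * ‖k‖ ^ 2) := by
      rw [norm_div, norm_mul, Complex.norm_ofNat, norm_pow]
      gcongr
      exact b2 x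
    have h2 : ‖g x + h x‖ ≤ 2 * (B / ‖k‖) := by
      refine (norm_add_le _ _).trans ?_
      linarith [bg x, hh x]
    have h3 : ‖lam * conj (q0 x) * (g x + h x) ^ 2‖ ≤ B * (2 * (B / ‖k‖)) ^ 2 := by
      rw [norm_mul, norm_mul, hlamn, one_mul, norm_pow, RCLike.norm_conj]
      gcongr
      exact b0 x
    calc ‖F h x‖ ≤ B / (4 * ‖k‖ ^ 2) + B * (2 * (B / ‖k‖)) ^ 2 := by
          refine (norm_sub_le _ _).trans ?_
          rw [norm_neg]
          exact add_le_add h1 h3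
      _ = (B / 4 + 4 * B ^ 3) / ‖k‖ ^ 2 := by field_simp; ring
      _ ≤ 5 * B ^ 3 / ‖k‖ ^ 2 := by
        gcongr
        nlinarith [mul_pos hB0 hB0, mul_nonneg hB0.le (mul_self_nonneg (B - 1))]
  have bG : ∀ h : ℝ → ℂ, (∀ x, ‖h x‖ ≤ ρ) → ∀ x, ‖greenOp L k (F h) x‖ ≤ ρ := by
    intro h hh x
    refine (norm_greenOp_le hL hk (bF h hh) x).trans (le_of_eq ?_)
    rw [hρ, hN]; ring
  have pF : ∀ h : ℝ → ℂ, (∀ x, h (x + L) = h x) → ∀ x, F h (x + L) = F h x := by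
    intro h hh x
    simp only [hF, hg, p0, p1, p2, hh]
  have dG : ∀ h : ℝ → ℂ, Continuous h → (∀ x, h (x + L) = h x) → ∀ x,
      HasDerivAt (greenOp L k (F h)) (-(2 * I * k) * greenOp L k (F h) x + F h x) x :=
    fun h hh hp x => hasDerivAt_greenOp hL hk (cF h hh) (pF h hp) x
  have pG : ∀ h : ℝ → ℂ, (∀ x, h (x + L) = h x) →
      ∀ x, greenOp L k (F h) (x + L) = greenOp L k (F h) x := by
    intro h hh x
    simp only [greenOp]
    congr 2
    funext s
    rw [show x + L - s = (x - s) + L by ring, pF h hh]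
  set S : Set (BoundedContinuousFunction ℝ ℂ) :=
    {h | (∀ x, ‖h x‖ ≤ ρ) ∧ ∀ x, h (x + L) = h x} with hS
  have hSc : IsComplete S := by
    apply IsClosed.isComplete
    have e1 : S = (⋂ x, {h | ‖h x‖ ≤ ρ}) ∩ ⋂ x, {h | h (x + L) = h x} := by
      ext h; simp [hS]
    rw [e1]
    have hev : ∀ x : ℝ, Continuous fun h : BoundedContinuousFunction ℝ ℂ => h x := fun x =>
      continuous_eval_const x
    exact (isClosed_iInter fun x => isClosed_le (hev x).norm continuous_const).inter
      (isClosed_iInter fun x => isClosed_eq (hev _) (hev _))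
  classical
  set T : BoundedContinuousFunction ℝ ℂ → BoundedContinuousFunction ℝ ℂ := fun h =>
    if hh : h ∈ S then BoundedContinuousFunction.ofNormedAddCommGroup (greenOp L k (F h))
      (continuous_iff_continuousAt.2 fun x => (dG h h.continuous hh.2 x).continuousAt) ρ
      (bG h hh.1) else 0 with hT
  have hTS : ∀ h ∈ S, ∀ x, T h x = greenOp L k (F h) x := by
    intro h hh x
    simp only [hT, dif_pos hh]
    rfl
  have hmaps : MapsTo T S S := by
    intro h hh
    refine ⟨fun x => ?_, fun x => ?_⟩
    · rw [hTS h hh]; exact bG h hh.1 x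
    · rw [hTS h hh, hTS h hh]; exact pG h hh.2 x
  have hcontr : ContractingWith (1 / 2) (hmaps.restrict T S S) := by
    refine ⟨by norm_num, LipschitzWith.of_dist_le_mul fun h h' => ?_⟩
    rw [Subtype.dist_eq, Subtype.dist_eq]
    obtain ⟨h, hh⟩ := h
    obtain ⟨h', hh'⟩ := h'
    change dist (T h) (T h') ≤ _
    rw [BoundedContinuousFunction.dist_le (by positivity)]
    intro x
    rw [hTS h hh, hTS h' hh', dist_eq_norm,
      greenOp_sub (cF h h.continuous) (cF h' h'.continuous)]
    have hb : ∀ y, ‖F h y - F h' y‖ ≤ B * (4 * (B / ‖k‖)) * dist h h' := by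
      intro y
      have e1 : F h y - F h' y =
          lam * conj (q0 y) * ((g y + h y) + (g y + h' y)) * (h' y - h y) := by
        simp only [hF]; ring
      rw [e1, norm_mul, norm_mul, norm_mul, hlamn, one_mul, RCLike.norm_conj]
      have h1 : ‖g y + h y + (g y + h' y)‖ ≤ 4 * (B / ‖k‖) := by
        refine (norm_add_le _ _).trans ?_
        have := norm_add_le (g y) (h y)
        have := norm_add_le (g y) (h' y)
        linarith [bg y, hh.1 y, hh'.1 y]
      have h2 : ‖h' y - h y‖ ≤ dist h h' := by
        rw [← dist_eq_norm, dist_comm]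
        exact BoundedContinuousFunction.dist_coe_le_dist y
      gcongr
      exact b0 y
    refine (norm_greenOp_le hL hk hb x).trans ?_
    have : 3 * L * (B * (4 * (B / ‖k‖)) * dist h h') = (4 * N * B ^ 2 / ‖k‖) * dist h h' := by
      rw [hN]; field_simp
    rw [this]
    refine mul_le_mul_of_nonneg_right ?_ dist_nonneg
    rw [div_le_iff₀ hkpos]
    push_cast
    linarith
  have h0S : (0 : BoundedContinuousFunction ℝ ℂ) ∈ S := ⟨fun x => by simpa using hρ0, fun x => rfl⟩
  obtain ⟨h, hh, hfix, -⟩ := hcontr.exists_fixedPoint' hSc hmaps h0S (edist_ne_top _ _)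
  have hfx : ∀ x, h x = greenOp L k (F h) x := fun x => by
    rw [← hTS h hh x, hfix]
  refine ⟨fun x => g x + h x, fun x => ?_, fun x => ?_, fun x => ?_⟩
  · have dg : HasDerivAt g (q1 x / (2 * I * k) + q2 x / (4 * k ^ 2)) x :=
      ((d0 x).div_const _).add ((d1 x).div_const _)
    have dh : HasDerivAt h (-(2 * I * k) * h x + F h x) x := by
      have := dG h h.continuous hh.2 x
      rw [show greenOp L k (F h) = h from (funext hfx).symm] at this
      exact this
    refine (dg.add dh).congr_deriv ?_
    have e1 : 2 * I * k * (q0 x / (2 * I * k)) = q0 x := by field_simp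
    have e2 : q1 x / (2 * I * k) = -(I * q1 x) / (2 * k) := by
      rw [div_eq_div_iff (by simp [hk0]) (by simp [hk0])]
      linear_combination (2 * k * q1 x) * I_sq
    have e3 : 2 * I * k * (q1 x / (4 * k ^ 2)) = I * q1 x / (2 * k) := by field_simp; ring
    simp only [hF, hg]
    linear_combination e1 + e2 + e3
  · simp only [hg, p0, p1, hh.2]
  · have e1 : g x + h x - q0 x / (2 * I * k) = q1 x / (4 * k ^ 2) + h x := by
      simp only [hg]; ring
    rw [e1]
    have h2 : ‖q1 x / (4 * k ^ 2)‖ ≤ B / ‖k‖ ^ 2 := by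
      rw [norm_div, norm_mul, Complex.norm_ofNat, norm_pow]
      have h3 : ‖k‖ ^ 2 ≤ 4 * ‖k‖ ^ 2 := by nlinarith
      gcongr
      exact b1 x
    calc _ ≤ B / ‖k‖ ^ 2 + ρ := (norm_add_le _ _).trans (add_le_add h2 (hh.1 x))
      _ = (5 * N * B ^ 3 + B) / ‖k‖ ^ 2 := by rw [hρ]; ring

end Riccati

attribute [local instance] Matrix.linftyOpNormedRing Matrix.linftyOpNormedAlgebra

section Bloch

/-- Eigenvectors of a `2 × 2` matrix for an eigenvalue different from `ν` are proportional
to `(g, 1)`. -/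
theorem eigenvector_unique {m00 m01 m10 m11 g h μ ν κ v1 v2 : ℂ}
    (h1 : m00 * g + m01 = μ * g) (h2 : m10 * g + m11 = μ)
    (h3 : m00 + m01 * h = ν) (h4 : m10 + m11 * h = ν * h) (hgh : g * h ≠ 1)
    (e1 : m00 * v1 + m01 * v2 = κ * v1) (e2 : m10 * v1 + m11 * v2 = κ * v2) (hκ : κ ≠ ν) :
    v1 = g * v2 := by
  have hp : (m00 - g * m10 - ν) * (1 - g * h) = 0 := by
    linear_combination (-h) * h1 + (g * h) * h2 + h3 - g * h4
  have hgh' : 1 - g * h ≠ 0 := fun h => hgh (by linear_combination -h)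
  have hp' : m00 - g * m10 - ν = 0 := (mul_eq_zero.1 hp).resolve_right hgh'
  have : (κ - ν) * (v1 - g * v2) = 0 := by
    linear_combination (-1 : ℂ) * e1 + g * e2 + v1 * hp' + v2 * h1 - g * v2 * h2 - g * v2 * hp'
  have := (mul_eq_zero.1 this).resolve_left (sub_ne_zero.2 hκ)
  linear_combination this

/-- A solution of the Riccati equation gives a solution of the `x`-part. -/
theorem bloch_of_riccati {lam : ℝ} {q0 Γ : ℝ → ℂ} {k : ℂ} (hq : Continuous q0)
    (hco : IsCoefficient fun s => laxU lam (q0 s) k)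
    (hΓ : ∀ x, HasDerivAt Γ (-(2 * I * k) * Γ x + q0 x - lam * conj (q0 x) * Γ x ^ 2) x) (s : ℝ) :
    xFund lam q0 k s 0 0 * Γ 0 + xFund lam q0 k s 0 1 =
      exp (I * k * s + ∫ y in (0 : ℝ)..s, lam * conj (q0 y) * Γ y) * Γ s ∧
    xFund lam q0 k s 1 0 * Γ 0 + xFund lam q0 k s 1 1 =
      exp (I * k * s + ∫ y in (0 : ℝ)..s, lam * conj (q0 y) * Γ y) := by
  have hc : Continuous Γ := continuous_iff_continuousAt.2 fun x => (hΓ x).continuousAt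
  set J : ℝ → ℂ := fun s => ∫ y in (0 : ℝ)..s, lam * conj (q0 y) * Γ y with hJ
  set v : ℝ → ℂ := fun s => exp (I * k * s + J s) with hv
  have hcJ : Continuous fun y => lam * conj (q0 y) * Γ y := by fun_prop
  have hJd : ∀ s, HasDerivAt J (lam * conj (q0 s) * Γ s) s := fun s =>
    (hcJ.integral_hasStrictDerivAt 0 s).hasDerivAt
  have hvd : ∀ s, HasDerivAt v (v s * (I * k + lam * conj (q0 s) * Γ s)) s := by
    intro s
    have h1 : HasDerivAt (fun y : ℝ => I * k * (y : ℂ)) (I * k) s := by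
      simpa using (Complex.ofRealCLM.hasDerivAt (x := s)).const_mul (I * k)
    exact (h1.add (hJd s)).cexp
  have hu : ∀ s, HasDerivAt (fun s => v s * Γ s)
      (laxU lam (q0 s) k 0 0 * (v s * Γ s) + laxU lam (q0 s) k 0 1 * v s) s := by
    intro s
    refine ((hvd s).mul (hΓ s)).congr_deriv ?_
    simp [laxU]; ring
  have hw : ∀ s, HasDerivAt v
      (laxU lam (q0 s) k 1 0 * (v s * Γ s) + laxU lam (q0 s) k 1 1 * v s) s := by
    intro s
    refine (hvd s).congr_deriv ?_
    simp [laxU]; ring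
  have := eq_fundSol_vec hco hu hw s
  have hv0 : v 0 = 1 := by simp [hv, hJ]
  rw [hv0, one_mul, mul_one, mul_one] at this
  exact ⟨this.1.symm, this.2.symm⟩

theorem norm_exp_sub_one_le_two_mul {z : ℂ} (hz : ‖z‖ ≤ 1) : ‖exp z - 1‖ ≤ 2 * ‖z‖ :=
  Complex.norm_exp_sub_one_le hz

theorem norm_one_sub_exp_lower {L : ℝ} (hL : 0 < L) {k : ℂ} (hk : k ∉ disks L) :
    1 + ‖exp (-(2 * I * k * L))‖ ≤ 6 * ‖1 - exp (-(2 * I * k * L))‖ := by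
  have hs := exp_le_sin_of_notMem_disks hL hk
  rw [norm_one_sub_exp, Complex.norm_exp]
  have h1 : (-(2 * I * k * L)).re = k.im * L + k.im * L := by simp; ring
  rw [h1, Real.exp_add]
  have h2 : 1 ≤ Real.exp (|k.im| * L) * Real.exp (k.im * L) := by
    rw [← Real.exp_add]
    apply Real.one_le_exp
    nlinarith [neg_abs_le k.im]
  have h3 : Real.exp (k.im * L) ≤ Real.exp (|k.im| * L) := by
    rw [Real.exp_le_exp]; nlinarith [le_abs_self k.im]
  have h4 := Real.exp_pos (k.im * L)
  nlinarith

/-- The two Floquet multipliers are well separated off the disks. -/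
theorem multipliers_ne {L : ℝ} (hL : 0 < L) {k : ℂ} (hk : k ∉ disks L) {w w' : ℂ}
    (h1 : ‖w - 1‖ ≤ 1 / 10) (h2 : ‖w' - 1‖ ≤ 1 / 10) :
    exp (I * k * L) * w ≠ exp (-(I * k * L)) * w' := by
  intro heq
  have hlow := norm_one_sub_exp_lower hL hk
  have e1 : w = exp (-(2 * I * k * L)) * w' := by
    have e2 : exp (-(I * k * L)) * exp (I * k * L) = 1 := by rw [← Complex.exp_add]; simp
    have e3 : exp (-(2 * I * k * L)) = exp (-(I * k * L)) * exp (-(I * k * L)) := by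
      rw [← Complex.exp_add]; ring_nf
    rw [e3]
    linear_combination exp (-(I * k * L)) * heq - w * e2
  have e4 : 1 - exp (-(2 * I * k * L)) =
      -(w - 1) + exp (-(2 * I * k * L)) * (w' - 1) := by rw [mul_sub, ← e1]; ring
  have e5 : ‖1 - exp (-(2 * I * k * L))‖ ≤ 1 / 10 + ‖exp (-(2 * I * k * L))‖ * (1 / 10) := by
    rw [e4]
    refine (norm_add_le _ _).trans (add_le_add (by rwa [norm_neg]) ?_)
    rw [norm_mul]
    gcongr
  nlinarith [norm_nonneg (exp (-(2 * I * k * L)))]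

theorem gronwallBound_zero_le {η t : ℝ} (hη : 0 < η) (ht : 0 ≤ t) (h1 : η * t ≤ 1) :
    gronwallBound 0 η η t ≤ 2 * (η * t) := by
  rw [gronwallBound_of_K_ne_0 hη.ne']
  simp only [zero_mul, zero_add, div_self hη.ne', one_mul]
  have h0 : 0 ≤ η * t := by positivity
  have := Real.abs_exp_sub_one_le (x := η * t) (by rwa [abs_of_nonneg h0])
  rw [abs_of_nonneg h0] at this
  exact (le_abs_self _).trans this

theorem conj_notMem_disks {L : ℝ} {k : ℂ} (hk : k ∉ disks L) : conj k ∉ disks L := by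
  intro h
  apply hk
  obtain ⟨n, hn⟩ := mem_iUnion.1 h
  refine mem_iUnion.2 ⟨n, ?_⟩
  rw [mem_ball, dist_eq_norm] at hn ⊢
  rw [← RCLike.norm_conj]
  simpa using hn

/-- The connection between the initial data and the solution at a point `(x, t)` that enters the
Riemann–Hilbert problem: `Ψ` is the fundamental solution of the Lax pair, and its behaviour for
large `k` is described by Bloch solutions. -/
structure IsSpectralData (lam L x t : ℝ) (a b : ℂ → ℂ) (Ψ : ℂ → Mat2) (qv : ℂ) : Prop where
  diff_a : Differentiable ℂ a
  diff_b : Differentiable ℂ b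
  diff_Ψ : ∀ i j, Differentiable ℂ fun k => Ψ k i j
  det_s : ∀ k, a k * schwarz a k - lam * b k * schwarz b k = 1
  det_Ψ : ∀ k, Ψ k 0 0 * Ψ k 1 1 - Ψ k 0 1 * Ψ k 1 0 = 1
  sym11 : ∀ k, Ψ k 1 1 = schwarz (fun k => Ψ k 0 0) k
  sym10 : ∀ k, Ψ k 1 0 = lam * schwarz (fun k => Ψ k 0 1) k
  asymp : ∃ K > 0, ∃ C > 0, ∀ k ∉ disks L, K ≤ ‖k‖ → ∃ g γ d w : ℂ,
    ‖g‖ ≤ C / ‖k‖ ∧ ‖γ - qv / (2 * I * k)‖ ≤ C / ‖k‖ ^ 2 ∧ ‖d - 1‖ ≤ C / ‖k‖ ∧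
    ‖w - 1‖ ≤ C / ‖k‖ ∧
    exp (-(I * k * L)) * a k * g - exp (-(I * k * L)) * b k = exp (I * k * L) * w * g ∧
    -(lam * exp (I * k * L) * schwarz b k * g) + exp (I * k * L) * schwarz a k =
      exp (I * k * L) * w ∧
    Ψ k 0 0 * g + Ψ k 0 1 = exp (I * theta x t k) * d * γ ∧
    Ψ k 1 0 * g + Ψ k 1 1 = exp (I * theta x t k) * d
  gap : lam = 1 → ∀ k : ℂ, k.im ≠ 0 → discr L a k ^ 2 ≠ 4

variable {lam L T : ℝ} {q qx qxx qt : ℝ → ℝ → ℂ}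

theorem IsNLSData.exists_bloch (h : IsNLSData lam L q qx qxx qt) (hlam : lam = 1 ∨ lam = -1)
    (hL : 0 < L) (T : ℝ) : ∃ K > 0, ∃ C > 0, ∀ t ∈ Icc 0 T, ∀ k ∉ disks L, K ≤ ‖k‖ →
      ∃ Γ : ℝ → ℂ, ∃ J : ℝ → ℂ, Γ L = Γ 0 ∧
        (∀ x, ‖Γ x‖ ≤ C / ‖k‖) ∧ (∀ x, ‖Γ x - q x t / (2 * I * k)‖ ≤ C / ‖k‖ ^ 2) ∧
        (∀ x ∈ Icc 0 L, ‖exp (J x) - 1‖ ≤ C / ‖k‖) ∧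
        ∀ s, xFund lam (fun y => q y t) k s 0 0 * Γ 0 + xFund lam (fun y => q y t) k s 0 1 =
          exp (I * k * s) * exp (J s) * Γ s ∧
        xFund lam (fun y => q y t) k s 1 0 * Γ 0 + xFund lam (fun y => q y t) k s 1 1 =
          exp (I * k * s) * exp (J s) := by
  obtain ⟨B0, hB0⟩ := exists_bound_of_periodic hL h.cont h.per T
  obtain ⟨B1, hB1⟩ := exists_bound_of_periodic hL h.contx h.perx T
  obtain ⟨B2, hB2⟩ := exists_bound_of_periodic hL h.contxx h.perxx T
  set B : ℝ := max (max 1 B0) (max B1 B2) with hB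
  have b1 : 1 ≤ B := (le_max_left _ _).trans (le_max_left _ _)
  have l0 : B0 ≤ B := (le_max_right _ _).trans (le_max_left _ _)
  have l1 : B1 ≤ B := (le_max_left _ _).trans (le_max_right _ _)
  have l2 : B2 ≤ B := (le_max_right _ _).trans (le_max_right _ _)
  obtain ⟨K, hK, C, hC, hric⟩ := exists_riccati hlam hL b1
  have hBpos : 0 < B := by linarith
  set C' : ℝ := B + C with hC'
  have hC'pos : 0 < C' := by positivity
  refine ⟨max (max 1 K) (L * B * C'), by positivity, C' + 2 * (L * B * C'), by positivity, ?_⟩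
  intro t ht k hk hkK
  have hk1 : 1 ≤ ‖k‖ := ((le_max_left _ _).trans (le_max_left _ _)).trans hkK
  have hk2 : K ≤ ‖k‖ := ((le_max_right _ _).trans (le_max_left _ _)).trans hkK
  have hk3 : L * B * C' ≤ ‖k‖ := (le_max_right _ _).trans hkK
  have hkpos : 0 < ‖k‖ := by linarith
  have hcs := h.continuous_slice ht.1
  obtain ⟨Γ, hΓ, hΓp, hΓb⟩ := hric (fun y => q y t) (fun y => qx y t) (fun y => qxx y t) hcs.2.2.1
    (fun x => h.dx x t ht.1) (fun x => h.dxx x t ht.1) (fun x => h.per x t ht.1)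
    (fun x => h.perx x t ht.1) (fun x => h.perxx x t ht.1) (fun x => (hB0 x t ht).trans l0)
    (fun x => (hB1 x t ht).trans l1) (fun x => (hB2 x t ht).trans l2) k hk hk2
  have hlamn : ‖(lam : ℂ)‖ = 1 := by rcases hlam with rfl | rfl <;> simp
  have hΓn : ∀ x, ‖Γ x‖ ≤ C' / ‖k‖ := by
    intro x
    have h1 : ‖q x t / (2 * I * k)‖ ≤ B / ‖k‖ := by
      rw [norm_div, norm_mul, norm_mul, norm_I, Complex.norm_ofNat, mul_one]
      have : ‖k‖ ≤ 2 * ‖k‖ := by linarith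
      gcongr
      exact (hB0 x t ht).trans l0
    have h2 : C / ‖k‖ ^ 2 ≤ C / ‖k‖ := by
      gcongr
      nlinarith
    have h3 : Γ x = q x t / (2 * I * k) + (Γ x - q x t / (2 * I * k)) := by ring
    rw [h3]
    calc _ ≤ B / ‖k‖ + C / ‖k‖ := (norm_add_le _ _).trans (add_le_add h1 ((hΓb x).trans h2))
      _ = C' / ‖k‖ := by rw [hC']; ring
  have hco := h.isCoefficient_x hL ht.1 k
  refine ⟨Γ, fun s => ∫ y in (0 : ℝ)..s, lam * conj (q y t) * Γ y, by simpa using hΓp 0,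
    fun x => (hΓn x).trans ?_, fun x => (hΓb x).trans ?_, fun x hx => ?_, fun s => ?_⟩
  · gcongr
    have : 0 ≤ L * B * C' := by positivity
    linarith
  · gcongr
    have : 0 ≤ L * B * C' := by positivity
    linarith
  · have hJ : ‖∫ y in (0 : ℝ)..x, lam * conj (q y t) * Γ y‖ ≤ L * B * C' / ‖k‖ := by
      have h1 : ‖∫ y in (0 : ℝ)..x, lam * conj (q y t) * Γ y‖ ≤ (B * (C' / ‖k‖)) * |x - 0| := by
        apply intervalIntegral.norm_integral_le_of_norm_le_const
        intro y _
        rw [norm_mul, norm_mul, hlamn, one_mul, RCLike.norm_conj]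
        gcongr
        · exact (hB0 y t ht).trans l0
        · exact hΓn y
      refine h1.trans ?_
      rw [sub_zero, abs_of_nonneg hx.1]
      calc B * (C' / ‖k‖) * x ≤ B * (C' / ‖k‖) * L := by
            gcongr
            exact hx.2
        _ = _ := by ring
    have hJ1 : L * B * C' / ‖k‖ ≤ 1 := by rwa [div_le_one hkpos]
    refine (norm_exp_sub_one_le_two_mul (hJ.trans hJ1)).trans ?_
    calc _ ≤ 2 * (L * B * C' / ‖k‖) := by gcongr
      _ = 2 * (L * B * C') / ‖k‖ := by ring
      _ ≤ _ := by gcongr; linarith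
  · have := bloch_of_riccati hcs.1 hco hΓ s
    rw [Complex.exp_add] at this
    exact this

end Bloch

attribute [local instance] Matrix.linftyOpNormedRing Matrix.linftyOpNormedAlgebra

section Data

variable {lam L T : ℝ} {q qx qxx qt : ℝ → ℝ → ℂ}

theorem IsNLSData.xFund_sym (h : IsNLSData lam L q qx qxx qt) (hlam : lam = 1 ∨ lam = -1)
    (hL : 0 < L) {t : ℝ} (ht : 0 ≤ t) (k : ℂ) (s : ℝ) :
    xFund lam (fun y => q y t) k s = sym lam (xFund lam (fun y => q y t) (conj k) s) :=
  fundSol_sym hlam (h.isCoefficient_x hL ht (conj k)) (h.isCoefficient_x hL ht k)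
    (fun _ => laxU_conj hlam _ _) s

theorem IsNLSData.tFund_sym (h : IsNLSData lam L q qx qxx qt) (hlam : lam = 1 ∨ lam = -1)
    (hL : 0 < L) (hT : 0 ≤ T) (k : ℂ) (s : ℝ) :
    tFund lam q qx T k s = sym lam (tFund lam q qx T (conj k) s) :=
  fundSol_sym hlam (h.isCoefficient_t hL hT (conj k)) (h.isCoefficient_t hL hT k)
    (fun _ => laxV_conj hlam _ _ _) s

theorem IsNLSData.monodromy_entries (h : IsNLSData lam L q qx qxx qt) (hlam : lam = 1 ∨ lam = -1)
    (hL : 0 < L) (k : ℂ) :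
    xFund lam (fun y => q y 0) k L 0 0 = exp (-(I * k * L)) * specA lam L (fun y => q y 0) k ∧
    xFund lam (fun y => q y 0) k L 0 1 = -(exp (-(I * k * L)) * specB lam L (fun y => q y 0) k) ∧
    xFund lam (fun y => q y 0) k L 1 0 =
      -(lam * exp (I * k * L) * schwarz (specB lam L fun y => q y 0) k) ∧
    xFund lam (fun y => q y 0) k L 1 1 =
      exp (I * k * L) * schwarz (specA lam L fun y => q y 0) k := by
  have e2 : exp (-(I * k * L)) * exp (I * k * L) = 1 := by rw [← Complex.exp_add]; simp
  have hs := h.xFund_sym hlam hL le_rfl k L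
  have hco := h.isCoefficient_x hL le_rfl k
  have hco' := h.isCoefficient_x hL le_rfl (conj k)
  have e3 : conj (exp (I * (conj k) * L)) = exp (-(I * k * L)) := by
    rw [← exp_conj]; simp
  refine ⟨?_, ?_, ?_, ?_⟩
  · rw [specA_eq hco, ← mul_assoc, e2, one_mul]
  · rw [specB_eq hco]
    linear_combination (-(xFund lam (fun y => q y 0) k L 0 1)) * e2
  · rw [schwarz, specB_eq hco', hs, map_neg, map_mul, e3]
    simp only [sym, Matrix.of_apply, Matrix.cons_val', Matrix.cons_val_zero, Matrix.cons_val_one,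
      Matrix.cons_val_fin_one]
    linear_combination (-(lam * conj (xFund lam (fun y => q y 0) (conj k) L 0 1))) * e2
  · rw [schwarz, specA_eq hco', hs, map_mul, e3]
    simp only [sym, Matrix.of_apply, Matrix.cons_val', Matrix.cons_val_one,
      Matrix.cons_val_fin_one]
    linear_combination (-(conj (xFund lam (fun y => q y 0) (conj k) L 0 0))) * e2

/-- The time evolution of the Bloch vector. -/
theorem IsNLSData.tFund_bloch (h : IsNLSData lam L q qx qxx qt) (hlam : lam = 1 ∨ lam = -1)
    (hL : 0 < L) (hT : 0 ≤ T) {k : ℂ} (hk : k ≠ 0) {B C : ℝ} (hB : 0 < B) (hC : 0 < C)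
    (hq : ∀ τ ∈ Icc 0 T, ‖q 0 τ‖ ≤ B) (hqx : ∀ τ ∈ Icc 0 T, ‖qx 0 τ‖ ≤ B)
    {G : ℝ → ℂ} (hG1 : ∀ τ ∈ Icc 0 T, ‖G τ‖ ≤ C / ‖k‖)
    (hG2 : ∀ τ ∈ Icc 0 T, ‖G τ - q 0 τ / (2 * I * k)‖ ≤ C / ‖k‖ ^ 2) {g : ℂ}
    (hGv : ∀ τ ∈ Icc 0 T, tFund lam q qx T k τ 0 0 * g + tFund lam q qx T k τ 0 1 =
      G τ * (tFund lam q qx T k τ 1 0 * g + tFund lam q qx T k τ 1 1))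
    (hsmall : 3 * B * C / ‖k‖ * T ≤ 1) :
    ‖exp (-(2 * I * k ^ 2 * T)) * (tFund lam q qx T k T 1 0 * g + tFund lam q qx T k T 1 1) - 1‖ ≤
      2 * (3 * B * C / ‖k‖ * T) := by
  have hco := h.isCoefficient_t hL hT k
  set Y := tFund lam q qx T k with hY
  have hkpos : 0 < ‖k‖ := norm_pos_iff.2 hk
  have hlamn : ‖(lam : ℂ)‖ = 1 := by rcases hlam with rfl | rfl <;> simp
  set e : ℝ → ℂ := fun τ => exp (-(2 * I * k ^ 2 * τ)) * (Y τ 1 0 * g + Y τ 1 1) with he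
  set V : ℝ → Mat2 := fun s => laxV lam (q 0 (clamp T s)) (qx 0 (clamp T s)) k with hV
  have hYd : ∀ τ, HasDerivAt Y (V τ * Y τ) τ := fun τ => hasDerivAt_fundSol hco τ
  have hed : ∀ τ ∈ Icc 0 T, HasDerivAt e
      ((V τ 1 0 * G τ + I * lam * (q 0 τ * conj (q 0 τ))) * e τ) τ := by
    intro τ hτ
    have h1 : HasDerivAt (fun y : ℝ => -(2 * I * k ^ 2 * (y : ℂ))) (-(2 * I * k ^ 2)) τ := by
      have h0 : HasDerivAt (fun y : ℝ => -(2 * I * k ^ 2 * (y : ℂ))) (-(2 * I * k ^ 2 * 1)) τ :=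
        ((Complex.ofRealCLM.hasDerivAt (x := τ)).const_mul (2 * I * k ^ 2)).neg
      rwa [mul_one] at h0
    have h2 := h1.cexp.mul (((HasDerivAt.entry (hYd τ) 1 0).mul_const g).add
      (HasDerivAt.entry (hYd τ) 1 1))
    refine h2.congr_deriv ?_
    have h3 := hGv τ hτ
    have h4 : V τ 1 1 = 2 * I * k ^ 2 + I * lam * (q 0 τ * conj (q 0 τ)) := by
      simp [hV, laxV, clamp_of_mem hτ]
    simp only [Matrix.mul_apply, Fin.sum_univ_two, h4, he, Pi.add_apply]
    linear_combination exp (-(2 * I * k ^ 2 * τ)) * V τ 1 0 * h3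
  set η : ℝ := 3 * B * C / ‖k‖ with hη
  have hηpos : 0 < η := by positivity
  have hbound : ∀ τ ∈ Icc 0 T, ‖V τ 1 0 * G τ + I * lam * (q 0 τ * conj (q 0 τ))‖ ≤ η := by
    intro τ hτ
    have h4 : V τ 1 0 = 2 * k * (lam * conj (q 0 τ)) - I * (lam * conj (qx 0 τ)) := by
      simp [hV, laxV, clamp_of_mem hτ]
    have h5 : V τ 1 0 * G τ + I * lam * (q 0 τ * conj (q 0 τ)) =
        2 * k * (lam * conj (q 0 τ)) * (G τ - q 0 τ / (2 * I * k)) -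
          I * (lam * conj (qx 0 τ)) * G τ := by
      rw [h4]
      have : q 0 τ / (2 * I * k) = -I * q 0 τ / (2 * k) := by
        field_simp
        rw [I_sq]; ring
      rw [this]
      field_simp
      ring
    rw [h5]
    calc _ ≤ 2 * ‖k‖ * B * (C / ‖k‖ ^ 2) + B * (C / ‖k‖) := by
          refine (norm_sub_le _ _).trans (add_le_add ?_ ?_)
          · rw [norm_mul, norm_mul, norm_mul, norm_mul, hlamn, one_mul, RCLike.norm_conj,
              Complex.norm_ofNat]
            gcongr
            · exact hq τ hτ
            · exact hG2 τ hτ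
          · rw [norm_mul, norm_mul, norm_mul, hlamn, one_mul, RCLike.norm_conj, norm_I,
              one_mul]
            gcongr
            · exact hqx τ hτ
            · exact hG1 τ hτ
      _ = η := by rw [hη]; field_simp; ring
  have hY0 : Y 0 = 1 := fundSol_zero hco
  have hf0 : ‖e 0 - 1‖ ≤ 0 := by simp [he, hY0]
  have hgr := norm_le_gronwallBound_of_norm_deriv_right_le (f := fun τ => e τ - 1)
    (f' := fun τ => (V τ 1 0 * G τ + I * lam * (q 0 τ * conj (q 0 τ))) * e τ) (δ := 0) (K := η)
    (ε := η) (a := 0) (b := T)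
    (fun τ hτ => ((hed τ hτ).continuousAt.sub continuousAt_const).continuousWithinAt)
    (fun τ hτ => ((hed τ (Ico_subset_Icc_self hτ)).sub_const 1).hasDerivWithinAt) hf0
    (fun τ hτ => by
      rw [norm_mul]
      have h6 : ‖e τ‖ ≤ ‖e τ - 1‖ + 1 := by
        have := norm_add_le (e τ - 1) 1
        simpa using this
      calc _ ≤ η * (‖e τ - 1‖ + 1) := by
            gcongr
            exact hbound τ (Ico_subset_Icc_self hτ)
        _ = _ := by ring) T ⟨hT, le_rfl⟩
  rw [sub_zero] at hgr
  exact hgr.trans (gronwallBound_zero_le hηpos hT hsmall)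

end Data

attribute [local instance] Matrix.linftyOpNormedRing Matrix.linftyOpNormedAlgebra

section Data

variable {lam L T : ℝ} {q qx qxx qt : ℝ → ℝ → ℂ}

theorem IsNLSData.asymp (h : IsNLSData lam L q qx qxx qt) (hlam : lam = 1 ∨ lam = -1)
    (hL : 0 < L) (hT : 0 ≤ T) {x : ℝ} (hx : x ∈ Icc 0 L) :
    ∃ K > 0, ∃ C > 0, ∀ k ∉ disks L, K ≤ ‖k‖ → ∃ g γ d w : ℂ,
    ‖g‖ ≤ C / ‖k‖ ∧ ‖γ - q x T / (2 * I * k)‖ ≤ C / ‖k‖ ^ 2 ∧ ‖d - 1‖ ≤ C / ‖k‖ ∧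
    ‖w - 1‖ ≤ C / ‖k‖ ∧
    xFund lam (fun y => q y 0) k L 0 0 * g + xFund lam (fun y => q y 0) k L 0 1 =
      exp (I * k * L) * w * g ∧
    xFund lam (fun y => q y 0) k L 1 0 * g + xFund lam (fun y => q y 0) k L 1 1 =
      exp (I * k * L) * w ∧
    (xFund lam (fun y => q y T) k x * tFund lam q qx T k T) 0 0 * g +
      (xFund lam (fun y => q y T) k x * tFund lam q qx T k T) 0 1 =
      exp (I * theta x T k) * d * γ ∧
    (xFund lam (fun y => q y T) k x * tFund lam q qx T k T) 1 0 * g +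
      (xFund lam (fun y => q y T) k x * tFund lam q qx T k T) 1 1 =
      exp (I * theta x T k) * d := by
  obtain ⟨K, hK, C, hC, hbl⟩ := h.exists_bloch hlam hL T
  obtain ⟨B0, hB0⟩ := exists_bound_of_periodic hL h.cont h.per T
  obtain ⟨B1, hB1⟩ := exists_bound_of_periodic hL h.contx h.perx T
  set B : ℝ := max (max 1 B0) B1 with hB
  have b1 : 1 ≤ B := (le_max_left _ _).trans (le_max_left _ _)
  have l0 : B0 ≤ B := (le_max_right _ _).trans (le_max_left _ _)
  have l1 : B1 ≤ B := le_max_right _ _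
  have hBpos : 0 < B := by linarith
  have h3T : 0 ≤ 3 * B * C * T := by positivity
  refine ⟨max K (10 * C + 3 * B * C * T + 1), by positivity, 2 * C + 12 * B * C * T + 1,
    by linarith, ?_⟩
  intro k hk hkK
  have hk1 : K ≤ ‖k‖ := (le_max_left _ _).trans hkK
  have hk2 : 10 * C + 3 * B * C * T + 1 ≤ ‖k‖ := (le_max_right _ _).trans hkK
  have hkpos : 0 < ‖k‖ := hK.trans_le hk1
  have hk0 : k ≠ 0 := norm_pos_iff.1 hkpos
  have hC10 : C / ‖k‖ ≤ 1 / 10 := by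
    rw [div_le_div_iff₀ hkpos (by norm_num)]; linarith
  have hsmall : 3 * B * C / ‖k‖ * T ≤ 1 := by
    rw [div_mul_eq_mul_div, div_le_one hkpos]; linarith
  have h0T : (0 : ℝ) ∈ Icc 0 T := ⟨le_rfl, hT⟩
  have hTT : T ∈ Icc 0 T := ⟨hT, le_rfl⟩
  have h0L : (0 : ℝ) ∈ Icc 0 L := ⟨le_rfl, hL.le⟩
  have hLL : L ∈ Icc 0 L := ⟨hL.le, le_rfl⟩
  choose! Γ J hΓp hΓ1 hΓ2 hJ hblv using fun τ hτ => hbl τ hτ k hk hk1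
  set g := Γ 0 0 with hg
  set w := exp (J 0 L) with hw
  have hgv := hblv 0 h0T L
  rw [hΓp 0 h0T] at hgv
  have hM : ∀ τ ∈ Icc 0 T, xFund lam (fun y => q y τ) k L * tFund lam q qx T k τ =
      tFund lam q qx T k τ * xFund lam (fun y => q y 0) k L := fun τ hτ =>
    h.monodromy_mul_tFund hlam hL hτ k
  set Y := tFund lam q qx T k with hY
  set M := xFund lam (fun y => q y 0) k L with hMdef
  have hGv : ∀ τ ∈ Icc 0 T, Y τ 0 0 * g + Y τ 0 1 = Γ τ 0 * (Y τ 1 0 * g + Y τ 1 1) := by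
    intro τ hτ
    obtain ⟨Γ', J', hΓp', hΓ1', -, hJ', hblv'⟩ := hbl τ hτ (conj k) (conj_notMem_disks hk)
      (by rwa [RCLike.norm_conj])
    rw [RCLike.norm_conj] at hΓ1' hJ'
    have ev := hblv' L
    rw [hΓp'] at ev
    have hev := hblv τ hτ L
    rw [hΓp τ hτ] at hev
    have hsym := h.xFund_sym hlam hL hτ.1 k L
    have hMτ := hM τ hτ
    set N := xFund lam (fun y => q y τ) k L with hN
    set N' := xFund lam (fun y => q y τ) (conj k) L with hN'
    have e3 : conj (exp (I * (conj k) * L)) = exp (-(I * k * L)) := by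
      rw [← exp_conj]; simp
    have n00 : N 0 0 = conj (N' 1 1) := by rw [hsym]; simp [sym]
    have n01 : N 0 1 = lam * conj (N' 1 0) := by rw [hsym]; simp [sym]
    have n10 : N 1 0 = lam * conj (N' 0 1) := by rw [hsym]; simp [sym]
    have n11 : N 1 1 = conj (N' 0 0) := by rw [hsym]; simp [sym]
    have h2 : (lam : ℂ) * lam = 1 := by rcases hlam with rfl | rfl <;> simp
    have c1 := congrArg conj ev.1
    have c2 := congrArg conj ev.2
    simp only [map_add, map_mul, e3] at c1 c2
    have hm : ∀ i j, (N * Y τ) i j = (Y τ * M) i j := fun i j => by rw [hMτ]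
    have m00 := hm 0 0
    have m01 := hm 0 1
    have m10 := hm 1 0
    have m11 := hm 1 1
    simp only [Matrix.mul_apply, Fin.sum_univ_two] at m00 m01 m10 m11
    refine eigenvector_unique (m00 := N 0 0) (m01 := N 0 1) (m10 := N 1 0) (m11 := N 1 1)
      (h := lam * conj (Γ' 0)) (μ := exp (I * k * L) * exp (J τ L))
      (ν := exp (-(I * k * L)) * conj (exp (J' L))) (κ := exp (I * k * L) * w)
      hev.1 hev.2 ?_ ?_ ?_ ?_ ?_ ?_
    · rw [n00, n01]
      linear_combination c2 + conj (N' 1 0) * conj (Γ' 0) * h2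
    · rw [n10, n11]
      linear_combination lam * c1
    · intro heq
      have : ‖Γ τ 0 * (lam * conj (Γ' 0))‖ = 1 := by rw [heq, norm_one]
      have hlamn : ‖(lam : ℂ)‖ = 1 := by rcases hlam with rfl | rfl <;> simp
      rw [norm_mul, norm_mul, hlamn, one_mul, RCLike.norm_conj] at this
      have a1 := (hΓ1 τ hτ 0).trans hC10
      have a2 := (hΓ1' 0).trans hC10
      nlinarith [norm_nonneg (Γ τ 0), norm_nonneg (Γ' 0)]
    · linear_combination g * m00 + m01 + Y τ 0 0 * hgv.1 + Y τ 0 1 * hgv.2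
    · linear_combination g * m10 + m11 + Y τ 1 0 * hgv.1 + Y τ 1 1 * hgv.2
    · refine multipliers_ne hL hk ((hJ 0 h0T L hLL).trans hC10) ?_
      have : conj (exp (J' L)) - 1 = conj (exp (J' L) - 1) := by simp
      rw [this, RCLike.norm_conj]
      exact (hJ' L hLL).trans hC10
  have htime := h.tFund_bloch hlam hL hT hk0 hBpos hC
    (fun τ hτ => (hB0 0 τ hτ).trans l0) (fun τ hτ => (hB1 0 τ hτ).trans l1)
    (fun τ hτ => hΓ1 τ hτ 0) (fun τ hτ => hΓ2 τ hτ 0) hGv hsmall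
  rw [← hY] at htime
  set e : ℂ := exp (-(2 * I * k ^ 2 * T)) * (Y T 1 0 * g + Y T 1 1) with he
  have hlast := hblv T hTT x
  have e5 : exp (2 * I * k ^ 2 * T) * exp (-(2 * I * k ^ 2 * T)) = 1 := by
    rw [← Complex.exp_add]; simp
  have hv2 : Y T 1 0 * g + Y T 1 1 = exp (2 * I * k ^ 2 * T) * e := by
    rw [he]; linear_combination (-(Y T 1 0 * g + Y T 1 1)) * e5
  have hθ : exp (I * theta x T k) = exp (I * k * x) * exp (2 * I * k ^ 2 * T) := by
    rw [← Complex.exp_add, theta]; ring_nf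
  have hv1 := hGv T hTT
  have hCC : ∀ n : ℕ, C / ‖k‖ ^ n ≤ (2 * C + 12 * B * C * T + 1) / ‖k‖ ^ n := fun n => by
    gcongr; nlinarith
  refine ⟨g, Γ T x, e * exp (J T x), w, (hΓ1 0 h0T 0).trans (by simpa using hCC 1),
    (hΓ2 T hTT x).trans (hCC 2), ?_, (hJ 0 h0T L hLL).trans (by simpa using hCC 1), hgv.1, hgv.2,
    ?_, ?_⟩
  · have hen : ‖e‖ ≤ 2 * 1 + 1 := by
      have := norm_add_le (e - 1) 1
      rw [sub_add_cancel, norm_one] at this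
      linarith
    have hJx := hJ T hTT x hx
    have hJ2 : ‖exp (J T x)‖ ≤ 2 := by
      have := norm_add_le (exp (J T x) - 1) 1
      rw [sub_add_cancel, norm_one] at this
      linarith [hJx.trans hC10]
    have : e * exp (J T x) - 1 = (e - 1) * exp (J T x) + (exp (J T x) - 1) := by ring
    rw [this]
    calc _ ≤ 2 * (3 * B * C / ‖k‖ * T) * 2 + C / ‖k‖ := by
          refine (norm_add_le _ _).trans (add_le_add ?_ hJx)
          rw [norm_mul]
          gcongr
      _ = (C + 12 * B * C * T) / ‖k‖ := by ring
      _ ≤ _ := div_le_div_of_nonneg_right (by linarith) hkpos.le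
  · simp only [Matrix.mul_apply, Fin.sum_univ_two]
    set X := xFund lam (fun y => q y T) k x
    rw [hθ]
    linear_combination X 0 0 * hv1 + (Y T 1 0 * g + Y T 1 1) * hlast.1 +
      exp (I * k * x) * exp (J T x) * Γ T x * hv2
  · simp only [Matrix.mul_apply, Fin.sum_univ_two]
    set X := xFund lam (fun y => q y T) k x
    rw [hθ]
    linear_combination X 1 0 * hv1 + (Y T 1 0 * g + Y T 1 1) * hlast.2 +
      exp (I * k * x) * exp (J T x) * hv2

end Data

attribute [local instance] Matrix.linftyOpNormedRing Matrix.linftyOpNormedAlgebra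

section Data

variable {lam L T : ℝ} {q qx qxx qt : ℝ → ℝ → ℂ}

theorem mulVec_vec_ne_zero {X : Mat2} (hX : X.adjugate * X = 1) {v : Fin 2 → ℂ} (hv : v ≠ 0) :
    ¬ (X 0 0 * v 0 + X 0 1 * v 1 = 0 ∧ X 1 0 * v 0 + X 1 1 * v 1 = 0) := by
  rintro ⟨h0, h1⟩
  apply hv
  have : X.mulVec v = 0 := by
    ext i
    fin_cases i <;> simpa [Matrix.mulVec, dotProduct, Fin.sum_univ_two]
  calc v = (X.adjugate * X).mulVec v := by rw [hX, Matrix.one_mulVec]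
    _ = 0 := by rw [← Matrix.mulVec_mulVec, this, Matrix.mulVec_zero]

/-- In the defocusing case the discriminant is not `±2` off the real axis. -/
theorem trace_sq_ne_four {q0 : ℝ → ℂ} {k : ℂ} (hL : 0 < L) (hk : k.im ≠ 0)
    (hco : IsCoefficient fun s => laxU 1 (q0 s) k) :
    (xFund 1 q0 k L 0 0 + xFund 1 q0 k L 1 1) ^ 2 ≠ 4 := by
  intro h4
  set X := xFund 1 q0 k with hX
  have hdet := det_fundSol hco L
  rw [Matrix.det_fin_two] at hdet
  have hdet' : X L 0 0 * X L 1 1 - X L 0 1 * X L 1 0 = 1 := hdet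
  obtain ⟨ε, hε, htr⟩ : ∃ ε : ℂ, ‖ε‖ = 1 ∧ ε ^ 2 = 1 ∧ X L 0 0 + X L 1 1 = 2 * ε := by
    have : (X L 0 0 + X L 1 1 - 2) * (X L 0 0 + X L 1 1 + 2) = 0 := by linear_combination h4
    rcases mul_eq_zero.1 this with h | h
    · exact ⟨1, by simp, by simp, by linear_combination h⟩
    · exact ⟨-1, by simp, by simp, by linear_combination h⟩
  have hd0 : (X L - ε • (1 : Mat2)).det = 0 := by
    rw [Matrix.det_fin_two]
    simp
    linear_combination hdet' - ε * htr.2 - htr.1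
  obtain ⟨v, hv, hve⟩ := Matrix.exists_mulVec_eq_zero_iff.2 hd0
  have hv0 := congrFun hve 0
  have hv1 := congrFun hve 1
  simp [Matrix.mulVec, dotProduct, Fin.sum_univ_two] at hv0 hv1
  set u : ℝ → ℂ := fun s => X s 0 0 * v 0 + X s 0 1 * v 1 with hu
  set w : ℝ → ℂ := fun s => X s 1 0 * v 0 + X s 1 1 * v 1 with hw
  have hXd : ∀ s, HasDerivAt X (laxU 1 (q0 s) k * X s) s := fun s => hasDerivAt_fundSol hco s
  have hud : ∀ s, HasDerivAt u (-(I * k) * u s + q0 s * w s) s := by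
    intro s
    refine (((HasDerivAt.entry (hXd s) 0 0).mul_const (v 0)).add
      ((HasDerivAt.entry (hXd s) 0 1).mul_const (v 1))).congr_deriv ?_
    simp [Matrix.mul_apply, Fin.sum_univ_two, laxU, hu, hw]; ring
  have hwd : ∀ s, HasDerivAt w (conj (q0 s) * u s + I * k * w s) s := by
    intro s
    refine (((HasDerivAt.entry (hXd s) 1 0).mul_const (v 0)).add
      ((HasDerivAt.entry (hXd s) 1 1).mul_const (v 1))).congr_deriv ?_
    simp [Matrix.mul_apply, Fin.sum_univ_two, laxU, hu, hw]; ring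
  have hN : ∀ s, HasDerivAt (fun s => ‖u s‖ ^ 2 - ‖w s‖ ^ 2)
      (2 * k.im * (‖u s‖ ^ 2 + ‖w s‖ ^ 2)) s := by
    intro s
    refine ((hud s).norm_sq.sub (hwd s).norm_sq).congr_deriv ?_
    simp only [Complex.inner, Complex.sq_norm, normSq_apply, mul_re,
      mul_im, add_re, add_im, conj_re, conj_im,
      neg_re, neg_im, Complex.I_re, Complex.I_im]
    ring
  have hX0 : X 0 = 1 := fundSol_zero hco
  have hend : ‖u 0‖ ^ 2 - ‖w 0‖ ^ 2 = ‖u L‖ ^ 2 - ‖w L‖ ^ 2 := by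
    have e1 : u 0 = v 0 := by simp [hu, hX0]
    have e2 : w 0 = v 1 := by simp [hw, hX0]
    have e3 : u L = ε * v 0 := by simp only [hu]; linear_combination hv0
    have e4 : w L = ε * v 1 := by simp only [hw]; linear_combination hv1
    rw [e1, e2, e3, e4, norm_mul, norm_mul, hε, one_mul, one_mul]
  obtain ⟨c, -, hc⟩ := exists_hasDerivAt_eq_zero hL
    (fun s _ => (hN s).continuousAt.continuousWithinAt) hend (fun s _ => hN s)
  have hc' : ‖u c‖ ^ 2 + ‖w c‖ ^ 2 = 0 := by
    rcases mul_eq_zero.1 hc with h | h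
    · exact absurd h (by simpa using hk)
    · exact h
  have h0 : ‖u c‖ = 0 := by nlinarith [sq_nonneg ‖u c‖, sq_nonneg ‖w c‖]
  have h1 : ‖w c‖ = 0 := by nlinarith [sq_nonneg ‖u c‖, sq_nonneg ‖w c‖]
  exact mulVec_vec_ne_zero (adjugate_mul_fundSol hco c) hv
    ⟨norm_eq_zero.1 h0, norm_eq_zero.1 h1⟩

theorem IsNLSData.exists_spectralData (h : IsNLSData lam L q qx qxx qt)
    (hlam : lam = 1 ∨ lam = -1) (hL : 0 < L) (hT : 0 ≤ T) {x : ℝ} (hx : x ∈ Icc 0 L) :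
    ∃ Ψ, IsSpectralData lam L x T (specA lam L fun y => q y 0) (specB lam L fun y => q y 0) Ψ
      (q x T) := by
  have hcs0 := h.continuous_slice le_rfl
  have hcsT := h.continuous_slice hT
  obtain ⟨B, hB⟩ := exists_bound_of_periodic hL h.cont h.per T
  have hent := h.monodromy_entries hlam hL
  have hdX : ∀ i j, Differentiable ℂ fun k => xFund lam (fun y => q y T) k x i j := fun i j =>
    differentiable_fundSol_laxU lam hcsT.1 (fun s => hB s T ⟨hT, le_rfl⟩) hx.1 i j
  have hdM : ∀ i j, Differentiable ℂ fun k => xFund lam (fun y => q y 0) k L i j := fun i j =>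
    differentiable_fundSol_laxU lam hcs0.1 (fun s => hB s 0 ⟨le_rfl, hT⟩) hL.le i j
  obtain ⟨ct1, ct2, B', hB', hB''⟩ := h.clamp_slice (T := T) hL hT
  have hdY : ∀ i j, Differentiable ℂ fun k => tFund lam q qx T k T i j := fun i j =>
    differentiable_fundSol_laxV lam ct1 ct2 hB' hB'' hT i j
  have hdΨ : ∀ i j, Differentiable ℂ fun k =>
      (xFund lam (fun y => q y T) k x * tFund lam q qx T k T) i j := by
    intro i j
    simp only [Matrix.mul_apply, Fin.sum_univ_two]
    exact ((hdX i 0).mul (hdY 0 j)).add ((hdX i 1).mul (hdY 1 j))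
  have hsymΨ : ∀ k, xFund lam (fun y => q y T) k x * tFund lam q qx T k T =
      sym lam (xFund lam (fun y => q y T) (conj k) x * tFund lam q qx T (conj k) T) := by
    intro k
    rw [sym_mul hlam, ← h.xFund_sym hlam hL hT, ← h.tFund_sym hlam hL hT]
  have h2 : (lam : ℂ) * lam = 1 := by rcases hlam with rfl | rfl <;> simp
  refine ⟨fun k => xFund lam (fun y => q y T) k x * tFund lam q qx T k T, ?_⟩
  obtain ⟨K, hK, C, hC, has⟩ := h.asymp hlam hL hT hx
  refine ⟨?_, ?_, hdΨ, ?_, ?_, ?_, ?_, ⟨K, hK, C, hC, ?_⟩, ?_⟩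
  · rw [show (specA lam L fun y => q y 0) = _ from
      funext fun k => specA_eq (h.isCoefficient_x hL le_rfl k)]
    exact Differentiable.mul (by fun_prop) (hdM 0 0)
  · rw [show (specB lam L fun y => q y 0) = _ from
      funext fun k => specB_eq (h.isCoefficient_x hL le_rfl k)]
    exact (Differentiable.mul (by fun_prop) (hdM 0 1)).neg
  · intro k
    obtain ⟨m00, m01, m10, m11⟩ := hent k
    have hdet : _ = (1 : ℂ) := det_fundSol (h.isCoefficient_x hL le_rfl k) L
    rw [Matrix.det_fin_two] at hdet
    change xFund lam (fun y => q y 0) k L 0 0 * xFund lam (fun y => q y 0) k L 1 1 -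
      xFund lam (fun y => q y 0) k L 0 1 * xFund lam (fun y => q y 0) k L 1 0 = 1 at hdet
    rw [m00, m01, m10, m11] at hdet
    have e2 : exp (-(I * k * L)) * exp (I * k * L) = 1 := by rw [← Complex.exp_add]; simp
    linear_combination hdet - (specA lam L (fun y => q y 0) k *
      schwarz (specA lam L fun y => q y 0) k - lam * specB lam L (fun y => q y 0) k *
      schwarz (specB lam L fun y => q y 0) k) * e2
  · intro k
    rw [← Matrix.det_fin_two, Matrix.det_mul]
    rw [show (xFund lam (fun y => q y T) k x).det = 1 from
      det_fundSol (h.isCoefficient_x hL hT k) x,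
      show (tFund lam q qx T k T).det = 1 from det_fundSol (h.isCoefficient_t hL hT k) T, one_mul]
  · intro k
    dsimp only [schwarz]
    rw [hsymΨ k]
    simp [sym]
  · intro k
    dsimp only [schwarz]
    rw [hsymΨ k]
    simp [sym]
  · intro k hk hkK
    obtain ⟨g, γ, d, w, h1, h2, h3, h4, h5, h6, h7, h8⟩ := has k hk hkK
    obtain ⟨m00, m01, m10, m11⟩ := hent k
    rw [m00, m01] at h5
    rw [m10, m11] at h6
    exact ⟨g, γ, d, w, h1, h2, h3, h4, by linear_combination h5, by linear_combination h6, h7, h8⟩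
  · rintro rfl k hk
    obtain ⟨m00, m01, m10, m11⟩ := hent k
    have := trace_sq_ne_four hL hk (h.isCoefficient_x hL le_rfl k)
    rw [m00, m11] at this
    convert this using 3
    rw [discr]; ring

end Data

section ComplexTools

/-! ### Square roots -/

theorem exists_sqrt_near {h : ℂ → ℂ} {k0 : ℂ} (hh : AnalyticAt ℂ h k0) (h0 : h k0 ≠ 0) :
    ∃ r, AnalyticAt ℂ r k0 ∧ r k0 ≠ 0 ∧ ∀ z, r z ^ 2 = h z := by
  obtain ⟨c, hc⟩ := IsAlgClosed.exists_pow_nat_eq (h k0) (n := 2) (by norm_num)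
  have hc0 : c ≠ 0 := by rintro rfl; exact h0 (by rw [← hc]; simp)
  refine ⟨fun z => c * (h z / h k0) ^ ((2 : ℕ) : ℂ)⁻¹, ?_, ?_, fun z => ?_⟩
  · refine analyticAt_const.mul (AnalyticAt.cpow (hh.div analyticAt_const h0) analyticAt_const ?_)
    rw [div_self h0]; simp
  · simp [div_self h0, hc0]
  · rw [mul_pow, cpow_nat_inv_pow _ (by norm_num), hc]
    field_simp

theorem exists_sqrt_near_of_even {f : ℂ → ℂ} {k0 : ℂ} (hf : AnalyticAt ℂ f k0) {m : ℕ}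
    (hm : analyticOrderAt f k0 = ((2 * m : ℕ) : ℕ∞)) :
    ∃ r, AnalyticAt ℂ r k0 ∧ ∀ᶠ z in 𝓝 k0, r z ^ 2 = f z := by
  obtain ⟨h, hh, h0, hfh⟩ := hf.analyticOrderAt_eq_natCast.1 hm
  obtain ⟨r, hr, -, hrh⟩ := exists_sqrt_near hh h0
  refine ⟨fun z => (z - k0) ^ m * r z, by fun_prop, ?_⟩
  filter_upwards [hfh] with z hz
  rw [hz, mul_pow, hrh, ← pow_mul, mul_comm m 2, smul_eq_mul]

theorem differentiableOn_sqrt {U : Set ℂ} (hU : IsOpen U) {f r : ℂ → ℂ}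
    (hf : DifferentiableOn ℂ f U) (hr : ContinuousOn r U) (hrf : ∀ z ∈ U, r z ^ 2 = f z)
    (h0 : ∀ z ∈ U, f z ≠ 0) : DifferentiableOn ℂ r U := by
  intro z hz
  have hr0 : r z ≠ 0 := fun h => h0 z hz (by rw [← hrf z hz, h]; simp)
  have hU' := hU.mem_nhds hz
  have hfd := (hf.differentiableAt hU').hasDerivAt
  have hrc : ContinuousAt r z := hr.continuousAt hU'
  refine HasDerivAt.differentiableAt (f' := deriv f z / (r z + r z)) ?_ |>.differentiableWithinAt
  rw [hasDerivAt_iff_tendsto_slope] at hfd ⊢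
  have hr2 : r z + r z ≠ 0 := by simpa [← two_mul] using hr0
  have h1 : Tendsto (fun w => slope f z w / (r w + r z)) (𝓝[≠] z)
      (𝓝 (deriv f z / (r z + r z))) :=
    hfd.div ((hrc.tendsto.mono_left nhdsWithin_le_nhds).add tendsto_const_nhds) hr2
  refine h1.congr' ?_
  have h2 : ∀ᶠ w in 𝓝 z, r w + r z ≠ 0 := (hrc.add continuousAt_const).eventually_ne hr2
  filter_upwards [nhdsWithin_le_nhds h2, nhdsWithin_le_nhds hU'] with w hw hwU
  rw [slope_def_field, slope_def_field, ← hrf w hwU, ← hrf z hz]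
  field_simp
  ring

theorem exists_sqrt_of_convex {U : Set ℂ} (hU : IsOpen U) (hc : Convex ℝ U) (hne : U.Nonempty)
    {f : ℂ → ℂ} (hf : DifferentiableOn ℂ f U) (h0 : ∀ z ∈ U, f z ≠ 0) :
    ∃ r, DifferentiableOn ℂ r U ∧ ∀ z, r z ^ 2 = f z := by
  have hsc : IsSimplyConnected U := by
    have := hc.contractibleSpace hne
    exact inferInstanceAs (SimplyConnectedSpace U)
  obtain ⟨r, hr, hrf⟩ := exists_continuousOn_pow_eq hsc hU hf.continuousOn
    (by rintro ⟨z, hz, hz0⟩; exact h0 z hz hz0) two_ne_zero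
  exact ⟨r, differentiableOn_sqrt hU hf hr (fun z _ => hrf z) h0, hrf⟩

theorem eq_or_eq_neg_of_sq_eq {U : Set ℂ} (hU : IsOpen U) (hc : IsPreconnected U) {r s : ℂ → ℂ}
    (hr : DifferentiableOn ℂ r U) (hs : DifferentiableOn ℂ s U) (h : ∀ z ∈ U, r z ^ 2 = s z ^ 2) :
    (∀ z ∈ U, r z = s z) ∨ ∀ z ∈ U, r z = -s z := by
  have := AnalyticOnNhd.eq_zero_or_eq_zero_of_mul_eq_zero (f := fun z => r z - s z)
    (g := fun z => r z + s z) ((hr.sub hs).analyticOnNhd hU) ((hr.add hs).analyticOnNhd hU)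
    (fun z hz => by linear_combination h z hz) hc
  exact this.imp (fun h z hz => sub_eq_zero.1 (h z hz)) fun h z hz => eq_neg_of_add_eq_zero_left
    (h z hz)

/-- A function that is non-negative on the real axis has zeros of even order there. -/
theorem even_order_of_nonneg {f : ℂ → ℂ} {x0 : ℝ} (hf : AnalyticAt ℂ f x0)
    (hnn : ∀ᶠ x : ℝ in 𝓝 x0, 0 ≤ (f x).re ∧ (f x).im = 0) {n : ℕ}
    (hn : analyticOrderAt f x0 = n) : Even n := by
  by_contra hodd
  rw [Nat.not_even_iff_odd] at hodd
  obtain ⟨h, hh, h0, hfh⟩ := hf.analyticOrderAt_eq_natCast.1 hn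
  have hco : Tendsto (fun x : ℝ => (x : ℂ)) (𝓝 x0) (𝓝 (x0 : ℂ)) :=
    continuous_ofReal.continuousAt
  have hhc : Tendsto (fun x : ℝ => h x) (𝓝 x0) (𝓝 (h x0)) := hh.continuousAt.tendsto.comp hco
  have key : ∀ᶠ x : ℝ in 𝓝 x0, x ≠ x0 → 0 ≤ (x - x0) * (h x).re ∧ (h x).im = 0 := by
    filter_upwards [hnn, hco.eventually hfh] with x hx hx' hne
    have e : f x = (((x - x0) ^ n : ℝ) : ℂ) * h x := by rw [hx']; simp
    rw [e, re_ofReal_mul, im_ofReal_mul] at hx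
    have hpow : (x - x0) ^ n ≠ 0 := pow_ne_zero _ (sub_ne_zero.2 hne)
    refine ⟨?_, (mul_eq_zero.1 hx.2).resolve_left hpow⟩
    rcases lt_or_gt_of_ne hne with hlt | hgt
    · have h1 : (x - x0) ^ n < 0 := hodd.pow_neg (by linarith)
      have h2 : (h x).re ≤ 0 := by nlinarith [hx.1]
      nlinarith
    · have h1 : 0 < (x - x0) ^ n := pow_pos (by linarith) n
      have h2 : 0 ≤ (h x).re := by nlinarith [hx.1]
      nlinarith
  apply h0
  have hre : Tendsto (fun x : ℝ => (h x).re) (𝓝 x0) (𝓝 (h x0).re) :=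
    (continuous_re.tendsto _).comp hhc
  have him : Tendsto (fun x : ℝ => (h x).im) (𝓝 x0) (𝓝 (h x0).im) :=
    (continuous_im.tendsto _).comp hhc
  apply Complex.ext
  · apply le_antisymm
    · refine le_of_tendsto (hre.mono_left (nhdsWithin_le_nhds (s := Iio x0))) ?_
      filter_upwards [self_mem_nhdsWithin, nhdsWithin_le_nhds key] with x hx hk
      have hx : x < x0 := hx
      have := (hk hx.ne).1
      rw [Complex.zero_re]
      nlinarith
    · refine ge_of_tendsto (hre.mono_left (nhdsWithin_le_nhds (s := Ioi x0))) ?_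
      filter_upwards [self_mem_nhdsWithin, nhdsWithin_le_nhds key] with x hx hk
      have hx : x0 < x := hx
      have := (hk hx.ne').1
      rw [Complex.zero_re]
      nlinarith
  · refine tendsto_nhds_unique (him.mono_left (nhdsWithin_le_nhds (s := Ioi x0))) ?_
    refine tendsto_const_nhds.congr' ?_
    filter_upwards [self_mem_nhdsWithin, nhdsWithin_le_nhds key] with x hx hk
    have hx : x0 < x := hx
    rw [(hk hx.ne').2]; simp

/-! ### Extension across a line -/

theorem differentiableOn_ball_of_horizontal {f : ℂ → ℂ} {c : ℂ} {ρ : ℝ}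
    (hc : ContinuousOn f (ball c ρ))
    (hd : DifferentiableOn ℂ f (ball c ρ ∩ {z | z.im ≠ c.im})) :
    DifferentiableOn ℂ f (ball c ρ) := by
  refine (Complex.IsConservativeOn.isExactOn_ball hc ?_).differentiableOn isOpen_ball
  intro z w hzw
  rw [← add_eq_zero_iff_eq_neg, wedgeIntegral_add_wedgeIntegral_eq]
  have hR : (uIcc z.re w.re) ×ℂ (uIcc z.im w.im) ⊆ ball c ρ := hzw
  have hsub : ∀ a b : ℝ, a ∈ uIcc z.im w.im → b ∈ uIcc z.im w.im →
      c.im ∉ Ioo (min a b) (max a b) →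
      (∫ x : ℝ in z.re..w.re, f (x + a * I)) - (∫ x : ℝ in z.re..w.re, f (x + b * I)) +
      I • (∫ y : ℝ in a..b, f (w.re + y * I)) - I • (∫ y : ℝ in a..b, f (z.re + y * I)) = 0 := by
    intro a b ha hb hab
    have := integral_boundary_rect_eq_zero_of_continuousOn_of_differentiableOn f
      ⟨z.re, a⟩ ⟨w.re, b⟩ ?_ ?_
    · simpa using this
    · refine hc.mono (Subset.trans ?_ hR)
      exact Complex.reProdIm_subset_iff.2 (prod_mono Subset.rfl (uIcc_subset_uIcc ha hb))
    · refine hd.mono fun u hu => ⟨hR ⟨Ioo_subset_Icc_self hu.1, uIcc_subset_uIcc ha hb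
        (Ioo_subset_Icc_self hu.2)⟩, fun h => hab ?_⟩
      rw [← h]
      exact hu.2
  by_cases hmem : c.im ∈ Ioo (min z.im w.im) (max z.im w.im)
  · have hci : c.im ∈ uIcc z.im w.im := Ioo_subset_Icc_self hmem
    have i1 := hsub z.im c.im left_mem_uIcc hci (by
      rintro ⟨h1, h2⟩; rcases le_total z.im c.im with h | h <;> simp [h] at h1 h2)
    have i2 := hsub c.im w.im hci right_mem_uIcc (by
      rintro ⟨h1, h2⟩; rcases le_total c.im w.im with h | h <;> simp [h] at h1 h2)
    have hint : ∀ a ∈ uIcc z.re w.re, ∀ b1 ∈ uIcc z.im w.im, ∀ b2 ∈ uIcc z.im w.im,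
        IntervalIntegrable (fun y : ℝ => f (a + y * I)) MeasureTheory.volume b1 b2 := by
      intro a ha b1 hb1 b2 hb2
      apply ContinuousOn.intervalIntegrable
      refine hc.comp (by fun_prop) fun y hy => hR ⟨?_, ?_⟩
      · simpa using ha
      · simpa using uIcc_subset_uIcc hb1 hb2 hy
    rw [← intervalIntegral.integral_add_adjacent_intervals
        (hint w.re right_mem_uIcc z.im left_mem_uIcc c.im hci)
        (hint w.re right_mem_uIcc c.im hci w.im right_mem_uIcc),
      ← intervalIntegral.integral_add_adjacent_intervals
        (hint z.re left_mem_uIcc z.im left_mem_uIcc c.im hci)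
        (hint z.re left_mem_uIcc c.im hci w.im right_mem_uIcc)]
    simp only [smul_eq_mul] at i1 i2 ⊢
    linear_combination i1 + i2
  · exact hsub z.im w.im left_mem_uIcc right_mem_uIcc hmem

theorem differentiableOn_ball_of_vertical {f : ℂ → ℂ} {c : ℂ} {ρ : ℝ}
    (hc : ContinuousOn f (ball c ρ))
    (hd : DifferentiableOn ℂ f (ball c ρ ∩ {z | z.re ≠ c.re})) :
    DifferentiableOn ℂ f (ball c ρ) := by
  have hm : ∀ u : ℂ, u ∈ ball (I * c) ρ ↔ -I * u ∈ ball c ρ := by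
    intro u
    have : -I * u - c = -I * (u - I * c) := by linear_combination (-c) * I_sq
    rw [mem_ball, mem_ball, dist_eq_norm, dist_eq_norm, this]
    simp
  have hg : DifferentiableOn ℂ (fun u => f (-I * u)) (ball (I * c) ρ) := by
    apply differentiableOn_ball_of_horizontal
    · exact hc.comp (by fun_prop) fun u hu => (hm u).1 hu
    · refine hd.comp (by fun_prop) fun u hu => ⟨(hm u).1 hu.1, ?_⟩
      simpa using hu.2
  have : f = fun z => (fun u => f (-I * u)) (I * z) := by
    funext z
    simp [← mul_assoc]
  rw [this]
  refine hg.comp (by fun_prop) fun z hz => (hm _).2 ?_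
  simpa [← mul_assoc] using hz

/-! ### Gluing and Liouville -/

theorem exists_glued {Ω G : Set ℂ} (hΩ : IsOpen Ω) (hG : Dense G) {M : ℂ → ℂ}
    (h : ∀ k ∈ Ω, ∃ ρ > 0, ∃ g, DifferentiableOn ℂ g (ball k ρ) ∧
      EqOn g M (ball k ρ ∩ G)) :
    ∃ N, DifferentiableOn ℂ N Ω ∧ EqOn N M (Ω ∩ G) := by
  choose! ρ hρ g hg hgM using h
  refine ⟨fun k => g k k, ?_, fun k hk => hgM k hk.1 ⟨mem_ball_self (hρ k hk.1), hk.2⟩⟩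
  intro k hk
  have hev : (fun z => g z z) =ᶠ[𝓝 k] g k := by
    filter_upwards [hΩ.mem_nhds hk, ball_mem_nhds k (hρ k hk)] with z hzΩ hz
    have hO : IsOpen (ball z (ρ z) ∩ ball k (ρ k)) :=
      isOpen_ball.inter isOpen_ball
    have hzm : z ∈ ball z (ρ z) ∩ ball k (ρ k) :=
      ⟨mem_ball_self (hρ z hzΩ), hz⟩
    have hcl : z ∈ closure (ball z (ρ z) ∩ ball k (ρ k) ∩ G) :=
      hG.open_subset_closure_inter hO hzm
    have hne : (𝓝[ball z (ρ z) ∩ ball k (ρ k) ∩ G] z).NeBot :=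
      mem_closure_iff_nhdsWithin_neBot.1 hcl
    have c1 : ContinuousAt (g z) z :=
      ((hg z hzΩ).differentiableAt (isOpen_ball.mem_nhds hzm.1)).continuousAt
    have c2 : ContinuousAt (g k) z :=
      ((hg k hk).differentiableAt (isOpen_ball.mem_nhds hzm.2)).continuousAt
    refine tendsto_nhds_unique
      (l := 𝓝[ball z (ρ z) ∩ ball k (ρ k) ∩ G] z)
      (c1.tendsto.mono_left nhdsWithin_le_nhds)
      ((c2.tendsto.mono_left nhdsWithin_le_nhds).congr' ?_)
    filter_upwards [self_mem_nhdsWithin] with u hu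
    rw [hgM z hzΩ ⟨hu.1.1, hu.2⟩, hgM k hk ⟨hu.1.2, hu.2⟩]
  exact (hev.differentiableAt_iff.2 ((hg k hk).differentiableAt
    (ball_mem_nhds k (hρ k hk)))).differentiableWithinAt

theorem ball_subset_compl_disks {L : ℝ} (hL : 0 < L) {k : ℂ}
    (hk : ∀ n : ℤ, Real.pi / (3 * L) ≤ dist k (((n : ℝ) * Real.pi / L : ℝ) : ℂ)) :
    ball k (Real.pi / (12 * L)) ⊆ (disks L)ᶜ := by
  intro z hz hzd
  obtain ⟨n, hn⟩ := mem_iUnion.1 hzd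
  have h1 := dist_triangle k z (((n : ℝ) * Real.pi / L : ℝ) : ℂ)
  have h2 := hk n
  rw [mem_ball] at hz hn
  rw [dist_comm] at hz
  have : Real.pi / (12 * L) + Real.pi / (4 * L) = Real.pi / (3 * L) := by field_simp; norm_num
  linarith

theorem eq_const_of_decay {L : ℝ} (hL : 0 < L) {G : Set ℂ} (hG : Dense G) {N : ℂ → ℂ} {c : ℂ}
    (hN : Differentiable ℂ N)
    (hdec : (fun k => N k - c) =O[cocompact ℂ ⊓ 𝓟 (G \ disks L)] fun k => k⁻¹) (k : ℂ) :
    N k = c := by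
  obtain ⟨C, hC0, hC⟩ := hdec.exists_pos
  rw [IsBigOWith, eventually_inf_principal] at hC
  obtain ⟨K, hK0, hK⟩ : ∃ K > 0, ∀ z ∈ G, z ∉ disks L → K ≤ ‖z‖ → ‖N z - c‖ ≤ C / ‖z‖ := by
    have hnb := (Metric.hasBasis_cobounded_compl_closedBall (0 : ℂ)).mem_iff.1
      (show {x | x ∈ G \ disks L → ‖N x - c‖ ≤ C * ‖x⁻¹‖} ∈ Bornology.cobounded ℂ by
        rw [Metric.cobounded_eq_cocompact]; exact hC)
    obtain ⟨K, -, hK⟩ := hnb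
    refine ⟨max K 0 + 1, by positivity, fun z hz hzd hzK => ?_⟩
    have := hK (show z ∈ (closedBall (0 : ℂ) K)ᶜ by
      simp only [mem_compl_iff, mem_closedBall_zero_iff, not_le]
      linarith [le_max_left K 0]) ⟨hz, hzd⟩
    rwa [norm_inv, ← div_eq_mul_inv] at this
  have hπ := Real.pi_pos
  set δ : ℝ := Real.pi / (3 * L) with hδ
  have hδ0 : 0 < δ := by positivity
  have hfar : ∀ z : ℂ, (∀ n : ℤ, δ ≤ dist z (((n : ℝ) * Real.pi / L : ℝ) : ℂ)) → K < ‖z‖ →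
      ‖N z - c‖ ≤ C / ‖z‖ := by
    intro z hz hzK
    have hb := ball_subset_compl_disks hL hz
    have hzpos : 0 < ‖z‖ := hK0.trans hzK
    have : (𝓝[G] z).NeBot := mem_closure_iff_nhdsWithin_neBot.1 (hG z)
    have t1 : Tendsto (fun u => ‖N u - c‖) (𝓝[G] z) (𝓝 ‖N z - c‖) :=
      ((hN.continuous.sub continuous_const).norm.tendsto z).mono_left nhdsWithin_le_nhds
    have t2 : Tendsto (fun u : ℂ => C / ‖u‖) (𝓝[G] z) (𝓝 (C / ‖z‖)) :=
      (tendsto_const_nhds.div (continuous_norm.tendsto z) hzpos.ne').mono_left nhdsWithin_le_nhds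
    refine le_of_tendsto_of_tendsto t1 t2 ?_
    have hK' : ∀ᶠ u in 𝓝 z, K < ‖u‖ := continuous_norm.continuousAt.eventually (lt_mem_nhds hzK)
    filter_upwards [self_mem_nhdsWithin, nhdsWithin_le_nhds hK',
      nhdsWithin_le_nhds (ball_mem_nhds z (by positivity : 0 < Real.pi / (12 * L)))]
      with u hu huK hub
    exact hK u hu (hb hub) huK.le
  have hall : ∀ z : ℂ, K + 2 * δ + 1 ≤ ‖z‖ → ‖N z - c‖ ≤ C / (‖z‖ - 2 * δ) := by
    intro z hz
    by_cases hfz : ∀ n : ℤ, δ ≤ dist z (((n : ℝ) * Real.pi / L : ℝ) : ℂ)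
    · refine (hfar z hfz (by linarith)).trans ?_
      apply div_le_div_of_nonneg_left hC0.le <;> linarith
    · push Not at hfz
      obtain ⟨n, hn⟩ := hfz
      set p : ℂ := (((n : ℝ) * Real.pi / L : ℝ) : ℂ) with hp
      refine norm_le_of_forall_mem_frontier_norm_le (f := fun z => N z - c)
        (U := ball p δ) Metric.isBounded_ball (hN.sub_const c).diffContOnCl ?_
        (subset_closure hn)
      intro u hu
      rw [frontier_ball p hδ0.ne', mem_sphere_iff_norm, ← dist_eq_norm] at hu
      have huz : ‖z‖ - 2 * δ ≤ ‖u‖ := by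
        have h1 := dist_triangle z p u
        rw [dist_comm p u, hu] at h1
        have h2 := norm_sub_norm_le z u
        rw [← dist_eq_norm] at h2
        linarith
      refine (hfar u (fun m => ?_) (by linarith)).trans ?_
      · by_cases hmn : m = n
        · rw [hmn, ← hp, hu]
        · have h1 := dist_triangle p u (((m : ℝ) * Real.pi / L : ℝ) : ℂ)
          rw [dist_comm p u, hu] at h1
          have h2 : Real.pi / L ≤ dist p (((m : ℝ) * Real.pi / L : ℝ) : ℂ) := by
            rw [hp, Complex.dist_of_im_eq (by simp), ofReal_re, ofReal_re,
              Real.dist_eq]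
            have e : (n : ℝ) * Real.pi / L - m * Real.pi / L = ((n - m : ℤ) : ℝ) * (Real.pi / L) := by
              push_cast; ring
            rw [e, abs_mul, abs_of_pos (by positivity : 0 < Real.pi / L)]
            have h3 : (1 : ℝ) ≤ |((n - m : ℤ) : ℝ)| := by
              rw [← Int.cast_abs]
              exact_mod_cast Int.one_le_abs (sub_ne_zero.2 (Ne.symm hmn))
            nlinarith [div_pos hπ hL]
          have h4 : Real.pi / L = 3 * δ := by rw [hδ]; field_simp
          linarith
      · apply div_le_div_of_nonneg_left hC0.le <;> linarith
  have hlim : Tendsto N (cocompact ℂ) (𝓝 c) := by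
    rw [tendsto_iff_norm_sub_tendsto_zero]
    have h1 : Tendsto (fun z : ℂ => C / (‖z‖ - 2 * δ)) (cocompact ℂ) (𝓝 0) := by
      refine tendsto_const_nhds.div_atTop ?_
      exact tendsto_atTop_add_const_right _ _ (tendsto_norm_cocompact_atTop)
    refine squeeze_zero' (Eventually.of_forall fun _ => norm_nonneg _) ?_ h1
    filter_upwards [tendsto_norm_cocompact_atTop.eventually_ge_atTop (K + 2 * δ + 1)] with z hz
    exact hall z hz
  exact hN.apply_eq_of_tendsto_cocompact k hlim

end ComplexTools

section Asymptotics

variable {lam L x t : ℝ} {a b : ℂ → ℂ} {Ψ : ℂ → Mat2} {qv : ℂ}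

theorem lam_mul_lam (hlam : lam = 1 ∨ lam = -1) : (lam : ℂ) * lam = 1 := by
  rcases hlam with rfl | rfl <;> simp

theorem norm_lam (hlam : lam = 1 ∨ lam = -1) : ‖(lam : ℂ)‖ = 1 := by
  rcases hlam with rfl | rfl <;> simp

theorem exp_neg_mul_exp (z : ℂ) : exp (-z) * exp z = 1 := by rw [← Complex.exp_add]; simp

theorem conj_exp_I_mul (L : ℝ) (k : ℂ) : conj (exp (I * conj k * L)) = exp (-(I * k * L)) := by
  rw [← exp_conj]; simp

theorem conj_exp_neg_I_mul (L : ℝ) (k : ℂ) :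
    conj (exp (-(I * conj k * L))) = exp (I * k * L) := by
  rw [← exp_conj]; simp

theorem conj_discr (L : ℝ) (a : ℂ → ℂ) (k : ℂ) : conj (discr L a (conj k)) = discr L a k := by
  simp only [discr, schwarz, map_add, map_mul, conj_exp_I_mul, conj_exp_neg_I_mul, conj_conj]
  ring

theorem differentiable_schwarz {f : ℂ → ℂ} (hf : Differentiable ℂ f) :
    Differentiable ℂ (schwarz f) := fun k => by
  simpa [schwarz, Function.comp_def] using! (hf (conj k)).conj_conj

/-- The pair of Bloch vectors `(g, 1)` and `(1, lam h)` at `k`, together with the values at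
`(x, t)` of the solutions that they generate. -/
structure IsBlochPair (lam L x t : ℝ) (a b : ℂ → ℂ) (Ψ : ℂ → Mat2) (qv : ℂ) (δ : ℝ)
    (k g h γ γ' d d' w w' : ℂ) : Prop where
  g_le : ‖g‖ ≤ δ
  h_le : ‖h‖ ≤ δ
  γ_le : ‖γ‖ ≤ δ
  γ'_le : ‖γ'‖ ≤ δ
  d_le : ‖d - 1‖ ≤ δ
  d'_le : ‖d' - 1‖ ≤ δ
  w_le : ‖w - 1‖ ≤ δ
  w'_le : ‖w' - 1‖ ≤ δ
  lead : ‖2 * I * k * γ - qv‖ ≤ δ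
  row1 : exp (-(I * k * L)) * a k * g - exp (-(I * k * L)) * b k = exp (I * k * L) * w * g
  row2 : -(lam * exp (I * k * L) * schwarz b k * g) + exp (I * k * L) * schwarz a k =
    exp (I * k * L) * w
  row3 : exp (-(I * k * L)) * a k - lam * exp (-(I * k * L)) * b k * h =
    exp (-(I * k * L)) * w'
  row4 : exp (I * k * L) * schwarz a k * h - exp (I * k * L) * schwarz b k =
    exp (-(I * k * L)) * w' * h
  psi1 : Ψ k 0 0 * g + Ψ k 0 1 = exp (I * theta x t k) * d * γ
  psi2 : Ψ k 1 0 * g + Ψ k 1 1 = exp (I * theta x t k) * d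
  psi3 : Ψ k 0 0 + Ψ k 0 1 * (lam * h) = exp (-(I * theta x t k)) * d'
  psi4 : Ψ k 1 0 + Ψ k 1 1 * (lam * h) = exp (-(I * theta x t k)) * d' * (lam * γ')

theorem IsSpectralData.exists_blochPair (D : IsSpectralData lam L x t a b Ψ qv)
    (hlam : lam = 1 ∨ lam = -1) : ∃ K > 0, ∃ C > 0, ∀ k ∉ disks L, K ≤ ‖k‖ →
      ∃ g h γ γ' d d' w w', IsBlochPair lam L x t a b Ψ qv (C / ‖k‖) k g h γ γ' d d' w w' := by
  obtain ⟨K, hK, C, hC, hD⟩ := D.asymp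
  refine ⟨max K 1, by positivity, 2 * C + ‖qv‖, by positivity, fun k hk hkK => ?_⟩
  have hk1 : K ≤ ‖k‖ := (le_max_left _ _).trans hkK
  have hk2 : 1 ≤ ‖k‖ := (le_max_right _ _).trans hkK
  have hkpos : 0 < ‖k‖ := by linarith
  have hk0 : k ≠ 0 := norm_pos_iff.1 hkpos
  have hll := lam_mul_lam hlam
  obtain ⟨g, γ, d, w, h1, h2, h3, h4, h5, h6, h7, h8⟩ := hD k hk hk1
  obtain ⟨g', γ', d', w', h1', h2', h3', h4', h5', h6', h7', h8'⟩ := hD (conj k)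
    (conj_notMem_disks hk) (by rwa [RCLike.norm_conj])
  rw [RCLike.norm_conj] at h1' h2' h3' h4'
  have hmono : C / ‖k‖ ≤ (2 * C + ‖qv‖) / ‖k‖ := by
    gcongr
    linarith [norm_nonneg qv]
  have hγ : ∀ γ κ : ℂ, ‖κ‖ = ‖k‖ → ‖γ - qv / (2 * I * κ)‖ ≤ C / ‖k‖ ^ 2 →
      ‖γ‖ ≤ (2 * C + ‖qv‖) / ‖k‖ := by
    intro γ κ hκ hγ
    have e1 : ‖qv / (2 * I * κ)‖ ≤ ‖qv‖ / ‖k‖ := by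
      rw [norm_div, norm_mul, norm_mul, norm_I, Complex.norm_ofNat, mul_one, hκ]
      gcongr
      linarith
    have e2 : C / ‖k‖ ^ 2 ≤ C / ‖k‖ := by
      gcongr
      nlinarith
    have e3 : γ = qv / (2 * I * κ) + (γ - qv / (2 * I * κ)) := by ring
    rw [e3]
    calc _ ≤ ‖qv‖ / ‖k‖ + C / ‖k‖ := (norm_add_le _ _).trans (add_le_add e1 (hγ.trans e2))
      _ = (C + ‖qv‖) / ‖k‖ := by ring
      _ ≤ _ := by gcongr; linarith
  have hθ : conj (exp (I * theta x t (conj k))) = exp (-(I * theta x t k)) := by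
    rw [← exp_conj]
    simp [theta, conj_ofNat]
  have c5 := congrArg conj h5'
  have c6 := congrArg conj h6'
  have c7 := congrArg conj h7'
  have c8 := congrArg conj h8'
  simp only [map_add, map_sub, map_mul, map_neg, hθ, Complex.conj_ofReal, conj_exp_I_mul,
    conj_exp_neg_I_mul] at c5 c6 c7 c8
  have s11 : conj (Ψ (conj k) 0 0) = Ψ k 1 1 := (D.sym11 k).symm
  have s10 : conj (Ψ (conj k) 0 1) = lam * Ψ k 1 0 := by
    rw [D.sym10 k]; simp only [schwarz]; linear_combination (-conj (Ψ (conj k) 0 1)) * hll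
  have s11' : conj (Ψ (conj k) 1 1) = Ψ k 0 0 := by rw [D.sym11 (conj k)]; simp [schwarz]
  have s10' : conj (Ψ (conj k) 1 0) = lam * Ψ k 0 1 := by rw [D.sym10 (conj k)]; simp [schwarz]
  rw [s11, s10] at c7
  rw [s11', s10'] at c8
  have sb : conj (schwarz b (conj k)) = b k := by simp [schwarz]
  have sa : conj (schwarz a (conj k)) = a k := by simp [schwarz]
  rw [sa, sb] at c6
  have hsub : ∀ z : ℂ, ‖conj z - 1‖ = ‖z - 1‖ := fun z => by
    rw [← RCLike.norm_conj (z - 1)]; simp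
  refine ⟨g, conj g', γ, conj γ', d, conj d', w, conj w',
    { g_le := h1.trans hmono
      h_le := by rw [RCLike.norm_conj]; exact h1'.trans hmono
      γ_le := hγ γ k rfl h2
      γ'_le := by rw [RCLike.norm_conj]; exact hγ γ' _ (RCLike.norm_conj k) h2'
      d_le := h3.trans hmono
      d'_le := by rw [hsub]; exact h3'.trans hmono
      w_le := h4.trans hmono
      w'_le := by rw [hsub]; exact h4'.trans hmono
      lead := ?_
      row1 := h5
      row2 := h6
      row3 := by linear_combination c6
      row4 := c5
      psi1 := h7
      psi2 := h8
      psi3 := by linear_combination c8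
      psi4 := by linear_combination lam * c7 - Ψ k 1 0 * hll }⟩
  have e1 : 2 * I * k * γ - qv = 2 * I * k * (γ - qv / (2 * I * k)) := by
    field_simp
  rw [e1, norm_mul, norm_mul, norm_mul, norm_I, Complex.norm_ofNat, mul_one]
  calc 2 * ‖k‖ * ‖γ - qv / (2 * I * k)‖ ≤ 2 * ‖k‖ * (C / ‖k‖ ^ 2) := by gcongr
    _ = 2 * C / ‖k‖ := by field_simp
    _ ≤ _ := by gcongr; linarith [norm_nonneg qv]

/-- The Floquet multipliers of a Bloch pair. -/
theorem IsBlochPair.multipliers {δ : ℝ} {k g h γ γ' d d' w w' : ℂ}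
    (B : IsBlochPair lam L x t a b Ψ qv δ k g h γ γ' d d' w w') (hlam : lam = 1 ∨ lam = -1)
    (hs : ∀ k, a k * schwarz a k - lam * b k * schwarz b k = 1) (hδ : δ < 1) :
    w * w' = 1 ∧ exp (I * k * L) * w + exp (-(I * k * L)) * w' = discr L a k := by
  have hn := norm_lam hlam
  have hgh : 1 - lam * g * h ≠ 0 := by
    intro h0
    have : ‖(lam : ℂ) * g * h‖ = 1 := by rw [← sub_eq_zero.1 h0, norm_one]
    rw [norm_mul, norm_mul, hn, one_mul] at this
    nlinarith [norm_nonneg g, norm_nonneg h, B.g_le, B.h_le]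
  have hee := exp_neg_mul_exp (I * k * L)
  set ep := exp (I * k * L)
  set em := exp (-(I * k * L))
  have r1 := B.row1
  have r2 := B.row2
  have r3 := B.row3
  have r4 := B.row4
  have hdet := hs k
  have htr : ep * w + em * w' = discr L a k := by
    apply mul_left_cancel₀ hgh
    rw [discr]
    linear_combination (-(1 : ℂ)) * r2 - r3 + lam * h * r1 + lam * g * r4
  refine ⟨?_, htr⟩
  apply mul_left_cancel₀ hgh
  rw [discr] at htr
  have e1 : (ep * w) * (em * w') * (1 - lam * g * h) = (1 - lam * g * h) * (em * ep) := by
    have k1 : (ep * w) * (em * w') =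
      (-(lam * ep * schwarz b k * g) + ep * schwarz a k) * (em * a k - lam * em * b k * h) := by
        rw [r2, r3]
    have k2 : (ep * w * g) * (em * w' * h) = (em * a k * g - em * b k) *
        (ep * schwarz a k * h - ep * schwarz b k) := by rw [r1, r4]
    linear_combination k1 - lam * k2 + em * ep * (1 - lam * g * h) * hdet
  linear_combination e1 + (-(w * w' * (1 - lam * g * h)) + (1 - lam * g * h)) * hee

/-- Off the disks the discriminant is close to that of the zero potential. -/
theorem IsSpectralData.exists_root (D : IsSpectralData lam L x t a b Ψ qv)
    (hlam : lam = 1 ∨ lam = -1) (hL : 0 < L) : ∃ K > 0, ∃ C > 0, ∀ k ∉ disks L, K ≤ ‖k‖ →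
      Complex.sin (k * L) ≠ 0 ∧ C / ‖k‖ ≤ 1 ∧
      ∃ g h γ γ' d d' w w', IsBlochPair lam L x t a b Ψ qv (C / ‖k‖) k g h γ γ' d d' w w' ∧
        w * w' = 1 ∧ exp (I * k * L) * w + exp (-(I * k * L)) * w' = discr L a k ∧
        (-I * (exp (I * k * L) * w - exp (-(I * k * L)) * w')) ^ 2 = 4 - discr L a k ^ 2 ∧
        ‖-I * (exp (I * k * L) * w - exp (-(I * k * L)) * w') - 2 * Complex.sin (k * L)‖ ≤
          C / ‖k‖ * ‖Complex.sin (k * L)‖ := by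
  obtain ⟨K, hK, C, hC, hB⟩ := D.exists_blochPair hlam
  refine ⟨max K (12 * C + 1), by positivity, 12 * C, by positivity, fun k hk hkK => ?_⟩
  have hk1 : K ≤ ‖k‖ := (le_max_left _ _).trans hkK
  have hk2 : 12 * C + 1 ≤ ‖k‖ := (le_max_right _ _).trans hkK
  have hkpos : 0 < ‖k‖ := by linarith
  have hsin := exp_le_sin_of_notMem_disks hL hk
  have hs0 : Complex.sin (k * L) ≠ 0 := by
    intro h0
    rw [h0, norm_zero, mul_zero] at hsin
    exact absurd hsin (not_le.2 (Real.exp_pos _))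
  have hδ1 : 12 * C / ‖k‖ ≤ 1 := by rw [div_le_one hkpos]; linarith
  obtain ⟨g, h, γ, γ', d, d', w, w', B⟩ := hB k hk hk1
  have hδ : C / ‖k‖ < 1 := by rw [div_lt_one hkpos]; linarith
  obtain ⟨m1, m2⟩ := B.multipliers hlam D.det_s hδ
  have hle : C / ‖k‖ ≤ 12 * C / ‖k‖ := by gcongr; linarith
  refine ⟨hs0, hδ1, g, h, γ, γ', d, d', w, w', { B with
      g_le := B.g_le.trans hle
      h_le := B.h_le.trans hle
      γ_le := B.γ_le.trans hle
      γ'_le := B.γ'_le.trans hle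
      d_le := B.d_le.trans hle
      d'_le := B.d'_le.trans hle
      w_le := B.w_le.trans hle
      w'_le := B.w'_le.trans hle
      lead := B.lead.trans hle }, m1, m2, ?_, ?_⟩
  · have hee := exp_neg_mul_exp (I * k * L)
    rw [← m2]
    linear_combination (exp (I * k * L) * w - exp (-(I * k * L)) * w') ^ 2 * I_sq +
      4 * w * w' * hee + 4 * m1
  · have e1 : -I * (exp (I * k * L) * w - exp (-(I * k * L)) * w') - 2 * Complex.sin (k * L) =
        -I * (exp (I * k * L) * (w - 1) - exp (-(I * k * L)) * (w' - 1)) := by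
      rw [Complex.sin, show k * L * I = I * k * L by ring, show -(k * L) * I = -(I * k * L) by ring]
      ring
    have hE : ∀ z : ℂ, |z.re| ≤ |k.im| * L → ‖exp z‖ ≤ 6 * ‖Complex.sin (k * L)‖ := by
      intro z hz
      rw [Complex.norm_exp]
      exact (Real.exp_le_exp.2 ((le_abs_self _).trans hz)).trans hsin
    have habs : |k.im * L| = |k.im| * L := by rw [abs_mul, abs_of_pos hL]
    have hE1 := hE (I * k * L) (by simp [abs_mul, abs_of_pos hL])
    have hE2 := hE (-(I * k * L)) (by simp [abs_mul, abs_of_pos hL])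
    rw [e1, norm_mul, norm_neg, norm_I, one_mul]
    calc _ ≤ 6 * ‖Complex.sin (k * L)‖ * (C / ‖k‖) + 6 * ‖Complex.sin (k * L)‖ * (C / ‖k‖) := by
          refine (norm_sub_le _ _).trans (add_le_add ?_ ?_)
          · rw [norm_mul]
            gcongr
            exact B.w_le
          · rw [norm_mul]
            gcongr
            exact B.w'_le
      _ = _ := by ring

end Asymptotics

section Zeros

variable {lam L x t : ℝ} {a b : ℂ → ℂ} {Ψ : ℂ → Mat2} {qv : ℂ}

/-- The function `4 - Δ²`. -/
def disc4 (L : ℝ) (a : ℂ → ℂ) (k : ℂ) : ℂ := 4 - discr L a k ^ 2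

/-- The properties of the discriminant `Δ` on which the structure of the branch cuts rests. -/
structure IsDiscriminant (lam L : ℝ) (a : ℂ → ℂ) : Prop where
  lam_eq : lam = 1 ∨ lam = -1
  pos : 0 < L
  diff : Differentiable ℂ (discr L a)
  asymp : ∃ K > 0, ∃ C > 0, ∀ k ∉ disks L, K ≤ ‖k‖ → Complex.sin (k * L) ≠ 0 ∧ C / ‖k‖ ≤ 1 ∧
    ∃ ρ : ℂ, ρ ^ 2 = disc4 L a k ∧
      ‖ρ - 2 * Complex.sin (k * L)‖ ≤ C / ‖k‖ * ‖Complex.sin (k * L)‖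
  defocusing : lam = 1 → ∀ k : ℂ, k.im ≠ 0 → disc4 L a k ≠ 0
  focusing : lam = -1 → ∀ k : ℂ, k.im = 0 → ‖discr L a k‖ ≤ 2

theorem IsSpectralData.isDiscriminant (D : IsSpectralData lam L x t a b Ψ qv)
    (hlam : lam = 1 ∨ lam = -1) (hL : 0 < L) : IsDiscriminant lam L a where
  lam_eq := hlam
  pos := hL
  diff := by
    have := D.diff_a
    have := differentiable_schwarz D.diff_a
    unfold discr
    fun_prop
  asymp := by
    obtain ⟨K, hK, C, hC, h⟩ := D.exists_root hlam hL
    refine ⟨K, hK, C, hC, fun k hk hkK => ?_⟩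
    obtain ⟨h1, h2, g, h', γ, γ', d, d', w, w', -, -, -, h3, h4⟩ := h k hk hkK
    exact ⟨h1, h2, _, h3, h4⟩
  defocusing h1 k hk h0 := D.gap h1 k hk (by rw [disc4] at h0; linear_combination -h0)
  focusing h1 k hk := by
    have hck : conj k = k := conj_eq_iff_im.2 hk
    have hs := D.det_s k
    simp only [h1, schwarz, hck] at hs
    rw [Complex.mul_conj, mul_assoc, Complex.mul_conj] at hs
    have hs' : Complex.normSq (a k) + Complex.normSq (b k) = 1 := by
      have := congrArg Complex.re hs
      simpa using this
    have ha : ‖a k‖ ≤ 1 := by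
      have h1 := Complex.normSq_nonneg (b k)
      have h2 := Complex.sq_norm (a k)
      nlinarith [norm_nonneg (a k)]
    have hre : ∀ z : ℂ, z.re = 0 → ‖exp z‖ = 1 := fun z hz => by rw [Complex.norm_exp, hz, Real.exp_zero]
    rw [discr, schwarz, hck]
    calc _ ≤ ‖a k‖ * 1 + ‖a k‖ * 1 := by
          refine (norm_add_le _ _).trans (add_le_add ?_ ?_)
          · rw [norm_mul, hre _ (by simp [hk])]
          · rw [norm_mul, hre _ (by simp [hk]), RCLike.norm_conj]
      _ ≤ 2 := by linarith

theorem conj_disc4 (L : ℝ) (a : ℂ → ℂ) (k : ℂ) : conj (disc4 L a (conj k)) = disc4 L a k := by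
  simp [disc4, conj_discr, conj_ofNat]

theorem norm_im_le_of_mem_disks {L : ℝ} {k : ℂ} (hk : k ∈ disks L) : |k.im| < Real.pi / (4 * L) := by
  obtain ⟨n, hn⟩ := mem_iUnion.1 hk
  rw [mem_ball, dist_eq_norm] at hn
  have := abs_im_le_norm (k - (((n : ℝ) * Real.pi / L : ℝ) : ℂ))
  rw [sub_im, ofReal_im, sub_zero] at this
  linarith

variable (H : IsDiscriminant lam L a)
include H

theorem IsDiscriminant.differentiable_disc4 : Differentiable ℂ (disc4 L a) := by
  have := H.diff
  unfold disc4
  fun_prop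

theorem IsDiscriminant.analyticAt (k : ℂ) : AnalyticAt ℂ (disc4 L a) k :=
  H.differentiable_disc4.analyticAt k

/-- `4 - Δ²` has no zeros far away off the disks. -/
theorem IsDiscriminant.exists_ne_zero :
    ∃ K > 0, ∀ k ∉ disks L, K ≤ ‖k‖ → disc4 L a k ≠ 0 := by
  obtain ⟨K, hK, C, hC, h⟩ := H.asymp
  refine ⟨K, hK, fun k hk hkK h0 => ?_⟩
  obtain ⟨h1, h2, ρ, h3, h4⟩ := h k hk hkK
  rw [h0] at h3
  have hρ : ρ = 0 := by simpa using h3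
  rw [hρ, zero_sub, norm_neg, norm_mul, Complex.norm_ofNat] at h4
  have := norm_pos_iff.2 h1
  nlinarith

theorem IsDiscriminant.exists_im_bound :
    ∃ Y > 0, ∀ k, disc4 L a k = 0 → |k.im| < Y := by
  obtain ⟨K, hK, h⟩ := H.exists_ne_zero
  have hπ := Real.pi_pos
  have := H.pos
  refine ⟨K + Real.pi / (4 * L), by positivity, fun k h0 => ?_⟩
  by_cases hd : k ∈ disks L
  · have := norm_im_le_of_mem_disks hd
    linarith
  · have h1 : ‖k‖ < K := by
      by_contra hc
      exact h k hd (not_lt.1 hc) h0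
    have h2 := abs_im_le_norm k
    have : 0 < Real.pi / (4 * L) := by positivity
    linarith

theorem IsDiscriminant.order_ne_top (k : ℂ) : analyticOrderAt (disc4 L a) k ≠ ⊤ := by
  obtain ⟨Y, hY, h⟩ := H.exists_im_bound
  have hAn : AnalyticOnNhd ℂ (disc4 L a) univ := fun z _ => H.analyticAt z
  refine AnalyticOnNhd.analyticOrderAt_ne_top_of_isPreconnected hAn isPreconnected_univ
    (x := (Y : ℂ) * I) (mem_univ _) (mem_univ _) ?_
  have : disc4 L a (Y * I) ≠ 0 := fun h0 => by
    have := h _ h0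
    simp [abs_of_pos hY] at this
  rw [(H.analyticAt _).analyticOrderAt_eq_zero.2 this]
  simp

theorem IsDiscriminant.finite_zeros_of_isCompact {s : Set ℂ} (hs : IsCompact s) :
    {k | disc4 L a k = 0 ∧ k ∈ s}.Finite := by
  refine hs.induction_on (p := fun s => {k | disc4 L a k = 0 ∧ k ∈ s}.Finite) (by simp)
    (fun s t hst ht => ht.subset fun k hk => ⟨hk.1, hst hk.2⟩)
    (fun s t hs ht => (hs.union ht).subset fun k hk => ?_) fun z _ => ?_
  · exact hk.2.imp (fun h => ⟨hk.1, h⟩) fun h => ⟨hk.1, h⟩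
  · rcases (H.analyticAt z).eventually_eq_zero_or_eventually_ne_zero with h | h
    · exact absurd (analyticOrderAt_eq_top.2 h) (H.order_ne_top z)
    · refine ⟨insert z {w | disc4 L a w ≠ 0}, mem_nhdsWithin_of_mem_nhds
        (insert_mem_nhds_iff.2 h), (finite_singleton z).subset fun w hw => ?_⟩
      exact hw.2.resolve_right fun h => h hw.1

theorem IsDiscriminant.finite_zeros_strip (X : ℝ) :
    {k | disc4 L a k = 0 ∧ |k.re| ≤ X}.Finite := by
  obtain ⟨Y, hY, h⟩ := H.exists_im_bound
  refine (H.finite_zeros_of_isCompact ((isCompact_Icc (a := -X) (b := X)).reProdIm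
    (isCompact_Icc (a := -Y) (b := Y)))).subset fun k hk => ⟨hk.1, ?_, ?_⟩
  · exact abs_le.1 hk.2
  · exact abs_le.1 (h k hk.1).le

/-- The zeros of `4 - Δ²` and their real parts are locally finite. -/
theorem IsDiscriminant.exists_isolating (k0 : ℂ) : ∃ ε > 0, ∀ k, disc4 L a k = 0 →
    (|k.re - k0.re| < ε → k.re = k0.re) ∧ (dist k k0 < ε → k = k0) := by
  have hfin := H.finite_zeros_strip (|k0.re| + 1)
  set F := {k | disc4 L a k = 0 ∧ |k.re| ≤ |k0.re| + 1}
  have h1 : (F \ {k0})ᶜ ∈ 𝓝 k0 := (hfin.sdiff.isClosed.isOpen_compl).mem_nhds (by simp)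
  have h2 : ((Complex.re '' F) \ {k0.re})ᶜ ∈ 𝓝 k0.re :=
    ((hfin.image _).sdiff.isClosed.isOpen_compl).mem_nhds (by simp)
  obtain ⟨ε1, hε1, h1⟩ := Metric.mem_nhds_iff.1 h1
  obtain ⟨ε2, hε2, h2⟩ := Metric.mem_nhds_iff.1 h2
  refine ⟨min 1 (min ε1 ε2), by positivity, fun k hk => ⟨fun hd => ?_, fun hd => ?_⟩⟩
  · by_contra hne
    have hF : k ∈ F := by
      refine ⟨hk, ?_⟩
      have h3 : |k.re - k0.re| < 1 := hd.trans_le (min_le_left _ _)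
      have h4 := abs_sub_abs_le_abs_sub k.re k0.re
      linarith
    refine h2 (show k.re ∈ ball k0.re ε2 from ?_) ⟨⟨k, hF, rfl⟩, hne⟩
    rw [mem_ball, Real.dist_eq]
    exact hd.trans_le ((min_le_right _ _).trans (min_le_right _ _))
  · by_contra hne
    have h5 : |k.re - k0.re| ≤ dist k k0 := by
      rw [dist_eq_norm, ← sub_re]; exact abs_re_le_norm _
    have hF : k ∈ F := by
      refine ⟨hk, ?_⟩
      have h3 : |k.re - k0.re| < 1 := h5.trans_lt (hd.trans_le (min_le_left _ _))
      have h4 := abs_sub_abs_le_abs_sub k.re k0.re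
      linarith
    exact h1 (show k ∈ ball k0 ε1 from
      hd.trans_le ((min_le_right _ _).trans (min_le_left _ _))) ⟨hF, hne⟩

end Zeros

section Cuts

variable {lam L : ℝ} {a : ℂ → ℂ}

theorem analyticOrderAt_conj {f : ℂ → ℂ} (hf : Differentiable ℂ f)
    (hc : ∀ k, conj (f (conj k)) = f k) (k : ℂ) :
    analyticOrderAt f (conj k) = analyticOrderAt f k := by
  have key : ∀ k : ℂ, ∀ n : ℕ, analyticOrderAt f k = n → analyticOrderAt f (conj k) = n := by
    intro k n hn
    obtain ⟨g, hg, hg0, hfg⟩ := (hf.analyticAt k).analyticOrderAt_eq_natCast.1 hn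
    refine (hf.analyticAt _).analyticOrderAt_eq_natCast.2 ⟨schwarz g, ?_, ?_, ?_⟩
    · rw [analyticAt_iff_eventually_differentiableAt] at hg ⊢
      have hcont : Tendsto (fun z : ℂ => conj z) (𝓝 (conj k)) (𝓝 k) := by
        have := (continuous_conj.tendsto (conj k))
        simpa using this
      filter_upwards [hcont.eventually hg] with z hz
      have := hz.conj_conj
      simpa [schwarz, Function.comp_def] using! this
    · simpa [schwarz] using hg0
    · have hcont : Tendsto (fun z : ℂ => conj z) (𝓝 (conj k)) (𝓝 k) := by
        have := (continuous_conj.tendsto (conj k))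
        simpa using this
      filter_upwards [hcont.eventually hfg] with z hz
      rw [← hc z, hz]
      simp [schwarz]
  rcases eq_or_ne (analyticOrderAt f k) ⊤ with h | h
  · rw [h]
    by_contra hne
    obtain ⟨n, hn⟩ := ENat.ne_top_iff_exists.1 hne
    have := key _ n hn.symm
    rw [conj_conj, h] at this
    simp at this
  · obtain ⟨n, hn⟩ := ENat.ne_top_iff_exists.1 h
    rw [← hn]
    exact key k n hn.symm

/-- The points of `oddZeros` on the vertical line through `k`, strictly below `k`. -/
def below (L : ℝ) (a : ℂ → ℂ) (k : ℂ) : Set ℂ := {u | u ∈ oddZeros L a ∧ u.re = k.re ∧ u.im < k.im}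

/-- The points of `oddZeros` on the vertical line through `k`, strictly above `k`. -/
def above (L : ℝ) (a : ℂ → ℂ) (k : ℂ) : Set ℂ := {u | u ∈ oddZeros L a ∧ u.re = k.re ∧ k.im < u.im}

theorem disc4_eq_zero_of_mem_oddZeros {k : ℂ} (hk : k ∈ oddZeros L a) : disc4 L a k = 0 := by
  obtain ⟨-, n, hn, h⟩ := hk
  apply apply_eq_zero_of_analyticOrderAt_ne_zero
  change analyticOrderAt (fun z => 4 - discr L a z ^ 2) k ≠ 0
  rw [h]
  rcases hn with ⟨m, rfl⟩
  simp

variable (H : IsDiscriminant lam L a)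
include H

theorem IsDiscriminant.conj_mem_oddZeros {k : ℂ} (hk : k ∈ oddZeros L a) :
    conj k ∈ oddZeros L a := by
  obtain ⟨h1, n, hn, h⟩ := hk
  refine ⟨by simpa using h1, n, hn, ?_⟩
  rw [← h]
  exact analyticOrderAt_conj H.differentiable_disc4 (conj_disc4 L a) k

theorem IsDiscriminant.finite_line (x0 : ℝ) : {u | u ∈ oddZeros L a ∧ u.re = x0}.Finite :=
  (H.finite_zeros_strip |x0|).subset fun u hu =>
    ⟨disc4_eq_zero_of_mem_oddZeros hu.1, by rw [hu.2]⟩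

theorem IsDiscriminant.finite_below (k : ℂ) : (below L a k).Finite :=
  (H.finite_line k.re).subset fun _ hu => ⟨hu.1, hu.2.1⟩

theorem IsDiscriminant.finite_above (k : ℂ) : (above L a k).Finite :=
  (H.finite_line k.re).subset fun _ hu => ⟨hu.1, hu.2.1⟩

theorem IsDiscriminant.ncard_above_conj (k : ℂ) :
    (above L a (conj k)).ncard = (below L a k).ncard := by
  have : above L a (conj k) = (fun z : ℂ => conj z) '' below L a k := by
    ext u
    constructor
    · rintro ⟨h1, h2, h3⟩
      refine ⟨conj u, ⟨H.conj_mem_oddZeros h1, by simpa using h2, ?_⟩, by simp⟩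
      simp only [conj_im] at h3 ⊢
      linarith
    · rintro ⟨v, ⟨h1, h2, h3⟩, rfl⟩
      refine ⟨H.conj_mem_oddZeros h1, by simpa using h2, ?_⟩
      simp only [conj_im]
      linarith
  rw [this]
  exact ncard_image_of_injective _ (starRingEnd ℂ).injective

theorem IsDiscriminant.even_line (x0 : ℝ) : Even ({u | u ∈ oddZeros L a ∧ u.re = x0}).ncard := by
  have hr : ((x0 : ℂ)).im = 0 := by simp
  have : {u | u ∈ oddZeros L a ∧ u.re = x0} = below L a x0 ∪ above L a x0 := by
    ext u
    constructor
    · rintro ⟨h1, h2⟩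
      rcases lt_or_gt_of_ne h1.1 with h | h
      · exact Or.inl ⟨h1, h2, by simpa using h⟩
      · exact Or.inr ⟨h1, h2, by simpa using h⟩
    · rintro (⟨h1, h2, -⟩ | ⟨h1, h2, -⟩) <;> exact ⟨h1, h2⟩
  rw [this, ncard_union_eq _ (H.finite_below _) (H.finite_above _), ← H.ncard_above_conj]
  · simp
  · rw [Set.disjoint_left]
    rintro u ⟨-, -, h⟩ ⟨-, -, h'⟩
    linarith

theorem IsDiscriminant.even_add {k : ℂ} (hk : k ∉ oddZeros L a) :
    Even ((below L a k).ncard + (above L a k).ncard) := by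
  have : {u | u ∈ oddZeros L a ∧ u.re = k.re} = below L a k ∪ above L a k := by
    ext u
    constructor
    · rintro ⟨h1, h2⟩
      rcases lt_trichotomy u.im k.im with h | h | h
      · exact Or.inl ⟨h1, h2, h⟩
      · exact absurd (Complex.ext h2 h ▸ h1) hk
      · exact Or.inr ⟨h1, h2, h⟩
    · rintro (⟨h1, h2, -⟩ | ⟨h1, h2, -⟩) <;> exact ⟨h1, h2⟩
  have h2 := H.even_line k.re
  rwa [this, ncard_union_eq _ (H.finite_below _) (H.finite_above _)] at h2
  rw [Set.disjoint_left]
  rintro u ⟨-, -, h⟩ ⟨-, -, h'⟩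
  linarith

theorem IsDiscriminant.odd_add {k : ℂ} (hk : k ∈ oddZeros L a) :
    Odd ((below L a k).ncard + (above L a k).ncard) := by
  have : {u | u ∈ oddZeros L a ∧ u.re = k.re} = insert k (below L a k ∪ above L a k) := by
    ext u
    constructor
    · rintro ⟨h1, h2⟩
      rcases lt_trichotomy u.im k.im with h | h | h
      · exact Or.inr (Or.inl ⟨h1, h2, h⟩)
      · exact Or.inl (Complex.ext h2 h)
      · exact Or.inr (Or.inr ⟨h1, h2, h⟩)
    · rintro (rfl | ⟨h1, h2, -⟩ | ⟨h1, h2, -⟩)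
      exacts [⟨hk, rfl⟩, ⟨h1, h2⟩, ⟨h1, h2⟩]
  have h2 := H.even_line k.re
  rw [this, ncard_insert_of_notMem _ ((H.finite_below _).union (H.finite_above _)),
    ncard_union_eq _ (H.finite_below _) (H.finite_above _)] at h2
  · rcases Nat.even_or_odd ((below L a k).ncard + (above L a k).ncard) with h | h
    · exact absurd h2 (Nat.not_even_iff_odd.2 h.add_one)
    · exact h
  · rw [Set.disjoint_left]
    rintro u ⟨-, -, h⟩ ⟨-, -, h'⟩
    linarith
  · rintro (⟨-, -, h⟩ | ⟨-, -, h⟩) <;> exact lt_irrefl _ h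

theorem IsDiscriminant.ncard_below_succ {z w : ℂ} (hz : z ∈ oddZeros L a) (hre : z.re = w.re)
    (him : z.im < w.im) (hb : ∀ u ∈ oddZeros L a, u.re = z.re → ¬(z.im < u.im ∧ u.im < w.im)) :
    (below L a w).ncard = (below L a z).ncard + 1 := by
  have : below L a w = insert z (below L a z) := by
    ext u
    constructor
    · rintro ⟨h1, h2, h3⟩
      rcases lt_trichotomy u.im z.im with h | h | h
      · exact Or.inr ⟨h1, h2.trans hre.symm, h⟩
      · exact Or.inl (Complex.ext (h2.trans hre.symm) h)
      · exact absurd ⟨h, h3⟩ (hb u h1 (h2.trans hre.symm))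
    · rintro (rfl | ⟨h1, h2, h3⟩)
      · exact ⟨hz, hre, him⟩
      · exact ⟨h1, h2.trans hre, h3.trans him⟩
  rw [this, ncard_insert_of_notMem _ (H.finite_below _)]
  rintro ⟨-, -, h⟩
  exact lt_irrefl _ h

/-- The highest point of `oddZeros` below `k`. -/
theorem IsDiscriminant.exists_pred {k : ℂ} (hne : (below L a k).Nonempty) :
    ∃ z ∈ oddZeros L a, z.re = k.re ∧ z.im < k.im ∧
      (∀ u ∈ oddZeros L a, u.re = z.re → ¬(z.im < u.im ∧ u.im < k.im)) := by
  obtain ⟨z, hz, hmax⟩ := Set.exists_max_image _ Complex.im (H.finite_below k) hne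
  refine ⟨z, hz.1, hz.2.1, hz.2.2, fun u hu hur h => ?_⟩
  have := hmax u ⟨hu, hur.trans hz.2.1, h.2⟩
  linarith [h.1]

theorem IsDiscriminant.exists_succ {k : ℂ} (hne : (above L a k).Nonempty) :
    ∃ z ∈ oddZeros L a, z.re = k.re ∧ k.im < z.im ∧
      (∀ u ∈ oddZeros L a, u.re = k.re → ¬(k.im < u.im ∧ u.im < z.im)) := by
  obtain ⟨z, hz, hmin⟩ := Set.exists_min_image _ Complex.im (H.finite_above k) hne
  refine ⟨z, hz.1, hz.2.1, hz.2.2, fun u hu hur h => ?_⟩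
  have := hmin u ⟨hu, hur, h.1⟩
  linarith [h.2]

omit H in
theorem mem_openSegment_vertical {z w k : ℂ} (hre : z.re = w.re) (him : z.im < w.im) :
    k ∈ openSegment ℝ z w ↔ k.re = z.re ∧ z.im < k.im ∧ k.im < w.im := by
  constructor
  · rintro ⟨s, r, hs, hr, hsr, rfl⟩
    have e : s = 1 - r := by linarith
    subst e
    simp only [add_re, add_im, Complex.real_smul, re_ofReal_mul,
      im_ofReal_mul, ← hre]
    refine ⟨by ring, by nlinarith, by nlinarith⟩
  · rintro ⟨h1, h2, h3⟩
    have hd : 0 < w.im - z.im := by linarith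
    refine ⟨(w.im - k.im) / (w.im - z.im), (k.im - z.im) / (w.im - z.im),
      div_pos (by linarith) hd, div_pos (by linarith) hd, by field_simp; ring, ?_⟩
    apply Complex.ext
    · simp only [add_re, Complex.real_smul, re_ofReal_mul, ← hre, h1]
      field_simp; ring
    · simp only [add_im, Complex.real_smul, im_ofReal_mul]
      field_simp; ring

theorem IsDiscriminant.mem_verticalCuts_iff (k : ℂ) :
    k ∈ verticalCuts L a ↔ k ∉ oddZeros L a ∧ Odd (below L a k).ncard := by
  constructor
  · rintro ⟨z, w, ⟨hz, hw, hre, him, hb, he⟩, hk⟩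
    rw [mem_openSegment_vertical hre him] at hk
    refine ⟨fun h => hb k h hk.1 hk.2, ?_⟩
    rw [H.ncard_below_succ hz hk.1.symm hk.2.1 fun u hu hur h => hb u hu hur ⟨h.1, h.2.trans hk.2.2⟩]
    exact Even.add_one he
  · rintro ⟨hk, hodd⟩
    have hne : (below L a k).Nonempty := by
      rw [nonempty_iff_ne_empty]; intro h; simp [h] at hodd
    obtain ⟨z, hz, hzre, hzim, hzb⟩ := H.exists_pred hne
    have hodd' : Odd (above L a k).ncard := by
      have := H.even_add hk
      rcases Nat.even_or_odd (above L a k).ncard with h | h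
      · exact absurd this (Nat.not_even_iff_odd.2 (hodd.add_even h))
      · exact h
    have hne' : (above L a k).Nonempty := by
      rw [nonempty_iff_ne_empty]; intro h; simp [h] at hodd'
    obtain ⟨w, hw, hwre, hwim, hwb⟩ := H.exists_succ hne'
    refine ⟨z, w, ⟨hz, hw, hzre.trans hwre.symm, hzim.trans hwim, ?_, ?_⟩, ?_⟩
    · rintro u hu hur ⟨h1, h2⟩
      rcases lt_trichotomy u.im k.im with h | h | h
      · exact hzb u hu hur ⟨h1, h⟩
      · exact hk (Complex.ext (hur.trans hzre) h ▸ hu)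
      · exact hwb u hu (hur.trans hzre) ⟨h, h2⟩
    · rw [H.ncard_below_succ hz hzre hzim hzb] at hodd
      rcases Nat.even_or_odd (below L a z).ncard with h | h
      · exact h
      · exact absurd hodd (Nat.not_odd_iff_even.2 h.add_one)
    · rw [mem_openSegment_vertical (hzre.trans hwre.symm) (hzim.trans hwim)]
      exact ⟨hzre.symm, hzim, hwim⟩

theorem IsDiscriminant.oddZeros_subset_closure :
    oddZeros L a ⊆ closure (verticalCuts L a) := by
  intro k hk
  have hsub : ∀ z w, IsCutPair L a z w → segment ℝ z w ⊆ closure (verticalCuts L a) := by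
    intro z w h
    exact segment_subset_closure_openSegment.trans (closure_mono fun u hu => ⟨z, w, h, hu⟩)
  have hodd := H.odd_add hk
  rcases Nat.even_or_odd (below L a k).ncard with he | ho
  · have hne : (above L a k).Nonempty := by
      rw [nonempty_iff_ne_empty]; intro h
      rw [h, ncard_empty, add_zero] at hodd
      exact Nat.not_odd_iff_even.2 he hodd
    obtain ⟨w, hw, hwre, hwim, hwb⟩ := H.exists_succ hne
    exact hsub k w ⟨hk, hw, hwre.symm, hwim, hwb, he⟩ (left_mem_segment ℝ k w)
  · have hne : (below L a k).Nonempty := by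
      rw [nonempty_iff_ne_empty]; intro h; simp [h] at ho
    obtain ⟨z, hz, hzre, hzim, hzb⟩ := H.exists_pred hne
    refine hsub z k ⟨hz, hk, hzre, hzim, hzb, ?_⟩ (right_mem_segment ℝ z k)
    rw [H.ncard_below_succ hz hzre hzim hzb] at ho
    rcases Nat.even_or_odd (below L a z).ncard with h | h
    · exact h
    · exact absurd ho (Nat.not_odd_iff_even.2 h.add_one)

theorem IsDiscriminant.verticalCuts_local (k0 : ℂ) : ∃ ε > 0, ∀ k ∈ ball k0 ε,
    (k.re ≠ k0.re → k ∉ verticalCuts L a) ∧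
    (k.re = k0.re → k0 ∉ oddZeros L a → (k ∈ verticalCuts L a ↔ k0 ∈ verticalCuts L a)) := by
  obtain ⟨ε, hε, h⟩ := H.exists_isolating k0
  refine ⟨ε, hε, fun k hk => ⟨fun hre hcut => ?_, fun hre hk0 => ?_⟩⟩
  · rw [H.mem_verticalCuts_iff] at hcut
    have hne : (below L a k).Nonempty := by
      rw [nonempty_iff_ne_empty]; intro h; simp [h] at hcut
    obtain ⟨u, hu, hur, -⟩ := hne
    apply hre
    rw [← hur]
    refine (h u (disc4_eq_zero_of_mem_oddZeros hu)).1 ?_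
    rw [hur]
    refine lt_of_le_of_lt ?_ (mem_ball.1 hk)
    rw [dist_eq_norm, ← sub_re]
    exact abs_re_le_norm _
  · have hno : ∀ u ∈ oddZeros L a, u.re = k0.re → |u.im - k0.im| ≤ |k.im - k0.im| → False := by
      intro u hu hur hui
      apply hk0
      rw [← (h u (disc4_eq_zero_of_mem_oddZeros hu)).2 ?_]
      · exact hu
      · rw [mem_ball, Complex.dist_of_re_eq hre, Real.dist_eq] at hk
        rw [Complex.dist_of_re_eq hur, Real.dist_eq]
        linarith
    have hkn : k ∉ oddZeros L a := fun hk' => hno k hk' hre le_rfl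
    have hb : below L a k = below L a k0 := by
      ext u
      constructor
      · rintro ⟨h1, h2, h3⟩
        refine ⟨h1, h2.trans hre, ?_⟩
        by_contra hc
        refine hno u h1 (h2.trans hre) ?_
        rw [abs_of_nonneg (by linarith), abs_of_nonneg (by linarith)]
        linarith
      · rintro ⟨h1, h2, h3⟩
        refine ⟨h1, h2.trans hre.symm, ?_⟩
        by_contra hc
        refine hno u h1 h2 ?_
        rw [abs_of_nonpos (by linarith), abs_of_nonpos (by linarith)]
        linarith
    rw [H.mem_verticalCuts_iff, H.mem_verticalCuts_iff, hb]
    simp [hkn, hk0]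

theorem IsDiscriminant.closure_verticalCuts_subset :
    closure (verticalCuts L a) ⊆ verticalCuts L a ∪ oddZeros L a := by
  intro k0 hk0
  by_contra hc
  simp only [mem_union, not_or] at hc
  obtain ⟨ε, hε, h⟩ := H.verticalCuts_local k0
  obtain ⟨k, hk, hkd⟩ := Metric.mem_closure_iff.1 hk0 ε hε
  have hkb : k ∈ ball k0 ε := by rwa [mem_ball, dist_comm]
  by_cases hre : k.re = k0.re
  · exact hc.1 (((h k hkb).2 hre hc.2).1 hk)
  · exact (h k hkb).1 hre hk

theorem IsDiscriminant.conj_mem_verticalCuts {k : ℂ} (hk : k ∈ verticalCuts L a) :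
    conj k ∈ verticalCuts L a := by
  rw [H.mem_verticalCuts_iff] at hk ⊢
  have h1 : conj k ∉ oddZeros L a := fun h => hk.1 (by simpa using H.conj_mem_oddZeros h)
  refine ⟨h1, ?_⟩
  have h2 := H.even_add h1
  rw [H.ncard_above_conj] at h2
  rcases Nat.even_or_odd (below L a (conj k)).ncard with h | h
  · exact absurd h2 (Nat.not_even_iff_odd.2 (h.add_odd hk.2))
  · exact h

end Cuts

section Contour

variable {lam L : ℝ} {a : ℂ → ℂ}

theorem leftNormal_cases (k : ℂ) :
    leftNormal k = 1 ∨ leftNormal k = -1 ∨ leftNormal k = I ∨ leftNormal k = -I := by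
  unfold leftNormal
  split_ifs <;> simp

theorem leftNormal_of_im_ne {k : ℂ} (hk : k.im ≠ 0) : leftNormal k = 1 ∨ leftNormal k = -1 := by
  unfold leftNormal
  rcases lt_or_gt_of_ne hk with h | h
  · simp [h, not_lt.2 h.le]
  · simp [h]

theorem leftNormal_of_im_eq {k : ℂ} (hk : k.im = 0) : leftNormal k = I ∨ leftNormal k = -I := by
  unfold leftNormal
  simp only [hk, lt_irrefl, if_false]
  split_ifs <;> simp

theorem leftNormal_line_iff (k z : ℂ) : ((z - k) * conj (leftNormal k)).re = 0 ↔
    if k.im = 0 then z.im = 0 else z.re = k.re := by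
  split_ifs with h
  · rcases leftNormal_of_im_eq h with h' | h' <;> simp [h', h]
  · rcases leftNormal_of_im_ne h with h' | h' <;> simp [h', sub_eq_zero, eq_comm]

theorem not_mem_gaps_focusing (H : IsDiscriminant (-1) L a) (k : ℂ) : k ∉ spectralGaps L a :=
  fun h => absurd (H.focusing rfl k h.1) (not_le.2 h.2)

theorem cuts_one (L : ℝ) (a : ℂ → ℂ) : cuts 1 L a = spectralGaps L a := by
  ext k
  simp only [cuts, mem_ofPred_eq, or_iff_left_iff_imp]
  rintro ⟨h, -⟩
  norm_num at h

theorem IsDiscriminant.cuts_neg_one (H : IsDiscriminant (-1) L a) :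
    cuts (-1) L a = verticalCuts L a := by
  ext k
  simp [cuts, not_mem_gaps_focusing H]

variable (H : IsDiscriminant lam L a)
include H

theorem IsDiscriminant.continuous : Continuous (discr L a) := H.diff.continuous

omit H in
/-- `Δ` is real on the real axis. -/
theorem discr_im_eq_zero (L : ℝ) (a : ℂ → ℂ) {k : ℂ} (hk : k.im = 0) : (discr L a k).im = 0 := by
  have h := conj_discr L a k
  rw [conj_eq_iff_im.2 hk] at h
  exact conj_eq_iff_im.1 h

omit H in
theorem disc4_of_real (L : ℝ) (a : ℂ → ℂ) {k : ℂ} (hk : k.im = 0) :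
    disc4 L a k = ((4 - ‖discr L a k‖ ^ 2 : ℝ) : ℂ) := by
  have h := discr_im_eq_zero L a hk
  rw [disc4, Complex.sq_norm, normSq_apply, h]
  apply Complex.ext <;> simp [sq, h]

theorem IsDiscriminant.closure_gaps_subset {k : ℂ} (hk : k ∈ closure (spectralGaps L a)) :
    k.im = 0 ∧ 2 ≤ ‖discr L a k‖ := by
  have hcl : IsClosed {k : ℂ | k.im = 0 ∧ 2 ≤ ‖discr L a k‖} :=
    (isClosed_eq continuous_im continuous_const).inter
      (isClosed_le continuous_const H.continuous.norm)
  have hsub : spectralGaps L a ⊆ {k : ℂ | k.im = 0 ∧ 2 ≤ ‖discr L a k‖} :=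
    fun k hk => ⟨hk.1, hk.2.le⟩
  exact closure_minimal hsub hcl hk

theorem IsDiscriminant.mem_closure_cuts {k : ℂ} (hk : k ∈ closure (cuts lam L a)) :
    k ∈ cuts lam L a ∨ disc4 L a k = 0 := by
  rcases H.lam_eq with rfl | rfl
  · rw [cuts_one] at hk ⊢
    obtain ⟨h1, h2⟩ := H.closure_gaps_subset hk
    rcases h2.eq_or_lt with h | h
    · right
      rw [disc4_of_real L a h1, ← h]
      norm_num
    · exact Or.inl ⟨h1, h⟩
  · rw [H.cuts_neg_one] at hk ⊢
    exact (H.closure_verticalCuts_subset hk).imp_right disc4_eq_zero_of_mem_oddZeros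

theorem IsDiscriminant.conj_mem_cuts {k : ℂ} (hk : k ∈ cuts lam L a) : conj k ∈ cuts lam L a := by
  rcases hk with hk | ⟨h, hk⟩
  · left
    rwa [conj_eq_iff_im.2 hk.1]
  · exact Or.inr ⟨h, H.conj_mem_verticalCuts hk⟩

theorem IsDiscriminant.conj_mem_closure_cuts {k : ℂ} :
    conj k ∈ closure (cuts lam L a) ↔ k ∈ closure (cuts lam L a) := by
  have : ∀ k, k ∈ closure (cuts lam L a) → conj k ∈ closure (cuts lam L a) := fun k hk =>
    map_mem_closure continuous_conj hk fun z hz => H.conj_mem_cuts hz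
  exact ⟨fun h => by simpa using this _ h, this k⟩

/-- Near a cut point that is not a self-intersection the cuts form a straight line. -/
theorem IsDiscriminant.cuts_local {k0 : ℂ} (hk0 : k0 ∈ cuts lam L a)
    (hs : k0 ∉ selfIntersections lam L a) : ∃ ε > 0, ∀ k ∈ ball k0 ε,
      (k ∈ cuts lam L a ↔ ((k - k0) * conj (leftNormal k0)).re = 0) := by
  rcases H.lam_eq with rfl | rfl
  · rw [cuts_one] at hk0 ⊢
    have hnear : ∀ᶠ k in 𝓝 k0, 2 < ‖discr L a k‖ :=
      H.continuous.norm.continuousAt.eventually (lt_mem_nhds hk0.2)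
    obtain ⟨ε, hε, h⟩ := eventually_nhds_iff_ball.1 hnear
    refine ⟨ε, hε, fun k hk => ?_⟩
    rw [leftNormal_line_iff, if_pos hk0.1]
    exact ⟨fun h' => h'.1, fun h' => ⟨h', h k hk⟩⟩
  · rw [H.cuts_neg_one] at hk0 ⊢
    have him : k0.im ≠ 0 := fun h => hs (Or.inr ⟨rfl, hk0, h⟩)
    obtain ⟨ε, hε, h⟩ := H.verticalCuts_local k0
    refine ⟨ε, hε, fun k hk => ?_⟩
    rw [leftNormal_line_iff, if_neg him]
    constructor
    · intro hc
      by_contra hre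
      exact (h k hk).1 hre hc
    · intro hre
      exact ((h k hk).2 hre ((H.mem_verticalCuts_iff k0).1 hk0).1).2 hk0

theorem IsDiscriminant.re_of_mem_closure_cuts {k : ℂ} (hk : k ∈ closure (cuts lam L a)) :
    k.im = 0 ∨ ∃ z, disc4 L a z = 0 ∧ z.re = k.re := by
  rcases H.lam_eq with rfl | rfl
  · rw [cuts_one] at hk
    exact Or.inl (H.closure_gaps_subset hk).1
  · right
    rcases H.mem_closure_cuts hk with hk | hk
    · rw [H.cuts_neg_one] at hk
      obtain ⟨z, w, ⟨hz, hw, hre, him, -⟩, hk⟩ := hk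
      rw [mem_openSegment_vertical hre him] at hk
      exact ⟨z, disc4_eq_zero_of_mem_oddZeros hz, hk.1.symm⟩
    · exact ⟨k, hk, rfl⟩

omit H in
theorem center_eq_of_re_eq (hL : 0 < L) {z w : ℂ} (hre : z.re = w.re) {n m : ℤ}
    (hz : z ∈ ball (((n : ℝ) * Real.pi / L : ℝ) : ℂ) (Real.pi / (4 * L)))
    (hw : w ∈ ball (((m : ℝ) * Real.pi / L : ℝ) : ℂ) (Real.pi / (4 * L))) : n = m := by
  rw [mem_ball, dist_eq_norm] at hz hw
  have h1 := (abs_re_le_norm _).trans_lt hz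
  have h2 := (abs_re_le_norm _).trans_lt hw
  rw [sub_re, ofReal_re] at h1 h2
  rw [hre] at h1
  have hπ := Real.pi_pos
  have e : (n : ℝ) * Real.pi / L - m * Real.pi / L = ((n - m : ℤ) : ℝ) * (Real.pi / L) := by
    push_cast; ring
  have h3 : |((n - m : ℤ) : ℝ)| * (Real.pi / L) < 1 * (Real.pi / L) := by
    rw [← abs_of_pos (div_pos hπ hL), ← abs_mul, ← e, one_mul]
    have e1 : Real.pi / L = 4 * (Real.pi / (4 * L)) := by field_simp
    have h4 : 0 < Real.pi / (4 * L) := by positivity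
    rw [abs_of_pos (div_pos hπ hL), e1]
    rw [abs_lt] at h1 h2 ⊢
    constructor <;> linarith
  have h5 := lt_of_mul_lt_mul_right h3 (div_pos hπ hL).le
  rw [← Int.cast_abs] at h5
  have h6 : |n - m| < 1 := by exact_mod_cast h5
  have h7 := Int.abs_lt_one_iff.1 h6
  linarith

/-- Far away, the closure of the cuts is contained in the disks. -/
theorem IsDiscriminant.exists_notMem_closure :
    ∃ K > 0, ∀ k ∉ disks L, K ≤ ‖k‖ → k ∉ closure (cuts lam L a) := by
  have hL := H.pos
  rcases H.lam_eq with rfl | rfl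
  · obtain ⟨K, hK, C, hC, h⟩ := H.asymp
    refine ⟨K, hK, fun k hk hkK hcut => ?_⟩
    obtain ⟨h1, h2, ρ, h3, h4⟩ := h k hk hkK
    rw [cuts_one] at hcut
    obtain ⟨g1, g2⟩ := H.closure_gaps_subset hcut
    rw [disc4_of_real L a g1] at h3
    have hρ : ρ.re = 0 := by
      have e1 := congrArg Complex.re h3
      have e2 := congrArg Complex.im h3
      simp only [sq, mul_re, mul_im, ofReal_re, ofReal_im] at e1 e2
      have e3 : ρ.re * ρ.im = 0 := by linarith
      rcases mul_eq_zero.1 e3 with h | h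
      · exact h
      · rw [h] at e1
        nlinarith [norm_nonneg (discr L a k)]
    have hkr : k = (k.re : ℂ) := Complex.ext rfl (by simp [g1])
    have hsr : Complex.sin (k * L) = ((Real.sin (k.re * L) : ℝ) : ℂ) := by
      rw [hkr]; push_cast; simp
    have h5 : ‖Complex.sin (k * L)‖ * 2 ≤ ‖ρ - 2 * Complex.sin (k * L)‖ := by
      have h6 := abs_re_le_norm (ρ - 2 * Complex.sin (k * L))
      rw [hsr] at h6 ⊢
      rw [sub_re, hρ, Complex.norm_real] at *
      simp only [zero_sub, abs_neg, mul_re, re_ofNat, im_ofNat,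
        ofReal_re, zero_mul, sub_zero, abs_mul, Nat.abs_ofNat] at h6
      rw [Real.norm_eq_abs]
      linarith
    have h7 := norm_pos_iff.2 h1
    nlinarith
  · obtain ⟨K, hK, h⟩ := H.exists_ne_zero
    obtain ⟨Y, hY, hYb⟩ := H.exists_im_bound
    refine ⟨K + Y, by positivity, fun k hk hkK hcut => ?_⟩
    rcases H.mem_closure_cuts hcut with hc | hc
    · rw [H.cuts_neg_one] at hc
      obtain ⟨z, w, ⟨hz, hw, hre, him, -⟩, hseg⟩ := hc
      have hkm := (mem_openSegment_vertical hre him).1 hseg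
      have z0 := disc4_eq_zero_of_mem_oddZeros hz
      have w0 := disc4_eq_zero_of_mem_oddZeros hw
      have hkY : |k.im| < Y := by
        have h1 := abs_lt.1 (hYb z z0)
        have h2 := abs_lt.1 (hYb w w0)
        exact abs_lt.2 ⟨by linarith, by linarith⟩
      have hkre : K < |k.re| := by
        have := norm_le_abs_re_add_abs_im k
        linarith
      have hzd : ∀ z : ℂ, disc4 L a z = 0 → z.re = k.re → z ∈ disks L := by
        intro z z0 hzk
        by_contra hd
        refine h z hd ?_ z0
        have := abs_re_le_norm z
        rw [hzk] at this
        linarith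
      obtain ⟨n, hn⟩ := mem_iUnion.1 (hzd z z0 hkm.1.symm)
      obtain ⟨m, hm⟩ := mem_iUnion.1 (hzd w w0 (hre ▸ hkm.1.symm))
      obtain rfl := center_eq_of_re_eq hL hre hn hm
      exact hk (mem_iUnion.2 ⟨n, (convex_ball _ _).openSegment_subset hn hm hseg⟩)
    · exact h k hk (by linarith) hc

/-- Points near `k0`, moved diagonally, avoid all vertical lines through zeros and both axes. -/
theorem IsDiscriminant.eventually_diagonal (k0 : ℂ) : ∀ᶠ s : ℝ in 𝓝[>] 0,
    (k0 + s * (1 + I)).im ≠ 0 ∧ (k0 + s * (1 + I)).re ≠ 0 ∧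
    ∀ z, disc4 L a z = 0 → z.re ≠ (k0 + s * (1 + I)).re := by
  obtain ⟨ε, hε, h⟩ := H.exists_isolating k0
  have hne : ∀ x : ℝ, ∀ᶠ s : ℝ in 𝓝[>] 0, x + s ≠ 0 := by
    intro x
    rcases eq_or_ne x 0 with rfl | hx
    · filter_upwards [self_mem_nhdsWithin] with s hs
      simpa using (ne_of_gt hs : s ≠ 0)
    · have : ContinuousAt (fun s : ℝ => x + s) 0 := by fun_prop
      exact nhdsWithin_le_nhds (this.eventually_ne (by simpa using hx))
  filter_upwards [hne k0.im, hne k0.re, Ioo_mem_nhdsGT hε] with s h1 h2 h3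
  have e1 : (k0 + s * (1 + I)).im = k0.im + s := by simp
  have e2 : (k0 + s * (1 + I)).re = k0.re + s := by simp
  rw [e1, e2]
  refine ⟨h1, h2, fun z hz hzr => ?_⟩
  have := (h z hz).1 (by rw [hzr]; simp [abs_of_pos h3.1, h3.2])
  rw [hzr] at this
  linarith [h3.1]

theorem IsDiscriminant.dense_good {P : Set ℂ} (hP : P.Finite) :
    Dense {k : ℂ | k.im ≠ 0 ∧ k.re ≠ 0 ∧ (∀ z, disc4 L a z = 0 → z.re ≠ k.re) ∧ k ∉ P} := by
  intro k0
  have ht : Tendsto (fun s : ℝ => k0 + s * (1 + I)) (𝓝[>] 0) (𝓝 k0) := by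
    have : ContinuousAt (fun s : ℝ => k0 + s * (1 + I)) 0 := by fun_prop
    have := this.tendsto
    simp only [Complex.ofReal_zero, zero_mul, add_zero] at this
    exact this.mono_left nhdsWithin_le_nhds
  have hPe : ∀ᶠ s : ℝ in 𝓝[>] 0, k0 + s * (1 + I) ∉ P := by
    have h1 : (P \ {k0})ᶜ ∈ 𝓝 k0 := hP.sdiff.isClosed.isOpen_compl.mem_nhds (by simp)
    filter_upwards [ht.eventually h1, self_mem_nhdsWithin] with s hs hs0 hsP
    refine hs ⟨hsP, fun h => ?_⟩
    have h2 : (s : ℂ) * (1 + I) = 0 := by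
      have : k0 + s * (1 + I) = k0 := h
      linear_combination this
    have h3 := congrArg Complex.re h2
    simp at h3
    exact (ne_of_gt (show (0 : ℝ) < s from hs0)) h3
  refine mem_closure_of_tendsto ht ?_
  filter_upwards [H.eventually_diagonal k0, hPe] with s h1 h2
  exact ⟨h1.1, h1.2.1, h1.2.2, h2⟩

theorem IsDiscriminant.good_notMem_contour {k : ℂ} (h1 : k.im ≠ 0) (h2 : k.re ≠ 0)
    (h3 : ∀ z, disc4 L a z = 0 → z.re ≠ k.re) : k ∉ contour lam L a := by
  rintro (h | h)
  · exact h.elim h1 h2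
  · rcases H.re_of_mem_closure_cuts h with h | ⟨z, hz, hzr⟩
    · exact h1 h
    · exact h3 z hz hzr

end Contour

section Root

variable {lam L : ℝ} {a : ℂ → ℂ}

theorem sides_of_im_eq {k : ℂ} (hk : k.im = 0) :
    (plusSide k = {z | 0 < z.im} ∧ minusSide k = {z | z.im < 0}) ∨
    (plusSide k = {z | z.im < 0} ∧ minusSide k = {z | 0 < z.im}) := by
  rcases leftNormal_of_im_eq hk with h | h
  · left; constructor <;> ext z <;> simp [plusSide, minusSide, h, hk]
  · right; constructor <;> ext z <;> simp [plusSide, minusSide, h, hk]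

theorem sides_of_im_ne {k : ℂ} (hk : k.im ≠ 0) :
    (plusSide k = {z | k.re < z.re} ∧ minusSide k = {z | z.re < k.re}) ∨
    (plusSide k = {z | z.re < k.re} ∧ minusSide k = {z | k.re < z.re}) := by
  rcases leftNormal_of_im_ne hk with h | h
  · left; constructor <;> ext z <;> simp [plusSide, minusSide, h]
  · right; constructor <;> ext z <;> simp [plusSide, minusSide, h]

/-- `R` is a branch of the square root of `4 - Δ²` off the cuts that changes sign across them. -/
structure IsBranch (lam L : ℝ) (a : ℂ → ℂ) (R : ℂ → ℂ) : Prop where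
  diff : DifferentiableOn ℂ R (closure (cuts lam L a))ᶜ
  sq : ∀ k ∈ (closure (cuts lam L a))ᶜ, R k ^ 2 = disc4 L a k
  jump : ∀ k0 ∈ cuts lam L a, k0 ∉ selfIntersections lam L a → ∃ ε > 0, ∃ r : ℂ → ℂ,
    DifferentiableOn ℂ r (ball k0 ε) ∧ (∀ z ∈ ball k0 ε, r z ^ 2 = disc4 L a z) ∧
    (∀ z ∈ ball k0 ε ∩ plusSide k0, R z = r z) ∧
    ∀ z ∈ ball k0 ε ∩ minusSide k0, R z = -r z

theorem IsDiscriminant.exists_ball_sqrt (H : IsDiscriminant lam L a) {k0 : ℂ} {m : ℕ}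
    (hm : analyticOrderAt (disc4 L a) k0 = ((2 * m : ℕ) : ℕ∞)) :
    ∃ ε > 0, ∃ r, DifferentiableOn ℂ r (ball k0 ε) ∧
      ∀ z ∈ ball k0 ε, r z ^ 2 = disc4 L a z := by
  obtain ⟨r, hr, hrf⟩ := exists_sqrt_near_of_even (H.analyticAt k0) hm
  rw [analyticAt_iff_eventually_differentiableAt] at hr
  obtain ⟨ε, hε, h⟩ := eventually_nhds_iff_ball.1 (hr.and hrf)
  exact ⟨ε, hε, r, fun z hz => (h z hz).1.differentiableWithinAt, fun z hz => (h z hz).2⟩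

theorem convex_ball_inter_im (k0 : ℂ) (ε : ℝ) : Convex ℝ (ball k0 ε ∩ {z | 0 < z.im}) :=
  (convex_ball k0 ε).inter (convex_halfSpace_im_gt 0)

/-- Near a real point, the reflected square root. -/
theorem exists_reflected {rp : ℂ → ℂ} {k0 : ℂ} (hk0 : k0.im = 0) {ε : ℝ}
    (hrp : DifferentiableOn ℂ rp {z | 0 < z.im}) (hsq : ∀ z, rp z ^ 2 = disc4 L a z) {r : ℂ → ℂ}
    (hr : DifferentiableOn ℂ r (ball k0 ε))
    (hrs : ∀ z ∈ ball k0 ε, r z ^ 2 = disc4 L a z) {x1 : ℂ}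
    (hx1 : x1 ∈ ball k0 ε) (hx1im : x1.im = 0) (h0 : disc4 L a x1 ≠ 0) :
    ∃ r', DifferentiableOn ℂ r' (ball k0 ε) ∧
      (∀ z ∈ ball k0 ε, r' z ^ 2 = disc4 L a z) ∧
      (∀ z ∈ ball k0 ε, 0 < z.im → rp z = r' z) ∧
      ((‖discr L a x1‖ ≤ 2 ∧ ∀ z ∈ ball k0 ε, z.im < 0 → conj (rp (conj z)) = r' z) ∨
      (2 < ‖discr L a x1‖ ∧ ∀ z ∈ ball k0 ε, z.im < 0 → conj (rp (conj z)) = -r' z)) := by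
  have hck0 : conj k0 = k0 := conj_eq_iff_im.2 hk0
  have hcb : ∀ z, z ∈ ball k0 ε → conj z ∈ ball k0 ε := by
    intro z hz
    rw [mem_ball, dist_eq_norm] at hz ⊢
    rw [← RCLike.norm_conj]
    simpa [hck0] using hz
  obtain ⟨r', hr', hrs', hpos⟩ : ∃ r', DifferentiableOn ℂ r' (ball k0 ε) ∧
      (∀ z ∈ ball k0 ε, r' z ^ 2 = disc4 L a z) ∧
      (∀ z ∈ ball k0 ε, 0 < z.im → rp z = r' z) := by
    have hopen : IsOpen (ball k0 ε ∩ {z : ℂ | 0 < z.im}) :=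
      isOpen_ball.inter (isOpen_lt continuous_const continuous_im)
    rcases eq_or_eq_neg_of_sq_eq hopen (convex_ball_inter_im k0 ε).isPreconnected
      (hrp.mono inter_subset_right) (hr.mono inter_subset_left)
      (fun z hz => by rw [hsq, hrs z hz.1]) with h | h
    · exact ⟨r, hr, hrs, fun z hz hz' => h z ⟨hz, hz'⟩⟩
    · exact ⟨fun z => -r z, hr.neg, fun z hz => by rw [neg_sq, hrs z hz],
        fun z hz hz' => h z ⟨hz, hz'⟩⟩
  refine ⟨r', hr', hrs', hpos, ?_⟩
  have hsd : DifferentiableOn ℂ (schwarz r') (ball k0 ε) := fun z hz => by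
    have h1 := (hr'.differentiableAt (isOpen_ball.mem_nhds (hcb z hz))).conj_conj
    have h2 : DifferentiableAt ℂ (schwarz r') z := by
      simpa [schwarz, Function.comp_def] using! h1
    exact h2.differentiableWithinAt
  have hlow : ∀ z ∈ ball k0 ε, z.im < 0 → conj (rp (conj z)) = schwarz r' z := by
    intro z hz hzi
    rw [schwarz, hpos _ (hcb z hz) (by simpa using hzi)]
  have hx1r : r' x1 ^ 2 = disc4 L a x1 := hrs' x1 hx1
  have hr0 : r' x1 ≠ 0 := fun h => h0 (by rw [← hx1r, h]; simp)
  have hcx1 : conj x1 = x1 := conj_eq_iff_im.2 hx1im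
  rw [disc4_of_real L a hx1im] at hx1r
  have e1 := congrArg Complex.re hx1r
  have e2 := congrArg Complex.im hx1r
  simp only [sq, mul_re, mul_im, ofReal_re, ofReal_im] at e1 e2
  have e3 : (r' x1).re * (r' x1).im = 0 := by linarith
  rcases eq_or_eq_neg_of_sq_eq isOpen_ball (convex_ball k0 ε).isPreconnected hsd hr'
    (fun z hz => by
      rw [hrs' z hz, schwarz, ← map_pow, hrs' _ (hcb z hz), conj_disc4]) with h | h
  · left
    refine ⟨?_, fun z hz hzi => by rw [hlow z hz hzi, h z hz]⟩
    have h1 := h x1 hx1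
    rw [schwarz, hcx1, conj_eq_iff_im] at h1
    rw [h1] at e1
    nlinarith [norm_nonneg (discr L a x1), sq_nonneg (r' x1).re]
  · right
    refine ⟨?_, fun z hz hzi => by rw [hlow z hz hzi, h z hz]⟩
    have h1 := congrArg Complex.re (h x1 hx1)
    rw [schwarz, hcx1, conj_re, neg_re] at h1
    have h2 : (r' x1).re = 0 := by linarith
    have h3 : (r' x1).im ≠ 0 := fun h3 => hr0 (Complex.ext h2 h3)
    rw [h2] at e1
    have h4 : 0 < (r' x1).im ^ 2 := by positivity
    nlinarith [norm_nonneg (discr L a x1)]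

theorem exists_branch_defocusing (H : IsDiscriminant 1 L a) : ∃ R, IsBranch 1 L a R := by
  have hUo : IsOpen {z : ℂ | 0 < z.im} := isOpen_lt continuous_const continuous_im
  obtain ⟨rp, hrp, hsq⟩ := exists_sqrt_of_convex hUo (convex_halfSpace_im_gt 0)
    ⟨I, by simp⟩ H.differentiable_disc4.differentiableOn
    fun z hz => H.defocusing rfl z (ne_of_gt hz)
  set M : ℂ → ℂ := fun k => if 0 < k.im then rp k else conj (rp (conj k)) with hM
  have hMp : ∀ k : ℂ, 0 < k.im → M k = rp k := fun k hk => if_pos hk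
  have hMn : ∀ k : ℂ, k.im < 0 → M k = conj (rp (conj k)) := fun k hk => if_neg (not_lt.2 hk.le)
  have hMsq : ∀ k, M k ^ 2 = disc4 L a k := by
    intro k
    simp only [hM]
    split_ifs
    · exact hsq k
    · rw [← map_pow, hsq, conj_disc4]
  set Ω := (closure (cuts 1 L a))ᶜ with hΩ
  have hΩo : IsOpen Ω := isClosed_closure.isOpen_compl
  have hG : Dense {k : ℂ | k.im ≠ 0} := by
    refine (H.dense_good (P := ∅) finite_empty).mono fun k hk => hk.1
  obtain ⟨R, hR, hRM⟩ := exists_glued (M := M) hΩo hG (by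
    intro k hk
    rcases lt_trichotomy k.im 0 with hi | hi | hi
    · have hLo : IsOpen {z : ℂ | z.im < 0} := isOpen_lt continuous_im continuous_const
      obtain ⟨ε, hε, hb⟩ := Metric.isOpen_iff.1 hLo k hi
      refine ⟨ε, hε, schwarz rp, fun z hz => ?_, fun z hz => (hMn z (hb hz.1)).symm⟩
      have h1 := (hrp.differentiableAt (x := conj z) (hUo.mem_nhds (by
        have := hb hz; simpa using this))).conj_conj
      have h2 : DifferentiableAt ℂ (schwarz rp) z := by
        simpa [schwarz, Function.comp_def] using! h1
      exact h2.differentiableWithinAt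
    · have hgap : k ∉ closure (spectralGaps L a) := by rwa [← cuts_one]
      obtain ⟨δ, hδ, hb⟩ := Metric.isOpen_iff.1 (isClosed_closure.isOpen_compl) k hgap
      have hreal : ∀ z ∈ ball k δ, z.im = 0 → ‖discr L a z‖ ≤ 2 := fun z hz hzi => by
        by_contra hc
        exact hb hz (subset_closure ⟨hzi, not_le.1 hc⟩)
      have hkr : k = ((k.re : ℝ) : ℂ) := Complex.ext rfl (by simp [hi])
      obtain ⟨n, hn⟩ := ENat.ne_top_iff_exists.1 (H.order_ne_top k)
      have heven : Even n := by
        refine even_order_of_nonneg (f := disc4 L a) (x0 := k.re) (H.analyticAt _) ?_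
          (by rw [← hkr]; exact hn.symm)
        have hco : Tendsto (fun x : ℝ => (x : ℂ)) (𝓝 k.re) (𝓝 ((k.re : ℝ) : ℂ)) :=
          continuous_ofReal.continuousAt
        rw [← hkr] at hco
        filter_upwards [hco.eventually (ball_mem_nhds k hδ)] with y hy
        rw [disc4_of_real L a (ofReal_im y)]
        refine ⟨?_, ofReal_im _⟩
        rw [ofReal_re]
        nlinarith [hreal _ hy (ofReal_im y), norm_nonneg (discr L a y)]
      obtain ⟨m, hm⟩ := heven
      obtain ⟨ε, hε, r, hr, hrs⟩ := H.exists_ball_sqrt (k0 := k) (m := m) (by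
        rw [← hn, hm, two_mul])
      set η := min ε δ with hη
      have hηpos : 0 < η := lt_min hε hδ
      obtain ⟨ε', hε', hiso⟩ := H.exists_isolating k
      set s := min (η / 2) (ε' / 2) with hs
      have hspos : 0 < s := by positivity
      set x1 : ℂ := k + (s : ℂ) with hx1
      have hd : dist x1 k = s := by
        rw [dist_eq_norm, hx1, add_sub_cancel_left, Complex.norm_real, Real.norm_eq_abs,
          abs_of_pos hspos]
      have hx1b : x1 ∈ ball k η := by
        rw [mem_ball, hd]; linarith [min_le_left (η / 2) (ε' / 2)]
      have hx1im : x1.im = 0 := by simp [hx1, hi]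
      have h0 : disc4 L a x1 ≠ 0 := fun h0 => by
        have := (hiso x1 h0).2 (by rw [hd]; linarith [min_le_right (η / 2) (ε' / 2)])
        rw [this, dist_self] at hd
        linarith
      have hsub : ball k η ⊆ ball k ε := ball_subset_ball (min_le_left _ _)
      obtain ⟨r', hr', hrs', hp, hcase⟩ := exists_reflected (L := L) (a := a) hi hrp hsq
        (hr.mono hsub) (fun z hz => hrs z (hsub hz)) hx1b hx1im h0
      rcases hcase with ⟨-, hn'⟩ | ⟨hlt, -⟩
      · refine ⟨η, hηpos, r', hr', fun z hz => ?_⟩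
        rcases lt_or_gt_of_ne hz.2 with h | h
        · rw [hMn z h, hn' z hz.1 h]
        · rw [hMp z h, hp z hz.1 h]
      · exact absurd (hreal x1 (ball_subset_ball (min_le_right _ _) hx1b) hx1im)
          (not_le.2 hlt)
    · obtain ⟨ε, hε, hb⟩ := Metric.isOpen_iff.1 hUo k hi
      exact ⟨ε, hε, rp, hrp.mono hb, fun z hz => (hMp z (hb hz.1)).symm⟩)
  have hnotcl : ∀ z : ℂ, z.im ≠ 0 → z ∈ Ω := fun z hz hc => by
    rw [cuts_one] at hc
    exact hz (H.closure_gaps_subset hc).1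
  refine ⟨R, hR, ?_, ?_⟩
  · have hcl : closure (Ω ∩ {k : ℂ | k.im ≠ 0}) ∩ Ω ⊆ {k | R k ^ 2 = disc4 L a k} := by
      rintro k ⟨hk, hkΩ⟩
      have : (𝓝[Ω ∩ {k : ℂ | k.im ≠ 0}] k).NeBot := mem_closure_iff_nhdsWithin_neBot.1 hk
      have c1 : ContinuousAt R k := (hR.differentiableAt (hΩo.mem_nhds hkΩ)).continuousAt
      refine tendsto_nhds_unique (l := 𝓝[Ω ∩ {k : ℂ | k.im ≠ 0}] k)
        ((c1.pow 2).tendsto.mono_left nhdsWithin_le_nhds) ?_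
      refine ((H.differentiable_disc4.continuous.tendsto k).mono_left nhdsWithin_le_nhds).congr' ?_
      filter_upwards [self_mem_nhdsWithin] with z hz
      rw [Pi.pow_apply, hRM hz, hMsq]
    exact fun k hk => hcl ⟨hG.open_subset_closure_inter hΩo hk, hk⟩
  · intro k0 hk0 _
    rw [cuts_one] at hk0
    have h0 : disc4 L a k0 ≠ 0 := by
      rw [disc4_of_real L a hk0.1]
      have := hk0.2
      intro h
      have := Complex.ofReal_eq_zero.1 h
      nlinarith
    obtain ⟨ε, hε, r, hr, hrs⟩ := H.exists_ball_sqrt (k0 := k0) (m := 0) (by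
      rw [(H.analyticAt k0).analyticOrderAt_eq_zero.2 h0]; simp)
    obtain ⟨r', hr', hrs', hp, hcase⟩ := exists_reflected (L := L) (a := a) hk0.1 hrp hsq hr hrs
      (mem_ball_self hε) hk0.1 h0
    rcases hcase with ⟨hle, -⟩ | ⟨-, hn⟩
    · exact absurd hk0.2 (not_lt.2 hle)
    have up : ∀ z ∈ ball k0 ε, 0 < z.im → R z = r' z := fun z hz hzi => by
      rw [hRM ⟨hnotcl z hzi.ne', hzi.ne'⟩, hMp z hzi, hp z hz hzi]
    have dn : ∀ z ∈ ball k0 ε, z.im < 0 → R z = -r' z := fun z hz hzi => by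
      rw [hRM ⟨hnotcl z hzi.ne, hzi.ne⟩, hMn z hzi, hn z hz hzi]
    rcases sides_of_im_eq hk0.1 with ⟨h1, h2⟩ | ⟨h1, h2⟩
    · refine ⟨ε, hε, r', hr', hrs', ?_, ?_⟩
      · rw [h1]; exact fun z hz => up z hz.1 hz.2
      · rw [h2]; exact fun z hz => dn z hz.1 hz.2
    · refine ⟨ε, hε, fun z => -r' z, hr'.neg, fun z hz => by rw [neg_sq, hrs' z hz], ?_, ?_⟩
      · rw [h1]; exact fun z hz => dn z hz.1 hz.2
      · rw [h2]; exact fun z hz => by rw [neg_neg]; exact up z hz.1 hz.2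

end Root

section Focusing

variable {lam L : ℝ} {a : ℂ → ℂ}

theorem exists_divide {f : ℂ → ℂ} (hf : Differentiable ℂ f) {z : ℂ} {n : ℕ}
    (hn : analyticOrderAt f z = n) :
    ∃ h, Differentiable ℂ h ∧ (∀ k, f k = (k - z) ^ n * h k) ∧ h z ≠ 0 := by
  obtain ⟨g, hg, hg0, hfg⟩ := (hf.analyticAt z).analyticOrderAt_eq_natCast.1 hn
  set h : ℂ → ℂ := fun k => if k = z then g z else f k / (k - z) ^ n with hh
  have hne : ∀ k, k ≠ z → h k = f k / (k - z) ^ n := fun k hk => if_neg hk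
  have hz : h z = g z := if_pos rfl
  have hev : h =ᶠ[𝓝 z] g := by
    filter_upwards [hfg] with k hk
    rcases eq_or_ne k z with rfl | hkz
    · exact hz
    · rw [hne k hkz, hk, smul_eq_mul, mul_div_cancel_left₀ _ (pow_ne_zero _ (sub_ne_zero.2 hkz))]
  refine ⟨h, fun k => ?_, fun k => ?_, by rwa [hz]⟩
  · rcases eq_or_ne k z with rfl | hkz
    · exact hev.differentiableAt_iff.2 hg.differentiableAt
    · have : h =ᶠ[𝓝 k] fun k => f k / (k - z) ^ n := by
        filter_upwards [isOpen_ne.mem_nhds hkz] with w hw using hne w hw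
      refine this.differentiableAt_iff.2 ((hf k).div (by fun_prop) ?_)
      exact pow_ne_zero _ (sub_ne_zero.2 hkz)
  · rcases eq_or_ne k z with rfl | hkz
    · rw [hz]; exact hfg.self_of_nhds
    · rw [hne k hkz, mul_div_cancel₀ _ (pow_ne_zero _ (sub_ne_zero.2 hkz))]

theorem exists_factorization {f : ℂ → ℂ} (hf : Differentiable ℂ f)
    (hord : ∀ z, analyticOrderAt f z ≠ ⊤) (Z : Finset ℂ) :
    ∃ h, Differentiable ℂ h ∧
      (∀ k, f k = (∏ z ∈ Z, (k - z) ^ analyticOrderNatAt f z) * h k) ∧ ∀ z ∈ Z, h z ≠ 0 := by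
  induction Z using Finset.induction_on with
  | empty => exact ⟨f, hf, fun k => by simp, by simp⟩
  | insert z Z hz ih =>
    obtain ⟨h, hh, hfh, h0⟩ := ih
    have hP : Differentiable ℂ fun k : ℂ => ∏ w ∈ Z, (k - w) ^ analyticOrderNatAt f w := by
      fun_prop
    have hPz : (∏ w ∈ Z, (z - w) ^ analyticOrderNatAt f w) ≠ 0 :=
      Finset.prod_ne_zero_iff.2 fun w hw => pow_ne_zero _ (sub_ne_zero.2 (by
        rintro rfl; exact hz hw))
    have horder : analyticOrderAt h z = (analyticOrderNatAt f z : ℕ) := by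
      rw [Nat.cast_analyticOrderNatAt (hord z)]
      have e : f = (fun k : ℂ => ∏ w ∈ Z, (k - w) ^ analyticOrderNatAt f w) * h :=
        funext hfh
      conv_rhs => rw [e]
      rw [analyticOrderAt_mul (hP.analyticAt z) (hh.analyticAt z),
        (hP.analyticAt z).analyticOrderAt_eq_zero.2 hPz, zero_add]
    obtain ⟨h', hh', hhh, h0'⟩ := exists_divide hh horder
    refine ⟨h', hh', fun k => ?_, fun w hw => ?_⟩
    · rw [Finset.prod_insert hz, hfh k, hhh k]; ring
    · rcases Finset.mem_insert.1 hw with rfl | hw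
      · exact h0'
      · intro hc
        apply h0 w hw
        rw [hhh w, hc, mul_zero]

/-- The square root of `k - z`, with a cut along the downward vertical ray from `z`. -/
def vsqrt (z k : ℂ) : ℂ := I ^ ((2 : ℕ) : ℂ)⁻¹ * (-I * (k - z)) ^ ((2 : ℕ) : ℂ)⁻¹

theorem vsqrt_sq (z k : ℂ) : vsqrt z k ^ 2 = k - z := by
  rw [vsqrt, mul_pow, cpow_nat_inv_pow _ two_ne_zero, cpow_nat_inv_pow _ two_ne_zero]
  linear_combination (-(k - z)) * I_sq

theorem analyticAt_vsqrt {z k : ℂ} (h : -I * (k - z) ∈ slitPlane) : AnalyticAt ℂ (vsqrt z) k := by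
  unfold vsqrt
  refine analyticAt_const.mul (AnalyticAt.cpow (by fun_prop) analyticAt_const h)

theorem analyticAt_vsqrt_of_re_ne {z k : ℂ} (h : k.re ≠ z.re) : AnalyticAt ℂ (vsqrt z) k := by
  refine analyticAt_vsqrt (mem_slitPlane_iff.2 (Or.inr ?_))
  simp only [mul_im, neg_re, Complex.I_re, neg_im, Complex.I_im,
    sub_re, sub_im]
  intro h'
  apply h
  linarith

theorem neg_cpow_half {v : ℂ} (hv : 0 < v.re) :
    (v.im ≤ 0 → (-v) ^ ((2 : ℕ) : ℂ)⁻¹ = I * v ^ ((2 : ℕ) : ℂ)⁻¹) ∧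
    (0 < v.im → (-v) ^ ((2 : ℕ) : ℂ)⁻¹ = -(I * v ^ ((2 : ℕ) : ℂ)⁻¹)) := by
  have hv0 : v ≠ 0 := fun h => by simp [h] at hv
  have hnv0 : -v ≠ 0 := neg_ne_zero.2 hv0
  have hI : exp (Real.pi * I / 2) = I := by
    rw [mul_div_right_comm, exp_pi_div_two_mul_I]
  have hI' : exp (-(Real.pi * I / 2)) = -I := by rw [Complex.exp_neg, hI, Complex.inv_I]
  rw [Complex.cpow_def_of_ne_zero hnv0, Complex.cpow_def_of_ne_zero hv0]
  constructor
  · intro him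
    have harg : (-v).arg = v.arg + Real.pi := by
      rw [Complex.arg_neg_eq_arg_add_pi_iff]
      rcases him.lt_or_eq with h | h
      · exact Or.inl h
      · exact Or.inr ⟨h, hv⟩
    have : log (-v) = log v + Real.pi * I := by
      rw [Complex.log, Complex.log, harg, norm_neg]; push_cast; ring
    rw [this, ← hI, ← Complex.exp_add, hI]
    congr 1
    push_cast; ring
  · intro him
    have harg : (-v).arg = v.arg - Real.pi := by
      rw [Complex.arg_neg_eq_arg_sub_pi_iff]
      exact Or.inl him
    have : log (-v) = log v - Real.pi * I := by
      rw [Complex.log, Complex.log, harg, norm_neg]; push_cast; ring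
    rw [this, ← neg_mul, ← hI', ← Complex.exp_add]
    congr 1
    push_cast; ring

/-- Powers of `vsqrt z` near a point of the vertical line through `z`. -/
theorem vsqrt_pow_local {z k0 : ℂ} (hre : z.re = k0.re) {n : ℕ} (hn : k0 = z → Even n) :
    ∃ ρ, AnalyticAt ℂ ρ k0 ∧ ∀ᶠ k in 𝓝 k0, (k.re ≤ k0.re → vsqrt z k ^ n = ρ k) ∧
      (k0.re < k.re → vsqrt z k ^ n = (if k0.im < z.im ∧ Odd n then -1 else 1) * ρ k) := by
  rcases lt_trichotomy k0.im z.im with h | h | h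
  · set ρ : ℂ → ℂ := fun k => I ^ ((2 : ℕ) : ℂ)⁻¹ * (I * (I * (k - z)) ^ ((2 : ℕ) : ℂ)⁻¹) with hρ
    have hpos : 0 < (I * (k0 - z)).re := by simp; linarith
    have hρa : AnalyticAt ℂ ρ k0 := by
      refine analyticAt_const.mul (analyticAt_const.mul (AnalyticAt.cpow (by fun_prop)
        analyticAt_const (mem_slitPlane_iff.2 (Or.inl hpos))))
    have hev : ∀ᶠ k in 𝓝 k0, 0 < (I * (k - z)).re := by
      have : ContinuousAt (fun k : ℂ => (I * (k - z)).re) k0 := by fun_prop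
      exact this.eventually (lt_mem_nhds hpos)
    have him : ∀ k : ℂ, (I * (k - z)).im = k.re - k0.re := fun k => by simp [hre]
    refine ⟨fun k => ρ k ^ n, hρa.pow n, ?_⟩
    filter_upwards [hev] with k hk
    have e : -I * (k - z) = -(I * (k - z)) := by ring
    constructor
    · intro hkr
      rw [vsqrt, e, (neg_cpow_half hk).1 (by rw [him]; linarith)]
    · intro hkr
      have : vsqrt z k = -ρ k := by
        rw [vsqrt, e, (neg_cpow_half hk).2 (by rw [him]; linarith)]; ring
      rw [this]
      by_cases ho : Odd n
      · rw [if_pos ⟨h, ho⟩, ho.neg_pow]; ring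
      · rw [if_neg (fun h' => ho h'.2), (Nat.not_odd_iff_even.1 ho).neg_pow, one_mul]
  · have hk0 : k0 = z := Complex.ext hre.symm h
    obtain ⟨m, hm⟩ := hn hk0
    refine ⟨fun k => (k - z) ^ m, by fun_prop, Eventually.of_forall fun k => ?_⟩
    have : vsqrt z k ^ n = (k - z) ^ m := by rw [hm, ← two_mul, pow_mul, vsqrt_sq]
    rw [if_neg (fun h' => absurd h (ne_of_lt h'.1)), one_mul]
    exact ⟨fun _ => this, fun _ => this⟩
  · refine ⟨fun k => vsqrt z k ^ n, (analyticAt_vsqrt (mem_slitPlane_iff.2 (Or.inl ?_))).pow n,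
      Eventually.of_forall fun k => ?_⟩
    · simp; linarith
    · rw [if_neg (fun h' => absurd h (not_lt.2 h'.1.le)), one_mul]
      exact ⟨fun _ => rfl, fun _ => rfl⟩

theorem IsDiscriminant.even_order_real (H : IsDiscriminant (-1) L a) {z : ℂ} (hz : z.im = 0) :
    Even (analyticOrderNatAt (disc4 L a) z) := by
  have hzr : z = ((z.re : ℝ) : ℂ) := Complex.ext rfl (by simp [hz])
  refine even_order_of_nonneg (f := disc4 L a) (x0 := z.re) (H.analyticAt _)
    (Eventually.of_forall fun y => ?_) ?_
  · rw [disc4_of_real L a (ofReal_im y)]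
    refine ⟨?_, ofReal_im _⟩
    rw [ofReal_re]
    nlinarith [H.focusing rfl y (ofReal_im y), norm_nonneg (discr L a y)]
  · rw [← hzr, Nat.cast_analyticOrderNatAt (H.order_ne_top z)]

theorem IsDiscriminant.mem_oddZeros_iff (H : IsDiscriminant (-1) L a) (z : ℂ) :
    z ∈ oddZeros L a ↔ Odd (analyticOrderNatAt (disc4 L a) z) := by
  constructor
  · rintro ⟨-, n, hn, h⟩
    have : analyticOrderAt (disc4 L a) z = n := h
    rwa [analyticOrderNatAt, this, ENat.toNat_natCast]
  · intro h
    refine ⟨fun hz => Nat.not_even_iff_odd.2 h (H.even_order_real hz), _, h, ?_⟩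
    exact (Nat.cast_analyticOrderNatAt (H.order_ne_top z)).symm

/-- A branch of the square root of `4 - Δ²` in a thin vertical strip. -/
theorem IsDiscriminant.exists_strip_root (H : IsDiscriminant (-1) L a) {Y : ℝ}
    (hY : ∀ k, disc4 L a k = 0 → |k.im| < Y) {rT : ℂ → ℂ}
    (hrT : DifferentiableOn ℂ rT {z | Y < z.im}) (hrTs : ∀ z, rT z ^ 2 = disc4 L a z) (x0 : ℝ) :
    ∃ ε > 0, ∃ R : ℂ → ℂ, (∀ k, |k.re - x0| < ε → R k ^ 2 = disc4 L a k) ∧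
      (∀ k, |k.re - x0| < ε → k.re ≠ x0 → DifferentiableAt ℂ R k) ∧
      (∀ k0 : ℂ, k0.re = x0 → k0 ∉ oddZeros L a → ∃ r, AnalyticAt ℂ r k0 ∧ ∀ᶠ k in 𝓝 k0,
        (k.re ≤ x0 → R k = r k) ∧ (x0 < k.re → R k = (-1) ^ (above L a k0).ncard * r k)) ∧
      (∀ k, |k.re - x0| < ε → Y < k.im → R k = rT k) ∧
      (∀ k, disc4 L a k = 0 → |k.re - x0| < ε → k.re = x0) := by
  obtain ⟨ε, hε, hiso⟩ := H.exists_isolating x0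
  have hiso' : ∀ k, disc4 L a k = 0 → |k.re - x0| < ε → k.re = x0 := fun k hk h => by
    simpa using (hiso k hk).1 (by simpa using h)
  set S : Set ℂ := {k | |k.re - x0| < ε} with hS
  have hSb : S = Complex.re ⁻¹' ball x0 ε := by
    ext k; simp [hS, Real.dist_eq]
  have hSo : IsOpen S := by rw [hSb]; exact isOpen_ball.preimage continuous_re
  have hSc : Convex ℝ S := by
    rw [hSb]; exact (convex_ball x0 ε).linear_preimage Complex.reLm
  have hfin : {z | disc4 L a z = 0 ∧ z.re = x0}.Finite :=
    (H.finite_zeros_strip |x0|).subset fun z hz => ⟨hz.1, by rw [hz.2]⟩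
  set Z := hfin.toFinset with hZ
  have hmZ : ∀ z, z ∈ Z ↔ disc4 L a z = 0 ∧ z.re = x0 := fun z => hfin.mem_toFinset
  set n : ℂ → ℕ := fun z => analyticOrderNatAt (disc4 L a) z with hn
  obtain ⟨h, hh, hfh, h0⟩ := exists_factorization H.differentiable_disc4 H.order_ne_top Z
  have hS0 : ∀ k ∈ S, h k ≠ 0 := by
    intro k hk hc
    have hk0 : disc4 L a k = 0 := by rw [hfh k, hc, mul_zero]
    exact h0 k ((hmZ k).2 ⟨hk0, hiso' k hk0 hk⟩) hc
  obtain ⟨g, hg, hgs⟩ := exists_sqrt_of_convex hSo hSc ⟨(x0 : ℂ), by simp [hS, hε]⟩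
    hh.differentiableOn hS0
  set R0 : ℂ → ℂ := fun k => g k * ∏ z ∈ Z, vsqrt z k ^ n z with hR0
  have hR0s : ∀ k, R0 k ^ 2 = disc4 L a k := by
    intro k
    simp only [hR0]
    rw [mul_pow, hgs, ← Finset.prod_pow, hfh k, mul_comm]
    congr 1
    refine Finset.prod_congr rfl fun z _ => ?_
    rw [← pow_mul, mul_comm, pow_mul, vsqrt_sq]
  have hR0d : ∀ k ∈ S, k.re ≠ x0 → DifferentiableAt ℂ R0 k := by
    intro k hk hkr
    refine (hg.differentiableAt (hSo.mem_nhds hk)).mul (DifferentiableAt.fun_finsetProd fun z hz => ?_)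
    have := (hmZ z).1 hz
    exact ((analyticAt_vsqrt_of_re_ne (by rw [this.2]; exact hkr)).pow _).differentiableAt
  have hR0l : ∀ k0 : ℂ, k0.re = x0 → k0 ∉ oddZeros L a → ∃ r, AnalyticAt ℂ r k0 ∧ ∀ᶠ k in 𝓝 k0,
      (k.re ≤ x0 → R0 k = r k) ∧ (x0 < k.re → R0 k = (-1) ^ (above L a k0).ncard * r k) := by
    intro k0 hk0 hodd
    have hk0S : k0 ∈ S := by simp [hS, hk0, hε]
    have hex : ∀ z ∈ Z, ∃ ρ, AnalyticAt ℂ ρ k0 ∧ ∀ᶠ k in 𝓝 k0,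
        (k.re ≤ k0.re → vsqrt z k ^ n z = ρ k) ∧
        (k0.re < k.re → vsqrt z k ^ n z = (if k0.im < z.im ∧ Odd (n z) then -1 else 1) * ρ k) := by
      intro z hz
      refine vsqrt_pow_local (((hmZ z).1 hz).2.trans hk0.symm) ?_
      rintro rfl
      rw [H.mem_oddZeros_iff] at hodd
      exact Nat.not_odd_iff_even.1 hodd
    choose! ρ hρ hρe using hex
    refine ⟨fun k => g k * ∏ z ∈ Z, ρ z k, ?_, ?_⟩
    · exact ((hg.analyticOnNhd hSo) k0 hk0S).mul (Finset.analyticAt_fun_prod _ fun z hz => hρ z hz)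
    · have hall : ∀ᶠ k in 𝓝 k0, ∀ z ∈ Z, (k.re ≤ k0.re → vsqrt z k ^ n z = ρ z k) ∧
        (k0.re < k.re → vsqrt z k ^ n z =
          (if k0.im < z.im ∧ Odd (n z) then -1 else 1) * ρ z k) :=
        (Filter.eventually_all_finset Z).2 hρe
      filter_upwards [hall] with k hk
      rw [hk0] at hk
      constructor
      · intro hkr
        simp only [hR0]
        rw [Finset.prod_congr rfl fun z hz => (hk z hz).1 hkr]
      · intro hkr
        simp only [hR0]
        rw [Finset.prod_congr rfl fun z hz => (hk z hz).2 hkr, Finset.prod_mul_distrib,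
          Finset.prod_ite, Finset.prod_const, Finset.prod_const_one, mul_one]
        have hcard : (above L a k0).ncard = (Z.filter fun z => k0.im < z.im ∧ Odd (n z)).card := by
          rw [← Set.ncard_coe_finset]
          congr 1
          ext u
          simp only [Finset.coe_filter, mem_ofPred_eq]
          constructor
          · rintro ⟨h1, h2, h3⟩
            exact ⟨(hmZ u).2 ⟨disc4_eq_zero_of_mem_oddZeros h1, h2.trans hk0⟩, h3,
              (H.mem_oddZeros_iff u).1 h1⟩
          · rintro ⟨h1, h2, h3⟩
            exact ⟨(H.mem_oddZeros_iff u).2 h3, ((hmZ u).1 h1).2.trans hk0.symm, h2⟩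
        rw [hcard]
        ring
  have hTo : IsOpen (S ∩ {z : ℂ | Y < z.im}) :=
    hSo.inter (isOpen_lt continuous_const continuous_im)
  have hTc : Convex ℝ (S ∩ {z : ℂ | Y < z.im}) := hSc.inter (convex_halfSpace_im_gt Y)
  have hR0T : DifferentiableOn ℂ R0 (S ∩ {z : ℂ | Y < z.im}) := by
    rintro k ⟨hkS, hkY⟩
    have hkY : Y < k.im := hkY
    refine DifferentiableAt.differentiableWithinAt ?_
    by_cases hkr : k.re = x0
    · have hne : k ∉ oddZeros L a := fun hk => by
        have := hY k (disc4_eq_zero_of_mem_oddZeros hk)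
        linarith [le_abs_self k.im]
      have hab : above L a k = ∅ := by
        ext u
        simp only [mem_empty_iff_false, iff_false]
        rintro ⟨h1, -, h3⟩
        have := hY u (disc4_eq_zero_of_mem_oddZeros h1)
        linarith [le_abs_self u.im]
      obtain ⟨r, hr, hre⟩ := hR0l k hkr hne
      rw [hab, ncard_empty, pow_zero] at hre
      have : R0 =ᶠ[𝓝 k] r := by
        filter_upwards [hre] with w hw
        rcases le_or_gt w.re x0 with h | h
        · exact hw.1 h
        · rw [hw.2 h, one_mul]
      exact this.differentiableAt_iff.2 hr.differentiableAt
    · exact hR0d k hkS hkr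
  rcases eq_or_eq_neg_of_sq_eq hTo hTc.isPreconnected hR0T (hrT.mono inter_subset_right)
    (fun z _ => by rw [hR0s, hrTs]) with hc | hc
  · exact ⟨ε, hε, R0, fun k _ => hR0s k, hR0d, hR0l, fun k hk hkY => hc k ⟨hk, hkY⟩, hiso'⟩
  · refine ⟨ε, hε, fun k => -R0 k, fun k _ => by rw [neg_sq, hR0s], fun k hk hkr =>
      (hR0d k hk hkr).neg, fun k0 hk0 hodd => ?_, fun k hk hkY => ?_, hiso'⟩
    · obtain ⟨r, hr, hre⟩ := hR0l k0 hk0 hodd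
      refine ⟨fun k => -r k, hr.neg, ?_⟩
      filter_upwards [hre] with k hk
      exact ⟨fun h => by rw [hk.1 h], fun h => by rw [hk.2 h]; ring⟩
    · change -R0 k = rT k
      rw [hc k ⟨hk, hkY⟩, neg_neg]

theorem exists_branch_focusing (H : IsDiscriminant (-1) L a) : ∃ R, IsBranch (-1) L a R := by
  obtain ⟨Y, hY0, hY⟩ := H.exists_im_bound
  obtain ⟨rT, hrT, hrTs⟩ := exists_sqrt_of_convex
    (isOpen_lt continuous_const continuous_im : IsOpen {z : ℂ | Y < z.im})
    (convex_halfSpace_im_gt Y) ⟨(Y + 1 : ℝ) * I, by simp⟩ H.differentiable_disc4.differentiableOn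
    fun z hz h0 => by
      have h1 := hY z h0
      have h2 : Y < z.im := hz
      linarith [le_abs_self z.im]
  choose ε hε R hsq hd hl hT hiso using H.exists_strip_root hY hrT hrTs
  have hcont : ∀ k0 : ℂ, disc4 L a k0 ≠ 0 → (∀ z, disc4 L a z = 0 → z.re ≠ k0.re) →
      ContinuousAt (R k0.re) k0 := by
    intro k0 h0 hz
    have hne : k0 ∉ oddZeros L a := fun h => h0 (disc4_eq_zero_of_mem_oddZeros h)
    have hab : above L a k0 = ∅ := by
      ext u
      simp only [mem_empty_iff_false, iff_false]
      rintro ⟨h1, h2, -⟩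
      exact hz u (disc4_eq_zero_of_mem_oddZeros h1) h2
    obtain ⟨r, hr, hre⟩ := hl k0.re k0 rfl hne
    rw [hab, ncard_empty, pow_zero] at hre
    refine hr.continuousAt.congr ?_
    filter_upwards [hre] with w hw
    rcases le_or_gt w.re k0.re with h | h
    · exact (hw.1 h).symm
    · rw [hw.2 h, one_mul]
  have hagree : ∀ x0 : ℝ, ∀ k : ℂ, |k.re - x0| < ε x0 → R k.re k = R x0 k := by
    intro x0 k hk
    by_cases hkx : k.re = x0
    · rw [hkx]
    have hnz : ∀ z, disc4 L a z = 0 → z.re ≠ k.re := by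
      intro z hz hzr
      exact hkx (hzr ▸ hiso x0 z hz (by rwa [hzr]))
    have hline : ∀ y : ℝ, disc4 L a (k.re + y * I) ≠ 0 := fun y hy => hnz _ hy (by simp)
    have hc : Continuous fun y : ℝ => (k.re : ℂ) + y * I := by fun_prop
    have := IsPreconnected.eq_of_sq_eq (S := (univ : Set ℝ)) isPreconnected_univ
      (f := fun y : ℝ => R k.re (k.re + y * I)) (g := fun y : ℝ => R x0 (k.re + y * I))
      (fun y _ => ?_) (fun y _ => ?_) (fun y _ => ?_) (fun {y} _ => ?_) (y := Y + 1) (mem_univ _) ?_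
    · have h1 := this (mem_univ k.im)
      simpa only [Complex.re_add_im] using h1
    · refine ContinuousAt.continuousWithinAt (ContinuousAt.comp (g := R k.re) ?_ hc.continuousAt)
      have h2 := hcont (k.re + y * I) (hline y) (by simpa using hnz)
      simpa using h2
    · refine ContinuousAt.continuousWithinAt (ContinuousAt.comp (g := R x0) ?_ hc.continuousAt)
      exact (hd x0 _ (by simpa using hk) (by simpa using hkx)).continuousAt
    · simp only [Pi.pow_apply]
      rw [hsq, hsq]
      · simpa using hk
      · simpa using hε k.re
    · intro h0
      apply hline y
      rw [← hsq x0 _ (by simpa using hk), h0]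
      simp
    · rw [hT, hT]
      · simpa using hk
      · simp
      · simpa using hε k.re
      · simp
  have hlocal : ∀ k0 : ℂ, ∀ᶠ k in 𝓝 k0, R k.re k = R k0.re k := by
    intro k0
    have : ContinuousAt (fun k : ℂ => |k.re - k0.re|) k0 := by fun_prop
    filter_upwards [this.eventually (gt_mem_nhds (by simpa using hε k0.re :
      |k0.re - k0.re| < ε k0.re))] with k hk
    exact hagree k0.re k hk
  refine ⟨fun k => R k.re k, ?_, fun k _ => hsq _ _ (by simpa using hε k.re), ?_⟩
  · intro k0 hk0
    rw [H.cuts_neg_one] at hk0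
    have hne : k0 ∉ oddZeros L a := fun h => hk0 (H.oddZeros_subset_closure h)
    have hcut : k0 ∉ verticalCuts L a := fun h => hk0 (subset_closure h)
    rw [H.mem_verticalCuts_iff, not_and, Nat.not_odd_iff_even] at hcut
    have hev : Even (above L a k0).ncard := by
      have := H.even_add hne
      rcases Nat.even_or_odd (above L a k0).ncard with h | h
      · exact h
      · exact absurd this (Nat.not_even_iff_odd.2 ((hcut hne).add_odd h))
    obtain ⟨r, hr, hre⟩ := hl k0.re k0 rfl hne
    have : (fun k => R k.re k) =ᶠ[𝓝 k0] r := by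
      filter_upwards [hlocal k0, hre] with k h1 h2
      rw [h1]
      rcases le_or_gt k.re k0.re with h | h
      · exact h2.1 h
      · rw [h2.2 h, hev.neg_one_pow, one_mul]
    exact (this.differentiableAt_iff.2 hr.differentiableAt).differentiableWithinAt
  · intro k0 hk0 hs
    rw [H.cuts_neg_one] at hk0
    have him : k0.im ≠ 0 := fun h => hs (Or.inr ⟨rfl, hk0, h⟩)
    obtain ⟨hne, hodd⟩ := (H.mem_verticalCuts_iff k0).1 hk0
    have hodd' : Odd (above L a k0).ncard := by
      have := H.even_add hne
      rcases Nat.even_or_odd (above L a k0).ncard with h | h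
      · exact absurd this (Nat.not_even_iff_odd.2 (hodd.add_even h))
      · exact h
    obtain ⟨r, hr, hre⟩ := hl k0.re k0 rfl hne
    rw [analyticAt_iff_eventually_differentiableAt] at hr
    obtain ⟨η, hη, hb⟩ := eventually_nhds_iff_ball.1 (hr.and (hre.and (hlocal k0)))
    have hle : ∀ z ∈ ball k0 η, z.re ≤ k0.re → R z.re z = r z := fun z hz h => by
      rw [(hb z hz).2.2, (hb z hz).2.1.1 h]
    have hgt : ∀ z ∈ ball k0 η, k0.re < z.re → R z.re z = -r z := fun z hz h => by
      rw [(hb z hz).2.2, (hb z hz).2.1.2 h, hodd'.neg_one_pow, neg_one_mul]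
    have hrs : ∀ z ∈ ball k0 η, r z ^ 2 = disc4 L a z := fun z hz => by
      rw [← hsq z.re z (by simpa using hε z.re)]
      rcases le_or_gt z.re k0.re with h | h
      · rw [hle z hz h]
      · rw [hgt z hz h, neg_sq]
    have hrd : DifferentiableOn ℂ r (ball k0 η) := fun z hz =>
      (hb z hz).1.differentiableWithinAt
    rcases sides_of_im_ne him with ⟨h1, h2⟩ | ⟨h1, h2⟩
    · refine ⟨η, hη, fun z => -r z, hrd.neg, fun z hz => by rw [neg_sq, hrs z hz], ?_, ?_⟩
      · rw [h1]; exact fun z hz => hgt z hz.1 hz.2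
      · rw [h2]; exact fun z hz => by rw [neg_neg]; exact hle z hz.1 (le_of_lt hz.2)
    · refine ⟨η, hη, r, hrd, hrs, ?_, ?_⟩
      · rw [h1]; exact fun z hz => hle z hz.1 (le_of_lt hz.2)
      · rw [h2]; exact fun z hz => hgt z hz.1 hz.2

theorem IsDiscriminant.exists_branch (H : IsDiscriminant lam L a) : ∃ R, IsBranch lam L a R := by
  rcases H.lam_eq with rfl | rfl
  · exact exists_branch_defocusing H
  · exact exists_branch_focusing H

end Focusing

section Normalization

variable {lam L : ℝ} {a : ℂ → ℂ}

theorem halfInteger_notMem_disks (hL : 0 < L) (n : ℤ) :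
    ((((n : ℝ) + 1 / 2) * Real.pi / L : ℝ) : ℂ) ∉ disks L := by
  intro h
  obtain ⟨m, hm⟩ := mem_iUnion.1 h
  rw [mem_ball, Complex.dist_of_im_eq (by simp), ofReal_re, ofReal_re,
    Real.dist_eq] at hm
  have hπ := Real.pi_pos
  have e : ((n : ℝ) + 1 / 2) * Real.pi / L - m * Real.pi / L =
      ((2 * (n - m) + 1 : ℤ) : ℝ) * (Real.pi / (2 * L)) := by
    push_cast; field_simp; ring
  rw [e, abs_mul, abs_of_pos (by positivity : 0 < Real.pi / (2 * L)), ← Int.cast_abs] at hm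
  have h1 : (1 : ℤ) ≤ |2 * (n - m) + 1| := Int.one_le_abs (by omega)
  have h2 : (1 : ℝ) ≤ ((|2 * (n - m) + 1| : ℤ) : ℝ) := by exact_mod_cast h1
  have h3 : Real.pi / (2 * L) = 2 * (Real.pi / (4 * L)) := by field_simp; norm_num
  have h4 : 0 < Real.pi / (4 * L) := by positivity
  nlinarith

theorem exists_real_notMem_disks (hL : 0 < L) (K : ℝ) :
    ∃ k : ℂ, k.im = 0 ∧ k ∉ disks L ∧ K ≤ ‖k‖ := by
  obtain ⟨n, hn⟩ := exists_nat_gt (K * L / Real.pi)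
  have hπ := Real.pi_pos
  refine ⟨_, ofReal_im _, halfInteger_notMem_disks hL n, ?_⟩
  rw [Complex.norm_real, Real.norm_eq_abs]
  refine le_trans ?_ (le_abs_self _)
  rw [div_lt_iff₀ hπ] at hn
  rw [le_div_iff₀ hL]
  push_cast
  nlinarith

theorem isPreconnected_compl_disks (hL : 0 < L) {K : ℝ} (hK : 0 < K) :
    IsPreconnected {k : ℂ | k ∉ disks L ∧ K ≤ ‖k‖} := by
  set U : Set ℂ := {k : ℂ | (k ∉ disks L ∧ K ≤ ‖k‖) ∧ 0 ≤ k.im} with hU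
  set Y : ℝ := max K (Real.pi / (4 * L)) with hY
  have hYpos : 0 < Y := hK.trans_le (le_max_left _ _)
  have htop : {z : ℂ | Y ≤ z.im} ⊆ U := by
    intro z hz
    have hz : Y ≤ z.im := hz
    refine ⟨⟨fun hd => ?_, ?_⟩, hYpos.le.trans hz⟩
    · have := norm_im_le_of_mem_disks hd
      linarith [le_abs_self z.im, le_max_right K (Real.pi / (4 * L))]
    · linarith [le_abs_self z.im, le_max_left K (Real.pi / (4 * L)), abs_im_le_norm z]
  have hmono : ∀ (p : ℝ) (k z : ℂ), 0 ≤ k.im → z.re = k.re → k.im ≤ z.im → ‖k - p‖ ≤ ‖z - p‖ := by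
    intro p k z h0 h1 h2
    rw [← sq_le_sq₀ (norm_nonneg _) (norm_nonneg _), Complex.sq_norm, Complex.sq_norm,
      normSq_apply, normSq_apply]
    simp only [sub_re, sub_im, ofReal_re, ofReal_im, sub_zero, h1]
    nlinarith
  have hUp : IsPreconnected U := by
    refine isPreconnected_of_forall ((Y : ℂ) * I) fun k hk => ?_
    refine ⟨{z : ℂ | z.re = k.re ∧ k.im ≤ z.im} ∪ {z : ℂ | Y ≤ z.im}, ?_, ?_, ?_, ?_⟩
    · refine union_subset ?_ htop
      rintro z ⟨h1, h2⟩
      refine ⟨⟨fun hd => ?_, ?_⟩, hk.2.trans h2⟩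
      · apply hk.1.1
        obtain ⟨n, hn⟩ := mem_iUnion.1 hd
        refine mem_iUnion.2 ⟨n, ?_⟩
        rw [mem_ball, dist_eq_norm] at hn ⊢
        exact (hmono _ k z hk.2 h1 h2).trans_lt hn
      · have := hmono 0 k z hk.2 h1 h2
        simp only [Complex.ofReal_zero, sub_zero] at this
        exact hk.1.2.trans this
    · right; simp
    · left; exact ⟨rfl, le_rfl⟩
    · refine IsPreconnected.union ⟨k.re, max k.im Y⟩ ⟨rfl, le_max_left _ _⟩
        (show Y ≤ max k.im Y from le_max_right _ _) ?_ ?_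
      · have : Convex ℝ {z : ℂ | z.re = k.re ∧ k.im ≤ z.im} :=
          ((convex_singleton k.re).linear_preimage Complex.reLm).inter (convex_halfSpace_im_ge _)
        exact this.isPreconnected
      · exact (convex_halfSpace_im_ge _).isPreconnected
  have hLo : IsPreconnected ((fun z : ℂ => conj z) '' U) :=
    hUp.image _ continuous_conj.continuousOn
  obtain ⟨k1, h1, h2, h3⟩ := exists_real_notMem_disks hL K
  have hk1 : k1 ∈ U := ⟨⟨h2, h3⟩, h1.ge⟩
  have hk1' : k1 ∈ (fun z : ℂ => conj z) '' U := ⟨k1, hk1, conj_eq_iff_im.2 h1⟩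
  have := IsPreconnected.union k1 hk1 hk1' hUp hLo
  convert this using 1
  ext k
  constructor
  · rintro ⟨h1, h2⟩
    rcases le_total 0 k.im with h | h
    · exact Or.inl ⟨⟨h1, h2⟩, h⟩
    · refine Or.inr ⟨conj k, ⟨⟨conj_notMem_disks h1, by rwa [RCLike.norm_conj]⟩, by simpa using h⟩,
        by simp⟩
  · rintro (h | ⟨z, h, rfl⟩)
    · exact h.1
    · exact ⟨conj_notMem_disks h.1.1, by rw [RCLike.norm_conj]; exact h.1.2⟩

/-- `R` is the branch of the square root of `4 - Δ²` that is close to `2 sin (kL)` off the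
disks. -/
structure IsNormalizedRoot (lam L : ℝ) (a : ℂ → ℂ) (R : ℂ → ℂ) : Prop where
  diff : DifferentiableOn ℂ R (closure (cuts lam L a))ᶜ
  sq : ∀ k ∈ (closure (cuts lam L a))ᶜ, R k ^ 2 = disc4 L a k
  asymp : ∃ K > 0, ∃ C > 0, ∀ k ∉ disks L, K ≤ ‖k‖ → Complex.sin (k * L) ≠ 0 ∧ C / ‖k‖ ≤ 1 ∧
    k ∉ closure (cuts lam L a) ∧
    ‖R k - 2 * Complex.sin (k * L)‖ ≤ C / ‖k‖ * ‖Complex.sin (k * L)‖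

variable (H : IsDiscriminant lam L a)
include H

theorem IsDiscriminant.normalized_or_neg {R : ℂ → ℂ}
    (hd : DifferentiableOn ℂ R (closure (cuts lam L a))ᶜ)
    (hsq : ∀ k ∈ (closure (cuts lam L a))ᶜ, R k ^ 2 = disc4 L a k) :
    IsNormalizedRoot lam L a R ∨ IsNormalizedRoot lam L a fun k => -R k := by
  obtain ⟨K1, hK1, C, hC, h1⟩ := H.asymp
  obtain ⟨K2, hK2, h2⟩ := H.exists_notMem_closure
  set K := max K1 K2 with hK
  have hKpos : 0 < K := hK1.trans_le (le_max_left _ _)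
  have hL := H.pos
  have hpre := isPreconnected_compl_disks hL hKpos
  set U := {k : ℂ | k ∉ disks L ∧ K ≤ ‖k‖} with hU
  have hU1 : ∀ k ∈ U, Complex.sin (k * L) ≠ 0 ∧ C / ‖k‖ ≤ 1 ∧ k ∉ closure (cuts lam L a) ∧
      (‖R k - 2 * Complex.sin (k * L)‖ ≤ C / ‖k‖ * ‖Complex.sin (k * L)‖ ∨
       ‖-R k - 2 * Complex.sin (k * L)‖ ≤ C / ‖k‖ * ‖Complex.sin (k * L)‖) := by
    intro k hk
    obtain ⟨e1, e2, ρ, e3, e4⟩ := h1 k hk.1 ((le_max_left _ _).trans hk.2)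
    have e5 := h2 k hk.1 ((le_max_right _ _).trans hk.2)
    refine ⟨e1, e2, e5, ?_⟩
    rw [← hsq k e5, sq_eq_sq_iff_eq_or_eq_neg] at e3
    rcases e3 with h | h
    · left; rwa [← h]
    · right; rwa [← h]
  set S : ℂ → ℝ := fun k => (R k / Complex.sin (k * L)).re with hS
  have hSc : ContinuousOn S U := by
    refine continuous_re.comp_continuousOn (ContinuousOn.div ?_ (by fun_prop)
      fun k hk => (hU1 k hk).1)
    exact hd.continuousOn.mono fun k hk => (hU1 k hk).2.2.1
  have hre : ∀ (r s δ : ℂ) (c : ℝ), s ≠ 0 → c ≤ 1 → ‖r - 2 * s‖ ≤ c * ‖s‖ → 1 ≤ (r / s).re := by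
    intro r s _ c hs hc h
    have e : ‖r / s - 2‖ ≤ 1 := by
      have : r / s - 2 = (r - 2 * s) / s := by field_simp
      rw [this, norm_div, div_le_one (norm_pos_iff.2 hs)]
      nlinarith [norm_nonneg s]
    have := (abs_le.1 ((abs_re_le_norm _).trans e)).1
    rw [sub_re, re_ofNat] at this
    linarith
  have hdich : ∀ k ∈ U, (1 ≤ S k ∧
      ‖R k - 2 * Complex.sin (k * L)‖ ≤ C / ‖k‖ * ‖Complex.sin (k * L)‖) ∨ (S k ≤ -1 ∧
      ‖-R k - 2 * Complex.sin (k * L)‖ ≤ C / ‖k‖ * ‖Complex.sin (k * L)‖) := by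
    intro k hk
    obtain ⟨e1, e2, e3, e4 | e4⟩ := hU1 k hk
    · exact Or.inl ⟨hre _ _ 0 _ e1 e2 e4, e4⟩
    · refine Or.inr ⟨?_, e4⟩
      have := hre _ _ 0 _ e1 e2 e4
      rw [neg_div, neg_re] at this
      simp only [hS]
      linarith
  have hsame : ∀ k ∈ U, ∀ k' ∈ U, S k < 0 → 0 < S k' → False := by
    intro k hk k' hk' h h'
    obtain ⟨c, hc, hc0⟩ := hpre.intermediate_value hk hk' hSc ⟨h.le, h'.le⟩
    rcases hdich c hc with h | h <;> linarith [h.1]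
  obtain ⟨k1, -, g2, g3⟩ := exists_real_notMem_disks hL K
  have hk1 : k1 ∈ U := ⟨g2, g3⟩
  rcases hdich k1 hk1 with h | h
  · left
    refine ⟨hd, hsq, K, hKpos, C, hC, fun k hk hkK => ?_⟩
    obtain ⟨e1, e2, e3, -⟩ := hU1 k ⟨hk, hkK⟩
    refine ⟨e1, e2, e3, ?_⟩
    rcases hdich k ⟨hk, hkK⟩ with h' | h'
    · exact h'.2
    · exact (hsame k ⟨hk, hkK⟩ k1 hk1 (by linarith [h'.1]) (by linarith [h.1])).elim
  · right
    refine ⟨hd.neg, fun k hk => by rw [neg_sq, hsq k hk], K, hKpos, C, hC, fun k hk hkK => ?_⟩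
    obtain ⟨e1, e2, e3, -⟩ := hU1 k ⟨hk, hkK⟩
    refine ⟨e1, e2, e3, ?_⟩
    rcases hdich k ⟨hk, hkK⟩ with h' | h'
    · exact (hsame k1 hk1 k ⟨hk, hkK⟩ (by linarith [h.1]) (by linarith [h'.1])).elim
    · exact h'.2

theorem IsNormalizedRoot.eqOn {R R' : ℂ → ℂ} (hR : IsNormalizedRoot lam L a R)
    (hR' : IsNormalizedRoot lam L a R') : EqOn R R' (closure (cuts lam L a))ᶜ := by
  have hΩo : IsOpen (closure (cuts lam L a))ᶜ := isClosed_closure.isOpen_compl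
  have hL := H.pos
  obtain ⟨K, hK, C, hC, h⟩ := hR.asymp
  obtain ⟨K', hK', C', hC', h'⟩ := hR'.asymp
  have hgood : ∀ k : ℂ, k.im ≠ 0 → (∀ z, disc4 L a z = 0 → z.re ≠ k.re) → R k = R' k := by
    intro k him hz
    set τ : ℝ := ((SignType.sign k.im : SignType) : ℝ) with hτ
    have hτ1 : τ * k.im = |k.im| := sign_mul_self k.im
    set c : ℝ → ℂ := fun s => k + (τ * s : ℝ) * I with hc
    have hcim : ∀ s, (c s).im = k.im + τ * s := fun s => by simp [hc]
    have hcre : ∀ s, (c s).re = k.re := fun s => by simp [hc]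
    have hττ : τ * τ = 1 := by
      rcases lt_or_gt_of_ne him with h | h
      · simp [hτ, sign_neg h]
      · simp [hτ, sign_pos h]
    have habs : ∀ s, 0 ≤ s → s ≤ |(c s).im| ∧ (c s).im ≠ 0 := by
      intro s hs
      have e : τ * (c s).im = |k.im| + s := by
        rw [hcim]; linear_combination hτ1 + s * hττ
      have hk := abs_pos.2 him
      have e2 : |(c s).im| = |k.im| + s := by
        rw [← abs_of_pos (by linarith : 0 < |k.im| + s), ← e, abs_mul]
        have : |τ| = 1 := by
          rcases lt_or_gt_of_ne him with h | h
          · simp [hτ, sign_neg h]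
          · simp [hτ, sign_pos h]
        rw [this, one_mul]
      refine ⟨by linarith, abs_pos.1 (by linarith)⟩
    have hcΩ : ∀ s ∈ Ici (0 : ℝ), c s ∈ (closure (cuts lam L a))ᶜ := by
      intro s hs hcl
      rcases H.re_of_mem_closure_cuts hcl with h | ⟨z, hz0, hzr⟩
      · exact (habs s hs).2 h
      · exact hz z hz0 (by rw [hzr, hcre])
    have hcc : Continuous c := by fun_prop
    set s1 : ℝ := max (max K K') (Real.pi / (4 * L)) with hs1
    have hs1p : 0 ≤ s1 := hK.le.trans ((le_max_left _ _).trans (le_max_left _ _))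
    have hb := (habs s1 hs1p).1
    have hn := abs_im_le_norm (c s1)
    have hnd : c s1 ∉ disks L := fun hd => by
      have := norm_im_le_of_mem_disks hd
      linarith [le_max_right (max K K') (Real.pi / (4 * L))]
    have hKs : max K K' ≤ ‖c s1‖ := by
      linarith [le_max_left (max K K') (Real.pi / (4 * L))]
    obtain ⟨e1, e2, -, e3⟩ := h (c s1) hnd ((le_max_left _ _).trans hKs)
    obtain ⟨-, e2', -, e3'⟩ := h' (c s1) hnd ((le_max_right _ _).trans hKs)
    have heq1 : R (c s1) = R' (c s1) := by
      have hsq : R (c s1) ^ 2 = R' (c s1) ^ 2 := by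
        rw [hR.sq _ (hcΩ s1 hs1p), hR'.sq _ (hcΩ s1 hs1p)]
      rcases sq_eq_sq_iff_eq_or_eq_neg.1 hsq with h | h
      · exact h
      · exfalso
        rw [h] at e3
        set u := Complex.sin (c s1 * L)
        have h4 : ‖4 * u‖ ≤ ‖-R' (c s1) - 2 * u‖ + ‖R' (c s1) - 2 * u‖ := by
          rw [show 4 * u = -((-R' (c s1) - 2 * u) + (R' (c s1) - 2 * u)) by ring, norm_neg]
          exact norm_add_le _ _
        rw [norm_mul, Complex.norm_ofNat] at h4
        have := norm_pos_iff.2 e1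
        nlinarith
    have := IsPreconnected.eq_of_sq_eq (S := Ici (0 : ℝ)) isPreconnected_Ici
      (f := fun s => R (c s)) (g := fun s => R' (c s))
      (hR.diff.continuousOn.comp hcc.continuousOn hcΩ)
      (hR'.diff.continuousOn.comp hcc.continuousOn hcΩ)
      (fun s hs => by
        simp only [Pi.pow_apply]
        rw [hR.sq _ (hcΩ s hs), hR'.sq _ (hcΩ s hs)])
      (fun {s} hs h0 => by
        have := hR'.sq _ (hcΩ s hs)
        rw [h0] at this
        exact hz (c s) (by rw [← this]; simp) (hcre s)) (y := s1) hs1p heq1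
    have h0 := this (mem_Ici.2 le_rfl)
    simpa [hc] using h0
  have hdense := H.dense_good (P := ∅) finite_empty
  intro k hk
  have hcl := hdense.open_subset_closure_inter hΩo hk
  have hne := mem_closure_iff_nhdsWithin_neBot.1 hcl
  have c1 := (hR.diff.differentiableAt (hΩo.mem_nhds hk)).continuousAt
  have c2 := (hR'.diff.differentiableAt (hΩo.mem_nhds hk)).continuousAt
  refine @tendsto_nhds_unique _ _ _ _ _ _ _ _ hne (c1.tendsto.mono_left nhdsWithin_le_nhds)
    ((c2.tendsto.mono_left nhdsWithin_le_nhds).congr' ?_)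
  filter_upwards [self_mem_nhdsWithin] with z hz
  exact (hgood z hz.2.1 hz.2.2.2.1).symm

omit H in
theorem IsNormalizedRoot.isSqrtBranch {R : ℂ → ℂ} (hR : IsNormalizedRoot lam L a R) :
    IsSqrtBranch lam L a R := by
  refine ⟨hR.diff, hR.sq, ?_⟩
  obtain ⟨K, hK, C, hC, h⟩ := hR.asymp
  rw [IsEquivalent, isLittleO_iff]
  intro c hc
  rw [eventually_inf_principal]
  filter_upwards [tendsto_norm_cocompact_atTop.eventually_ge_atTop (max K (C / c))] with k hk hkd
  obtain ⟨-, -, -, h4⟩ := h k hkd.2 ((le_max_left _ _).trans hk)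
  have hkpos : 0 < ‖k‖ := hK.trans_le ((le_max_left _ _).trans hk)
  have h5 : C / ‖k‖ ≤ c := by
    have := (le_max_right K (C / c)).trans hk
    rw [div_le_iff₀ hc] at this
    rw [div_le_iff₀ hkpos]
    linarith
  refine h4.trans ?_
  rw [norm_mul, Complex.norm_ofNat]
  nlinarith [norm_nonneg (Complex.sin (k * L))]

theorem IsSqrtBranch.isNormalizedRoot {R : ℂ → ℂ} (hR : IsSqrtBranch lam L a R) :
    IsNormalizedRoot lam L a R := by
  obtain ⟨hd, hsq, heq⟩ := hR
  rcases H.normalized_or_neg hd hsq with h | h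
  · exact h
  · exfalso
    obtain ⟨K, hK, C, hC, h⟩ := h.asymp
    rw [IsEquivalent, isLittleO_iff] at heq
    have hev := heq (c := 1 / 2) (by norm_num)
    rw [eventually_inf_principal, ← Metric.cobounded_eq_cocompact] at hev
    obtain ⟨K', -, hK'⟩ := (Metric.hasBasis_cobounded_compl_closedBall (0 : ℂ)).mem_iff.1 hev
    obtain ⟨k, hk1, hk2, hk3⟩ := exists_real_notMem_disks H.pos (max K (K' + 1))
    obtain ⟨e1, e2, -, e3⟩ := h k hk2 ((le_max_left _ _).trans hk3)
    have e4 := hK' (show k ∈ (closedBall (0 : ℂ) K')ᶜ by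
      simp only [mem_compl_iff, mem_closedBall_zero_iff, not_le]
      linarith [(le_max_right K (K' + 1)).trans hk3]) ⟨hk1, hk2⟩
    set u := Complex.sin (k * L)
    simp only [Pi.sub_apply] at e4
    have h4 : ‖4 * u‖ ≤ ‖-R k - 2 * u‖ + ‖R k - 2 * u‖ := by
      rw [show 4 * u = -((-R k - 2 * u) + (R k - 2 * u)) by ring, norm_neg]
      exact norm_add_le _ _
    rw [norm_mul, Complex.norm_ofNat] at h4 e4
    have := norm_pos_iff.2 e1
    nlinarith

theorem IsDiscriminant.isNormalizedRoot_sqrtDiscr :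
    IsNormalizedRoot lam L a (sqrtDiscr lam L a) := by
  apply IsSqrtBranch.isNormalizedRoot H
  obtain ⟨R, hR⟩ := H.exists_branch
  refine Classical.epsilon_spec (p := IsSqrtBranch lam L a) ?_
  rcases H.normalized_or_neg hR.diff hR.sq with h | h
  · exact ⟨_, h.isSqrtBranch⟩
  · exact ⟨_, h.isSqrtBranch⟩

theorem IsDiscriminant.isBranch_sqrtDiscr : IsBranch lam L a (sqrtDiscr lam L a) := by
  have hN := H.isNormalizedRoot_sqrtDiscr
  have key : ∀ R, IsBranch lam L a R → IsNormalizedRoot lam L a R →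
      IsBranch lam L a (sqrtDiscr lam L a) := by
    intro R hB hR
    have heq := IsNormalizedRoot.eqOn H hN hR
    refine ⟨hN.diff, hN.sq, fun k0 hk0 hs => ?_⟩
    obtain ⟨ε, hε, r, h1, h2, h3, h4⟩ := hB.jump k0 hk0 hs
    obtain ⟨δ, hδ, hl⟩ := H.cuts_local hk0 hs
    have hoff : ∀ z ∈ ball k0 (min ε δ), ((z - k0) * conj (leftNormal k0)).re ≠ 0 →
        z ∈ (closure (cuts lam L a))ᶜ := by
      intro z hz hne hcl
      have hopen : IsOpen (ball k0 δ ∩ {z | ((z - k0) * conj (leftNormal k0)).re ≠ 0}) :=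
        isOpen_ball.inter (isOpen_ne_fun (by fun_prop) continuous_const)
      obtain ⟨w, hw, hwc⟩ := mem_closure_iff.1 hcl _ hopen
        ⟨ball_subset_ball (min_le_right _ _) hz, hne⟩
      exact hw.2 ((hl w hw.1).1 hwc)
    have hsub : ball k0 (min ε δ) ⊆ ball k0 ε :=
      ball_subset_ball (min_le_left _ _)
    refine ⟨min ε δ, lt_min hε hδ, r, h1.mono hsub, fun z hz => h2 z (hsub hz), fun z hz => ?_,
      fun z hz => ?_⟩
    · rw [heq (hoff z hz.1 (ne_of_gt hz.2)), h3 z ⟨hsub hz.1, hz.2⟩]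
    · rw [heq (hoff z hz.1 (ne_of_lt hz.2)), h4 z ⟨hsub hz.1, hz.2⟩]
  obtain ⟨R, hR⟩ := H.exists_branch
  rcases H.normalized_or_neg hR.diff hR.sq with h | h
  · exact key R hR h
  · refine key _ ⟨h.diff, h.sq, fun k0 hk0 hs => ?_⟩ h
    obtain ⟨ε, hε, r, h1, h2, h3, h4⟩ := hR.jump k0 hk0 hs
    exact ⟨ε, hε, fun z => -r z, h1.neg, fun z hz => by rw [neg_sq, h2 z hz],
      fun z hz => by rw [h3 z hz], fun z hz => by rw [h4 z hz]⟩

theorem IsDiscriminant.conj_sqrtDiscr {k : ℂ} (hk : k ∈ (closure (cuts lam L a))ᶜ) :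
    conj (sqrtDiscr lam L a (conj k)) = sqrtDiscr lam L a k := by
  have hN := H.isNormalizedRoot_sqrtDiscr
  have hΩo : IsOpen (closure (cuts lam L a))ᶜ := isClosed_closure.isOpen_compl
  have hcΩ : ∀ z, z ∈ (closure (cuts lam L a))ᶜ → conj z ∈ (closure (cuts lam L a))ᶜ :=
    fun z hz h => hz (H.conj_mem_closure_cuts.1 h)
  refine IsNormalizedRoot.eqOn (R := schwarz (sqrtDiscr lam L a)) H ⟨fun z hz => ?_,
    fun z hz => ?_, ?_⟩ hN hk
  · have h1 := (hN.diff.differentiableAt (hΩo.mem_nhds (hcΩ z hz))).conj_conj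
    have h2 : DifferentiableAt ℂ (schwarz (sqrtDiscr lam L a)) z := by
      simpa [schwarz, Function.comp_def] using! h1
    exact h2.differentiableWithinAt
  · rw [schwarz, ← map_pow, hN.sq _ (hcΩ z hz), conj_disc4]
  · obtain ⟨K, hK, C, hC, h⟩ := hN.asymp
    refine ⟨K, hK, C, hC, fun z hz hzK => ?_⟩
    obtain ⟨e1, e2, e3, e4⟩ := h (conj z) (conj_notMem_disks hz) (by rwa [RCLike.norm_conj])
    have hs : Complex.sin (z * L) = conj (Complex.sin (conj z * L)) := by
      rw [← Complex.sin_conj]; simp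
    rw [RCLike.norm_conj] at e2 e4
    refine ⟨by rw [hs]; simpa using e1, e2, fun h => e3 (H.conj_mem_closure_cuts.2 h), ?_⟩
    rw [hs, schwarz, RCLike.norm_conj]
    refine le_trans (le_of_eq ?_) e4
    rw [← RCLike.norm_conj]
    simp [conj_ofNat]

end Normalization

section Gamma

variable {lam L x t : ℝ} {a b : ℂ → ℂ} {Ψ : ℂ → Mat2} {qv : ℂ}

theorem eL_eq (L : ℝ) (k : ℂ) : eL L k = exp (I * k * L) ^ 2 := by
  rw [eL, ← Complex.exp_nat_mul]; congr 1; push_cast; ring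

theorem eLInv_eq (L : ℝ) (k : ℂ) : eLInv L k = exp (-(I * k * L)) ^ 2 := by
  rw [eLInv, ← Complex.exp_nat_mul]; congr 1; push_cast; ring

theorem eL_mul_eLInv (L : ℝ) (k : ℂ) : eL L k * eLInv L k = 1 := by
  rw [eL, eLInv, ← Complex.exp_add]; simp

/-- The function `E` built with the value `r` of the square root. -/
def bigE (L : ℝ) (a : ℂ → ℂ) (r k : ℂ) : ℂ := exp (I * k * L) * (discr L a k - I * r) / 2

/-- The reciprocal of `E` built with the value `r` of the square root. -/
def bigE' (L : ℝ) (a : ℂ → ℂ) (r k : ℂ) : ℂ := exp (-(I * k * L)) * (discr L a k + I * r) / 2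

theorem bigE_mul_bigE' {r k : ℂ} (hr : r ^ 2 = disc4 L a k) : bigE L a r k * bigE' L a r k = 1 := by
  have h := exp_neg_mul_exp (I * k * L)
  rw [disc4] at hr
  simp only [bigE, bigE']
  linear_combination (discr L a k ^ 2 + r ^ 2) / 4 * h + hr / 4 -
    exp (-(I * k * L)) * exp (I * k * L) * r ^ 2 / 4 * I_sq

theorem bigE_add (L : ℝ) (a : ℂ → ℂ) (r k : ℂ) :
    bigE L a r k + eL L k * bigE' L a r k = a k + eL L k * schwarz a k := by
  have h := exp_neg_mul_exp (I * k * L)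
  rw [eL_eq]
  simp only [bigE, bigE', discr]
  linear_combination (exp (I * k * L) * (a k * exp (-(I * k * L)) + schwarz a k * exp (I * k * L) +
    I * r) / 2 + a k) * h

theorem bigE_neg (L : ℝ) (a : ℂ → ℂ) (r k : ℂ) : bigE L a (-r) k = eL L k * bigE' L a r k := by
  have h := exp_neg_mul_exp (I * k * L)
  rw [eL_eq]
  simp only [bigE, bigE']
  linear_combination (-exp (I * k * L) * (discr L a k + I * r) / 2) * h

theorem bigE'_neg (L : ℝ) (a : ℂ → ℂ) (r k : ℂ) : bigE' L a (-r) k = eLInv L k * bigE L a r k := by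
  have h := exp_neg_mul_exp (I * k * L)
  rw [eLInv_eq]
  simp only [bigE, bigE']
  linear_combination (-exp (-(I * k * L)) * (discr L a k - I * r) / 2) * h

theorem conj_bigE (L : ℝ) (a : ℂ → ℂ) (r k : ℂ) :
    conj (bigE L a r (conj k)) = bigE' L a (conj r) k := by
  simp only [bigE, bigE', map_div₀, map_mul, map_sub, conj_discr, conj_exp_I_mul, conj_I,
    conj_ofNat]
  ring

theorem conj_bigE' (L : ℝ) (a : ℂ → ℂ) (r k : ℂ) :
    conj (bigE' L a r (conj k)) = bigE L a (conj r) k := by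
  simp only [bigE, bigE', map_div₀, map_mul, map_add, conj_discr, conj_exp_neg_I_mul, conj_I,
    conj_ofNat]
  ring

theorem conj_eL (L : ℝ) (k : ℂ) : conj (eL L (conj k)) = eLInv L k := by
  simp [eL, eLInv, ← exp_conj, conj_ofNat]

/-- The relations between `Γ̃`, `E`, `1 / E` and the spectral functions at `k`. -/
structure GammaRel (lam L : ℝ) (a b : ℂ → ℂ) (k r G : ℂ) : Prop where
  one : lam * schwarz b k * G = schwarz a k - bigE' L a r k
  two : a k * G - b k = eL L k * bigE' L a r k * G

/-- The relations between the conjugate of `Γ̃`, `E`, `1 / E` and the spectral functions at `k`. -/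
structure GammaBarRel (lam L : ℝ) (a b : ℂ → ℂ) (k r G : ℂ) : Prop where
  one : lam * b k * G = a k - bigE L a r k
  two : schwarz a k * G - schwarz b k = eLInv L k * bigE L a r k * G

theorem GammaRel.conj {k r G : ℂ} (h : GammaRel lam L a b (conj k) r G) :
    GammaBarRel lam L a b k (conj r) (conj G) := by
  have h1 := congrArg conj h.one
  have h2 := congrArg conj h.two
  simp only [map_mul, map_sub, Complex.conj_ofReal, conj_bigE', conj_eL] at h1 h2
  constructor
  · simpa [schwarz] using h1
  · exact h2

theorem exists_analytic_quotient {N B f : ℂ → ℂ} {k0 : ℂ} {l : Filter ℂ} [l.NeBot]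
    (hl : l ≤ 𝓝[≠] k0) (hN : AnalyticAt ℂ N k0) (hB : AnalyticAt ℂ B k0)
    (hB0 : ∀ᶠ z in 𝓝[≠] k0, B z ≠ 0) (hf : f =O[l] fun _ => (1 : ℂ))
    (hfB : ∀ᶠ z in l, B z * f z = N z) :
    ∃ G, AnalyticAt ℂ G k0 ∧ ∀ᶠ z in 𝓝 k0, B z * G z = N z := by
  by_cases hNtop : analyticOrderAt N k0 = ⊤
  · refine ⟨0, analyticAt_const, ?_⟩
    filter_upwards [analyticOrderAt_eq_top.1 hNtop] with z hz
    simp [hz]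
  have hBtop : analyticOrderAt B k0 ≠ ⊤ := fun h => by
    have h1 := (analyticOrderAt_eq_top.1 h).filter_mono (nhdsWithin_le_nhds (s := {k0}ᶜ))
    obtain ⟨z, h2, h3⟩ := (h1.and hB0).exists
    exact h3 h2
  obtain ⟨n, hn⟩ := ENat.ne_top_iff_exists.1 hNtop
  obtain ⟨m, hm⟩ := ENat.ne_top_iff_exists.1 hBtop
  obtain ⟨N1, hN1, hN0, hNe⟩ := hN.analyticOrderAt_eq_natCast.1 hn.symm
  obtain ⟨B1, hB1, hB10, hBe⟩ := hB.analyticOrderAt_eq_natCast.1 hm.symm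
  have hB1ne : ∀ᶠ z in 𝓝 k0, B1 z ≠ 0 := hB1.continuousAt.eventually_ne hB10
  rcases le_or_gt m n with hmn | hmn
  · refine ⟨fun z => (z - k0) ^ (n - m) * N1 z / B1 z,
      (((analyticAt_id.sub analyticAt_const).pow _).mul hN1).div hB1 hB10, ?_⟩
    filter_upwards [hNe, hBe, hB1ne] with z h1 h2 h3
    rw [h1, h2, smul_eq_mul, smul_eq_mul]
    obtain ⟨d, rfl⟩ := Nat.exists_eq_add_of_le hmn
    rw [Nat.add_sub_cancel_left]
    field_simp
    ring
  · exfalso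
    obtain ⟨d, rfl⟩ := Nat.exists_eq_add_of_lt hmn
    have hl' : l ≤ 𝓝 k0 := hl.trans nhdsWithin_le_nhds
    have hne : ∀ᶠ z in l, z ≠ k0 := hl self_mem_nhdsWithin
    have e : ∀ᶠ z in l, (z - k0) ^ (d + 1) * B1 z * f z = N1 z := by
      filter_upwards [hl' hNe, hl' hBe, hfB, hne] with z h1 h2 h3 h4
      have h4 : z - k0 ≠ 0 := sub_ne_zero.2 h4
      rw [h1, h2, smul_eq_mul, smul_eq_mul, pow_add, pow_add] at h3
      apply mul_left_cancel₀ (pow_ne_zero n h4)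
      rw [← h3, pow_add]
      ring
    have h0 : Tendsto (fun z => (z - k0) ^ (d + 1) * B1 z) l (𝓝 0) := by
      have : ContinuousAt (fun z => (z - k0) ^ (d + 1) * B1 z) k0 :=
        (by fun_prop : ContinuousAt (fun z => (z - k0) ^ (d + 1)) k0).mul hB1.continuousAt
      have := this.tendsto.mono_left hl'
      simpa using this
    have h1 : (fun z => (z - k0) ^ (d + 1) * B1 z * f z) =o[l] fun _ => (1 : ℂ) := by
      simpa using ((isLittleO_one_iff ℂ).2 h0).mul_isBigO hf
    have h2 := ((isLittleO_one_iff ℂ).1 h1).congr' e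
    exact hN0 (tendsto_nhds_unique (hN1.continuousAt.tendsto.mono_left hl') h2)

theorem eventually_ne_of_ne_zero {f : ℂ → ℂ} (hf : Differentiable ℂ f) (h0 : f ≠ 0) (k0 : ℂ) :
    ∀ᶠ z in 𝓝[≠] k0, f z ≠ 0 := by
  rcases (hf.analyticAt k0).eventually_eq_zero_or_eventually_ne_zero with h | h
  · exact absurd ((hf.differentiableOn.analyticOnNhd isOpen_univ).eq_of_eventuallyEq
      (g := 0) (fun _ _ => analyticAt_const) h) h0
  · exact h

theorem schwarz_ne_zero {f : ℂ → ℂ} (h0 : f ≠ 0) : schwarz f ≠ 0 := fun h => h0 <| by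
  ext k
  have := congrFun h (conj k)
  simpa [schwarz] using this

variable (D : IsSpectralData lam L x t a b Ψ qv) (H : IsDiscriminant lam L a)

include D H in
/-- Near infinity off the disks the square root is given by the Floquet multipliers. -/
theorem IsSpectralData.exists_bloch_root : ∃ K > 0, ∃ C > 0, ∀ k ∉ disks L, K ≤ ‖k‖ →
    C / ‖k‖ ≤ 1 ∧ k ∉ closure (cuts lam L a) ∧ sqrtDiscr lam L a k ≠ 0 ∧
    ∃ g h γ γ' d d' w w', IsBlochPair lam L x t a b Ψ qv (C / ‖k‖) k g h γ γ' d d' w w' ∧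
      sqrtDiscr lam L a k = -I * (exp (I * k * L) * w - exp (-(I * k * L)) * w') ∧
      w' = bigE L a (sqrtDiscr lam L a k) k ∧ w = bigE' L a (sqrtDiscr lam L a k) k := by
  obtain ⟨K1, hK1, C1, hC1, h1⟩ := D.exists_root H.lam_eq H.pos
  obtain ⟨K2, hK2, C2, hC2, h2⟩ := H.isNormalizedRoot_sqrtDiscr.asymp
  refine ⟨max (max K1 K2) (2 * (C1 + C2)), by positivity, C1, hC1, fun k hk hkK => ?_⟩
  have hkK1 := (le_max_left _ _).trans ((le_max_left _ _).trans hkK)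
  have hkK2 := (le_max_right _ _).trans ((le_max_left _ _).trans hkK)
  have hkC := (le_max_right _ _).trans hkK
  have hkpos : 0 < ‖k‖ := hK1.trans_le hkK1
  obtain ⟨hs, hc1, g, h, γ, γ', d, d', w, w', hB, hw, hsum, hsq, hclose⟩ := h1 k hk hkK1
  obtain ⟨-, hc2, hcl, hR⟩ := h2 k hk hkK2
  set R := sqrtDiscr lam L a k
  set u := Complex.sin (k * L)
  set ρ := -I * (exp (I * k * L) * w - exp (-(I * k * L)) * w')
  have hu : 0 < ‖u‖ := norm_pos_iff.2 hs
  have hhalf : C1 / ‖k‖ + C2 / ‖k‖ ≤ 1 / 2 := by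
    rw [← add_div, div_le_iff₀ hkpos]; linarith
  have hsq2 : R ^ 2 = ρ ^ 2 := by
    rw [hsq]; exact H.isNormalizedRoot_sqrtDiscr.sq k hcl
  have hRρ : R = ρ := by
    rcases sq_eq_sq_iff_eq_or_eq_neg.1 hsq2 with h | h
    · exact h
    · exfalso
      rw [h] at hR
      have h4 : ‖4 * u‖ ≤ ‖-ρ - 2 * u‖ + ‖ρ - 2 * u‖ := by
        rw [show 4 * u = -((-ρ - 2 * u) + (ρ - 2 * u)) by ring, norm_neg]
        exact norm_add_le _ _
      rw [norm_mul, Complex.norm_ofNat] at h4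
      nlinarith
  have hR0 : R ≠ 0 := fun h0 => by
    have hC2k : 0 < C1 / ‖k‖ := by positivity
    rw [h0, zero_sub, norm_neg, norm_mul, Complex.norm_ofNat] at hR
    nlinarith
  have he := exp_neg_mul_exp (I * k * L)
  refine ⟨hc1, hcl, hR0, g, h, γ, γ', d, d', w, w', hB, hRρ, ?_, ?_⟩
  · rw [bigE, ← hsum, hRρ]
    linear_combination (-w') * he + exp (I * k * L) *
      (exp (I * k * L) * w - exp (-(I * k * L)) * w') / 2 * (-I_sq)
  · rw [bigE', ← hsum, hRρ]
    linear_combination (-w) * he + exp (-(I * k * L)) *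
      (exp (I * k * L) * w - exp (-(I * k * L)) * w') / 2 * I_sq

include D H in
theorem IsSpectralData.sqrtDiscr_of_eq_zero (hb : b = 0) {k : ℂ}
    (hk : k ∈ (closure (cuts lam L a))ᶜ) : bigE' L a (sqrtDiscr lam L a k) k = schwarz a k := by
  have hda := D.diff_a
  have hds := differentiable_schwarz hda
  have hsb : schwarz b = 0 := by ext z; simp [schwarz, hb]
  have hN := H.isNormalizedRoot_sqrtDiscr
  set R' : ℂ → ℂ := fun k => -I * (schwarz a k * exp (I * k * L) - a k * exp (-(I * k * L)))
  have hR' : IsNormalizedRoot lam L a R' := by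
    refine ⟨Differentiable.differentiableOn (by fun_prop), fun z _ => ?_, ?_⟩
    · have hdet := D.det_s z
      simp only [hb, Pi.zero_apply, mul_zero, zero_mul, sub_zero] at hdet
      have he := exp_neg_mul_exp (I * z * L)
      simp only [R', disc4, discr]
      linear_combination 4 * he * (a z * schwarz a z) + 4 * hdet +
        (schwarz a z * exp (I * z * L) - a z * exp (-(I * z * L))) ^ 2 * I_sq
    · obtain ⟨K, hK, C, hC, h⟩ := hN.asymp
      obtain ⟨K', hK', C', hC', h'⟩ := D.exists_bloch_root H
      refine ⟨max K K', by positivity, C, hC, fun z hz hzK => ?_⟩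
      obtain ⟨e1, e2, e3, e4⟩ := h z hz ((le_max_left _ _).trans hzK)
      obtain ⟨-, -, -, g, h, γ, γ', d, d', w, w', hB, hR, -⟩ :=
        h' z hz ((le_max_right _ _).trans hzK)
      refine ⟨e1, e2, e3, ?_⟩
      have r2 := hB.row2
      have r3 := hB.row3
      rw [hsb] at r2
      rw [hb] at r3
      simp only [Pi.zero_apply, mul_zero, zero_mul, neg_zero, zero_add, sub_zero] at r2 r3
      have : R' z = sqrtDiscr lam L a z := by
        rw [hR]; simp only [R']; linear_combination (-I) * r2 + I * r3
      rwa [this]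
  have := IsNormalizedRoot.eqOn H hN hR' hk
  rw [this]
  have he := exp_neg_mul_exp (I * k * L)
  simp only [bigE', R', discr]
  linear_combination schwarz a k * he - exp (-(I * k * L)) *
    (schwarz a k * exp (I * k * L) - a k * exp (-(I * k * L))) / 2 * I_sq

include H in
theorem IsDiscriminant.analyticAt_sqrtDiscr {k : ℂ} (hk : k ∈ (closure (cuts lam L a))ᶜ) :
    AnalyticAt ℂ (sqrtDiscr lam L a) k :=
  H.isNormalizedRoot_sqrtDiscr.diff.analyticAt (isClosed_closure.isOpen_compl.mem_nhds hk)

theorem analyticAt_exp_lin (L : ℝ) (k : ℂ) : AnalyticAt ℂ (fun k => exp (I * k * L)) k :=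
  (by fun_prop : Differentiable ℂ fun k : ℂ => exp (I * k * L)).analyticAt k

theorem analyticAt_exp_neg_lin (L : ℝ) (k : ℂ) : AnalyticAt ℂ (fun k => exp (-(I * k * L))) k :=
  (by fun_prop : Differentiable ℂ fun k : ℂ => exp (-(I * k * L))).analyticAt k

include H in
theorem IsDiscriminant.analyticAt_bigE {r : ℂ → ℂ} {k : ℂ} (hr : AnalyticAt ℂ r k) :
    AnalyticAt ℂ (fun z => bigE L a (r z) z) k :=
  ((analyticAt_exp_lin L k).mul ((H.diff.analyticAt k).sub (analyticAt_const.mul hr))).div_const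

include H in
theorem IsDiscriminant.analyticAt_bigE' {r : ℂ → ℂ} {k : ℂ} (hr : AnalyticAt ℂ r k) :
    AnalyticAt ℂ (fun z => bigE' L a (r z) z) k :=
  ((analyticAt_exp_neg_lin L k).mul ((H.diff.analyticAt k).add (analyticAt_const.mul hr))).div_const

include D H in
theorem IsSpectralData.meromorphicOn_gammaQuotient :
    MeromorphicOn (gammaQuotient lam L a b) (closure (cuts lam L a))ᶜ := by
  intro k hk
  have h1 := (D.diff_a.analyticAt k).meromorphicAt
  have h2 := ((differentiable_schwarz D.diff_a).analyticAt k).meromorphicAt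
  have h3 := ((differentiable_schwarz D.diff_b).analyticAt k).meromorphicAt
  have h4 := (analyticAt_exp_lin L k).meromorphicAt
  have h5 := (analyticAt_exp_neg_lin L k).meromorphicAt
  have h6 := (H.analyticAt_sqrtDiscr hk).meromorphicAt
  exact ((MeromorphicAt.const _ _).div (((MeromorphicAt.const _ _).mul h4).mul h3)).mul
    (((h2.mul h4).sub (h1.mul h5)).sub ((MeromorphicAt.const _ _).mul h6))

include D H in
theorem IsSpectralData.gammaT_eq_of_analyticAt {k : ℂ} (hk : k ∈ (closure (cuts lam L a))ᶜ)
    (h : AnalyticAt ℂ (gammaQuotient lam L a b) k) :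
    gammaT lam L a b k = gammaQuotient lam L a b k := by
  rw [gammaT, toMeromorphicNFOn_eq_toMeromorphicNFAt (D.meromorphicOn_gammaQuotient H) hk,
    toMeromorphicNFAt_eq_self.2 h.meromorphicNFAt]

include D H in
theorem IsSpectralData.gammaT_of_eq_zero (hb : b = 0) {k : ℂ}
    (hk : k ∈ (closure (cuts lam L a))ᶜ) : gammaT lam L a b k = 0 := by
  have h0 : gammaQuotient lam L a b = fun _ => 0 := by
    ext z; simp [gammaQuotient, schwarz, hb]
  rw [D.gammaT_eq_of_analyticAt H hk (by rw [h0]; exact analyticAt_const), h0]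

include D H in
theorem IsSpectralData.mul_gammaT {k : ℂ} (hk : k ∈ (closure (cuts lam L a))ᶜ)
    (hb : schwarz b k ≠ 0) : lam * schwarz b k * gammaT lam L a b k =
      schwarz a k - bigE' L a (sqrtDiscr lam L a k) k := by
  have hden : 2 * exp (I * k * L) * schwarz b k ≠ 0 :=
    mul_ne_zero (mul_ne_zero two_ne_zero (Complex.exp_ne_zero _)) hb
  have han : AnalyticAt ℂ (gammaQuotient lam L a b) k := by
    have h1 := D.diff_a.analyticAt k
    have h2 := (differentiable_schwarz D.diff_a).analyticAt k
    have h3 := (differentiable_schwarz D.diff_b).analyticAt k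
    exact (analyticAt_const.div ((analyticAt_const.mul (analyticAt_exp_lin L k)).mul h3) hden).mul
      (((h2.mul (analyticAt_exp_lin L k)).sub (h1.mul (analyticAt_exp_neg_lin L k))).sub
      (analyticAt_const.mul (H.analyticAt_sqrtDiscr hk)))
  rw [D.gammaT_eq_of_analyticAt H hk han]
  have he := exp_neg_mul_exp (I * k * L)
  have hll := lam_mul_lam H.lam_eq
  have he0 := Complex.exp_ne_zero (I * k * L)
  rw [gammaQuotient, div_mul_eq_mul_div, mul_div_assoc', div_eq_iff hden]
  simp only [bigE', discr]
  linear_combination schwarz b k * (schwarz a k * exp (I * k * L) - a k * exp (-(I * k * L)) -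
    I * sqrtDiscr lam L a k) * hll + schwarz b k * (a k * exp (-(I * k * L)) +
    schwarz a k * exp (I * k * L) + I * sqrtDiscr lam L a k) * he

include D H in
theorem IsSpectralData.gammaRel_of_one {k r G : ℂ} (hr : r ^ 2 = disc4 L a k)
    (hb : schwarz b k ≠ 0) (h : lam * schwarz b k * G = schwarz a k - bigE' L a r k) :
    GammaRel lam L a b k r G := by
  refine ⟨h, ?_⟩
  have h1 := bigE_mul_bigE' hr
  have h2 := bigE_add L a r k
  have hdet := D.det_s k
  have hl : (lam : ℂ) * schwarz b k ≠ 0 :=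
    mul_ne_zero (fun h0 => by simpa [h0] using lam_mul_lam H.lam_eq) hb
  apply mul_left_cancel₀ hl
  linear_combination (a k - eL L k * bigE' L a r k) * h + hdet - h1 + bigE' L a r k * h2

include D H in
/-- Analytic continuation of `Γ̃` from one side of a point near which it is bounded. -/
theorem IsSpectralData.exists_gamma_extension {k0 : ℂ} {l : Filter ℂ} [l.NeBot]
    (hl : l ≤ 𝓝[≠] k0) {r : ℂ → ℂ} (hr : AnalyticAt ℂ r k0)
    (hr2 : ∀ᶠ z in 𝓝 k0, r z ^ 2 = disc4 L a z)
    (hlr : ∀ᶠ z in l, z ∈ (closure (cuts lam L a))ᶜ ∧ sqrtDiscr lam L a z = r z)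
    (hbd : gammaT lam L a b =O[l] fun _ => (1 : ℂ)) :
    ∃ G, AnalyticAt ℂ G k0 ∧ (∀ᶠ z in 𝓝 k0, GammaRel lam L a b z (r z) (G z)) ∧
      ∀ᶠ z in 𝓝[≠] k0, z ∈ (closure (cuts lam L a))ᶜ → sqrtDiscr lam L a z = r z →
        gammaT lam L a b z = G z := by
  have ha' := (differentiable_schwarz D.diff_a).analyticAt k0
  by_cases hb : b = 0
  · have hsb : schwarz b = 0 := by ext z; simp [schwarz, hb]
    refine ⟨fun _ => 0, analyticAt_const, ?_, Eventually.of_forall fun z hz _ =>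
      D.gammaT_of_eq_zero H hb hz⟩
    have hev : ∀ᶠ z in l, bigE' L a (r z) z = schwarz a z := by
      filter_upwards [hlr] with z hz
      rw [← hz.2, D.sqrtDiscr_of_eq_zero H hb hz.1]
    have := (AnalyticAt.frequently_eq_iff_eventually_eq (H.analyticAt_bigE' hr) ha').1
      (hev.frequently.filter_mono hl)
    filter_upwards [this] with z hz
    constructor <;> simp [hz, hb]
  · have hsb := eventually_ne_of_ne_zero (differentiable_schwarz D.diff_b) (schwarz_ne_zero hb) k0
    have hl0 : (lam : ℂ) ≠ 0 := fun h0 => by simpa [h0] using lam_mul_lam H.lam_eq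
    have hB : AnalyticAt ℂ (fun z => (lam : ℂ) * schwarz b z) k0 :=
      analyticAt_const.mul ((differentiable_schwarz D.diff_b).analyticAt k0)
    obtain ⟨G, hG, hGe⟩ := exists_analytic_quotient hl (ha'.sub (H.analyticAt_bigE' hr)) hB
      (hsb.mono fun z hz => mul_ne_zero hl0 hz) hbd (by
        filter_upwards [hlr, hl hsb] with z h1 h2
        rw [Pi.sub_apply, ← h1.2]
        exact D.mul_gammaT H h1.1 h2)
    have hone : ∀ᶠ z in 𝓝 k0, lam * schwarz b z * G z = schwarz a z - bigE' L a (r z) z := hGe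
    refine ⟨G, hG, ?_, ?_⟩
    · have h2 : ∀ᶠ z in 𝓝[≠] k0, a z * G z - b z = eL L z * bigE' L a (r z) z * G z := by
        filter_upwards [nhdsWithin_le_nhds hone, nhdsWithin_le_nhds hr2, hsb] with z h1 h2 h3
        exact (D.gammaRel_of_one H h2 h3 h1).two
      have han1 : AnalyticAt ℂ (fun z => a z * G z - b z) k0 :=
        ((D.diff_a.analyticAt k0).mul hG).sub (D.diff_b.analyticAt k0)
      have hdL : Differentiable ℂ (eL L) := by unfold eL; fun_prop
      have han2 : AnalyticAt ℂ (fun z => eL L z * bigE' L a (r z) z * G z) k0 :=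
        ((hdL.analyticAt k0).mul (H.analyticAt_bigE' hr)).mul hG
      have h3 := (AnalyticAt.frequently_eq_iff_eventually_eq han1 han2).1 h2.frequently
      filter_upwards [hone, h3] with z e1 e2
      exact ⟨e1, e2⟩
    · filter_upwards [nhdsWithin_le_nhds hone, hsb] with z h1 h2 h3 h4
      apply mul_left_cancel₀ (mul_ne_zero hl0 h2)
      rw [D.mul_gammaT H h3 h2, h1, h4]

end Gamma

section LocalBoundary

variable {lam L x t : ℝ} {a b : ℂ → ℂ} {Ψ : ℂ → Mat2} {qv : ℂ}

theorem normSq_leftNormal (k : ℂ) : leftNormal k * conj (leftNormal k) = 1 := by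
  rcases leftNormal_cases k with h | h | h | h <;> simp [h]

theorem tendsto_add_mul_leftNormal (k c : ℂ) :
    Tendsto (fun s : ℝ => k + s * c) (𝓝[>] 0) (𝓝 k) := by
  have : ContinuousAt (fun s : ℝ => k + s * c) 0 := by fun_prop
  have := this.tendsto
  simp only [Complex.ofReal_zero, zero_mul, add_zero] at this
  exact this.mono_left nhdsWithin_le_nhds

instance plusSide_neBot (k : ℂ) : (𝓝[plusSide k] k).NeBot := by
  refine ((tendsto_nhdsWithin_iff.2 ⟨tendsto_add_mul_leftNormal k (leftNormal k), ?_⟩) :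
    Tendsto _ (𝓝[>] (0 : ℝ)) (𝓝[plusSide k] k)).neBot
  filter_upwards [self_mem_nhdsWithin] with s hs
  have e : (k + s * leftNormal k - k) * conj (leftNormal k) = s := by
    linear_combination s * normSq_leftNormal k
  change 0 < ((k + s * leftNormal k - k) * conj (leftNormal k)).re
  rw [e]
  exact hs

instance minusSide_neBot (k : ℂ) : (𝓝[minusSide k] k).NeBot := by
  refine ((tendsto_nhdsWithin_iff.2 ⟨tendsto_add_mul_leftNormal k (-leftNormal k), ?_⟩) :
    Tendsto _ (𝓝[>] (0 : ℝ)) (𝓝[minusSide k] k)).neBot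
  filter_upwards [self_mem_nhdsWithin] with s hs
  have e : (k + s * -leftNormal k - k) * conj (leftNormal k) = -s := by
    linear_combination (-s) * normSq_leftNormal k
  change ((k + s * -leftNormal k - k) * conj (leftNormal k)).re < 0
  rw [e, ← Complex.ofReal_neg]
  exact neg_neg_of_pos hs

theorem nhdsWithin_plusSide_le (k : ℂ) : 𝓝[plusSide k] k ≤ 𝓝[≠] k :=
  nhdsWithin_mono _ fun z hz h => by
    rw [mem_singleton_iff.1 h] at hz
    simp [plusSide] at hz

theorem nhdsWithin_minusSide_le (k : ℂ) : 𝓝[minusSide k] k ≤ 𝓝[≠] k :=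
  nhdsWithin_mono _ fun z hz h => by
    rw [mem_singleton_iff.1 h] at hz
    simp [minusSide] at hz

theorem analyticAt_schwarz {f : ℂ → ℂ} {k : ℂ} (hf : AnalyticAt ℂ f (conj k)) :
    AnalyticAt ℂ (schwarz f) k := by
  rw [analyticAt_iff_eventually_differentiableAt] at hf ⊢
  filter_upwards [(continuous_conj.tendsto k).eventually hf] with z hz
  simpa [schwarz, Function.comp_def] using! hz.conj_conj

theorem eventually_conj {p : ℂ → Prop} {k : ℂ} (h : ∀ᶠ z in 𝓝 (conj k), p z) :
    ∀ᶠ z in 𝓝 k, p (conj z) := (continuous_conj.tendsto k).eventually h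

variable (H : IsDiscriminant lam L a)
include H

theorem IsDiscriminant.conj_mem_contour {k : ℂ} (hk : k ∈ contour lam L a) :
    conj k ∈ contour lam L a := by
  rcases hk with hk | hk
  · left
    exact hk.imp (fun h => by simp [h]) fun h => by simp [h]
  · exact Or.inr (H.conj_mem_closure_cuts.2 hk)

omit H in
theorem mem_cuts_or_notMem_closure {k : ℂ} (hk : k ∈ contourStar lam L a) :
    k ∈ cuts lam L a ∨ k ∉ closure (cuts lam L a) := by
  by_contra h
  push Not at h
  exact hk.2 (Or.inl ⟨h.2, h.1⟩)

theorem IsDiscriminant.contourStar_local {k0 : ℂ} (hk0 : k0 ∈ contourStar lam L a) :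
    ∀ᶠ z in 𝓝 k0, (z ∈ contour lam L a ↔ ((z - k0) * conj (leftNormal k0)).re = 0) ∧
      (z ∈ closure (cuts lam L a) → ((z - k0) * conj (leftNormal k0)).re = 0) ∧
      (((z - k0) * conj (leftNormal k0)).re = 0 → z ∈ contourStar lam L a ∧
        leftNormal z = leftNormal k0 ∧ (z ∈ cuts lam L a ↔ k0 ∈ cuts lam L a)) := by
  have hs : k0 ∉ selfIntersections lam L a := fun h => hk0.2 (Or.inr h)
  have h0 : k0 ≠ 0 := fun h => hs (Or.inl h)
  have hcont : Continuous fun z => ((z - k0) * conj (leftNormal k0)).re := by fun_prop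
  -- near `k0` the closure of the cuts is either empty or the whole line
  have hcuts : ∀ᶠ z in 𝓝 k0,
      (k0 ∈ cuts lam L a → (z ∈ cuts lam L a ↔ ((z - k0) * conj (leftNormal k0)).re = 0)) ∧
      (k0 ∉ cuts lam L a → z ∉ closure (cuts lam L a)) ∧
      (z ∈ closure (cuts lam L a) → ((z - k0) * conj (leftNormal k0)).re = 0) := by
    rcases mem_cuts_or_notMem_closure hk0 with h | h
    · obtain ⟨ε, hε, hl⟩ := H.cuts_local h hs
      filter_upwards [ball_mem_nhds k0 hε] with z hz
      refine ⟨fun _ => hl z hz, fun h' => absurd h h', fun hc => ?_⟩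
      by_contra hne
      obtain ⟨w, hw, hwc⟩ := mem_closure_iff.1 hc _
        (isOpen_ball.inter (isOpen_ne_fun hcont continuous_const)) ⟨hz, hne⟩
      exact hw.2 ((hl w hw.1).1 hwc)
    · filter_upwards [isClosed_closure.isOpen_compl.mem_nhds h] with z hz
      exact ⟨fun h' => absurd (subset_closure h') h, fun _ => hz, fun h' => absurd h' hz⟩
  have hreal : k0.im = 0 → k0 ∈ cuts lam L a → lam ≠ -1 := by
    rintro h1 h2 rfl
    exact hs (Or.inr ⟨rfl, by rwa [H.cuts_neg_one] at h2, h1⟩)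
  have hlocim : k0.im ≠ 0 → ∀ᶠ z in 𝓝 k0, 0 < z.im * k0.im := fun h =>
    (Continuous.tendsto (by fun_prop : Continuous fun z : ℂ => z.im * k0.im) k0).eventually
      (lt_mem_nhds (mul_self_pos.2 h))
  have hlocre : k0.re ≠ 0 → ∀ᶠ z in 𝓝 k0, 0 < z.re * k0.re := fun h =>
    (Continuous.tendsto (by fun_prop : Continuous fun z : ℂ => z.re * k0.re) k0).eventually
      (lt_mem_nhds (mul_self_pos.2 h))
  by_cases him : k0.im = 0
  · have hre : k0.re ≠ 0 := fun h => h0 (Complex.ext h him)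
    filter_upwards [hcuts, hlocre hre] with z ⟨h1, h2, h3⟩ h4
    have hre0 : z.re ≠ 0 := fun h => by simp [h] at h4
    have hline := leftNormal_line_iff k0 z
    rw [if_pos him] at hline
    have hcon : z ∈ contour lam L a ↔ ((z - k0) * conj (leftNormal k0)).re = 0 := by
      constructor
      · rintro (h | h)
        · exact hline.2 (h.resolve_right hre0)
        · exact h3 h
      · exact fun h => Or.inl (Or.inl (hline.1 h))
    have hcut : ((z - k0) * conj (leftNormal k0)).re = 0 →
        (z ∈ cuts lam L a ↔ k0 ∈ cuts lam L a) := by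
      intro h
      by_cases hk : k0 ∈ cuts lam L a
      · simp [hk, (h1 hk).2 h]
      · simp only [hk, iff_false]
        exact fun h' => h2 hk (subset_closure h')
    refine ⟨hcon, h3, fun h => ⟨⟨hcon.2 h, ?_⟩, ?_, hcut h⟩⟩
    · rintro (⟨hc, hnc⟩ | (hz0 | ⟨hlam, hv, -⟩))
      · by_cases hk : k0 ∈ cuts lam L a
        · exact hnc ((hcut h).2 hk)
        · exact h2 hk hc
      · exact hre0 (by simp [hz0])
      · have hzc : z ∈ cuts lam L a := Or.inr ⟨hlam, hv⟩
        exact hreal him ((hcut h).1 hzc) hlam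
    · simp only [leftNormal, hline.1 h, him, lt_irrefl, if_false]
      rcases lt_or_gt_of_ne hre with h' | h'
      · rw [if_neg (by nlinarith), if_neg (by linarith)]
      · rw [if_pos (by nlinarith), if_pos (by linarith)]
  · have hcross : ∀ᶠ z in 𝓝 k0, k0.re ≠ 0 → 0 < z.re * k0.re := by
      by_cases h : k0.re = 0
      · exact Eventually.of_forall fun z h' => absurd h h'
      · exact (hlocre h).mono fun z hz _ => hz
    filter_upwards [hcuts, hlocim him, hcross] with z ⟨h1, h2, h3⟩ h4 h5
    have him0 : z.im ≠ 0 := fun h => by simp [h] at h4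
    have hline := leftNormal_line_iff k0 z
    rw [if_neg him] at hline
    have hcut : ((z - k0) * conj (leftNormal k0)).re = 0 →
        (z ∈ cuts lam L a ↔ k0 ∈ cuts lam L a) := by
      intro h
      by_cases hk : k0 ∈ cuts lam L a
      · simp [hk, (h1 hk).2 h]
      · simp only [hk, iff_false]
        exact fun h' => h2 hk (subset_closure h')
    have hcon : z ∈ contour lam L a ↔ ((z - k0) * conj (leftNormal k0)).re = 0 := by
      constructor
      · rintro (h | h)
        · have hz := h.resolve_left him0
          have : k0.re = 0 := by
            by_contra h'
            have := h5 h'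
            simp [hz] at this
          exact hline.2 (by rw [hz, this])
        · exact h3 h
      · intro h
        rcases hk0.1 with h' | h'
        · exact Or.inl (Or.inr ((hline.1 h).trans (h'.resolve_left him)))
        · refine Or.inr (subset_closure ((hcut h).2 ?_))
          exact (mem_cuts_or_notMem_closure hk0).resolve_right (not_not.2 h')
    refine ⟨hcon, h3, fun h => ⟨⟨hcon.2 h, ?_⟩, ?_, hcut h⟩⟩
    · rintro (⟨hc, hnc⟩ | (hz0 | ⟨-, -, hz⟩))
      · by_cases hk : k0 ∈ cuts lam L a
        · exact hnc ((hcut h).2 hk)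
        · exact h2 hk hc
      · exact him0 (by simp [hz0])
      · exact him0 hz
    · unfold leftNormal
      rcases lt_or_gt_of_ne him with h' | h'
      · have : z.im < 0 := by nlinarith
        rw [if_neg this.not_gt, if_pos this, if_neg h'.not_gt, if_pos h']
      · have : 0 < z.im := by nlinarith
        rw [if_pos this, if_pos h']

end LocalBoundary

section LocalBoundary

variable {lam L x t : ℝ} {a b : ℂ → ℂ} {Ψ : ℂ → Mat2} {qv : ℂ}
variable (D : IsSpectralData lam L x t a b Ψ qv) (H : IsDiscriminant lam L a)

theorem meromorphicNFAt_gammaT {k : ℂ} (hk : k ∈ (closure (cuts lam L a))ᶜ) :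
    MeromorphicNFAt (gammaT lam L a b) k :=
  meromorphicNFOn_toMeromorphicNFOn _ _ hk

theorem gammaT_eventuallyEq {k : ℂ} (hk : k ∈ (closure (cuts lam L a))ᶜ)
    {G : ℂ → ℂ} (hG : AnalyticAt ℂ G k) (h : gammaT lam L a b =ᶠ[𝓝[≠] k] G) :
    gammaT lam L a b =ᶠ[𝓝 k] G :=
  ((meromorphicNFAt_gammaT hk).eventuallyEq_nhdsNE_iff_eventuallyEq_nhds
    hG.meromorphicNFAt).1 h

include H in
theorem IsDiscriminant.sqrtDiscr_local {k : ℂ} (hk : k ∈ (closure (cuts lam L a))ᶜ) :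
    ∀ᶠ z in 𝓝 k, z ∈ (closure (cuts lam L a))ᶜ ∧ sqrtDiscr lam L a z ^ 2 = disc4 L a z := by
  filter_upwards [isClosed_closure.isOpen_compl.mem_nhds hk] with z hz
  exact ⟨hz, H.isNormalizedRoot_sqrtDiscr.sq z hz⟩

include D H in
theorem IsSpectralData.gammaT_of_bounded {k : ℂ} (hk : k ∈ (closure (cuts lam L a))ᶜ)
    (hbd : gammaT lam L a b =O[𝓝[≠] k] fun _ => (1 : ℂ)) : AnalyticAt ℂ (gammaT lam L a b) k ∧
      ∀ᶠ z in 𝓝 k, GammaRel lam L a b z (sqrtDiscr lam L a z) (gammaT lam L a b z) := by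
  have hloc := H.sqrtDiscr_local hk
  obtain ⟨G, hG, hrel, heq⟩ := D.exists_gamma_extension H le_rfl (H.analyticAt_sqrtDiscr hk)
    (hloc.mono fun z hz => hz.2)
    ((hloc.filter_mono nhdsWithin_le_nhds).mono fun z hz => ⟨hz.1, rfl⟩) hbd
  have h := gammaT_eventuallyEq hk hG (by
    filter_upwards [heq, nhdsWithin_le_nhds hloc] with z h1 h2
    exact h1 h2.1 rfl)
  refine ⟨hG.congr h.symm, ?_⟩
  filter_upwards [hrel, h] with z h1 h2
  rwa [h2]

include D H in
theorem IsSpectralData.gammaT_of_not_pole {k : ℂ} (hk : k ∈ (closure (cuts lam L a))ᶜ)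
    (hp : ¬ meromorphicOrderAt (gammaT lam L a b) k < 0) : AnalyticAt ℂ (gammaT lam L a b) k ∧
      ∀ᶠ z in 𝓝 k, GammaRel lam L a b z (sqrtDiscr lam L a z) (gammaT lam L a b z) := by
  have h := (meromorphicNFAt_gammaT hk).meromorphicOrderAt_nonneg_iff_analyticAt.1 (not_lt.1 hp)
  refine D.gammaT_of_bounded H hk ?_
  exact (h.continuousAt.tendsto.isBigO_one ℂ).mono nhdsWithin_le_nhds

include D H in
theorem IsSpectralData.exists_gammaBar_extension {k0 : ℂ} {l : Filter ℂ} [l.NeBot]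
    (hl : l ≤ 𝓝[≠] k0) {r : ℂ → ℂ} (hr : AnalyticAt ℂ r k0)
    (hr2 : ∀ᶠ z in 𝓝 k0, r z ^ 2 = disc4 L a z)
    (hlr : ∀ᶠ z in l, z ∈ (closure (cuts lam L a))ᶜ ∧ sqrtDiscr lam L a z = r z)
    (hbd : schwarz (gammaT lam L a b) =O[l] fun _ => (1 : ℂ)) :
    ∃ G, AnalyticAt ℂ G k0 ∧ (∀ᶠ z in 𝓝 k0, GammaBarRel lam L a b z (r z) (G z)) ∧
      ∀ᶠ z in 𝓝[≠] k0, z ∈ (closure (cuts lam L a))ᶜ → sqrtDiscr lam L a z = r z →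
        schwarz (gammaT lam L a b) z = G z := by
  have hcc : Tendsto (fun z : ℂ => conj z) (𝓝[≠] k0) (𝓝[≠] (conj k0)) :=
    tendsto_nhdsWithin_iff.2 ⟨(continuous_conj.tendsto k0).mono_left nhdsWithin_le_nhds,
      eventually_mem_nhdsWithin.mono fun z hz h =>
        hz ((starRingEnd ℂ).injective (mem_singleton_iff.1 h))⟩
  have hr' : AnalyticAt ℂ (schwarz r) (conj k0) := analyticAt_schwarz (by simpa using hr)
  have hcΩ : ∀ {z}, z ∈ (closure (cuts lam L a))ᶜ → conj z ∈ (closure (cuts lam L a))ᶜ :=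
    fun hz h => hz (H.conj_mem_closure_cuts.1 h)
  obtain ⟨G, hG, hrel, heq⟩ := D.exists_gamma_extension H (l := l.map fun z => conj z)
    ((map_mono hl).trans hcc) hr' (by
      refine (eventually_conj (by simpa using hr2)).mono fun z hz => ?_
      rw [schwarz, ← map_pow, hz, conj_disc4]) (by
      rw [eventually_map]
      filter_upwards [hlr] with z hz
      refine ⟨hcΩ hz.1, ?_⟩
      rw [schwarz, conj_conj, ← hz.2, ← H.conj_sqrtDiscr hz.1, conj_conj]) (by
      rw [isBigO_map]
      refine IsBigO.of_norm_left (hbd.norm_left.congr_left fun z => ?_)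
      simp [schwarz])
  refine ⟨schwarz G, analyticAt_schwarz hG, ?_, ?_⟩
  · filter_upwards [eventually_conj hrel] with z hz
    have := hz.conj
    simp only [schwarz, conj_conj] at this
    exact this
  · filter_upwards [hcc.eventually heq] with z hz h1 h2
    rw [schwarz, schwarz, hz (hcΩ h1)]
    rw [schwarz, conj_conj, ← h2, ← H.conj_sqrtDiscr h1, conj_conj]

include H in
theorem IsDiscriminant.exists_sqrt_sides {k0 : ℂ} (hk0 : k0 ∈ contourStar lam L a) :
    ∃ rp rm : ℂ → ℂ, AnalyticAt ℂ rp k0 ∧ AnalyticAt ℂ rm k0 ∧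
      (∀ᶠ z in 𝓝 k0, rp z ^ 2 = disc4 L a z ∧ rm z ^ 2 = disc4 L a z) ∧
      (∀ᶠ z in 𝓝 k0, (z ∈ plusSide k0 → sqrtDiscr lam L a z = rp z) ∧
        (z ∈ minusSide k0 → sqrtDiscr lam L a z = rm z)) ∧
      (k0 ∈ cuts lam L a → rm k0 = -rp k0) ∧
      (k0 ∉ cuts lam L a → rp = sqrtDiscr lam L a ∧ rm = sqrtDiscr lam L a) := by
  by_cases hc : k0 ∈ cuts lam L a
  · obtain ⟨ε, hε, r, h1, h2, h3, h4⟩ := H.isBranch_sqrtDiscr.jump k0 hc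
      fun h => hk0.2 (Or.inr h)
    have hb := ball_mem_nhds k0 hε
    have hr := h1.analyticAt hb
    refine ⟨r, -r, hr, hr.neg, ?_, ?_, fun _ => rfl, fun h => absurd hc h⟩
    · filter_upwards [hb] with z hz
      exact ⟨h2 z hz, by rw [Pi.neg_apply, neg_sq, h2 z hz]⟩
    · filter_upwards [hb] with z hz
      exact ⟨fun h => h3 z ⟨hz, h⟩, fun h => h4 z ⟨hz, h⟩⟩
  · have hk := (mem_cuts_or_notMem_closure hk0).resolve_left hc
    have hr := H.analyticAt_sqrtDiscr hk
    exact ⟨_, _, hr, hr, (H.sqrtDiscr_local hk).mono fun z hz => ⟨hz.2, hz.2⟩,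
      Eventually.of_forall fun z => ⟨fun _ => rfl, fun _ => rfl⟩, fun h => absurd h hc,
      fun _ => ⟨rfl, rfl⟩⟩

/-- Analytic continuations of the square root and of `Γ̃` from the two sides of the contour to a
full neighbourhood of a point `k0`. -/
structure LocalBoundary (lam L : ℝ) (a b : ℂ → ℂ) (k0 : ℂ) (rp rm Gp Gm Gbp Gbm : ℂ → ℂ)
    (B : Set ℂ) : Prop where
  diff_rp : DifferentiableOn ℂ rp B
  diff_rm : DifferentiableOn ℂ rm B
  diff_Gp : DifferentiableOn ℂ Gp B
  diff_Gm : DifferentiableOn ℂ Gm B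
  diff_Gbp : DifferentiableOn ℂ Gbp B
  diff_Gbm : DifferentiableOn ℂ Gbm B
  sq : ∀ z ∈ B, rp z ^ 2 = disc4 L a z ∧ rm z ^ 2 = disc4 L a z
  rel_p : ∀ z ∈ B, GammaRel lam L a b z (rp z) (Gp z) ∧ GammaBarRel lam L a b z (rp z) (Gbp z)
  rel_m : ∀ z ∈ B, GammaRel lam L a b z (rm z) (Gm z) ∧ GammaBarRel lam L a b z (rm z) (Gbm z)
  contour_iff : ∀ z ∈ B, z ∈ contour lam L a ↔ ((z - k0) * conj (leftNormal k0)).re = 0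
  line : ∀ z ∈ B, ((z - k0) * conj (leftNormal k0)).re = 0 → z ∈ contourStar lam L a ∧
    leftNormal z = leftNormal k0 ∧ (z ∈ cuts lam L a ↔ k0 ∈ cuts lam L a)
  plus : ∀ z ∈ B, z ∈ plusSide k0 → sqrtDiscr lam L a z = rp z ∧ gammaT lam L a b z = Gp z ∧
    schwarz (gammaT lam L a b) z = Gbp z
  minus : ∀ z ∈ B, z ∈ minusSide k0 → sqrtDiscr lam L a z = rm z ∧ gammaT lam L a b z = Gm z ∧
    schwarz (gammaT lam L a b) z = Gbm z
  cut : k0 ∈ cuts lam L a → rm k0 = -rp k0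
  noncut : k0 ∉ cuts lam L a → rm k0 = rp k0 ∧ gammaT lam L a b k0 = Gp k0 ∧
    gammaT lam L a b k0 = Gm k0 ∧ schwarz (gammaT lam L a b) k0 = Gbp k0 ∧
    schwarz (gammaT lam L a b) k0 = Gbm k0

include H in
theorem IsDiscriminant.isBigO_schwarz_gammaT
    (hbd : ∀ k ∈ contour lam L a,
      gammaT lam L a b =O[𝓝[(closure (cuts lam L a))ᶜ] k] fun _ => (1 : ℂ))
    {k : ℂ} (hk : k ∈ contour lam L a) :
    schwarz (gammaT lam L a b) =O[𝓝[(closure (cuts lam L a))ᶜ] k] fun _ => (1 : ℂ) := by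
  have h := hbd (conj k) (H.conj_mem_contour hk)
  have hcc : Tendsto (fun z : ℂ => conj z) (𝓝[(closure (cuts lam L a))ᶜ] k)
      (𝓝[(closure (cuts lam L a))ᶜ] (conj k)) :=
    tendsto_nhdsWithin_iff.2 ⟨(continuous_conj.tendsto k).mono_left nhdsWithin_le_nhds,
      eventually_mem_nhdsWithin.mono fun z hz h => hz (H.conj_mem_closure_cuts.1 h)⟩
  refine IsBigO.of_norm_left ?_
  refine ((h.comp_tendsto hcc).norm_left).congr_left fun z => ?_
  simp [schwarz]

include D H in
theorem IsSpectralData.exists_localBoundary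
    (hbd : ∀ k ∈ contour lam L a,
      gammaT lam L a b =O[𝓝[(closure (cuts lam L a))ᶜ] k] fun _ => (1 : ℂ))
    {k0 : ℂ} (hk0 : k0 ∈ contourStar lam L a) :
    ∃ rp rm Gp Gm Gbp Gbm : ℂ → ℂ, ∃ ε > 0,
      LocalBoundary lam L a b k0 rp rm Gp Gm Gbp Gbm (ball k0 ε) := by
  obtain ⟨rp, rm, hrp, hrm, hsq, hside, hcut, hnon⟩ := H.exists_sqrt_sides hk0
  have hgeom := H.contourStar_local hk0
  have hΩ : ∀ᶠ z in 𝓝 k0, ((z - k0) * conj (leftNormal k0)).re ≠ 0 →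
      z ∈ (closure (cuts lam L a))ᶜ := hgeom.mono fun z hz hne hc => hne (hz.2.1 hc)
  have hpΩ : ∀ᶠ z in 𝓝[plusSide k0] k0, z ∈ (closure (cuts lam L a))ᶜ := by
    filter_upwards [nhdsWithin_le_nhds hΩ, self_mem_nhdsWithin] with z h1 h2
    exact h1 (ne_of_gt h2)
  have hmΩ : ∀ᶠ z in 𝓝[minusSide k0] k0, z ∈ (closure (cuts lam L a))ᶜ := by
    filter_upwards [nhdsWithin_le_nhds hΩ, self_mem_nhdsWithin] with z h1 h2
    exact h1 (ne_of_lt h2)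
  have hpl : 𝓝[plusSide k0] k0 ≤ 𝓝[(closure (cuts lam L a))ᶜ] k0 :=
    le_inf nhdsWithin_le_nhds (le_principal_iff.2 hpΩ)
  have hml : 𝓝[minusSide k0] k0 ≤ 𝓝[(closure (cuts lam L a))ᶜ] k0 :=
    le_inf nhdsWithin_le_nhds (le_principal_iff.2 hmΩ)
  have hp : ∀ᶠ z in 𝓝[plusSide k0] k0, z ∈ (closure (cuts lam L a))ᶜ ∧
      sqrtDiscr lam L a z = rp z := by
    filter_upwards [hpΩ, nhdsWithin_le_nhds hside, self_mem_nhdsWithin] with z h1 h2 h3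
    exact ⟨h1, h2.1 h3⟩
  have hm : ∀ᶠ z in 𝓝[minusSide k0] k0, z ∈ (closure (cuts lam L a))ᶜ ∧
      sqrtDiscr lam L a z = rm z := by
    filter_upwards [hmΩ, nhdsWithin_le_nhds hside, self_mem_nhdsWithin] with z h1 h2 h3
    exact ⟨h1, h2.2 h3⟩
  have hb1 := hbd k0 hk0.1
  have hb2 := H.isBigO_schwarz_gammaT hbd hk0.1
  obtain ⟨Gp, hGp, relp, eqp⟩ := D.exists_gamma_extension H (nhdsWithin_plusSide_le k0) hrp
    (hsq.mono fun z h => h.1) hp (hb1.mono hpl)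
  obtain ⟨Gm, hGm, relm, eqm⟩ := D.exists_gamma_extension H (nhdsWithin_minusSide_le k0) hrm
    (hsq.mono fun z h => h.2) hm (hb1.mono hml)
  obtain ⟨Gbp, hGbp, relbp, eqbp⟩ := D.exists_gammaBar_extension H (nhdsWithin_plusSide_le k0) hrp
    (hsq.mono fun z h => h.1) hp (hb2.mono hpl)
  obtain ⟨Gbm, hGbm, relbm, eqbm⟩ := D.exists_gammaBar_extension H (nhdsWithin_minusSide_le k0) hrm
    (hsq.mono fun z h => h.2) hm (hb2.mono hml)
  have hall := hrp.eventually_analyticAt.and (hrm.eventually_analyticAt.and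
    (hGp.eventually_analyticAt.and (hGm.eventually_analyticAt.and
    (hGbp.eventually_analyticAt.and hGbm.eventually_analyticAt))))
  have heqs := ((eventually_nhdsWithin_iff.1 eqp).and (eventually_nhdsWithin_iff.1 eqm)).and
    ((eventually_nhdsWithin_iff.1 eqbp).and (eventually_nhdsWithin_iff.1 eqbm))
  obtain ⟨ε, hε, h⟩ := eventually_nhds_iff_ball.1 ((hall.and heqs).and
    (((hsq.and hside).and (hgeom.and hΩ)).and ((relp.and relbp).and (relm.and relbm))))
  refine ⟨rp, rm, Gp, Gm, Gbp, Gbm, ε, hε, ?_⟩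
  have hd : ∀ {f : ℂ → ℂ}, (∀ z ∈ ball k0 ε, AnalyticAt ℂ f z) →
      DifferentiableOn ℂ f (ball k0 ε) :=
    fun hf z hz => (hf z hz).differentiableAt.differentiableWithinAt
  refine ⟨hd fun z hz => (h z hz).1.1.1, hd fun z hz => (h z hz).1.1.2.1,
    hd fun z hz => (h z hz).1.1.2.2.1, hd fun z hz => (h z hz).1.1.2.2.2.1,
    hd fun z hz => (h z hz).1.1.2.2.2.2.1, hd fun z hz => (h z hz).1.1.2.2.2.2.2,
    fun z hz => (h z hz).2.1.1.1, fun z hz => (h z hz).2.2.1, fun z hz => (h z hz).2.2.2,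
    fun z hz => (h z hz).2.1.2.1.1, fun z hz => (h z hz).2.1.2.1.2.2, fun z hz hs => ?_,
    fun z hz hs => ?_, hcut, fun hc => ?_⟩
  · have hzΩ := (h z hz).2.1.2.2 (ne_of_gt hs)
    have hR := (h z hz).2.1.1.2.1 hs
    have hne : z ∈ ({k0}ᶜ : Set ℂ) := fun h' => by
      rw [mem_singleton_iff.1 h'] at hs; simp [plusSide] at hs
    exact ⟨hR, (h z hz).1.2.1.1 hne hzΩ hR, (h z hz).1.2.2.1 hne hzΩ hR⟩
  · have hzΩ := (h z hz).2.1.2.2 (ne_of_lt hs)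
    have hR := (h z hz).2.1.1.2.2 hs
    have hne : z ∈ ({k0}ᶜ : Set ℂ) := fun h' => by
      rw [mem_singleton_iff.1 h'] at hs; simp [minusSide] at hs
    exact ⟨hR, (h z hz).1.2.1.2 hne hzΩ hR, (h z hz).1.2.2.2 hne hzΩ hR⟩
  · obtain ⟨rfl, rfl⟩ := hnon hc
    have hk : k0 ∈ (closure (cuts lam L a))ᶜ := (mem_cuts_or_notMem_closure hk0).resolve_left hc
    have hck : conj k0 ∈ (closure (cuts lam L a))ᶜ := fun h => hk (H.conj_mem_closure_cuts.1 h)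
    have hΩn : (closure (cuts lam L a))ᶜ ∈ 𝓝 k0 := isClosed_closure.isOpen_compl.mem_nhds hk
    have hΩc : (closure (cuts lam L a))ᶜ ∈ 𝓝 (conj k0) := isClosed_closure.isOpen_compl.mem_nhds hck
    have c1 : ContinuousAt (gammaT lam L a b) k0 := by
      refine (D.gammaT_of_bounded H hk (hb1.mono ?_)).1.continuousAt
      rw [nhdsWithin_eq_nhds.2 hΩn]
      exact nhdsWithin_le_nhds
    have c2 : ContinuousAt (schwarz (gammaT lam L a b)) k0 := by
      refine (analyticAt_schwarz (D.gammaT_of_bounded H hck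
        ((hbd _ (H.conj_mem_contour hk0.1)).mono ?_)).1).continuousAt
      rw [nhdsWithin_eq_nhds.2 hΩc]
      exact nhdsWithin_le_nhds
    have key : ∀ {f g : ℂ → ℂ}, ContinuousAt f k0 → AnalyticAt ℂ g k0 → (∀ᶠ z in 𝓝[≠] k0,
        z ∈ (closure (cuts lam L a))ᶜ → sqrtDiscr lam L a z = sqrtDiscr lam L a z → f z = g z) →
        f k0 = g k0 := by
      intro f g hf hg hfg
      refine tendsto_nhds_unique (hf.tendsto.mono_left nhdsWithin_le_nhds)
        ((hg.continuousAt.tendsto.mono_left nhdsWithin_le_nhds).congr' (f₁ := g) (f₂ := f)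
          (l₁ := 𝓝[≠] k0) ?_)
      filter_upwards [hfg, nhdsWithin_le_nhds hΩn] with z h1 h2
      exact (h1 h2 rfl).symm
    exact ⟨rfl, key c1 hGp eqp, key c1 hGm eqm, key c2 hGbp eqbp, key c2 hGbm eqbm⟩

end LocalBoundary

section Sectors

variable {lam L x t : ℝ} {a b : ℂ → ℂ} {Ψ : ℂ → Mat2} {qv : ℂ}

/-- The right factor of the solution in the quadrant `D (j + 1)`. -/
def sectorFactor (lam L x t : ℝ) (a b : ℂ → ℂ) (k r G Gb : ℂ) : Fin 4 → Mat2 :=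
  let E := bigE L a r k
  let E' := bigE' L a r k
  let η := exp (I * theta x t k)
  let ζ := exp (-(I * theta x t k))
  ![!![η * E', ζ * E * G; 0, ζ * E],
    !![η * E', ζ * b k; η * E' * (lam * Gb), ζ * a k],
    !![η * schwarz a k, ζ * E * G; η * (lam * schwarz b k), ζ * E],
    !![η * E', 0; η * E' * (lam * Gb), ζ * E]]

theorem eTheta_eq (x t : ℝ) (k : ℂ) : eTheta x t k = exp (I * theta x t k) ^ 2 := by
  rw [eTheta, ← Complex.exp_nat_mul]; congr 1; push_cast; ring

theorem eThetaInv_eq (x t : ℝ) (k : ℂ) : eThetaInv x t k = exp (-(I * theta x t k)) ^ 2 := by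
  rw [eThetaInv, ← Complex.exp_nat_mul]; congr 1; push_cast; ring

theorem GammaBarRel.F_eq {k r G : ℂ} (h : GammaBarRel lam L a b k r G) :
    a k - lam * b k * G = bigE L a r k := by
  rw [h.one]; ring

theorem GammaRel.Fbar_eq {k r G : ℂ} (h : GammaRel lam L a b k r G) :
    schwarz a k - lam * schwarz b k * G = bigE' L a r k := by
  rw [h.one]; ring

theorem GammaRel.E_eq {k r G : ℂ} (h : GammaRel lam L a b k r G) :
    a k + lam * schwarz b k * G * eL L k = bigE L a r k := by
  linear_combination eL L k * h.one - bigE_add L a r k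

theorem GammaBarRel.Ebar_eq {k r G : ℂ} (h : GammaBarRel lam L a b k r G) :
    schwarz a k + lam * b k * G * eLInv L k = bigE' L a r k := by
  linear_combination eLInv L k * h.one - eLInv L k * bigE_add L a r k +
    (bigE' L a r k - schwarz a k) * eL_mul_eLInv L k

theorem det_sectorFactor {k r G Gb : ℂ} {j : Fin 4} (h3 : bigE L a r k * bigE' L a r k = 1)
    (hG : j = 0 ∨ j = 2 → GammaRel lam L a b k r G)
    (hGb : j = 1 ∨ j = 3 → GammaBarRel lam L a b k r Gb) :
    (sectorFactor lam L x t a b k r G Gb j).det = 1 := by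
  have h4 := exp_neg_mul_exp (I * theta x t k)
  fin_cases j <;>
    simp only [sectorFactor, Matrix.det_fin_two_of, Fin.reduceFinMk, Matrix.cons_val]
  · grind
  · have := (hGb (by simp)).one
    grind
  · have := (hG (by simp)).one
    grind
  · grind

/-- The relations used for the jump at `k`. -/
structure JumpRel (lam L : ℝ) (a b : ℂ → ℂ) (k r G Gb : ℂ) : Prop where
  inv : bigE L a r k * bigE' L a r k = 1
  rel : GammaRel lam L a b k r G
  bar : GammaBarRel lam L a b k r Gb

variable {k r G Gb : ℂ} (h : JumpRel lam L a b k r G Gb)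
include h

theorem JumpRel.num_eq : schwarz a k * G * eL L k + b k = bigE L a r k * G := by
  linear_combination G * (-bigE_add L a r k) - h.rel.two

theorem JumpRel.num_bar_eq : a k * Gb * eLInv L k + schwarz b k = bigE' L a r k * Gb := by
  linear_combination -h.bar.two - eLInv L k * Gb * bigE_add L a r k +
    (bigE' L a r k - schwarz a k) * Gb * eL_mul_eLInv L k

theorem JumpRel.v1_eq : sectorFactor lam L x t a b k r G Gb 1 =
    sectorFactor lam L x t a b k r G Gb 0 * v1 lam L x t a b k G Gb := by
  have h3 := h.inv
  have h4 := exp_neg_mul_exp (I * theta x t k)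
  have h5 := eL_mul_eLInv L k
  have h6 := bigE_add L a r k
  have g1 := h.rel.one
  have g2 := h.rel.two
  have l1 := h.bar.one
  have l2 := h.bar.two
  have hE0 : bigE L a r k ≠ 0 := left_ne_zero_of_mul_eq_one h3
  have hE0' : bigE' L a r k ≠ 0 := right_ne_zero_of_mul_eq_one h3
  rw [v1, h.bar.F_eq, h.rel.E_eq, h.bar.two, eTheta_eq, eThetaInv_eq]
  ext i j
  fin_cases i <;> fin_cases j <;> simp [sectorFactor, Matrix.mul_apply, Fin.sum_univ_two] <;>
    field_simp <;> grind

theorem JumpRel.v2_eq : sectorFactor lam L x t a b k r G Gb 3 =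
    sectorFactor lam L x t a b k r G Gb 0 * v2 lam L x t a b k G Gb := by
  have h3 := h.inv
  have h4 := exp_neg_mul_exp (I * theta x t k)
  have h5 := eL_mul_eLInv L k
  have h6 := bigE_add L a r k
  have g1 := h.rel.one
  have g2 := h.rel.two
  have l1 := h.bar.one
  have l2 := h.bar.two
  have hE0 : bigE L a r k ≠ 0 := left_ne_zero_of_mul_eq_one h3
  have hE0' : bigE' L a r k ≠ 0 := right_ne_zero_of_mul_eq_one h3
  rw [v2, h.bar.Ebar_eq, h.rel.E_eq, h.num_eq, h.num_bar_eq, eTheta_eq, eThetaInv_eq]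
  ext i j
  fin_cases i <;> fin_cases j <;> simp [sectorFactor, Matrix.mul_apply, Fin.sum_univ_two] <;>
    field_simp <;> grind

theorem JumpRel.v3_eq : sectorFactor lam L x t a b k r G Gb 3 =
    sectorFactor lam L x t a b k r G Gb 2 * v3 lam L x t a b k G Gb := by
  have h3 := h.inv
  have h4 := exp_neg_mul_exp (I * theta x t k)
  have h5 := eL_mul_eLInv L k
  have h6 := bigE_add L a r k
  have g1 := h.rel.one
  have g2 := h.rel.two
  have l1 := h.bar.one
  have l2 := h.bar.two
  have hE0 : bigE L a r k ≠ 0 := left_ne_zero_of_mul_eq_one h3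
  have hE0' : bigE' L a r k ≠ 0 := right_ne_zero_of_mul_eq_one h3
  rw [v3, h.bar.Ebar_eq, h.rel.Fbar_eq, h.rel.two, eTheta_eq, eThetaInv_eq]
  ext i j
  fin_cases i <;> fin_cases j <;> simp [sectorFactor, Matrix.mul_apply, Fin.sum_univ_two] <;>
    field_simp <;> grind

theorem JumpRel.v4_eq : sectorFactor lam L x t a b k r G Gb 1 =
    sectorFactor lam L x t a b k r G Gb 2 * v4 lam x t a b k G Gb := by
  have h3 := h.inv
  have h4 := exp_neg_mul_exp (I * theta x t k)
  have h5 := eL_mul_eLInv L k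
  have h6 := bigE_add L a r k
  have g1 := h.rel.one
  have g2 := h.rel.two
  have l1 := h.bar.one
  have l2 := h.bar.two
  have hE0 : bigE L a r k ≠ 0 := left_ne_zero_of_mul_eq_one h3
  have hE0' : bigE' L a r k ≠ 0 := right_ne_zero_of_mul_eq_one h3
  rw [v4, h.bar.F_eq, h.rel.Fbar_eq, h.rel.two, h.bar.two, eTheta_eq, eThetaInv_eq]
  ext i j
  fin_cases i <;> fin_cases j <;> simp [sectorFactor, Matrix.mul_apply, Fin.sum_univ_two] <;>
    field_simp <;> grind

variable {G' Gb' : ℂ} (h' : JumpRel lam L a b k (-r) G' Gb')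
include h'

theorem JumpRel.vCut1_eq : sectorFactor lam L x t a b k (-r) G' Gb' 0 =
    sectorFactor lam L x t a b k r G Gb 0 * vCut1 lam L x t a b k G G' := by
  have h3 := h.inv
  have h4 := exp_neg_mul_exp (I * theta x t k)
  have h5 := eL_mul_eLInv L k
  have e1 := bigE_neg L a r k
  have e2 := bigE'_neg L a r k
  have hE0 : bigE L a r k ≠ 0 := left_ne_zero_of_mul_eq_one h3
  have hE0' : bigE' L a r k ≠ 0 := right_ne_zero_of_mul_eq_one h3
  have hL0 : eL L k ≠ 0 := left_ne_zero_of_mul_eq_one h5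
  have hL0' : eLInv L k ≠ 0 := right_ne_zero_of_mul_eq_one h5
  rw [vCut1, h.rel.E_eq, h'.rel.E_eq, eThetaInv_eq]
  ext i j
  fin_cases i <;> fin_cases j <;> simp [sectorFactor, Matrix.mul_apply, Fin.sum_univ_two, e1, e2] <;>
    field_simp <;> grind

theorem JumpRel.vCut2_eq : sectorFactor lam L x t a b k (-r) G' Gb' 1 =
    sectorFactor lam L x t a b k r G Gb 1 * vCut2 lam x t a b k Gb Gb' := by
  have h3 := h.inv
  have h4 := exp_neg_mul_exp (I * theta x t k)
  have h5 := eL_mul_eLInv L k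
  have e1 := bigE_neg L a r k
  have e2 := bigE'_neg L a r k
  have f1 := h.bar.one
  have f2 := h'.bar.one
  have f3 := h.num_bar_eq
  have f4 := h'.num_bar_eq
  rw [e1] at f2
  rw [e2] at f4
  have hE0 : bigE L a r k ≠ 0 := left_ne_zero_of_mul_eq_one h3
  have hE0' : bigE' L a r k ≠ 0 := right_ne_zero_of_mul_eq_one h3
  have hL0 : eL L k ≠ 0 := left_ne_zero_of_mul_eq_one h5
  have hL0' : eLInv L k ≠ 0 := right_ne_zero_of_mul_eq_one h5
  rw [vCut2, h.bar.F_eq, h'.bar.F_eq, eTheta_eq]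
  ext i j
  fin_cases i <;> fin_cases j <;> simp [sectorFactor, Matrix.mul_apply, Fin.sum_univ_two, e1, e2] <;>
    field_simp <;> grind

theorem JumpRel.vCut3_eq : sectorFactor lam L x t a b k (-r) G' Gb' 2 =
    sectorFactor lam L x t a b k r G Gb 2 * vCut3 lam x t a b k G G' := by
  have h3 := h.inv
  have h4 := exp_neg_mul_exp (I * theta x t k)
  have h5 := eL_mul_eLInv L k
  have e1 := bigE_neg L a r k
  have e2 := bigE'_neg L a r k
  have f1 := h.rel.one
  have f2 := h'.rel.one
  have f3 := h.num_eq
  have f4 := h'.num_eq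
  rw [e2] at f2
  rw [e1] at f4
  have hE0 : bigE L a r k ≠ 0 := left_ne_zero_of_mul_eq_one h3
  have hE0' : bigE' L a r k ≠ 0 := right_ne_zero_of_mul_eq_one h3
  have hL0 : eL L k ≠ 0 := left_ne_zero_of_mul_eq_one h5
  have hL0' : eLInv L k ≠ 0 := right_ne_zero_of_mul_eq_one h5
  rw [vCut3, h.rel.Fbar_eq, h'.rel.Fbar_eq, eThetaInv_eq]
  ext i j
  fin_cases i <;> fin_cases j <;> simp [sectorFactor, Matrix.mul_apply, Fin.sum_univ_two, e1, e2] <;>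
    field_simp <;> grind

theorem JumpRel.vCut4_eq : sectorFactor lam L x t a b k (-r) G' Gb' 3 =
    sectorFactor lam L x t a b k r G Gb 3 * vCut4 lam L x t a b k Gb Gb' := by
  have h3 := h.inv
  have h4 := exp_neg_mul_exp (I * theta x t k)
  have h5 := eL_mul_eLInv L k
  have e1 := bigE_neg L a r k
  have e2 := bigE'_neg L a r k
  have hE0 : bigE L a r k ≠ 0 := left_ne_zero_of_mul_eq_one h3
  have hE0' : bigE' L a r k ≠ 0 := right_ne_zero_of_mul_eq_one h3
  have hL0 : eL L k ≠ 0 := left_ne_zero_of_mul_eq_one h5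
  have hL0' : eLInv L k ≠ 0 := right_ne_zero_of_mul_eq_one h5
  rw [vCut4, h.bar.Ebar_eq, h'.bar.Ebar_eq, eTheta_eq]
  ext i j
  fin_cases i <;> fin_cases j <;> simp [sectorFactor, Matrix.mul_apply, Fin.sum_univ_two, e1, e2] <;>
    field_simp <;> grind

end Sectors

section Solution

variable {lam L x t : ℝ} {a b : ℂ → ℂ} {Ψ : ℂ → Mat2} {qv : ℂ}

/-- The index of the quadrant containing `k`. -/
def quad (k : ℂ) : Fin 4 :=
  if 0 < k.im then if 0 < k.re then 0 else 1 else if 0 < k.re then 3 else 2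

/-- The index of the quadrant to the left of the contour at `k`. -/
def plusQuad (k : ℂ) : Fin 4 :=
  if 0 < k.im then if 0 ≤ k.re then 0 else 1
  else if k.im < 0 then if 0 < k.re then 3 else 2 else if 0 < k.re then 0 else 2

/-- The index of the quadrant to the right of the contour at `k`. -/
def minusQuad (k : ℂ) : Fin 4 :=
  if 0 < k.im then if 0 < k.re then 0 else 1
  else if k.im < 0 then if 0 ≤ k.re then 3 else 2 else if 0 < k.re then 3 else 1

theorem quad_of_sides {k : ℂ} (hk : k ≠ 0) : ∀ᶠ z in 𝓝 k,
    (z ∈ plusSide k → quad z = plusQuad k) ∧ (z ∈ minusSide k → quad z = minusQuad k) := by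
  have hpos : ∀ {f : ℂ → ℝ}, Continuous f → 0 < f k → ∀ᶠ z in 𝓝 k, 0 < f z :=
    fun hf h => (hf.tendsto k).eventually (lt_mem_nhds h)
  have hneg : ∀ {f : ℂ → ℝ}, Continuous f → f k < 0 → ∀ᶠ z in 𝓝 k, f z < 0 :=
    fun hf h => (hf.tendsto k).eventually (gt_mem_nhds h)
  simp only [plusSide, minusSide, mem_ofPred_eq]
  rcases lt_trichotomy k.im 0 with hi | hi | hi <;> rcases lt_trichotomy k.re 0 with hr | hr | hr
  · filter_upwards [hneg continuous_im hi, hneg continuous_re hr] with z h1 h2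
    simp [quad, plusQuad, minusQuad, hi, not_lt.2 hi.le, not_lt.2 hr.le,
      not_le.2 hr, not_lt.2 h1.le, not_lt.2 h2.le]
  · filter_upwards [hneg continuous_im hi] with z h1
    simp [quad, plusQuad, minusQuad, leftNormal, hi, hr, not_lt.2 hi.le, not_lt.2 h1.le]
    exact fun h => h.le
  · filter_upwards [hneg continuous_im hi, hpos continuous_re hr] with z h1 h2
    simp [quad, plusQuad, minusQuad, hi, hr, h2, not_lt.2 hi.le, hr.le, not_lt.2 h1.le]
  · filter_upwards [hneg continuous_re hr] with z h2
    simp [quad, plusQuad, minusQuad, leftNormal, hi, not_lt.2 hr.le, not_lt.2 h2.le]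
    exact fun h => h.le
  · exact absurd (Complex.ext hr hi) hk
  · filter_upwards [hpos continuous_re hr] with z h2
    simp [quad, plusQuad, minusQuad, leftNormal, hi, hr, h2]
    exact fun h => h.le
  · filter_upwards [hpos continuous_im hi, hneg continuous_re hr] with z h1 h2
    simp [quad, plusQuad, minusQuad, hi, h1, not_lt.2 hr.le, not_le.2 hr, not_lt.2 h2.le]
  · filter_upwards [hpos continuous_im hi] with z h1
    simp [quad, plusQuad, minusQuad, leftNormal, hi, hr, h1]
    exact fun h => h.le
  · filter_upwards [hpos continuous_im hi, hpos continuous_re hr] with z h1 h2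
    simp [quad, plusQuad, minusQuad, hi, hr, h1, h2, hr.le]

theorem sectorFactor_mul_jump {k r r' Gp Gm Gbp Gbm : ℂ} (hk : k ≠ 0)
    (hp : JumpRel lam L a b k r Gp Gbp) (hm : JumpRel lam L a b k r' Gm Gbm)
    (h1 : bdryPlus (gammaT lam L a b) k = Gp) (h2 : bdryMinus (gammaT lam L a b) k = Gm)
    (h3 : bdryPlus (schwarz (gammaT lam L a b)) k = Gbp)
    (h4 : bdryMinus (schwarz (gammaT lam L a b)) k = Gbm)
    (hcut : k ∈ cuts lam L a → r' = -r)
    (hnon : k ∉ cuts lam L a → k ∈ cross ∧ r' = r ∧ gammaT lam L a b k = Gp ∧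
      gammaT lam L a b k = Gm ∧ schwarz (gammaT lam L a b) k = Gbp ∧
      schwarz (gammaT lam L a b) k = Gbm) :
    sectorFactor lam L x t a b k r' Gm Gbm (minusQuad k) =
      sectorFactor lam L x t a b k r Gp Gbp (plusQuad k) * jump lam L x t a b k := by
  by_cases hc : k ∈ cuts lam L a
  · obtain rfl := hcut hc
    simp only [jump, h1, h2, h3, h4, if_pos hc]
    rcases lt_trichotomy k.im 0 with hi | hi | hi <;>
      rcases lt_trichotomy k.re 0 with hr | hr | hr
    · simp [D1, D2, D3, plusQuad, minusQuad, hi, hr, not_lt.2 hi.le, not_lt.2 hr.le, not_le.2 hr]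
      exact hp.vCut3_eq hm
    · simp [D1, D2, D3, D4, plusQuad, minusQuad, hi, hr, not_lt.2 hi.le]
      rw [← Matrix.mul_assoc, ← hp.vCut3_eq hm, hm.v3_eq]
    · simp [D1, D2, D3, D4, plusQuad, minusQuad, hi, hr, not_lt.2 hi.le, not_lt.2 hr.le, hr.le]
      exact hp.vCut4_eq hm
    · simp [D1, D2, D3, D4, plusQuad, minusQuad, hi, not_lt.2 hr.le]
      rw [← Matrix.mul_assoc, ← hp.vCut3_eq hm, hm.v4_eq]
    · exact absurd (Complex.ext hr hi) hk
    · simp [D1, D2, D3, D4, plusQuad, minusQuad, hi, hr]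
      rw [← Matrix.mul_assoc, ← hp.vCut1_eq hm, hm.v2_eq]
    · simp [D1, D2, plusQuad, minusQuad, hi, hr, not_lt.2 hr.le, not_le.2 hr]
      exact hp.vCut2_eq hm
    · simp [D1, D2, D3, D4, plusQuad, minusQuad, hi, hr, not_lt.2 hi.le]
      rw [← Matrix.mul_assoc, ← hp.vCut1_eq hm, hm.v1_eq]
    · simp [D1, plusQuad, minusQuad, hi, hr, hr.le]
      exact hp.vCut1_eq hm
  · obtain ⟨hcr, rfl, e1, e2, e3, e4⟩ := hnon hc
    obtain rfl : Gp = Gm := e1.symm.trans e2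
    obtain rfl : Gbp = Gbm := e3.symm.trans e4
    simp only [jump, e1, e3, if_neg hc]
    rcases lt_trichotomy k.im 0 with hi | hi | hi
    · have hr : k.re = 0 := hcr.resolve_left hi.ne
      simp [plusQuad, minusQuad, hi, hr, not_lt.2 hi.le]
      exact hp.v3_eq
    · rcases lt_trichotomy k.re 0 with hr | hr | hr
      · simp [plusQuad, minusQuad, hi, not_lt.2 hr.le]
        exact hp.v4_eq
      · exact absurd (Complex.ext hr hi) hk
      · simp [plusQuad, minusQuad, hi, hr]
        exact hp.v2_eq
    · have hr : k.re = 0 := hcr.resolve_left hi.ne'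
      simp [plusQuad, minusQuad, hi, hr]
      exact hp.v1_eq

variable (D : IsSpectralData lam L x t a b Ψ qv) (H : IsDiscriminant lam L a)

include D H in
theorem IsSpectralData.analyticAt_mul_sectorFactor {r G Gb : ℂ → ℂ} {k : ℂ} {j : Fin 4}
    (hr : AnalyticAt ℂ r k) (hG : j = 0 ∨ j = 2 → AnalyticAt ℂ G k)
    (hGb : j = 1 ∨ j = 3 → AnalyticAt ℂ Gb k) (i c : Fin 2) :
    AnalyticAt ℂ (fun z => (Ψ z * sectorFactor lam L x t a b z (r z) (G z) (Gb z) j) i c) k := by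
  have h1 := H.analyticAt_bigE hr
  have h2 := H.analyticAt_bigE' hr
  have h3 : AnalyticAt ℂ (fun z => exp (I * theta x t z)) k :=
    (by unfold theta; fun_prop : Differentiable ℂ fun z => exp (I * theta x t z)).analyticAt k
  have h4 : AnalyticAt ℂ (fun z => exp (-(I * theta x t z))) k :=
    (by unfold theta; fun_prop : Differentiable ℂ fun z => exp (-(I * theta x t z))).analyticAt k
  have h5 := D.diff_a.analyticAt k
  have h6 := D.diff_b.analyticAt k
  have h7 := (differentiable_schwarz D.diff_a).analyticAt k
  have h8 := (differentiable_schwarz D.diff_b).analyticAt k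
  have h9 : AnalyticAt ℂ (fun _ => (lam : ℂ)) k := analyticAt_const
  have key : ∀ i' : Fin 2,
      AnalyticAt ℂ (fun z => sectorFactor lam L x t a b z (r z) (G z) (Gb z) j i' c) k := by
    intro i'
    fin_cases j
    · have hG := hG (by simp)
      fin_cases i' <;> fin_cases c
      exacts [h3.mul h2, (h4.mul h1).mul hG, analyticAt_const, h4.mul h1]
    · have hGb := hGb (by simp)
      fin_cases i' <;> fin_cases c
      exacts [h3.mul h2, h4.mul h6, (h3.mul h2).mul (h9.mul hGb), h4.mul h5]
    · have hG := hG (by simp)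
      fin_cases i' <;> fin_cases c
      exacts [h3.mul h7, (h4.mul h1).mul hG, h3.mul (h9.mul h8), h4.mul h1]
    · have hGb := hGb (by simp)
      fin_cases i' <;> fin_cases c
      exacts [h3.mul h2, analyticAt_const, (h3.mul h2).mul (h9.mul hGb), h4.mul h1]
  simp only [Matrix.mul_apply, Fin.sum_univ_two]
  exact (((D.diff_Ψ i 0).analyticAt k).mul (key 0)).add (((D.diff_Ψ i 1).analyticAt k).mul (key 1))

/-- The solution of the Riemann–Hilbert problem. -/
def rhSol (lam L x t : ℝ) (a b : ℂ → ℂ) (Ψ : ℂ → Mat2) (k : ℂ) : Mat2 :=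
  Ψ k * sectorFactor lam L x t a b k (sqrtDiscr lam L a k) (gammaT lam L a b k)
    (schwarz (gammaT lam L a b) k) (quad k)

end Solution

section Solution

variable {lam L x t : ℝ} {a b : ℂ → ℂ} {Ψ : ℂ → Mat2} {qv : ℂ}

theorem plusSide_eq {k z : ℂ} (h : ((z - k) * conj (leftNormal k)).re = 0)
    (hn : leftNormal z = leftNormal k) : plusSide z = plusSide k := by
  ext w
  change 0 < ((w - z) * conj (leftNormal z)).re ↔ 0 < ((w - k) * conj (leftNormal k)).re
  rw [hn, show (w - k) * conj (leftNormal k) = (w - z) * conj (leftNormal k) +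
    (z - k) * conj (leftNormal k) by ring, add_re, h, add_zero]

theorem minusSide_eq {k z : ℂ} (h : ((z - k) * conj (leftNormal k)).re = 0)
    (hn : leftNormal z = leftNormal k) : minusSide z = minusSide k := by
  ext w
  change ((w - z) * conj (leftNormal z)).re < 0 ↔ ((w - k) * conj (leftNormal k)).re < 0
  rw [hn, show (w - k) * conj (leftNormal k) = (w - z) * conj (leftNormal k) +
    (z - k) * conj (leftNormal k) by ring, add_re, h, add_zero]

theorem quad_eventually {k : ℂ} (hi : k.im ≠ 0) (hr : k.re ≠ 0) : ∀ᶠ z in 𝓝 k, quad z = quad k := by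
  have h1 : ∀ᶠ z in 𝓝 k, 0 < z.im * k.im :=
    (Continuous.tendsto (by fun_prop : Continuous fun z : ℂ => z.im * k.im) k).eventually
      (lt_mem_nhds (mul_self_pos.2 hi))
  have h2 : ∀ᶠ z in 𝓝 k, 0 < z.re * k.re :=
    (Continuous.tendsto (by fun_prop : Continuous fun z : ℂ => z.re * k.re) k).eventually
      (lt_mem_nhds (mul_self_pos.2 hr))
  filter_upwards [h1, h2] with z h1 h2
  have e1 : 0 < z.im ↔ 0 < k.im := ⟨fun h => by nlinarith, fun h => by nlinarith⟩
  have e2 : 0 < z.re ↔ 0 < k.re := ⟨fun h => by nlinarith, fun h => by nlinarith⟩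
  simp only [quad, e1, e2]

theorem mem_quadrant_of_quad {k : ℂ} (hi : k.im ≠ 0) (hr : k.re ≠ 0) :
    (quad k = 0 ∨ quad k = 2 → k ∈ D1 ∨ k ∈ D3) ∧
    (quad k = 1 ∨ quad k = 3 → conj k ∈ D1 ∨ conj k ∈ D3) := by
  simp only [quad, D1, D3, mem_ofPred_eq, conj_re, conj_im]
  rcases lt_or_gt_of_ne hi with h1 | h1 <;> rcases lt_or_gt_of_ne hr with h2 | h2 <;>
    simp [h1, h2, not_lt.2 h1.le, not_lt.2 h2.le]

variable (D : IsSpectralData lam L x t a b Ψ qv) (H : IsDiscriminant lam L a)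

include D H in
/-- Off the contour and the poles the factor of `Γ̃` used in the quadrant is analytic. -/
theorem IsSpectralData.regular_of_notMem {k : ℂ} (hk : k ∉ contour lam L a ∪ poleSet lam L a b) :
    k.im ≠ 0 ∧ k.re ≠ 0 ∧ k ∈ (closure (cuts lam L a))ᶜ ∧
    (quad k = 0 ∨ quad k = 2 → AnalyticAt ℂ (gammaT lam L a b) k ∧
      GammaRel lam L a b k (sqrtDiscr lam L a k) (gammaT lam L a b k)) ∧
    (quad k = 1 ∨ quad k = 3 → AnalyticAt ℂ (schwarz (gammaT lam L a b)) k ∧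
      GammaBarRel lam L a b k (sqrtDiscr lam L a k) (schwarz (gammaT lam L a b) k)) := by
  have hi : k.im ≠ 0 := fun h => hk (Or.inl (Or.inl (Or.inl h)))
  have hr : k.re ≠ 0 := fun h => hk (Or.inl (Or.inl (Or.inr h)))
  have hΩ : k ∈ (closure (cuts lam L a))ᶜ := fun h => hk (Or.inl (Or.inr h))
  have hΩc : conj k ∈ (closure (cuts lam L a))ᶜ := fun h => hΩ (H.conj_mem_closure_cuts.1 h)
  have hq := mem_quadrant_of_quad hi hr
  refine ⟨hi, hr, hΩ, fun h => ?_, fun h => ?_⟩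
  · obtain ⟨h1, h2⟩ := D.gammaT_of_not_pole H hΩ (b := b) fun hp => hk <| Or.inr <| Or.inl <|
      (hq.1 h).imp (fun h' => ⟨h', hΩ, hp⟩) fun h' => ⟨h', hΩ, hp⟩
    exact ⟨h1, h2.self_of_nhds⟩
  · obtain ⟨h1, h2⟩ := D.gammaT_of_not_pole H hΩc (b := b) fun hp => hk <| Or.inr <| Or.inr <|
      (hq.2 h).imp (fun h' => ⟨h', hΩc, hp⟩) fun h' => ⟨h', hΩc, hp⟩
    refine ⟨analyticAt_schwarz h1, ?_⟩
    have := h2.self_of_nhds.conj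
    rwa [H.conj_sqrtDiscr hΩ] at this

include D H in
theorem IsSpectralData.analyticAt_rhSol {k : ℂ} (hk : k ∉ contour lam L a ∪ poleSet lam L a b)
    (i j : Fin 2) : AnalyticAt ℂ (fun z => rhSol lam L x t a b Ψ z i j) k := by
  obtain ⟨hi, hr, hΩ, h0, h1⟩ := D.regular_of_notMem H hk
  refine (D.analyticAt_mul_sectorFactor H (j := quad k) (H.analyticAt_sqrtDiscr hΩ)
    (fun h => (h0 h).1) (fun h => (h1 h).1) i j).congr ?_
  filter_upwards [quad_eventually hi hr] with z hz
  rw [rhSol, hz]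

include D in
theorem IsSpectralData.det_Psi (k : ℂ) : (Ψ k).det = 1 := by
  rw [Matrix.det_fin_two]; exact D.det_Ψ k

include D H in
theorem IsSpectralData.det_rhSol {k : ℂ} (hk : k ∉ contour lam L a ∪ poleSet lam L a b) :
    (rhSol lam L x t a b Ψ k).det = 1 := by
  obtain ⟨-, -, hΩ, h0, h1⟩ := D.regular_of_notMem H hk
  rw [rhSol, Matrix.det_mul, D.det_Psi, one_mul]
  exact det_sectorFactor (bigE_mul_bigE' (H.isNormalizedRoot_sqrtDiscr.sq k hΩ))
    (fun h => (h0 h).2) fun h => (h1 h).2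

include D H in
/-- Near a point of the contour the solution continues analytically from both sides, and the
continuations are related by the jump matrix. -/
theorem IsSpectralData.exists_boundary
    (hbd : ∀ k ∈ contour lam L a,
      gammaT lam L a b =O[𝓝[(closure (cuts lam L a))ᶜ] k] fun _ => (1 : ℂ))
    {k0 : ℂ} (hk0 : k0 ∈ contourStar lam L a) : ∃ ε > 0, ∃ Mp Mm : ℂ → Mat2,
      (∀ i j, DifferentiableOn ℂ (fun z => Mp z i j) (ball k0 ε)) ∧
      (∀ i j, DifferentiableOn ℂ (fun z => Mm z i j) (ball k0 ε)) ∧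
      (∀ z ∈ ball k0 ε, z ∈ plusSide k0 → rhSol lam L x t a b Ψ z = Mp z) ∧
      (∀ z ∈ ball k0 ε, z ∈ minusSide k0 → rhSol lam L x t a b Ψ z = Mm z) ∧
      Mm k0 = Mp k0 * jump lam L x t a b k0 ∧
      ∀ z ∈ ball k0 ε, (z ∈ contour lam L a ↔ ((z - k0) * conj (leftNormal k0)).re = 0) ∧
        (((z - k0) * conj (leftNormal k0)).re = 0 → z ∈ contourStar lam L a ∧
          plusSide z = plusSide k0 ∧ minusSide z = minusSide k0) := by
  obtain ⟨rp, rm, Gp, Gm, Gbp, Gbm, ε1, hε1, B⟩ := D.exists_localBoundary H hbd hk0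
  have h0 : k0 ≠ 0 := fun h => hk0.2 (Or.inr (Or.inl h))
  obtain ⟨ε2, hε2, hq⟩ := eventually_nhds_iff_ball.1 (quad_of_sides h0)
  have hs1 : ball k0 (min ε1 ε2) ⊆ ball k0 ε1 :=
    ball_subset_ball (min_le_left _ _)
  have hs2 : ball k0 (min ε1 ε2) ⊆ ball k0 ε2 :=
    ball_subset_ball (min_le_right _ _)
  have hself : k0 ∈ ball k0 ε1 := mem_ball_self hε1
  have han : ∀ {f : ℂ → ℂ}, DifferentiableOn ℂ f (ball k0 ε1) →
      ∀ z ∈ ball k0 ε1, AnalyticAt ℂ f z :=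
    fun hf z hz => hf.analyticAt (isOpen_ball.mem_nhds hz)
  have hev : ball k0 ε1 ∈ 𝓝 k0 := ball_mem_nhds k0 hε1
  have hJp : JumpRel lam L a b k0 (rp k0) (Gp k0) (Gbp k0) :=
    ⟨bigE_mul_bigE' (B.sq k0 hself).1, (B.rel_p k0 hself).1, (B.rel_p k0 hself).2⟩
  have hJm : JumpRel lam L a b k0 (rm k0) (Gm k0) (Gbm k0) :=
    ⟨bigE_mul_bigE' (B.sq k0 hself).2, (B.rel_m k0 hself).1, (B.rel_m k0 hself).2⟩
  have hlimp : ∀ {f g : ℂ → ℂ}, DifferentiableOn ℂ g (ball k0 ε1) →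
      (∀ z ∈ ball k0 ε1, z ∈ plusSide k0 → f z = g z) → bdryPlus f k0 = g k0 := by
    intro f g hg hfg
    refine Tendsto.limUnder_eq (((han hg k0 hself).continuousAt.tendsto.mono_left
      nhdsWithin_le_nhds).congr' ?_)
    filter_upwards [nhdsWithin_le_nhds hev, self_mem_nhdsWithin] with z h1 h2
    exact (hfg z h1 h2).symm
  have hlimm : ∀ {f g : ℂ → ℂ}, DifferentiableOn ℂ g (ball k0 ε1) →
      (∀ z ∈ ball k0 ε1, z ∈ minusSide k0 → f z = g z) → bdryMinus f k0 = g k0 := by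
    intro f g hg hfg
    refine Tendsto.limUnder_eq (((han hg k0 hself).continuousAt.tendsto.mono_left
      nhdsWithin_le_nhds).congr' ?_)
    filter_upwards [nhdsWithin_le_nhds hev, self_mem_nhdsWithin] with z h1 h2
    exact (hfg z h1 h2).symm
  refine ⟨min ε1 ε2, lt_min hε1 hε2,
    fun z => Ψ z * sectorFactor lam L x t a b z (rp z) (Gp z) (Gbp z) (plusQuad k0),
    fun z => Ψ z * sectorFactor lam L x t a b z (rm z) (Gm z) (Gbm z) (minusQuad k0),
    fun i j z hz => ?_, fun i j z hz => ?_, fun z hz hs => ?_, fun z hz hs => ?_, ?_,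
    fun z hz => ⟨B.contour_iff z (hs1 hz), fun hl => ?_⟩⟩
  · exact (D.analyticAt_mul_sectorFactor H (han B.diff_rp z (hs1 hz))
      (fun _ => han B.diff_Gp z (hs1 hz)) (fun _ => han B.diff_Gbp z (hs1 hz))
      i j).differentiableAt.differentiableWithinAt
  · exact (D.analyticAt_mul_sectorFactor H (han B.diff_rm z (hs1 hz))
      (fun _ => han B.diff_Gm z (hs1 hz)) (fun _ => han B.diff_Gbm z (hs1 hz))
      i j).differentiableAt.differentiableWithinAt
  · obtain ⟨e1, e2, e3⟩ := B.plus z (hs1 hz) hs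
    rw [rhSol, e1, e2, e3, (hq z (hs2 hz)).1 hs]
  · obtain ⟨e1, e2, e3⟩ := B.minus z (hs1 hz) hs
    rw [rhSol, e1, e2, e3, (hq z (hs2 hz)).2 hs]
  · dsimp only
    rw [Matrix.mul_assoc]
    congr 1
    refine sectorFactor_mul_jump h0 hJp hJm (hlimp B.diff_Gp fun z h1 h2 => (B.plus z h1 h2).2.1)
      (hlimm B.diff_Gm fun z h1 h2 => (B.minus z h1 h2).2.1)
      (hlimp B.diff_Gbp fun z h1 h2 => (B.plus z h1 h2).2.2)
      (hlimm B.diff_Gbm fun z h1 h2 => (B.minus z h1 h2).2.2) B.cut fun hc => ⟨?_, B.noncut hc⟩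
    exact hk0.1.resolve_right ((mem_cuts_or_notMem_closure hk0).resolve_left hc)
  · obtain ⟨e1, e2, -⟩ := B.line z (hs1 hz) hl
    exact ⟨e1, plusSide_eq hl e2, minusSide_eq hl e2⟩

include D H in
theorem IsSpectralData.isBigO_rhSol
    (hbd : ∀ k ∈ contour lam L a,
      gammaT lam L a b =O[𝓝[(closure (cuts lam L a))ᶜ] k] fun _ => (1 : ℂ))
    {k : ℂ} (hk : k ∈ contour lam L a) (i j : Fin 2) :
    (fun z => rhSol lam L x t a b Ψ z i j) =O[𝓝[(contour lam L a)ᶜ] k] fun _ => (1 : ℂ) := by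
  set l := 𝓝[(contour lam L a)ᶜ] k
  have hl : l ≤ 𝓝[(closure (cuts lam L a))ᶜ] k :=
    nhdsWithin_mono _ (compl_subset_compl.2 subset_union_right)
  have hc : ∀ {f : ℂ → ℂ}, Continuous f → f =O[l] fun _ => (1 : ℂ) := fun hf =>
    ((hf.tendsto k).isBigO_one ℂ).mono nhdsWithin_le_nhds
  have hmul : ∀ {f g : ℂ → ℂ}, f =O[l] (fun _ => (1 : ℂ)) → g =O[l] (fun _ => (1 : ℂ)) →
      (fun z => f z * g z) =O[l] fun _ => (1 : ℂ) := fun hf hg => by simpa using hf.mul hg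
  have hR : sqrtDiscr lam L a =O[l] fun _ => (1 : ℂ) := by
    refine IsBigO.of_pow two_ne_zero ?_
    have : (disc4 L a) =O[l] fun _ => (1 : ℂ) := hc H.differentiable_disc4.continuous
    refine (this.congr' ?_ ?_)
    · filter_upwards [self_mem_nhdsWithin] with z hz
      exact (H.isNormalizedRoot_sqrtDiscr.sq z fun h => hz (Or.inr h)).symm
    · exact Eventually.of_forall fun z => by simp
  have hE : (fun z => bigE L a (sqrtDiscr lam L a z) z) =O[l] fun _ => (1 : ℂ) := by
    have h1 : (fun z => exp (I * z * L) / 2) =O[l] fun _ => (1 : ℂ) := hc (by fun_prop)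
    have h2 := hmul h1 ((hc H.continuous).sub (hmul (hc (continuous_const (y := I))) hR))
    refine h2.congr_left fun z => ?_
    simp only [bigE]; ring
  have hE' : (fun z => bigE' L a (sqrtDiscr lam L a z) z) =O[l] fun _ => (1 : ℂ) := by
    have h1 : (fun z => exp (-(I * z * L)) / 2) =O[l] fun _ => (1 : ℂ) := hc (by fun_prop)
    have h2 := hmul h1 ((hc H.continuous).add (hmul (hc (continuous_const (y := I))) hR))
    refine h2.congr_left fun z => ?_
    simp only [bigE']; ring
  have hG : gammaT lam L a b =O[l] fun _ => (1 : ℂ) := (hbd k hk).mono hl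
  have hGb : schwarz (gammaT lam L a b) =O[l] fun _ => (1 : ℂ) :=
    (H.isBigO_schwarz_gammaT hbd hk).mono hl
  have hη : (fun z => exp (I * theta x t z)) =O[l] fun _ => (1 : ℂ) :=
    hc (by unfold theta; fun_prop)
  have hζ : (fun z => exp (-(I * theta x t z))) =O[l] fun _ => (1 : ℂ) :=
    hc (by unfold theta; fun_prop)
  have ha := hc D.diff_a.continuous
  have hb := hc D.diff_b.continuous
  have ha' := hc (differentiable_schwarz D.diff_a).continuous
  have hb' := hc (differentiable_schwarz D.diff_b).continuous
  have hlam := hc (continuous_const (y := (lam : ℂ)))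
  have h0 : (fun _ => (0 : ℂ)) =O[l] fun _ => (1 : ℂ) := isBigO_zero _ _
  have key : ∀ (q : Fin 4) (i' : Fin 2), (fun z => sectorFactor lam L x t a b z
      (sqrtDiscr lam L a z) (gammaT lam L a b z) (schwarz (gammaT lam L a b) z) q i' j) =O[l]
      fun _ => (1 : ℂ) := by
    intro q i'
    fin_cases q <;> fin_cases i' <;> fin_cases j
    exacts [hmul hη hE', hmul (hmul hζ hE) hG, h0, hmul hζ hE,
      hmul hη hE', hmul hζ hb, hmul (hmul hη hE') (hmul hlam hGb), hmul hζ ha,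
      hmul hη ha', hmul (hmul hζ hE) hG, hmul hη (hmul hlam hb'), hmul hζ hE,
      hmul hη hE', h0, hmul (hmul hη hE') (hmul hlam hGb), hmul hζ hE]
  have key2 : ∀ q : Fin 4, (fun z => (Ψ z * sectorFactor lam L x t a b z
      (sqrtDiscr lam L a z) (gammaT lam L a b z) (schwarz (gammaT lam L a b) z) q) i j) =O[l]
      fun _ => (1 : ℂ) := by
    intro q
    simp only [Matrix.mul_apply, Fin.sum_univ_two]
    exact (hmul (hc (D.diff_Ψ i 0).continuous) (key q 0)).add
      (hmul (hc (D.diff_Ψ i 1).continuous) (key q 1))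
  have key3 := IsBigO.sum (s := Finset.univ) fun q _ => (key2 q).norm_left
  refine (IsBigO.of_bound 1 (Eventually.of_forall fun z => ?_)).trans key3
  rw [one_mul, Finset.sum_apply, Real.norm_of_nonneg (Finset.sum_nonneg fun q _ => norm_nonneg _)]
  exact Finset.single_le_sum (f := fun q => ‖(Ψ z * sectorFactor lam L x t a b z
      (sqrtDiscr lam L a z) (gammaT lam L a b z) (schwarz (gammaT lam L a b) z) q) i j‖)
      (fun q _ => norm_nonneg _) (Finset.mem_univ (quad z))

end Solution

section Infinity

variable {lam L x t : ℝ} {a b : ℂ → ℂ} {Ψ : ℂ → Mat2} {qv : ℂ}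
variable (D : IsSpectralData lam L x t a b Ψ qv) (H : IsDiscriminant lam L a)

include D H in
theorem IsSpectralData.isBigO_gammaT_of_ne {k : ℂ} (hk : k ∈ (closure (cuts lam L a))ᶜ)
    (hne : a k - eL L k * bigE' L a (sqrtDiscr lam L a k) k ≠ 0) :
    gammaT lam L a b =O[𝓝[≠] k] fun _ => (1 : ℂ) := by
  have hloc := H.sqrtDiscr_local hk
  by_cases hb : b = 0
  · refine (isBigO_zero (fun _ => (1 : ℂ)) (𝓝[≠] k)).congr' ?_ EventuallyEq.rfl
    filter_upwards [nhdsWithin_le_nhds hloc] with z hz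
    exact (D.gammaT_of_eq_zero H hb hz.1).symm
  · have hsb := eventually_ne_of_ne_zero (differentiable_schwarz D.diff_b) (schwarz_ne_zero hb) k
    have hdL : Differentiable ℂ (eL L) := by unfold eL; fun_prop
    have han : ContinuousAt (fun z => b z / (a z - eL L z * bigE' L a (sqrtDiscr lam L a z) z)) k :=
      (D.diff_b k).continuousAt.div ((D.diff_a k).continuousAt.sub ((hdL k).continuousAt.mul
        (H.analyticAt_bigE' (H.analyticAt_sqrtDiscr hk)).continuousAt)) hne
    have hne' : ∀ᶠ z in 𝓝 k, a z - eL L z * bigE' L a (sqrtDiscr lam L a z) z ≠ 0 :=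
      ((D.diff_a k).continuousAt.sub ((hdL k).continuousAt.mul
        (H.analyticAt_bigE' (H.analyticAt_sqrtDiscr hk)).continuousAt)).eventually_ne hne
    refine ((han.tendsto.isBigO_one ℂ).mono nhdsWithin_le_nhds).congr' ?_ EventuallyEq.rfl
    filter_upwards [nhdsWithin_le_nhds hloc, hsb, nhdsWithin_le_nhds hne'] with z h1 h2 h3
    have := (D.gammaRel_of_one H h1.2 h2 (D.mul_gammaT H h1.1 h2)).two
    rw [div_eq_iff h3]
    linear_combination -this

include D H in
theorem IsSpectralData.gammaRel_of_ne {k : ℂ} (hk : k ∈ (closure (cuts lam L a))ᶜ)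
    (hne : a k - eL L k * bigE' L a (sqrtDiscr lam L a k) k ≠ 0) :
    GammaRel lam L a b k (sqrtDiscr lam L a k) (gammaT lam L a b k) :=
  (D.gammaT_of_bounded H hk (D.isBigO_gammaT_of_ne H hk hne)).2.self_of_nhds

/-- Near infinity off the disks `Γ̃` and its conjugate are the components of the Bloch pair. -/
theorem IsBlochPair.gammaRel {δ : ℝ} {k g h γ γ' d d' w w' r : ℂ}
    (B : IsBlochPair lam L x t a b Ψ qv δ k g h γ γ' d d' w w')
    (h1 : w' = bigE L a r k) (h2 : w = bigE' L a r k) :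
    GammaRel lam L a b k r g ∧ GammaBarRel lam L a b k r h := by
  have he := exp_neg_mul_exp (I * k * L)
  have he0 := Complex.exp_ne_zero (I * k * L)
  have he1 := Complex.exp_ne_zero (-(I * k * L))
  have r1 := B.row1
  have r2 := B.row2
  have r3 := B.row3
  have r4 := B.row4
  rw [h2] at r1 r2
  rw [h1] at r3 r4
  refine ⟨⟨mul_left_cancel₀ he0 ?_, mul_left_cancel₀ he1 ?_⟩,
    mul_left_cancel₀ he1 ?_, mul_left_cancel₀ he0 ?_⟩
  · linear_combination -r2
  · rw [eL_eq]
    linear_combination r1 - exp (I * k * L) * bigE' L a r k * g * he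
  · linear_combination -r3
  · rw [eLInv_eq]
    linear_combination r4 - exp (-(I * k * L)) * bigE L a r k * h * he

include D H in
theorem IsSpectralData.exists_bloch_gamma : ∃ K > 0, ∃ C > 0, ∀ k ∉ disks L, K ≤ ‖k‖ →
    C / ‖k‖ ≤ 1 / 2 ∧ k ∈ (closure (cuts lam L a))ᶜ ∧
    ∃ γ γ' d d' w w', IsBlochPair lam L x t a b Ψ qv (C / ‖k‖) k (gammaT lam L a b k)
        (schwarz (gammaT lam L a b) k) γ γ' d d' w w' ∧
      w' = bigE L a (sqrtDiscr lam L a k) k ∧ w = bigE' L a (sqrtDiscr lam L a k) k := by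
  obtain ⟨K, hK, C, hC, h⟩ := D.exists_bloch_root H
  have hll := lam_mul_lam H.lam_eq
  have key : ∀ k ∉ disks L, max K (2 * C) ≤ ‖k‖ → C / ‖k‖ ≤ 1 / 2 ∧
      k ∈ (closure (cuts lam L a))ᶜ ∧ ∃ g h γ γ' d d' w w',
      IsBlochPair lam L x t a b Ψ qv (C / ‖k‖) k g h γ γ' d d' w w' ∧
      w' = bigE L a (sqrtDiscr lam L a k) k ∧ w = bigE' L a (sqrtDiscr lam L a k) k ∧
      a k - eL L k * bigE' L a (sqrtDiscr lam L a k) k ≠ 0 ∧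
      schwarz a k - eLInv L k * bigE L a (sqrtDiscr lam L a k) k ≠ 0 := by
    intro k hk hkK
    obtain ⟨-, e2, e3, g, h, γ, γ', d, d', w, w', hB, -, e4, e5⟩ := h k hk ((le_max_left _ _).trans hkK)
    have hkpos : 0 < ‖k‖ := hK.trans_le ((le_max_left _ _).trans hkK)
    have hdiff : bigE L a (sqrtDiscr lam L a k) k - eL L k * bigE' L a (sqrtDiscr lam L a k) k =
        -I * exp (I * k * L) * sqrtDiscr lam L a k := by
      rw [eL_eq]
      simp only [bigE, bigE']
      linear_combination (-exp (I * k * L) * (discr L a k + I * sqrtDiscr lam L a k) / 2) *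
        exp_neg_mul_exp (I * k * L)
    have hne : bigE L a (sqrtDiscr lam L a k) k -
        eL L k * bigE' L a (sqrtDiscr lam L a k) k ≠ 0 := by
      rw [hdiff]
      exact mul_ne_zero (mul_ne_zero (neg_ne_zero.2 I_ne_zero) (Complex.exp_ne_zero _)) e3
    have hp := eL_mul_eLInv L k
    obtain ⟨q1, q2⟩ := hB.gammaRel e4 e5
    refine ⟨?_, e2, g, h, γ, γ', d, d', w, w', hB, e4, e5, fun h0 => hne ?_, fun h0 => hne ?_⟩
    · rw [div_le_iff₀ hkpos]
      linarith [(le_max_right _ _).trans hkK]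
    · have hb0 : b k = 0 := by linear_combination g * h0 - q1.two
      have := q2.one
      rw [hb0] at this
      linear_combination h0 + this
    · have hb0 : schwarz b k = 0 := by linear_combination h * h0 - q2.two
      have := q1.one
      rw [hb0] at this
      linear_combination (-bigE L a (sqrtDiscr lam L a k) k) * hp - eL L k * h0 - eL L k * this
  refine ⟨max K (2 * C), by positivity, C, hC, fun k hk hkK => ?_⟩
  obtain ⟨e1, e2, g, h, γ, γ', d, d', w, w', hB, e3, e4, e5, e6⟩ := key k hk hkK
  obtain ⟨-, f2, -, -, -, -, -, -, -, -, -, -, -, f5, -⟩ := key (conj k) (conj_notMem_disks hk)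
    (by rwa [RCLike.norm_conj])
  obtain ⟨q1, q2⟩ := hB.gammaRel e3 e4
  have r1 := (D.gammaRel_of_ne H e2 e5).two
  have r2 := (D.gammaRel_of_ne H f2 f5).conj.two
  rw [H.conj_sqrtDiscr e2] at r2
  have hg : g = gammaT lam L a b k := mul_left_cancel₀ e5 (by linear_combination q1.two - r1)
  have r3 := q2.two
  have hh : h = schwarz (gammaT lam L a b) k := by
    apply mul_left_cancel₀ e6
    simp only [schwarz] at r2 r3 ⊢
    linear_combination r3 - r2
  subst hg hh
  exact ⟨e1, e2, γ, γ', d, d', w, w', hB, e3, e4⟩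

/-- The exponential factor of the correction to the second column. -/
def corrExp (L x t : ℝ) (k : ℂ) : ℂ :=
  if quad k = 1 then eL L k * eThetaInv x t k else if quad k = 3 then eThetaInv x t k else 0

theorem theta_im (x t : ℝ) (k : ℂ) : (theta x t k).im = k.im * x + 4 * k.re * k.im * t := by
  simp only [theta, sq, add_im, mul_im, mul_re, ofReal_re,
    ofReal_im, re_ofNat, im_ofNat]
  ring

theorem norm_eTheta (x t : ℝ) (k : ℂ) : ‖eTheta x t k‖ = Real.exp (-(2 * (theta x t k).im)) := by
  rw [eTheta, Complex.norm_exp]; simp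

theorem norm_eThetaInv (x t : ℝ) (k : ℂ) : ‖eThetaInv x t k‖ = Real.exp (2 * (theta x t k).im) := by
  rw [eThetaInv, Complex.norm_exp]; simp

theorem norm_eL (L : ℝ) (k : ℂ) : ‖eL L k‖ = Real.exp (-(2 * (k.im * L))) := by
  rw [eL, Complex.norm_exp]; simp [mul_assoc]

theorem norm_eLInv (L : ℝ) (k : ℂ) : ‖eLInv L k‖ = Real.exp (2 * (k.im * L)) := by
  rw [eLInv, Complex.norm_exp]; simp [mul_assoc]

/-- The columns of the solution near infinity in terms of the Bloch pair. -/
theorem IsBlochPair.columns {δ : ℝ} {k g h γ γ' d d' w w' r : ℂ}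
    (B : IsBlochPair lam L x t a b Ψ qv δ k g h γ γ' d d' w w')
    (h1 : w' = bigE L a r k) (h2 : w = bigE' L a r k) (hlam : lam = 1 ∨ lam = -1)
    (hδ0 : 0 ≤ δ) (hδ : δ ≤ 1 / 2) (hx : x ∈ Icc 0 L) (ht : 0 ≤ t) (hi : k.im ≠ 0)
    (hr : k.re ≠ 0) : ∃ c0 c1 ν0 ν1 : ℂ, ‖c0‖ ≤ 2 * δ ∧ ‖c1‖ ≤ 2 * δ ∧
      ‖c1‖ ≤ 2 * δ * ‖corrExp L x t k‖ ∧ ‖ν0 - 1‖ ≤ δ ∧ ‖ν1 - 1‖ ≤ δ ∧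
      (Ψ k * sectorFactor lam L x t a b k r g h (quad k)) 0 0 = (w * d' - c0 * (d * γ)) / ν0 ∧
      (Ψ k * sectorFactor lam L x t a b k r g h (quad k)) 1 0 =
        (w * d' * (lam * γ') - c0 * d) / ν0 ∧
      (Ψ k * sectorFactor lam L x t a b k r g h (quad k)) 0 1 = (w' * d * γ - c1 * d') / ν1 ∧
      (Ψ k * sectorFactor lam L x t a b k r g h (quad k)) 1 1 =
        (w' * d - c1 * (d' * (lam * γ'))) / ν1 := by
  obtain ⟨q1, q2⟩ := B.gammaRel h1 h2
  have g1 := q1.one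
  have g2 := q1.two
  have l1 := q2.one
  have l2 := q2.two
  have hη := exp_neg_mul_exp (I * theta x t k)
  have hle : ∀ {z : ℂ}, ‖z - 1‖ ≤ δ → ‖z‖ ≤ 2 := fun {z} hz => by
    have := norm_add_le (z - 1) 1
    rw [sub_add_cancel, norm_one] at this
    linarith
  have hw := hle B.w_le
  have hw' := hle B.w'_le
  have hμ : ‖(1 - lam * g * h) - 1‖ ≤ δ := by
    rw [sub_sub_cancel_left, norm_neg, norm_mul, norm_mul, norm_lam hlam, one_mul]
    nlinarith [B.g_le, B.h_le, norm_nonneg g, norm_nonneg h]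
  have hμ0 : 1 - lam * g * h ≠ 0 := fun h0 => by
    rw [h0, zero_sub, norm_neg, norm_one] at hμ; linarith
  have h3 : ∀ {y s X : ℂ}, ‖y‖ ≤ δ → ‖s‖ ≤ 2 → ‖y * s * X‖ ≤ 2 * δ * ‖X‖ := fun hy hs => by
    rw [norm_mul, norm_mul]
    have := mul_le_mul hy hs (norm_nonneg _) hδ0
    exact mul_le_mul_of_nonneg_right (by linarith) (norm_nonneg _)
  have h4 : ∀ {y s X : ℂ}, ‖y‖ ≤ δ → ‖s‖ ≤ 2 → ‖X‖ ≤ 1 → ‖y * s * X‖ ≤ 2 * δ := fun hy hs hX =>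
    (h3 hy hs).trans (by nlinarith)
  have hlh : ‖lam * h‖ ≤ δ := by rw [norm_mul, norm_lam hlam, one_mul]; exact B.h_le
  have p1 := B.psi1
  have p2 := B.psi2
  have p3 := B.psi3
  have p4 := B.psi4
  have hθ := theta_im x t k
  have hη2 := eTheta_eq x t k
  have hζ2 := eThetaInv_eq x t k
  subst h1 h2
  set E := bigE L a r k
  set E' := bigE' L a r k
  set η := exp (I * theta x t k)
  set ζ := exp (-(I * theta x t k))
  have A1 : schwarz a k * (1 - lam * g * h) = E' - lam * g * h * eLInv L k * E := by
    linear_combination (-lam * g) * l2 - g1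
  have B1 : schwarz b k * (1 - lam * g * h) = h * (E' - eLInv L k * E) := by
    linear_combination -l2 - h * g1
  have A2 : a k * (1 - lam * g * h) = E - lam * g * h * eL L k * E' := by
    linear_combination (-lam * h) * g2 - l1
  have B2 : b k * (1 - lam * g * h) = g * (E - eL L k * E') := by
    linear_combination -g2 - g * l1
  have h00 : ‖(0 : ℂ)‖ ≤ 2 * δ := by simpa using hδ0
  have h01 : ‖(0 : ℂ)‖ ≤ 2 * δ * ‖corrExp L x t k‖ := by simp; positivity
  have h11 : ‖(1 : ℂ) - 1‖ ≤ δ := by simpa using hδ0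
  rcases lt_or_gt_of_ne hi with hi | hi <;> rcases lt_or_gt_of_ne hr with hr | hr
  · have hq : quad k = 2 := by simp [quad, not_lt.2 hi.le, not_lt.2 hr.le]
    have hX : ‖(eLInv L k * eTheta x t k)‖ ≤ 1 := by
      rw [norm_mul, norm_eLInv, norm_eTheta, ← Real.exp_add, Real.exp_le_one_iff, hθ]
      nlinarith [mul_nonneg (mul_nonneg_of_nonpos_of_nonpos hi.le hr.le) ht,
        mul_nonneg (neg_nonneg.2 hi.le) (sub_nonneg.2 hx.2)]
    rw [hq]
    refine ⟨lam * h * E * (eLInv L k * eTheta x t k), 0, 1 - lam * g * h, 1, h4 hlh hw' hX, h00, h01, hμ, h11,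
      ?_, ?_, ?_, ?_⟩ <;>
      simp only [sectorFactor, Matrix.mul_apply, Fin.sum_univ_two, Matrix.of_apply,
        Matrix.cons_val, Matrix.cons_val_zero, Matrix.cons_val_one, zero_mul, sub_zero, div_one,
        hη2]
    · rw [eq_div_iff hμ0]
      linear_combination η * Ψ k 0 0 * A1 + η * lam * Ψ k 0 1 * B1 + η * E' * p3 - η * lam * h * eLInv L k * E * p1 + E' * d' * hη
    · rw [eq_div_iff hμ0]
      linear_combination η * Ψ k 1 0 * A1 + η * lam * Ψ k 1 1 * B1 + η * E' * p4 - η * lam * h * eLInv L k * E * p2 + E' * d' * (lam * γ') * hη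
    · linear_combination ζ * E * p1 + E * d * γ * hη
    · linear_combination ζ * E * p2 + E * d * hη
  · have hq : quad k = 3 := by simp [quad, not_lt.2 hi.le, hr]
    have hX : ‖eThetaInv x t k‖ ≤ 1 := by
      rw [norm_eThetaInv, Real.exp_le_one_iff, hθ]
      nlinarith [mul_nonneg (mul_nonneg (neg_nonneg.2 hi.le) hr.le) ht,
        mul_nonneg (neg_nonneg.2 hi.le) hx.1]
    have hX' : corrExp L x t k = eThetaInv x t k := by simp [corrExp, hq]
    rw [hq, hX']
    refine ⟨0, g * E * eThetaInv x t k, 1, 1 - lam * g * h, h00, h4 B.g_le hw' hX, h3 B.g_le hw', h11, hμ,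
      ?_, ?_, ?_, ?_⟩ <;>
      simp only [sectorFactor, Matrix.mul_apply, Fin.sum_univ_two, Matrix.of_apply,
        Matrix.cons_val, Matrix.cons_val_zero, Matrix.cons_val_one, zero_mul, sub_zero, div_one,
        hζ2]
    · linear_combination η * E' * p3 + E' * d' * hη
    · linear_combination η * E' * p4 + E' * d' * (lam * γ') * hη
    · rw [eq_div_iff hμ0]
      linear_combination ζ * E * (p1 - g * p3) + E * d * γ * hη
    · rw [eq_div_iff hμ0]
      linear_combination ζ * E * (p2 - g * p4) + E * d * hη
  · have hq : quad k = 1 := by simp [quad, hi, not_lt.2 hr.le]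
    have hX : ‖(eL L k * eThetaInv x t k)‖ ≤ 1 := by
      rw [norm_mul, norm_eL, norm_eThetaInv, ← Real.exp_add, Real.exp_le_one_iff, hθ]
      nlinarith [mul_nonneg (mul_nonneg hi.le (neg_nonneg.2 hr.le)) ht,
        mul_nonneg hi.le (sub_nonneg.2 hx.2)]
    have hX' : corrExp L x t k = (eL L k * eThetaInv x t k) := by simp [corrExp, hq]
    rw [hq, hX']
    refine ⟨0, g * E' * (eL L k * eThetaInv x t k), 1, 1 - lam * g * h, h00, h4 B.g_le hw hX, h3 B.g_le hw, h11, hμ,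
      ?_, ?_, ?_, ?_⟩ <;>
      simp only [sectorFactor, Matrix.mul_apply, Fin.sum_univ_two, Matrix.of_apply,
        Matrix.cons_val_zero, Matrix.cons_val_one, zero_mul, sub_zero, div_one,
        hζ2]
    · linear_combination η * E' * p3 + E' * d' * hη
    · linear_combination η * E' * p4 + E' * d' * (lam * γ') * hη
    · rw [eq_div_iff hμ0]
      linear_combination ζ * Ψ k 0 0 * B2 + ζ * Ψ k 0 1 * A2 + ζ * E * p1 - ζ * g * eL L k * E' * p3 + E * d * γ * hη
    · rw [eq_div_iff hμ0]
      linear_combination ζ * Ψ k 1 0 * B2 + ζ * Ψ k 1 1 * A2 + ζ * E * p2 - ζ * g * eL L k * E' * p4 + E * d * hη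
  · have hq : quad k = 0 := by simp [quad, hi, hr]
    have hX : ‖eTheta x t k‖ ≤ 1 := by
      rw [norm_eTheta, Real.exp_le_one_iff, hθ]
      nlinarith [mul_nonneg (mul_nonneg hi.le hr.le) ht, mul_nonneg hi.le hx.1]
    rw [hq]
    refine ⟨lam * h * E' * eTheta x t k, 0, 1 - lam * g * h, 1, h4 hlh hw hX, h00, h01, hμ, h11,
      ?_, ?_, ?_, ?_⟩ <;>
      simp only [sectorFactor, Matrix.mul_apply, Fin.sum_univ_two, Matrix.of_apply,
        Matrix.cons_val_zero, Matrix.cons_val_one, zero_mul, sub_zero, div_one,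
        hη2]
    · rw [eq_div_iff hμ0]
      linear_combination η * E' * (p3 - lam * h * p1) + E' * d' * hη
    · rw [eq_div_iff hμ0]
      linear_combination η * E' * (p4 - lam * h * p2) + E' * d' * (lam * γ') * hη
    · linear_combination ζ * E * p1 + E * d * γ * hη
    · linear_combination ζ * E * p2 + E * d * hη

end Infinity

section Expansion

variable {lam L x t : ℝ} {a b : ℂ → ℂ} {Ψ : ℂ → Mat2} {qv : ℂ}
variable (D : IsSpectralData lam L x t a b Ψ qv) (H : IsDiscriminant lam L a)

theorem norm_div_sub_le {N ν c : ℂ} {A B : ℝ} (hν : ‖ν - 1‖ ≤ B) (hB : B ≤ 1 / 2)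
    (hN : ‖N - c‖ ≤ A) : ‖N / ν - c‖ ≤ 2 * (A + B * ‖c‖) := by
  have h1 : 1 / 2 ≤ ‖ν‖ := by
    have := norm_sub_norm_le (1 : ℂ) (1 - ν)
    rw [sub_sub_cancel, norm_one, norm_sub_rev] at this
    linarith
  have hν0 : ν ≠ 0 := norm_pos_iff.1 (by linarith)
  have e : N / ν - c = ((N - c) - c * (ν - 1)) / ν := by field_simp; ring
  rw [e, norm_div, div_le_iff₀ (by linarith)]
  have h2 : ‖(N - c) - c * (ν - 1)‖ ≤ A + B * ‖c‖ := by
    refine (norm_sub_le _ _).trans (add_le_add hN ?_)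
    rw [norm_mul, mul_comm]
    exact mul_le_mul_of_nonneg_right hν (norm_nonneg _)
  have h3 : 0 ≤ A + B * ‖c‖ := (norm_nonneg _).trans h2
  nlinarith

theorem norm_mul_sub_one_le {u v : ℂ} {δ : ℝ} (hu : ‖u - 1‖ ≤ δ) (hv : ‖v - 1‖ ≤ δ)
    (hv2 : ‖v‖ ≤ 2) : ‖u * v - 1‖ ≤ 3 * δ := by
  have e : u * v - 1 = (u - 1) * v + (v - 1) := by ring
  rw [e]
  refine (norm_add_le _ _).trans ?_
  rw [norm_mul]
  nlinarith [norm_nonneg (u - 1)]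

include D H in
theorem IsSpectralData.exists_expansion (hx : x ∈ Icc 0 L) (ht : 0 ≤ t) :
    ∃ K > 0, ∃ C > 0, ∀ k ∉ disks L, K ≤ ‖k‖ → k.im ≠ 0 → k.re ≠ 0 →
      (∀ i j, ‖rhSol lam L x t a b Ψ k i j - (1 : Mat2) i j‖ ≤ C / ‖k‖) ∧
      ‖2 * I * k * rhSol lam L x t a b Ψ k 0 1 - qv‖ ≤ C / ‖k‖ + C * ‖corrExp L x t k‖ := by
  obtain ⟨K, hK, C, hC, h⟩ := D.exists_bloch_gamma H
  refine ⟨K, hK, 16 * C * (1 + ‖qv‖), by positivity, fun k hk hkK hi hr => ?_⟩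
  obtain ⟨hδ, -, γ, γ', d, d', w, w', B, e1, e2⟩ := h k hk hkK
  have hkpos : 0 < ‖k‖ := hK.trans_le hkK
  have hδ0 : 0 ≤ C / ‖k‖ := by positivity
  obtain ⟨c0, c1, ν0, ν1, hc0, hc1, hc1', hν0, hν1, f00, f10, f01, f11⟩ :=
    B.columns e1 e2 H.lam_eq hδ0 hδ hx ht hi hr
  have hCk : C = C / ‖k‖ * ‖k‖ := by field_simp
  have hgoal : 16 * C * (1 + ‖qv‖) / ‖k‖ = 16 * (C / ‖k‖) * (1 + ‖qv‖) := by ring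
  have hle : ∀ {z : ℂ}, ‖z - 1‖ ≤ C / ‖k‖ → ‖z‖ ≤ 2 := fun {z} hz => by
    have := norm_add_le (z - 1) 1
    rw [sub_add_cancel, norm_one] at this
    linarith
  have hw := hle B.w_le
  have hw' := hle B.w'_le
  have hd := hle B.d_le
  have hd' := hle B.d'_le
  have hγ := B.γ_le
  have hγ' : ‖lam * γ'‖ ≤ C / ‖k‖ := by
    rw [norm_mul, norm_lam H.lam_eq, one_mul]; exact B.γ'_le
  have h1 := norm_mul_sub_one_le B.w_le B.d'_le hd'
  have h2 := norm_mul_sub_one_le B.w'_le B.d_le hd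
  set δ := C / ‖k‖
  have hq := norm_nonneg qv
  have h3 : ∀ {u v z : ℂ}, ‖u‖ ≤ 2 → ‖v‖ ≤ 2 → ‖z‖ ≤ δ → ‖u * v * z‖ ≤ 4 * δ := fun hu hv hz => by
    rw [norm_mul, norm_mul]
    have := mul_le_mul hu hv (norm_nonneg _) zero_le_two
    have := mul_le_mul this hz (norm_nonneg _) (by norm_num)
    linarith
  have h4 : ∀ {c v z : ℂ}, ‖c‖ ≤ 2 * δ → ‖v‖ ≤ 2 → ‖z‖ ≤ δ → ‖c * (v * z)‖ ≤ 2 * δ :=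
    fun hc hv hz => by
      rw [norm_mul, norm_mul]
      have h5 := mul_le_mul hv hz (norm_nonneg _) zero_le_two
      have := mul_le_mul hc h5 (by positivity) (by positivity)
      nlinarith
  have h5 : ∀ {c v : ℂ}, ‖c‖ ≤ 2 * δ → ‖v‖ ≤ 2 → ‖c * v‖ ≤ 4 * δ := fun hc hv => by
    rw [norm_mul]
    have := mul_le_mul hc hv (norm_nonneg _) (by positivity)
    linarith
  have hsub : ∀ {p q c : ℂ}, ‖p - c‖ ≤ 4 * δ → ‖q‖ ≤ 4 * δ → ‖p - q - c‖ ≤ 8 * δ :=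
    fun {p q c} hp hq => by
      rw [show p - q - c = (p - c) - q by ring]
      exact (norm_sub_le _ _).trans (by linarith)
  have hsub' : ∀ {p q c : ℂ}, ‖p - c‖ ≤ 3 * δ → ‖q‖ ≤ 2 * δ → ‖p - q - c‖ ≤ 5 * δ :=
    fun {p q c} hp hq => by
      rw [show p - q - c = (p - c) - q by ring]
      exact (norm_sub_le _ _).trans (by linarith)
  rw [hgoal]
  constructor
  · intro i j
    have hfin : ∀ {A : ℝ}, A ≤ 16 * δ → A ≤ 16 * δ * (1 + ‖qv‖) := fun hA => by nlinarith
    fin_cases i <;> fin_cases j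
    · refine hfin ?_
      have := norm_div_sub_le hν0 hδ (hsub' h1 (h4 hc0 hd hγ))
      rw [norm_one] at this
      change ‖rhSol lam L x t a b Ψ k 0 0 - (1 : Mat2) 0 0‖ ≤ _
      rw [rhSol, f00, Matrix.one_apply_eq]
      linarith
    · refine hfin ?_
      have := norm_div_sub_le (c := 0) hν1 hδ (hsub (by rw [sub_zero]; exact h3 hw' hd hγ)
        (h5 hc1 hd'))
      rw [norm_zero] at this
      change ‖rhSol lam L x t a b Ψ k 0 1 - (1 : Mat2) 0 1‖ ≤ _
      rw [rhSol, f01, Matrix.one_apply_ne (by decide)]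
      linarith
    · refine hfin ?_
      have := norm_div_sub_le (c := 0) hν0 hδ (hsub (by rw [sub_zero]; exact h3 hw hd' hγ')
        (h5 hc0 hd))
      rw [norm_zero] at this
      change ‖rhSol lam L x t a b Ψ k 1 0 - (1 : Mat2) 1 0‖ ≤ _
      rw [rhSol, f10, Matrix.one_apply_ne (by decide)]
      linarith
    · refine hfin ?_
      have := norm_div_sub_le hν1 hδ (hsub' h2 (h4 hc1 hd' hγ'))
      rw [norm_one] at this
      change ‖rhSol lam L x t a b Ψ k 1 1 - (1 : Mat2) 1 1‖ ≤ _
      rw [rhSol, f11, Matrix.one_apply_eq]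
      linarith
  · set X := ‖corrExp L x t k‖
    have hX : 0 ≤ X := norm_nonneg _
    have hN : ‖2 * I * k * (w' * d * γ - c1 * d') - qv‖ ≤
        4 * δ + 3 * δ * ‖qv‖ + 8 * C * X := by
      have e : 2 * I * k * (w' * d * γ - c1 * d') - qv =
          w' * d * (2 * I * k * γ - qv) + (w' * d - 1) * qv - 2 * I * k * c1 * d' := by ring
      rw [e]
      refine (norm_sub_le _ _).trans (add_le_add ((norm_add_le _ _).trans (add_le_add
        (h3 hw' hd B.lead) ?_)) ?_)
      · rw [norm_mul]
        exact mul_le_mul_of_nonneg_right h2 hq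
      · rw [norm_mul, norm_mul, norm_mul, norm_mul, norm_I, Complex.norm_ofNat, mul_one]
        have := mul_le_mul hc1' hd' (norm_nonneg _) (by positivity)
        have := mul_le_mul_of_nonneg_left this (by positivity : 0 ≤ 2 * ‖k‖)
        calc _ = 2 * ‖k‖ * (‖c1‖ * ‖d'‖) := by ring
          _ ≤ _ := this
          _ = 8 * (δ * ‖k‖) * X := by ring
          _ = _ := by rw [← hCk]
    have := norm_div_sub_le hν1 hδ hN
    rw [rhSol, f01, mul_div_assoc']
    refine this.trans ?_
    have : 0 ≤ C * X * ‖qv‖ := by positivity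
    nlinarith

end Expansion

section Residues

variable {lam L x t : ℝ} {a b : ℂ → ℂ} {Ψ : ℂ → Mat2} {qv : ℂ}
variable (D : IsSpectralData lam L x t a b Ψ qv) (H : IsDiscriminant lam L a)

include D H in
theorem IsSpectralData.gammaRel_eventually {k : ℂ} (hk : k ∈ (closure (cuts lam L a))ᶜ) :
    ∀ᶠ z in 𝓝[≠] k, GammaRel lam L a b z (sqrtDiscr lam L a z) (gammaT lam L a b z) := by
  have hloc := H.sqrtDiscr_local hk
  by_cases hb : b = 0
  · have hsb : schwarz b = 0 := by ext z; simp [schwarz, hb]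
    filter_upwards [nhdsWithin_le_nhds hloc] with z hz
    rw [D.gammaT_of_eq_zero H hb hz.1]
    constructor <;> simp [hb, D.sqrtDiscr_of_eq_zero H hb hz.1]
  · have hsb := eventually_ne_of_ne_zero (differentiable_schwarz D.diff_b) (schwarz_ne_zero hb) k
    filter_upwards [nhdsWithin_le_nhds hloc, hsb] with z h1 h2
    exact D.gammaRel_of_one H h1.2 h2 (D.mul_gammaT H h1.1 h2)

include D H in
/-- The relations at a simple pole of `Γ̃`. -/
theorem IsSpectralData.at_pole {p : ℂ} (hp : p ∈ (closure (cuts lam L a))ᶜ)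
    (ho : meromorphicOrderAt (gammaT lam L a b) p = -1) :
    schwarz b p = 0 ∧ bigE L a (sqrtDiscr lam L a p) p = eL L p * schwarz a p ∧
    Tendsto (fun z => (z - p) * gammaT lam L a b z) (𝓝[≠] p)
      (𝓝 (simpleResidue (gammaT lam L a b) p)) := by
  have hneg : ¬ AnalyticAt ℂ (gammaT lam L a b) p := fun h => by
    have := (meromorphicNFAt_gammaT hp).meromorphicOrderAt_nonneg_iff_analyticAt.2 h
    rw [ho] at this
    exact absurd this (by decide)
  have hloc := H.sqrtDiscr_local hp
  have hl0 : (lam : ℂ) ≠ 0 := fun h0 => by simpa [h0] using lam_mul_lam H.lam_eq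
  have hb : schwarz b p = 0 := by
    by_contra hb
    refine hneg (D.gammaT_of_bounded H hp ?_).1
    have hds := differentiable_schwarz D.diff_b
    have hc : ContinuousAt (fun z => (schwarz a z - bigE' L a (sqrtDiscr lam L a z) z) /
        (lam * schwarz b z)) p :=
      ((differentiable_schwarz D.diff_a p).continuousAt.sub
        (H.analyticAt_bigE' (H.analyticAt_sqrtDiscr hp)).continuousAt).div
        (continuousAt_const.mul (hds p).continuousAt) (mul_ne_zero hl0 hb)
    refine ((hc.tendsto.isBigO_one ℂ).mono nhdsWithin_le_nhds).congr' ?_ EventuallyEq.rfl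
    filter_upwards [nhdsWithin_le_nhds hloc, nhdsWithin_le_nhds ((hds p).continuousAt.eventually_ne hb)]
      with z h1 h2
    rw [div_eq_iff (mul_ne_zero hl0 h2), ← D.mul_gammaT H h1.1 h2]
    ring
  refine ⟨hb, ?_, ?_⟩
  · have h1 : a p - eL L p * bigE' L a (sqrtDiscr lam L a p) p = 0 := by
      by_contra hne
      exact hneg (D.gammaT_of_bounded H hp (D.isBigO_gammaT_of_ne H hp hne)).1
    have hdet := D.det_s p
    rw [hb] at hdet
    linear_combination (-bigE L a (sqrtDiscr lam L a p) p) * hdet + bigE L a (sqrtDiscr lam L a p) p *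
      schwarz a p * h1 + eL L p * schwarz a p *
      bigE_mul_bigE' (H.isNormalizedRoot_sqrtDiscr.sq p hp)
  · obtain ⟨g, hg, -, hge⟩ := (meromorphicOrderAt_eq_int_iff
      (meromorphicNFAt_gammaT hp).meromorphicAt).1 (show meromorphicOrderAt (gammaT lam L a b) p =
        ((-1 : ℤ) : WithTop ℤ) from ho)
    have : Tendsto (fun z => (z - p) * gammaT lam L a b z) (𝓝[≠] p) (𝓝 (g p)) := by
      refine (hg.continuousAt.tendsto.mono_left nhdsWithin_le_nhds).congr' ?_
      filter_upwards [hge, self_mem_nhdsWithin] with z h1 h2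
      have h2 : z - p ≠ 0 := sub_ne_zero.2 h2
      rw [h1, smul_eq_mul, zpow_neg_one]
      field_simp
    rwa [simpleResidue, this.limUnder_eq]

theorem tendsto_conj_nhdsNE (k : ℂ) :
    Tendsto (fun z : ℂ => conj z) (𝓝[≠] (conj k)) (𝓝[≠] k) :=
  tendsto_nhdsWithin_iff.2 ⟨by
    simpa using (continuous_conj.tendsto (conj k)).mono_left nhdsWithin_le_nhds,
    eventually_mem_nhdsWithin.mono fun z hz h => hz <| mem_singleton_iff.2 <| by
      rw [← mem_singleton_iff.1 h, conj_conj]⟩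

theorem tendsto_conj_residue {f : ℂ → ℂ} {p ρ : ℂ}
    (h : Tendsto (fun z => (z - p) * f z) (𝓝[≠] p) (𝓝 ρ)) :
    Tendsto (fun z => (z - conj p) * schwarz f z) (𝓝[≠] (conj p)) (𝓝 (conj ρ)) := by
  have := (continuous_conj.tendsto ρ).comp (h.comp (tendsto_conj_nhdsNE p))
  refine this.congr fun z => ?_
  simp [schwarz]

include D H in
/-- Residue condition in a quadrant in which the second column contains `Γ̃`. -/
theorem IsSpectralData.residue_right {p ρ C0 : ℂ} (hp : p ∈ (closure (cuts lam L a))ᶜ)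
    (hi : p.im ≠ 0) (hr : p.re ≠ 0) (hq : quad p = 0 ∨ quad p = 2)
    (hρ : Tendsto (fun z => (z - p) * gammaT lam L a b z) (𝓝[≠] p) (𝓝 ρ))
    (hC : ∀ i, C0 * (Ψ p * sectorFactor lam L x t a b p (sqrtDiscr lam L a p) 0 0 (quad p)) i 0 =
      Ψ p i 0 * (exp (-(I * theta x t p)) * bigE L a (sqrtDiscr lam L a p) p)) :
    ResidueCondition (rhSol lam L x t a b Ψ) p 1 0 (C0 * ρ) := by
  have hR := H.analyticAt_sqrtDiscr hp
  refine ⟨fun i => (Ψ p * sectorFactor lam L x t a b p (sqrtDiscr lam L a p) 0 0 (quad p)) i 0,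
    fun i => ⟨?_, ?_⟩⟩
  · have h1 := (D.analyticAt_mul_sectorFactor H (x := x) (t := t) (j := quad p) (G := fun _ => 0)
      (Gb := fun _ => 0) hR (fun _ => analyticAt_const) (fun _ => analyticAt_const) i 0)
    refine (h1.continuousAt.tendsto.mono_left nhdsWithin_le_nhds).congr' ?_
    filter_upwards [nhdsWithin_le_nhds (quad_eventually hi hr)] with z hz
    rw [rhSol, hz]
    rcases hq with hq | hq <;> simp [hq, sectorFactor, Matrix.mul_apply]
  · have hE := (H.analyticAt_bigE hR).continuousAt
    have hζ : ContinuousAt (fun z => exp (-(I * theta x t z))) p := by unfold theta; fun_prop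
    have h0 := (D.diff_Ψ i 0 p).continuousAt
    have h1 := (D.diff_Ψ i 1 p).continuousAt
    have hs : ContinuousAt (fun z : ℂ => z - p) p := by fun_prop
    have A := (((h0.mul (hζ.mul hE)).tendsto.mono_left (nhdsWithin_le_nhds (s := {p}ᶜ))).mul hρ).add
      ((hs.mul (h1.mul (hζ.mul hE))).tendsto.mono_left (nhdsWithin_le_nhds (s := {p}ᶜ)))
    have hval : C0 * ρ * (Ψ p * sectorFactor lam L x t a b p (sqrtDiscr lam L a p) 0 0 (quad p)) i 0
        = Ψ p i 0 * (exp (-(I * theta x t p)) * bigE L a (sqrtDiscr lam L a p) p) * ρ +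
          (p - p) * (Ψ p i 1 * (exp (-(I * theta x t p)) * bigE L a (sqrtDiscr lam L a p) p)) := by
      linear_combination ρ * hC i
    rw [hval]
    refine A.congr' ?_
    filter_upwards [nhdsWithin_le_nhds (quad_eventually hi hr)] with z hz
    rw [rhSol, hz]
    rcases hq with hq | hq <;> simp [hq, sectorFactor, Matrix.mul_apply] <;> ring

include D H in
/-- Residue condition in a quadrant in which the first column contains the conjugate of `Γ̃`. -/
theorem IsSpectralData.residue_left {p ρ C0 : ℂ} (hp : p ∈ (closure (cuts lam L a))ᶜ)
    (hi : p.im ≠ 0) (hr : p.re ≠ 0) (hq : quad p = 1 ∨ quad p = 3)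
    (hρ : Tendsto (fun z => (z - p) * schwarz (gammaT lam L a b) z) (𝓝[≠] p) (𝓝 ρ))
    (hC : ∀ i, C0 * (Ψ p * sectorFactor lam L x t a b p (sqrtDiscr lam L a p) 0 0 (quad p)) i 1 =
      Ψ p i 1 * (exp (I * theta x t p) * bigE' L a (sqrtDiscr lam L a p) p) * lam) :
    ResidueCondition (rhSol lam L x t a b Ψ) p 0 1 (C0 * ρ) := by
  have hR := H.analyticAt_sqrtDiscr hp
  refine ⟨fun i => (Ψ p * sectorFactor lam L x t a b p (sqrtDiscr lam L a p) 0 0 (quad p)) i 1,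
    fun i => ⟨?_, ?_⟩⟩
  · have h1 := (D.analyticAt_mul_sectorFactor H (x := x) (t := t) (j := quad p) (G := fun _ => 0)
      (Gb := fun _ => 0) hR (fun _ => analyticAt_const) (fun _ => analyticAt_const) i 1)
    refine (h1.continuousAt.tendsto.mono_left nhdsWithin_le_nhds).congr' ?_
    filter_upwards [nhdsWithin_le_nhds (quad_eventually hi hr)] with z hz
    rw [rhSol, hz]
    rcases hq with hq | hq <;> simp [hq, sectorFactor, Matrix.mul_apply]
  · have hE := (H.analyticAt_bigE' hR).continuousAt
    have hζ : ContinuousAt (fun z => exp (I * theta x t z)) p := by unfold theta; fun_prop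
    have h0 := (D.diff_Ψ i 0 p).continuousAt
    have h1 := (D.diff_Ψ i 1 p).continuousAt
    have hs : ContinuousAt (fun z : ℂ => z - p) p := by fun_prop
    have A := (((h1.mul (hζ.mul hE)).mul (continuousAt_const (y := (lam : ℂ)))).tendsto.mono_left
      (nhdsWithin_le_nhds (s := {p}ᶜ)) |>.mul hρ).add
      ((hs.mul (h0.mul (hζ.mul hE))).tendsto.mono_left (nhdsWithin_le_nhds (s := {p}ᶜ)))
    have hval : C0 * ρ * (Ψ p * sectorFactor lam L x t a b p (sqrtDiscr lam L a p) 0 0 (quad p)) i 1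
        = Ψ p i 1 * (exp (I * theta x t p) * bigE' L a (sqrtDiscr lam L a p) p) * lam * ρ +
          (p - p) * (Ψ p i 0 * (exp (I * theta x t p) * bigE' L a (sqrtDiscr lam L a p) p)) := by
      linear_combination ρ * hC i
    rw [hval]
    refine A.congr' ?_
    filter_upwards [nhdsWithin_le_nhds (quad_eventually hi hr)] with z hz
    rw [rhSol, hz]
    rcases hq with hq | hq <;> simp [hq, sectorFactor, Matrix.mul_apply] <;> ring

theorem valueAt_eq {f g : ℂ → ℂ} {p : ℂ} (hg : ContinuousAt g p) (h : f =ᶠ[𝓝[≠] p] g) :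
    valueAt f p = g p :=
  Tendsto.limUnder_eq ((hg.tendsto.mono_left nhdsWithin_le_nhds).congr' h.symm)

theorem continuous_eL (L : ℝ) : Continuous (eL L) := by unfold eL; fun_prop
theorem continuous_eLInv (L : ℝ) : Continuous (eLInv L) := by unfold eLInv; fun_prop
theorem continuous_eTheta (x t : ℝ) : Continuous (eTheta x t) := by unfold eTheta theta; fun_prop
theorem continuous_eThetaInv (x t : ℝ) : Continuous (eThetaInv x t) := by
  unfold eThetaInv theta; fun_prop

include D H in
theorem IsSpectralData.gammaBarRel_eventually {k : ℂ} (hk : k ∈ (closure (cuts lam L a))ᶜ) :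
    ∀ᶠ z in 𝓝[≠] (conj k),
      GammaBarRel lam L a b z (sqrtDiscr lam L a z) (schwarz (gammaT lam L a b) z) := by
  have hck : conj k ∈ (closure (cuts lam L a))ᶜ := fun h => hk (H.conj_mem_closure_cuts.1 h)
  filter_upwards [(tendsto_conj_nhdsNE k).eventually (D.gammaRel_eventually H hk),
    nhdsWithin_le_nhds (isClosed_closure.isOpen_compl.mem_nhds hck)] with z h1 h2
  have := h1.conj
  rwa [H.conj_sqrtDiscr h2] at this

variable (hP : PoleAssumption lam L a b)

include D H hP in
theorem IsSpectralData.residue_D1 {p : ℂ} (hp : p ∈ polesIn lam L a b D1) :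
    ResidueCondition (rhSol lam L x t a b Ψ) p 1 0
      (valueAt (fun k => (a k + lam * schwarz b k * gammaT lam L a b k * eL L k)
          * schwarz a k * eL L k * eThetaInv x t k) p
        * simpleResidue (gammaT lam L a b) p) := by
  obtain ⟨⟨hr, hi⟩, hΩ, -⟩ := id hp
  obtain ⟨hb, hE, hρ⟩ := D.at_pole H hΩ (hP.simple_D1 p hp)
  have hq : quad p = 0 := by simp [quad, hi, hr]
  refine D.residue_right H hΩ hi.ne' hr.ne' (Or.inl hq) hρ fun i => ?_
  rw [valueAt_eq (g := fun k => bigE L a (sqrtDiscr lam L a k) k * schwarz a k * eL L k *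
      eThetaInv x t k) ((((H.analyticAt_bigE (H.analyticAt_sqrtDiscr hΩ)).continuousAt.mul
      (differentiable_schwarz D.diff_a p).continuousAt).mul (continuous_eL L).continuousAt).mul
      (continuous_eThetaInv x t).continuousAt)
      ((D.gammaRel_eventually H hΩ).mono fun z hz => by simp only [hz.E_eq]), eThetaInv_eq]
  have h1 := bigE_mul_bigE' (H.isNormalizedRoot_sqrtDiscr.sq p hΩ)
  have h2 := exp_neg_mul_exp (I * theta x t p)
  simp [hq, sectorFactor, Matrix.mul_apply]
  grind

include D H hP in
theorem IsSpectralData.residue_D3 {p : ℂ} (hp : p ∈ polesIn lam L a b D3) :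
    ResidueCondition (rhSol lam L x t a b Ψ) p 1 0
      (valueAt (fun k => a k * eThetaInv x t k
          / (schwarz a k - lam * schwarz b k * gammaT lam L a b k)) p
        * simpleResidue (gammaT lam L a b) p) := by
  obtain ⟨⟨hr, hi⟩, hΩ, -⟩ := id hp
  obtain ⟨hb, hE, hρ⟩ := D.at_pole H hΩ (hP.simple_D3 p hp)
  have hq : quad p = 2 := by simp [quad, not_lt.2 hi.le, not_lt.2 hr.le]
  have h1 := bigE_mul_bigE' (H.isNormalizedRoot_sqrtDiscr.sq p hΩ)
  refine D.residue_right H hΩ hi.ne hr.ne (Or.inr hq) hρ fun i => ?_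
  rw [valueAt_eq (g := fun k => a k * eThetaInv x t k / bigE' L a (sqrtDiscr lam L a k) k)
      (((D.diff_a p).continuousAt.mul (continuous_eThetaInv x t).continuousAt).div
      (H.analyticAt_bigE' (H.analyticAt_sqrtDiscr hΩ)).continuousAt
      (right_ne_zero_of_mul_eq_one h1))
      ((D.gammaRel_eventually H hΩ).mono fun z hz => by simp only [hz.Fbar_eq]), eThetaInv_eq]
  have h2 := exp_neg_mul_exp (I * theta x t p)
  have hdet := D.det_s p
  rw [div_eq_of_eq_mul (right_ne_zero_of_mul_eq_one h1) (c := a p * exp (-(I * theta x t p)) ^ 2 *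
    bigE L a (sqrtDiscr lam L a p) p) (by linear_combination (-(a p * exp (-(I * theta x t p)) ^ 2)) * h1)]
  simp [hq, sectorFactor, Matrix.mul_apply, hb]
  rw [hb] at hdet
  grind

include D H hP in
theorem IsSpectralData.residue_D4 {p : ℂ} (hp : p ∈ polesIn lam L a b D1) :
    ResidueCondition (rhSol lam L x t a b Ψ) (conj p) 0 1
      (valueAt (fun k =>
          lam * (schwarz a k + lam * b k * schwarz (gammaT lam L a b) k * eLInv L k)
          * a k * eLInv L k * eTheta x t k) (conj p)
        * conj (simpleResidue (gammaT lam L a b) p)) := by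
  obtain ⟨⟨hr, hi⟩, hΩ, -⟩ := id hp
  obtain ⟨hb, hE, hρ⟩ := D.at_pole H hΩ (hP.simple_D1 p hp)
  have hΩc : conj p ∈ (closure (cuts lam L a))ᶜ := fun h => hΩ (H.conj_mem_closure_cuts.1 h)
  have hi' : (conj p).im < 0 := by simpa using hi
  have hr' : 0 < (conj p).re := by simpa using hr
  have hq : quad (conj p) = 3 := by simp [quad, hr, hi.le]
  have hE' : bigE' L a (sqrtDiscr lam L a (conj p)) (conj p) = eLInv L (conj p) * a (conj p) := by
    have h1 := congrArg conj hE
    have h2 := conj_bigE L a (sqrtDiscr lam L a p) (conj p)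
    have h3 := conj_eL L (conj p)
    rw [conj_conj] at h2 h3
    rw [← conj_conj p, H.conj_sqrtDiscr hΩc, conj_conj] at h2
    rw [h2, map_mul, h3, schwarz, conj_conj] at h1
    exact h1
  refine D.residue_left H hΩc hi'.ne hr'.ne' (Or.inr hq) (tendsto_conj_residue hρ) fun i => ?_
  rw [valueAt_eq (g := fun k => lam * bigE' L a (sqrtDiscr lam L a k) k * a k * eLInv L k *
      eTheta x t k) (((((continuousAt_const (y := (lam : ℂ))).mul
      (H.analyticAt_bigE' (H.analyticAt_sqrtDiscr hΩc)).continuousAt).mul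
      (D.diff_a _).continuousAt).mul (continuous_eLInv L).continuousAt).mul
      (continuous_eTheta x t).continuousAt)
      ((D.gammaBarRel_eventually H hΩ).mono fun z hz => by simp only [hz.Ebar_eq]), eTheta_eq]
  have h1 := bigE_mul_bigE' (H.isNormalizedRoot_sqrtDiscr.sq _ hΩc)
  have h2 := exp_neg_mul_exp (I * theta x t (conj p))
  simp [hq, sectorFactor, Matrix.mul_apply]
  grind

include D H hP in
theorem IsSpectralData.residue_D2 {p : ℂ} (hp : p ∈ polesIn lam L a b D3) :
    ResidueCondition (rhSol lam L x t a b Ψ) (conj p) 0 1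
      (valueAt (fun k => lam * schwarz a k * eTheta x t k
          / (a k - lam * b k * schwarz (gammaT lam L a b) k)) (conj p)
        * conj (simpleResidue (gammaT lam L a b) p)) := by
  obtain ⟨⟨hr, hi⟩, hΩ, -⟩ := id hp
  obtain ⟨hb, hE, hρ⟩ := D.at_pole H hΩ (hP.simple_D3 p hp)
  have hΩc : conj p ∈ (closure (cuts lam L a))ᶜ := fun h => hΩ (H.conj_mem_closure_cuts.1 h)
  have hi' : 0 < (conj p).im := by simpa using hi
  have hr' : (conj p).re < 0 := by simpa using hr
  have hq : quad (conj p) = 1 := by simp [quad, hi, not_lt.2 hr.le]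
  have hb' : b (conj p) = 0 := by simpa [schwarz] using hb
  have h1 := bigE_mul_bigE' (H.isNormalizedRoot_sqrtDiscr.sq _ hΩc)
  refine D.residue_left H hΩc hi'.ne' hr'.ne (Or.inl hq) (tendsto_conj_residue hρ) fun i => ?_
  rw [valueAt_eq (g := fun k => lam * schwarz a k * eTheta x t k / bigE L a (sqrtDiscr lam L a k) k)
      ((((continuousAt_const (y := (lam : ℂ))).mul (differentiable_schwarz D.diff_a _).continuousAt).mul
      (continuous_eTheta x t).continuousAt).div
      (H.analyticAt_bigE (H.analyticAt_sqrtDiscr hΩc)).continuousAt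
      (left_ne_zero_of_mul_eq_one h1))
      ((D.gammaBarRel_eventually H hΩ).mono fun z hz => by simp only [hz.F_eq]), eTheta_eq]
  have h2 := exp_neg_mul_exp (I * theta x t (conj p))
  have hdet := D.det_s (conj p)
  rw [div_eq_of_eq_mul (left_ne_zero_of_mul_eq_one h1) (c := lam * schwarz a (conj p) *
    exp (I * theta x t (conj p)) ^ 2 * bigE' L a (sqrtDiscr lam L a (conj p)) (conj p))
    (by linear_combination (-(lam * schwarz a (conj p) * exp (I * theta x t (conj p)) ^ 2)) * h1)]
  simp [hq, sectorFactor, Matrix.mul_apply, hb']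
  rw [hb'] at hdet
  grind

end Residues

section Existence

variable {lam L x t : ℝ} {a b : ℂ → ℂ} {Ψ : ℂ → Mat2} {qv : ℂ}

theorem continuousAt_of_entries {M : ℂ → Mat2} {U : Set ℂ} (hU : IsOpen U)
    (hM : ∀ i j, DifferentiableOn ℂ (fun z => M z i j) U) {z : ℂ} (hz : z ∈ U) :
    ContinuousAt M z :=
  continuousAt_pi.2 fun i => continuousAt_pi.2 fun j =>
    ((hM i j).differentiableAt (hU.mem_nhds hz)).continuousAt

theorem tendsto_side {m M : ℂ → Mat2} {S T : Set ℂ} {k0 z : ℂ} {ε : ℝ}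
    (hM : ∀ i j, DifferentiableOn ℂ (fun z => M z i j) (ball k0 ε))
    (hm : ∀ z ∈ ball k0 ε, z ∈ S → m z = M z) (hz : z ∈ ball k0 ε) (hT : T = S) :
    Tendsto m (𝓝[T] z) (𝓝 (M z)) := by
  subst hT
  refine ((continuousAt_of_entries isOpen_ball hM hz).tendsto.mono_left
    nhdsWithin_le_nhds).congr' ?_
  filter_upwards [self_mem_nhdsWithin, nhdsWithin_le_nhds (isOpen_ball.mem_nhds hz)]
    with w hw hwb
  exact (hm w hwb hw).symm

theorem IsSpectralData.isRHSolution (D : IsSpectralData lam L x t a b Ψ qv)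
    (H : IsDiscriminant lam L a) (hP : PoleAssumption lam L a b) (hx : x ∈ Icc 0 L)
    (ht : 0 ≤ t) : IsRHSolution lam L x t a b (rhSol lam L x t a b Ψ) where
  analytic i j k hk := D.analyticAt_rhSol H hk i j
  jump_relation := by
    set m := rhSol lam L x t a b Ψ
    have key : ∀ k0 ∈ contourStar lam L a, ∃ Mp Mm : ℂ → Mat2,
        ContinuousAt Mp k0 ∧ ContinuousAt Mm k0 ∧ Mm k0 = Mp k0 * jump lam L x t a b k0 ∧
        ∀ᶠ z in 𝓝 k0, z ∈ contourStar lam L a →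
          Tendsto m (𝓝[plusSide z] z) (𝓝 (Mp z)) ∧ Tendsto m (𝓝[minusSide z] z) (𝓝 (Mm z)) := by
      intro k0 hk0
      obtain ⟨ε, hε, Mp, Mm, hMp, hMm, hp, hm, hj, hl⟩ :=
        D.exists_boundary H hP.contour_bounded hk0
      have hself := mem_ball_self (x := k0) hε
      refine ⟨Mp, Mm, continuousAt_of_entries isOpen_ball hMp hself,
        continuousAt_of_entries isOpen_ball hMm hself, hj, ?_⟩
      filter_upwards [ball_mem_nhds k0 hε] with z hz hzs
      obtain ⟨-, e1, e2⟩ := (hl z hz).2 ((hl z hz).1.1 hzs.1)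
      exact ⟨tendsto_side hMp hp hz e1, tendsto_side hMm hm hz e2⟩
    refine ⟨fun k => limUnder (𝓝[plusSide k] k) m, fun k => limUnder (𝓝[minusSide k] k) m,
      fun k0 hk0 => ?_, fun k0 hk0 => ?_, fun k0 hk0 => ?_⟩ <;>
      obtain ⟨Mp, Mm, cp, cm, hj, hev⟩ := key k0 hk0
    · refine cp.continuousWithinAt.congr_of_eventuallyEq ?_ (hev.self_of_nhds hk0).1.limUnder_eq
      filter_upwards [nhdsWithin_le_nhds hev, self_mem_nhdsWithin] with z hz hzs
      exact (hz hzs).1.limUnder_eq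
    · refine cm.continuousWithinAt.congr_of_eventuallyEq ?_ (hev.self_of_nhds hk0).2.limUnder_eq
      filter_upwards [nhdsWithin_le_nhds hev, self_mem_nhdsWithin] with z hz hzs
      exact (hz hzs).2.limUnder_eq
    · obtain ⟨h1, h2⟩ := hev.self_of_nhds hk0
      simp only [h1.limUnder_eq, h2.limUnder_eq]
      exact ⟨h1, h2, hj⟩
  at_infinity i j := by
    obtain ⟨K, -, C, -, h⟩ := D.exists_expansion H hx ht
    refine IsBigO.of_bound C ?_
    rw [eventually_inf_principal]
    filter_upwards [(tendsto_norm_cocompact_atTop (E := ℂ)).eventually_ge_atTop K] with k hK hk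
    have hc : k ∉ contour lam L a := fun hc => hk.1 (Or.inl hc)
    have := (h k hk.2 hK (fun hi => hc (Or.inl (Or.inl hi))) fun hr => hc (Or.inl (Or.inr hr))).1 i j
    rwa [norm_inv, ← div_eq_mul_inv]
  bounded k hk i j := D.isBigO_rhSol H hP.contour_bounded hk.1 i j
  residue_D1 _ hp := D.residue_D1 H hP hp
  residue_D4 _ hp := D.residue_D4 H hP hp
  residue_D3 _ hp := D.residue_D3 H hP hp
  residue_D2 _ hp := D.residue_D2 H hP hp

end Existence

section Removable

theorem exists_extension_of_line {f g : ℂ → ℂ} {k0 : ℂ} {ε : ℝ}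
    (hf : DifferentiableOn ℂ f
      (ball k0 ε ∩ {z | ((z - k0) * conj (leftNormal k0)).re ≠ 0}))
    (hg : ContinuousOn g (ball k0 ε ∩ {z | ((z - k0) * conj (leftNormal k0)).re = 0}))
    (hlim : ∀ z ∈ ball k0 ε, ((z - k0) * conj (leftNormal k0)).re = 0 →
      Tendsto f (𝓝[plusSide k0] z) (𝓝 (g z)) ∧ Tendsto f (𝓝[minusSide k0] z) (𝓝 (g z))) :
    ∃ F, DifferentiableOn ℂ F (ball k0 ε) ∧
      EqOn F f (ball k0 ε ∩ {z | ((z - k0) * conj (leftNormal k0)).re ≠ 0}) := by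
  set l : ℂ → ℝ := fun z => ((z - k0) * conj (leftNormal k0)).re with hl
  have hlc : Continuous l := by fun_prop
  set F : ℂ → ℂ := fun z => if l z = 0 then g z else f z with hF
  have hFf : EqOn F f {z | l z ≠ 0} := fun z hz => if_neg hz
  have hFg : EqOn F g {z | l z = 0} := fun z hz => if_pos hz
  have hopen : IsOpen {z | l z ≠ 0} := isOpen_ne_fun hlc continuous_const
  have hd : DifferentiableOn ℂ F (ball k0 ε ∩ {z | l z ≠ 0}) :=
    hf.congr fun z hz => hFf hz.2
  have hc : ContinuousOn F (ball k0 ε) := by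
    intro z hz
    refine ContinuousAt.continuousWithinAt ?_
    by_cases h : l z = 0
    · have hu : 𝓝 z ≤ (𝓝[plusSide k0] z ⊔ 𝓝[minusSide k0] z) ⊔ 𝓝[{z | l z = 0}] z := by
        rw [← nhdsWithin_union, ← nhdsWithin_union, ← nhdsWithin_univ]
        refine nhdsWithin_mono _ fun w _ => ?_
        rcases lt_trichotomy (l w) 0 with h | h | h
        exacts [Or.inl (Or.inr h), Or.inr h, Or.inl (Or.inl h)]
      refine Tendsto.mono_left ?_ hu
      rw [hFg h]
      refine Tendsto.sup (Tendsto.sup ?_ ?_) ?_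
      · exact (hlim z hz h).1.congr' (by
          filter_upwards [self_mem_nhdsWithin] with w hw using (hFf (ne_of_gt hw)).symm)
      · exact (hlim z hz h).2.congr' (by
          filter_upwards [self_mem_nhdsWithin] with w hw using (hFf (ne_of_lt hw)).symm)
      · have : ContinuousWithinAt g {z | l z = 0} z := (hg z ⟨hz, h⟩).mono_of_mem_nhdsWithin (inter_mem
          (nhdsWithin_le_nhds (isOpen_ball.mem_nhds hz)) self_mem_nhdsWithin)
        refine this.tendsto.congr' ?_
        filter_upwards [self_mem_nhdsWithin] with w hw using (hFg hw).symm
    · exact (hd.differentiableAt ((isOpen_ball.inter hopen).mem_nhds ⟨hz, h⟩)).continuousAt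
  refine ⟨F, ?_, fun z hz => hFf hz.2⟩
  by_cases h : k0.im = 0
  · refine differentiableOn_ball_of_horizontal hc (hd.mono fun z hz => ⟨hz.1, fun h' => hz.2 ?_⟩)
    rw [leftNormal_line_iff, if_pos h] at h'
    rw [h', h]
  · refine differentiableOn_ball_of_vertical hc (hd.mono fun z hz => ⟨hz.1, fun h' => hz.2 ?_⟩)
    rwa [leftNormal_line_iff, if_neg h] at h'

theorem exists_extension_of_tendsto {f : ℂ → ℂ} {k : ℂ} {ε : ℝ} (hε : 0 < ε)
    (hf : DifferentiableOn ℂ f (ball k ε \ {k}))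
    (hlim : Tendsto (fun z => (z - k) * f z) (𝓝[≠] k) (𝓝 0)) :
    ∃ F, DifferentiableOn ℂ F (ball k ε) ∧ EqOn F f (ball k ε \ {k}) := by
  refine ⟨_, differentiableOn_update_limUnder_of_isLittleO (ball_mem_nhds k hε) hf ?_,
    fun z hz => Function.update_of_ne hz.2 _ _⟩
  rw [isLittleO_iff_tendsto' (by
    filter_upwards [self_mem_nhdsWithin] with z hz h
    exact absurd (inv_eq_zero.1 h) (sub_ne_zero.2 hz))]
  have h1 : Tendsto (fun z => (z - k) * f k) (𝓝[≠] k) (𝓝 0) := by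
    have : ContinuousAt (fun z => (z - k) * f k) k := by fun_prop
    simpa using this.tendsto.mono_left nhdsWithin_le_nhds
  have h2 := hlim.sub h1
  rw [sub_zero] at h2
  refine h2.congr fun z => ?_
  rw [div_inv_eq_mul]
  ring

theorem exists_extension_of_bounded {f N : ℂ → ℂ} {G : Set ℂ} (hG : Dense G) {k : ℂ} {ε : ℝ}
    (hε : 0 < ε) (hN : DifferentiableOn ℂ N (ball k ε \ {k}))
    (hNf : EqOn N f ((ball k ε \ {k}) ∩ G)) (hf : f =O[𝓝[G] k] fun _ => (1 : ℂ)) :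
    ∃ F, DifferentiableOn ℂ F (ball k ε) ∧ EqOn F N (ball k ε \ {k}) := by
  refine exists_extension_of_tendsto hε hN ?_
  have hop : IsOpen (ball k ε \ {k}) := isOpen_ball.sdiff isClosed_singleton
  obtain ⟨C, -, hC⟩ := hf.exists_pos
  rw [IsBigOWith, eventually_nhdsWithin_iff] at hC
  have hbd : ∀ᶠ z in 𝓝[≠] k, ‖N z‖ ≤ C := by
    filter_upwards [nhdsWithin_le_nhds hC.eventually_nhds,
      nhdsWithin_le_nhds (ball_mem_nhds k hε), self_mem_nhdsWithin] with z hz hzb hzk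
    have hmem := hop.mem_nhds (show z ∈ ball k ε \ {k} from ⟨hzb, hzk⟩)
    have hne : (𝓝[G] z).NeBot := mem_closure_iff_nhdsWithin_neBot.1 (hG z)
    refine le_of_tendsto ((hN.differentiableAt hmem).continuousAt.norm.tendsto.mono_left
      (nhdsWithin_le_nhds (s := G))) ?_
    filter_upwards [nhdsWithin_le_nhds hz, nhdsWithin_le_nhds hmem, self_mem_nhdsWithin]
      with w h1 h2 h3
    simpa [hNf ⟨h2, h3⟩] using h1 h3
  have h1 : Tendsto (fun z => z - k) (𝓝[≠] k) (𝓝 0) := by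
    have : ContinuousAt (fun z => z - k) k := by fun_prop
    simpa using this.tendsto.mono_left nhdsWithin_le_nhds
  exact h1.zero_mul_isBoundedUnder_le ⟨C, by simpa using hbd⟩

theorem isBigO_mul_sub {α : Type*} {l : Filter α} {f g h : α → ℂ} {c d : ℂ}
    (hf : (fun z => f z - c) =O[l] h) (hg : (fun z => g z - d) =O[l] h)
    (hh : h =O[l] fun _ => (1 : ℂ)) : (fun z => f z * g z - c * d) =O[l] h := by
  have h1 := (hf.mul (hg.trans hh)).congr_right (fun z => mul_one (h z))
  have h2 := (hf.const_mul_left d).add (hg.const_mul_left c)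
  exact (h1.add h2).congr_left fun z => by ring

end Removable

section Uniqueness

variable {lam L x t : ℝ} {a b : ℂ → ℂ}

theorem isClosed_contour (lam L : ℝ) (a : ℂ → ℂ) : IsClosed (contour lam L a) :=
  ((isClosed_eq continuous_im continuous_const).union
    (isClosed_eq continuous_re continuous_const)).union isClosed_closure

theorem PoleAssumption.finite_poleSet (hP : PoleAssumption lam L a b) :
    (poleSet lam L a b).Finite := by
  have h := hP.finite_D1.union hP.finite_D3
  exact h.union (h.preimage (Function.Injective.injOn (star_injective (R := ℂ))))

theorem IsDiscriminant.disjoint_poleSet (H : IsDiscriminant lam L a) {k : ℂ}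
    (hk : k ∈ contour lam L a) : k ∉ poleSet lam L a b := by
  have key : ∀ z ∈ polesIn lam L a b D1 ∪ polesIn lam L a b D3, z ∉ contour lam L a := by
    rintro z (⟨⟨h1, h2⟩, h3, -⟩ | ⟨⟨h1, h2⟩, h3, -⟩) ((h | h) | h)
    exacts [h2.ne' h, h1.ne' h, h3 h, h2.ne h, h1.ne h, h3 h]
  rintro (h | h)
  · exact key k h hk
  · exact key _ h (H.conj_mem_contour hk)

theorem IsDiscriminant.isolated_singular (H : IsDiscriminant lam L a) (k0 : ℂ) :
    ∀ᶠ z in 𝓝[≠] k0, z ∈ contour lam L a → z ∈ contourStar lam L a := by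
  obtain ⟨ε, hε, h⟩ := H.exists_isolating k0
  have h0 : ∀ᶠ z in 𝓝[≠] k0, z ≠ 0 := by
    by_cases hk : k0 = 0
    · subst hk; exact self_mem_nhdsWithin
    · exact nhdsWithin_le_nhds (isOpen_ne.mem_nhds hk)
  have h1 : ∀ᶠ z in 𝓝[≠] k0, z.re = k0.re → z.im ≠ 0 := by
    by_cases hk : k0.im = 0
    · filter_upwards [self_mem_nhdsWithin] with z hz hr hi
      exact hz (Complex.ext hr (hi.trans hk.symm))
    · filter_upwards [nhdsWithin_le_nhds ((isOpen_ne_fun continuous_im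
        continuous_const).mem_nhds hk)] with z hz _ using hz
  filter_upwards [h0, h1, nhdsWithin_le_nhds (ball_mem_nhds k0 hε), self_mem_nhdsWithin]
    with z hz0 hz1 hzε hzk hzc
  refine ⟨hzc, ?_⟩
  rintro (⟨hb, hb'⟩ | hs | ⟨-, ⟨u, w, ⟨hu, -, hre, him, -⟩, hseg⟩, hi⟩)
  · exact hzk ((h z ((H.mem_closure_cuts hb).resolve_left hb')).2 hzε)
  · exact hz0 hs
  · rw [mem_openSegment_vertical hre him] at hseg
    have := (h u (disc4_eq_zero_of_mem_oddZeros hu)).1 (by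
      rw [← hseg.1, ← sub_re]
      exact (abs_re_le_norm _).trans_lt (by rwa [← dist_eq_norm]))
    exact hz1 (hseg.1.trans this) hi

variable (H : IsDiscriminant lam L a) (hP : PoleAssumption lam L a b)

include H hP in
theorem IsDiscriminant.dense_regular : Dense (contour lam L a ∪ poleSet lam L a b)ᶜ :=
  (H.dense_good hP.finite_poleSet).mono fun _ hk h =>
    h.elim (H.good_notMem_contour hk.1 hk.2.1 hk.2.2.1) hk.2.2.2

include H hP in
theorem IsDiscriminant.eventually_regular {k : ℂ} (hk : k ∈ contourStar lam L a) :
    ∃ ε > 0, ∀ z ∈ ball k ε, z ∉ poleSet lam L a b ∧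
      (z ∈ contour lam L a ↔ ((z - k) * conj (leftNormal k)).re = 0) ∧
      (((z - k) * conj (leftNormal k)).re = 0 → z ∈ contourStar lam L a ∧
        plusSide z = plusSide k ∧ minusSide z = minusSide k) := by
  refine eventually_nhds_iff_ball.1 ?_
  filter_upwards [H.contourStar_local hk, hP.finite_poleSet.isClosed.isOpen_compl.mem_nhds
    (H.disjoint_poleSet hk.1)] with z hz hzp
  refine ⟨hzp, hz.1, fun h => ?_⟩
  obtain ⟨h1, h2, -⟩ := hz.2.2 h
  exact ⟨h1, plusSide_eq h h2, minusSide_eq h h2⟩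

include H hP in
theorem IsDiscriminant.eventually_side {k : ℂ} (hk : k ∈ contourStar lam L a) :
    (∀ᶠ z in 𝓝[plusSide k] k, z ∈ (contour lam L a ∪ poleSet lam L a b)ᶜ) ∧
    ∀ᶠ z in 𝓝[minusSide k] k, z ∈ (contour lam L a ∪ poleSet lam L a b)ᶜ := by
  obtain ⟨ε, hε, h⟩ := H.eventually_regular hP hk
  constructor <;>
    filter_upwards [nhdsWithin_le_nhds (ball_mem_nhds k hε), self_mem_nhdsWithin]
      with z hz hzs <;>
    rintro (h' | h')
  · exact (ne_of_gt hzs) ((h z hz).2.1.1 h')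
  · exact (h z hz).1 h'
  · exact (ne_of_lt hzs) ((h z hz).2.1.1 h')
  · exact (h z hz).1 h'

variable {m m' : ℂ → Mat2} (hm : IsRHSolution lam L x t a b m) (hm' : IsRHSolution lam L x t a b m')
  (hdet : ∀ k ∈ (contour lam L a ∪ poleSet lam L a b)ᶜ, (m k).det = 1)

include hm hm' in
theorem IsRHSolution.differentiableOn_mul_adjugate (i j : Fin 2) :
    DifferentiableOn ℂ (fun k => (m' k * (m k).adjugate) i j)
      (contour lam L a ∪ poleSet lam L a b)ᶜ := by
  have h := fun i j => (hm.analytic i j).differentiableOn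
  have h' := fun i j => (hm'.analytic i j).differentiableOn
  have hadj : ∀ i j, DifferentiableOn ℂ (fun k => (m k).adjugate i j)
      (contour lam L a ∪ poleSet lam L a b)ᶜ := by
    intro i j
    simp only [Matrix.adjugate_fin_two]
    fin_cases i <;> fin_cases j
    exacts [h 1 1, (h 0 1).neg, (h 1 0).neg, h 0 0]
  simp only [Matrix.mul_apply, Fin.sum_univ_two]
  exact ((h' i 0).mul (hadj 0 j)).add ((h' i 1).mul (hadj 1 j))

include H hP hm hm' hdet in
theorem IsRHSolution.exists_extension_contourStar {k : ℂ} (hk : k ∈ contourStar lam L a)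
    (i j : Fin 2) : ∃ ρ > 0, ∃ g, DifferentiableOn ℂ g (ball k ρ) ∧
      EqOn g (fun k => (m' k * (m k).adjugate) i j)
        (ball k ρ ∩ (contour lam L a ∪ poleSet lam L a b)ᶜ) := by
  obtain ⟨mp, mm, cp, cm, hj⟩ := hm.jump_relation
  obtain ⟨mp', mm', cp', cm', hj'⟩ := hm'.jump_relation
  obtain ⟨ε, hε, h⟩ := H.eventually_regular hP hk
  have hadj : Continuous fun A : Mat2 => A.adjugate := continuous_id.matrix_adjugate
  have hent : Continuous fun A : Mat2 => A i j := continuous_id.matrix_elem i j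
  have hdetc : Continuous fun A : Mat2 => A.det := continuous_id.matrix_det
  have heq : ∀ z ∈ contourStar lam L a,
      mm' z * (mm z).adjugate = mp' z * (mp z).adjugate := by
    intro z hz
    obtain ⟨h1, h2, h3⟩ := hj z hz
    obtain ⟨-, -, h3'⟩ := hj' z hz
    obtain ⟨e1, e2⟩ := H.eventually_side hP hz
    have d1 : (mp z).det = 1 := tendsto_nhds_unique ((hdetc.tendsto _).comp h1)
      (tendsto_const_nhds.congr' (e1.mono fun w hw => (hdet w hw).symm))
    have d2 : (mm z).det = 1 := tendsto_nhds_unique ((hdetc.tendsto _).comp h2)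
      (tendsto_const_nhds.congr' (e2.mono fun w hw => (hdet w hw).symm))
    have d3 : (jump lam L x t a b z).det = 1 := by
      rw [h3, Matrix.det_mul, d1, one_mul] at d2
      exact d2
    rw [h3, h3', Matrix.adjugate_mul_distrib, Matrix.mul_assoc, ← Matrix.mul_assoc _ _ (mp z).adjugate,
      Matrix.mul_adjugate, d3, one_smul, Matrix.one_mul]
  have hsub : ball k ε ∩ {z | ((z - k) * conj (leftNormal k)).re = 0} ⊆
      contourStar lam L a := fun z hz => ((h z hz.1).2.2 hz.2).1
  have hreg : ∀ z ∈ ball k ε, ((z - k) * conj (leftNormal k)).re ≠ 0 →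
      z ∈ (contour lam L a ∪ poleSet lam L a b)ᶜ := fun z hz hl h' =>
    h'.elim (fun h' => hl ((h z hz).2.1.1 h')) (h z hz).1
  obtain ⟨F, hF, hFf⟩ := exists_extension_of_line (k0 := k) (ε := ε)
    (g := fun z => (mp' z * (mp z).adjugate) i j)
    ((hm.differentiableOn_mul_adjugate hm' i j).mono fun z hz => hreg z hz.1 hz.2)
    (hent.comp_continuousOn ((cp'.mul (hadj.comp_continuousOn cp)).mono hsub))
    fun z hz hl => by
      obtain ⟨hs, e1, e2⟩ := (h z hz).2.2 hl
      obtain ⟨h1, h2, h3⟩ := hj z hs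
      obtain ⟨h1', h2', h3'⟩ := hj' z hs
      rw [e1] at h1 h1'
      rw [e2] at h2 h2'
      refine ⟨(hent.tendsto _).comp (h1'.mul ((hadj.tendsto _).comp h1)), ?_⟩
      have := (hent.tendsto _).comp (h2'.mul ((hadj.tendsto _).comp h2))
      rw [heq z hs] at this
      exact this
  refine ⟨ε, hε, F, hF, fun z hz => hFf ⟨hz.1, fun hl => hz.2 (Or.inl ?_)⟩⟩
  exact (h z hz.1).2.1.2 hl

theorem ResidueCondition.tendsto_mul_adjugate {p c : ℂ} {n n' : Fin 2} (hn : n ≠ n')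
    (h : ResidueCondition m p n n' c) (h' : ResidueCondition m' p n n' c) (i j : Fin 2) :
    Tendsto (fun k => (k - p) * (m' k * (m k).adjugate) i j) (𝓝[≠] p) (𝓝 0) := by
  obtain ⟨u, hu⟩ := h
  obtain ⟨u', hu'⟩ := h'
  have key : ∀ l, Tendsto (fun k => (k - p) * (m' k i n' * m k l n - m' k i n * m k l n'))
      (𝓝[≠] p) (𝓝 0) := by
    intro l
    have := ((hu' i).1.mul (hu l).2).sub ((hu' i).2.mul (hu l).1)
    rw [show u' i * (c * u l) - c * u' i * u l = 0 by ring] at this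
    exact this.congr fun k => by ring
  have key' := fun l => (key l).neg
  simp only [neg_zero] at key'
  fin_cases n <;> fin_cases n' <;> first | exact absurd rfl hn | skip
  all_goals
    fin_cases j
  · exact (key' 1).congr fun k => by simp [Matrix.adjugate_fin_two, Matrix.mul_apply, -mul_eq_mul_left_iff]; ring
  · exact (key 0).congr fun k => by simp [Matrix.adjugate_fin_two, Matrix.mul_apply, -mul_eq_mul_left_iff]; ring
  · exact (key 1).congr fun k => by simp [Matrix.adjugate_fin_two, Matrix.mul_apply, -mul_eq_mul_left_iff]; ring
  · exact (key' 0).congr fun k => by simp [Matrix.adjugate_fin_two, Matrix.mul_apply, -mul_eq_mul_left_iff]; ring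

include hm hm' in
theorem IsRHSolution.tendsto_poleSet {p : ℂ} (hp : p ∈ poleSet lam L a b) (i j : Fin 2) :
    Tendsto (fun k => (k - p) * (m' k * (m k).adjugate) i j) (𝓝[≠] p) (𝓝 0) := by
  rcases hp with (hp | hp) | (hp | hp)
  · exact (hm.residue_D1 p hp).tendsto_mul_adjugate (by decide) (hm'.residue_D1 p hp) i j
  · exact (hm.residue_D3 p hp).tendsto_mul_adjugate (by decide) (hm'.residue_D3 p hp) i j
  · have h1 := hm.residue_D4 _ hp
    have h2 := hm'.residue_D4 _ hp
    rw [conj_conj] at h1 h2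
    exact h1.tendsto_mul_adjugate (by decide) h2 i j
  · have h1 := hm.residue_D2 _ hp
    have h2 := hm'.residue_D2 _ hp
    rw [conj_conj] at h1 h2
    exact h1.tendsto_mul_adjugate (by decide) h2 i j

include H hP hm hm' hdet in
theorem IsRHSolution.exists_extension (i j : Fin 2) (k : ℂ) :
    ∃ ρ > 0, ∃ g, DifferentiableOn ℂ g (ball k ρ) ∧
      EqOn g (fun k => (m' k * (m k).adjugate) i j)
        (ball k ρ ∩ (contour lam L a ∪ poleSet lam L a b)ᶜ) := by
  have hf := hm.differentiableOn_mul_adjugate hm' i j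
  set f : ℂ → ℂ := fun k => (m' k * (m k).adjugate) i j
  set E := contour lam L a ∪ poleSet lam L a b
  have hE : IsOpen Eᶜ :=
    ((isClosed_contour lam L a).union hP.finite_poleSet.isClosed).isOpen_compl
  have hG : Dense Eᶜ := H.dense_regular hP
  have reg : ∀ k ∈ Eᶜ, ∃ ρ > 0, ∃ g, DifferentiableOn ℂ g (ball k ρ) ∧
      EqOn g f (ball k ρ ∩ Eᶜ) := by
    intro k hk
    obtain ⟨ρ, hρ, hs⟩ := Metric.isOpen_iff.1 hE k hk
    exact ⟨ρ, hρ, f, hf.mono hs, fun _ _ => rfl⟩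
  by_cases hk : k ∈ contour lam L a
  · by_cases hks : k ∈ contourStar lam L a
    · exact hm.exists_extension_contourStar H hP hm' hdet hks i j
    · have hev := (H.isolated_singular k).and (nhdsWithin_le_nhds
        (hP.finite_poleSet.isClosed.isOpen_compl.mem_nhds (H.disjoint_poleSet hk)))
      obtain ⟨ε, hε, hball⟩ := Metric.mem_nhdsWithin_iff.1 hev
      obtain ⟨N, hN, hNf⟩ := exists_glued (Ω := ball k ε \ {k}) (M := f)
        (isOpen_ball.sdiff isClosed_singleton) hG fun z hz => by
          obtain ⟨h1, h2⟩ := hball ⟨hz.1, hz.2⟩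
          by_cases hzc : z ∈ contour lam L a
          · exact hm.exists_extension_contourStar H hP hm' hdet (h1 hzc) i j
          · exact reg z fun h => h.elim hzc h2
      have hb : ∀ i j, (fun z => m z i j) =O[𝓝[Eᶜ] k] fun _ => (1 : ℂ) := fun i j =>
        (hm.bounded k ⟨hk, hks⟩ i j).mono (nhdsWithin_mono _ fun z hz h => hz (Or.inl h))
      have hb' : ∀ i j, (fun z => m' z i j) =O[𝓝[Eᶜ] k] fun _ => (1 : ℂ) := fun i j =>
        (hm'.bounded k ⟨hk, hks⟩ i j).mono (nhdsWithin_mono _ fun z hz h => hz (Or.inl h))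
      have hba : ∀ i j, (fun z => (m z).adjugate i j) =O[𝓝[Eᶜ] k] fun _ => (1 : ℂ) := by
        intro i j
        simp only [Matrix.adjugate_fin_two]
        fin_cases i <;> fin_cases j
        exacts [hb 1 1, (hb 0 1).neg_left, (hb 1 0).neg_left, hb 0 0]
      have hfb : f =O[𝓝[Eᶜ] k] fun _ => (1 : ℂ) := by
        simp only [f, Matrix.mul_apply, Fin.sum_univ_two]
        simpa using ((hb' i 0).mul (hba 0 j)).add ((hb' i 1).mul (hba 1 j))
      obtain ⟨F, hF, hFN⟩ := exists_extension_of_bounded hG hε hN hNf hfb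
      refine ⟨ε, hε, F, hF, fun z hz => ?_⟩
      have hzk : z ≠ k := fun h => hz.2 (Or.inl (h ▸ hk))
      rw [hFN ⟨hz.1, hzk⟩]
      exact hNf ⟨⟨hz.1, hzk⟩, hz.2⟩
  · by_cases hkp : k ∈ poleSet lam L a b
    · have hev : (contour lam L a ∪ (poleSet lam L a b \ {k}))ᶜ ∈ 𝓝 k :=
        ((isClosed_contour lam L a).union hP.finite_poleSet.sdiff.isClosed).isOpen_compl.mem_nhds
          fun h => h.elim hk fun h => h.2 rfl
      obtain ⟨ε, hε, hball⟩ := Metric.mem_nhds_iff.1 hev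
      obtain ⟨F, hF, hFN⟩ := exists_extension_of_tendsto (f := f) hε
        (hf.mono fun z hz h => hball hz.1 (h.imp id fun h => ⟨h, hz.2⟩))
        (hm.tendsto_poleSet hm' hkp i j)
      exact ⟨ε, hε, F, hF, fun z hz => hFN ⟨hz.1, fun h => hz.2 (Or.inr (h ▸ hkp))⟩⟩
    · exact reg k fun h => h.elim hk hkp

include H hP hm hm' hdet in
theorem IsRHSolution.eqOn (hL : 0 < L) : EqOn m' m (contour lam L a ∪ poleSet lam L a b)ᶜ := by
  set E := contour lam L a ∪ poleSet lam L a b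
  have hG : Dense Eᶜ := H.dense_regular hP
  have key : ∀ i j, ∀ k ∈ Eᶜ, (m' k * (m k).adjugate) i j = (1 : Mat2) i j := by
    intro i j k hk
    obtain ⟨N, hN, hNf⟩ := exists_glued (Ω := univ) isOpen_univ hG
      fun k _ => hm.exists_extension H hP hm' hdet i j k
    have hl : ∀ i j, (fun k => (m k).adjugate i j - (1 : Mat2) i j)
        =O[cocompact ℂ ⊓ 𝓟 (Eᶜ \ disks L)] fun k => k⁻¹ := by
      intro i j
      have h := hm.at_infinity
      simp only [Matrix.adjugate_fin_two]
      fin_cases i <;> fin_cases j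
      · simpa [E] using h 1 1
      · simpa [E] using (h 0 1).neg_left
      · simpa [E] using (h 1 0).neg_left
      · simpa [E] using h 0 0
    have h1 : (fun k : ℂ => k⁻¹) =O[cocompact ℂ ⊓ 𝓟 (Eᶜ \ disks L)] fun _ => (1 : ℂ) :=
      ((tendsto_inv₀_cobounded (α := ℂ)).mono_left
        (inf_le_left.trans (Metric.cobounded_eq_cocompact (α := ℂ)).ge)).isBigO_one ℂ
    have hdec : (fun k => N k - (1 : Mat2) i j) =O[cocompact ℂ ⊓ 𝓟 (Eᶜ \ disks L)] fun k => k⁻¹ := by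
      have := (isBigO_mul_sub (hm'.at_infinity i 0) (hl 0 j) h1).add
        (isBigO_mul_sub (hm'.at_infinity i 1) (hl 1 j) h1)
      refine this.congr' ?_ EventuallyEq.rfl
      filter_upwards [mem_inf_of_right (mem_principal_self _)] with z hz
      rw [hNf ⟨mem_univ _, hz.1⟩]
      change _ = (m' z * (m z).adjugate) i j - _
      rw [Matrix.mul_apply, Fin.sum_univ_two]
      have : (1 : Mat2) i j = (1 : Mat2) i 0 * (1 : Mat2) 0 j + (1 : Mat2) i 1 * (1 : Mat2) 1 j := by
        rw [← Fin.sum_univ_two (f := fun l => (1 : Mat2) i l * (1 : Mat2) l j), ← Matrix.mul_apply,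
          Matrix.one_mul]
      rw [this]
      ring
    rw [← eq_const_of_decay hL hG (differentiableOn_univ.1 hN) hdec k]
    exact (hNf ⟨mem_univ _, hk⟩).symm
  intro k hk
  have h1 : m' k * (m k).adjugate = 1 := Matrix.ext fun i j => key i j k hk
  have h2 : (m k).adjugate * m k = 1 := by rw [Matrix.adjugate_mul, hdet k hk, one_smul]
  rw [← Matrix.mul_one (m' k), ← h2, ← Matrix.mul_assoc, h1, Matrix.one_mul]

end Uniqueness

section RayLimit

variable {lam L x t : ℝ} {a b : ℂ → ℂ} {Ψ : ℂ → Mat2} {qv : ℂ}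

theorem exists_norm_corrExp_le {φ : ℝ} (hc : Real.cos φ ≠ 0) (hs : Real.sin φ ≠ 0)
    (hx : x ∈ Icc 0 L) (ht : 0 ≤ t) (h4 : ¬ (x = 0 ∧ t = 0 ∧ 0 < Real.cos φ ∧ Real.sin φ < 0))
    (h2 : ¬ (x = L ∧ t = 0 ∧ Real.cos φ < 0 ∧ 0 < Real.sin φ)) :
    ∃ δ > 0, ∀ r : ℝ, 1 ≤ r → ‖corrExp L x t (r * exp (φ * I))‖ ≤ Real.exp (-(δ * r)) := by
  have hre : ∀ r : ℝ, ((r : ℂ) * exp (φ * I)).re = r * Real.cos φ := fun r => by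
    rw [re_ofReal_mul, exp_ofReal_mul_I_re]
  have him : ∀ r : ℝ, ((r : ℂ) * exp (φ * I)).im = r * Real.sin φ := fun r => by
    rw [im_ofReal_mul, exp_ofReal_mul_I_im]
  have hquad : ∀ r : ℝ, 0 < r → quad (r * exp (φ * I)) =
      if 0 < Real.sin φ then if 0 < Real.cos φ then 0 else 1
      else if 0 < Real.cos φ then 3 else 2 := fun r hr => by
    simp [quad, hre, him, hr]
  set c := Real.cos φ
  set s := Real.sin φ
  have hzero : (∀ r : ℝ, 0 < r → corrExp L x t (r * exp (φ * I)) = 0) →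
      ∃ δ > 0, ∀ r : ℝ, 1 ≤ r → ‖corrExp L x t (r * exp (φ * I))‖ ≤ Real.exp (-(δ * r)) :=
    fun h => ⟨1, one_pos, fun r hr => by
      rw [h r (by linarith), norm_zero]; exact (Real.exp_pos _).le⟩
  rcases lt_or_gt_of_ne hs with hs | hs <;> rcases lt_or_gt_of_ne hc with hc | hc
  · exact hzero fun r hr => by simp [corrExp, hquad r hr, not_lt.2 hs.le, not_lt.2 hc.le]
  · have hcs : 0 < c * -s := mul_pos hc (by linarith)
    refine ⟨2 * (-s) * x + 8 * (c * -s) * t, ?_, fun r hr => ?_⟩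
    · rcases ht.eq_or_lt with h | h
      · have hx0 : 0 < x := lt_of_le_of_ne hx.1 fun h' => h4 ⟨h'.symm, h.symm, hc, hs⟩
        have : 0 < (-s) * x := mul_pos (by linarith) hx0
        rw [← h]; linarith
      · have h1 : 0 ≤ (-s) * x := mul_nonneg (by linarith) hx.1
        have := mul_pos hcs h
        linarith
    · have hq : corrExp L x t (r * exp (φ * I)) = eThetaInv x t (r * exp (φ * I)) := by
        simp [corrExp, hquad r (by linarith), not_lt.2 hs.le, hc]
      rw [hq, norm_eThetaInv, Real.exp_le_exp, theta_im, hre, him]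
      have h1 : 0 ≤ (c * -s * t) * (r * (r - 1)) :=
        mul_nonneg (mul_nonneg hcs.le ht) (mul_nonneg (by linarith) (by linarith))
      linarith
  · have hcs : 0 < -c * s := mul_pos (by linarith) hs
    refine ⟨2 * s * (L - x) + 8 * (-c * s) * t, ?_, fun r hr => ?_⟩
    · rcases ht.eq_or_lt with h | h
      · have hx0 : 0 < L - x := sub_pos.2 (lt_of_le_of_ne hx.2 fun h' => h2 ⟨h', h.symm, hc, hs⟩)
        have := mul_pos hs hx0
        rw [← h]; linarith
      · have h1 : 0 ≤ s * (L - x) := mul_nonneg hs.le (sub_nonneg.2 hx.2)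
        have := mul_pos hcs h
        linarith
    · have hq : corrExp L x t (r * exp (φ * I)) =
          eL L (r * exp (φ * I)) * eThetaInv x t (r * exp (φ * I)) := by
        simp [corrExp, hquad r (by linarith), hs, not_lt.2 hc.le]
      rw [hq, norm_mul, norm_eL, norm_eThetaInv, ← Real.exp_add, Real.exp_le_exp, theta_im, hre, him]
      have h1 : 0 ≤ (-c * s * t) * (r * (r - 1)) :=
        mul_nonneg (mul_nonneg hcs.le ht) (mul_nonneg (by linarith) (by linarith))
      linarith
  · exact hzero fun r hr => by simp [corrExp, hquad r hr, hs, hc]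

theorem sin_cos_ne_zero {φ : ℝ} (h : ∀ n : ℤ, φ ≠ n * Real.pi / 2) :
    Real.sin φ ≠ 0 ∧ Real.cos φ ≠ 0 := by
  constructor
  · intro h0
    obtain ⟨n, hn⟩ := Real.sin_eq_zero_iff.1 h0
    exact h (2 * n) (by rw [← hn]; push_cast; ring)
  · intro h0
    obtain ⟨n, hn⟩ := Real.cos_eq_zero_iff.1 h0
    exact h (2 * n + 1) (by rw [hn]; push_cast; ring)

theorem IsSpectralData.tendsto_ray (D : IsSpectralData lam L x t a b Ψ qv)
    (H : IsDiscriminant lam L a) (hx : x ∈ Icc 0 L) (ht : 0 ≤ t) {φ : ℝ}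
    (hφ : ∀ n : ℤ, φ ≠ n * Real.pi / 2) (h4 : ¬ (x = 0 ∧ t = 0 ∧ exp (φ * I) ∈ D4))
    (h2 : ¬ (x = L ∧ t = 0 ∧ exp (φ * I) ∈ D2)) :
    Tendsto (fun r : ℝ => 2 * I * (r * exp (φ * I)) *
      rhSol lam L x t a b Ψ (r * exp (φ * I)) 0 1) atTop (𝓝 qv) := by
  obtain ⟨hs, hc⟩ := sin_cos_ne_zero hφ
  obtain ⟨K, -, C, hC, hexp⟩ := D.exists_expansion H hx ht
  have e1 : (exp (φ * I)).re = Real.cos φ := exp_ofReal_mul_I_re φ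
  have e2 : (exp (φ * I)).im = Real.sin φ := exp_ofReal_mul_I_im φ
  obtain ⟨δ, hδ, hcorr⟩ := exists_norm_corrExp_le hc hs hx ht
    (fun h => h4 ⟨h.1, h.2.1, by simpa only [D4, mem_ofPred_eq, e1, e2] using h.2.2⟩)
    (fun h => h2 ⟨h.1, h.2.1, by simpa only [D2, mem_ofPred_eq, e1, e2] using h.2.2⟩)
  rw [tendsto_iff_norm_sub_tendsto_zero]
  have hlim : Tendsto (fun r : ℝ => C / r + C * Real.exp (-(δ * r))) atTop (𝓝 0) := by
    have h1 : Tendsto (fun r : ℝ => C / r) atTop (𝓝 0) := tendsto_const_nhds.div_atTop tendsto_id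
    have h2 : Tendsto (fun r : ℝ => Real.exp (-(δ * r))) atTop (𝓝 0) :=
      Real.tendsto_exp_neg_atTop_nhds_zero.comp (tendsto_id.const_mul_atTop hδ)
    simpa using h1.add (h2.const_mul C)
  refine squeeze_zero' (Eventually.of_forall fun r => norm_nonneg _) ?_ hlim
  filter_upwards [eventually_ge_atTop 1, eventually_ge_atTop K,
    eventually_ge_atTop (Real.pi / (4 * L) / |Real.sin φ|)] with r h1 hK hd
  have hr : 0 < r := by linarith
  have hn : ‖(r : ℂ) * exp (φ * I)‖ = r := by
    rw [norm_mul, norm_exp_ofReal_mul_I, mul_one, Complex.norm_of_nonneg hr.le]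
  have him : ((r : ℂ) * exp (φ * I)).im = r * Real.sin φ := by rw [im_ofReal_mul, e2]
  have hre : ((r : ℂ) * exp (φ * I)).re = r * Real.cos φ := by rw [re_ofReal_mul, e1]
  have hdisk : (r : ℂ) * exp (φ * I) ∉ disks L := fun h => by
    have := norm_im_le_of_mem_disks h
    rw [him, abs_mul, abs_of_pos hr] at this
    rw [div_le_iff₀ (abs_pos.2 hs)] at hd
    linarith
  have := (hexp _ hdisk (by rwa [hn]) (him ▸ mul_ne_zero hr.ne' hs)
    (hre ▸ mul_ne_zero hr.ne' hc)).2
  rw [hn] at this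
  exact this.trans (by gcongr; exact hcorr r h1)

end RayLimit

end

end PeriodicNLS

theorem mainTheorem1 (lam L : ℝ) (hlam : lam = 1 ∨ lam = -1) (hL : 0 < L) (q : ℝ → ℝ → ℂ)
    (hq : PeriodicNLS.IsSmoothPeriodicSolution lam L q) (a b : ℂ → ℂ)
    (ha : a = PeriodicNLS.specA lam L (fun y => q y 0))
    (hb : b = PeriodicNLS.specB lam L (fun y => q y 0))
    (hpoles : PeriodicNLS.PoleAssumption lam L a b)
    (x t : ℝ) (hx : x ∈ Set.Icc 0 L) (ht : 0 ≤ t) :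
    ∃ m : ℂ → PeriodicNLS.Mat2,
      PeriodicNLS.IsRHSolution lam L x t a b m ∧
      (∀ m' : ℂ → PeriodicNLS.Mat2, PeriodicNLS.IsRHSolution lam L x t a b m' →
        Set.EqOn m' m (PeriodicNLS.contour lam L a ∪ PeriodicNLS.poleSet lam L a b)ᶜ) ∧
      ∀ φ : ℝ, (∀ n : ℤ, φ ≠ n * Real.pi / 2) →
        ¬ (x = 0 ∧ t = 0 ∧ Complex.exp (φ * Complex.I) ∈ PeriodicNLS.D4) →
        ¬ (x = L ∧ t = 0 ∧ Complex.exp (φ * Complex.I) ∈ PeriodicNLS.D2) →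
        Filter.Tendsto
          (fun r : ℝ => 2 * Complex.I * (r * Complex.exp (φ * Complex.I)) *
            m (r * Complex.exp (φ * Complex.I)) 0 1)
          Filter.atTop (nhds (q x t)) := by
  obtain ⟨qx, qxx, qt, h⟩ := hq.exists_data
  obtain ⟨Ψ, D⟩ := h.exists_spectralData hlam hL ht hx
  rw [← ha, ← hb] at D
  have H := D.isDiscriminant hlam hL
  have hm := D.isRHSolution H hpoles hx ht
  exact ⟨_, hm, fun m' hm' => hm.eqOn H hpoles hm' (fun k hk => D.det_rhSol H hk) hL,
    fun φ hφ h4 h2 => D.tendsto_ray H hx ht hφ h4 h2⟩
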